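/- Let $k$ be a field of characteristic $0$, let $\mathrm{GL}=\bigcup_{n\ge 1}\mathrm{GL}_n(k)$ (as a discrete group) and let $\mathbf V=\bigcup_{n\ge1}k^n$ be its standard representation. A $k$-linear representation of $\mathrm{GL}$ is *polynomial* if it is a subquotient of a (possibly infinite) direct sum of tensor powers of $\mathbf V$, and an element of a representation is polynomial if the subrepresentation it generates is polynomial. For a partition $\lambda$ write $k^{\oplus\lambda}=\mathbf S_\lambda(\mathbf V)$, where $\mathbf S_\lambda$ is the Schur functor, and for a finite tuple of partitions $\underline\sigma=[\sigma_1,\dots,\sigma_r]$ write $k^{\oplus\underline\sigma}=\bigoplus_j k^{\oplus\sigma_j}$. Let $\underline\sigma$ be a tuple of non-empty partitions ($r=0$ is allowed) and let $K=\mathrm{Frac}(\mathrm{Sym}(k^{\oplus\underline\sigma}))$ with the induced action of $\mathrm{GL}$. Let $\mathrm{Mod}_K$ be the abelian category of semilinear representations $M$ of $\mathrm{GL}$ over $K$ in which every element has the form $ax$ with $a\in K$ and $x\in M$ polynomial; morphisms are the $K$-linear $\mathrm{GL}$-equivariant maps. For a partition $\lambda$ let $K^{\oplus\lambda}=K\otimes_k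 k^{\oplus\lambda}\in\mathrm{Mod}_K$, and let $L_\lambda\subseteq K^{\oplus\lambda}$ be the intersection of the kernels of all morphisms $K^{\oplus\lambda}\to K^{\oplus\nu}$ in $\mathrm{Mod}_K$ with $|\nu|<|\lambda|$. Then for all partitions $\lambda,\mu$ and all $i\ge 0$ there is an isomorphism of $k$-vector spaces $$\mathrm{Ext}^i_{\mathrm{Mod}_K}(L_\lambda,L_\mu)\;\cong\;\mathrm{Hom}_{\mathrm{GL}}\Big(\textstyle\bigwedge^i(k^{\oplus\underline\sigma})\otimes_k k^{\oplus\lambda},\;k^{\oplus\mu}\Big).$$ -/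

import Mathlib

open CategoryTheory CategoryTheory.Limits
open scoped TensorProduct DirectSum

universe u

namespace GLRep

/-! ### The group `GL` and its polynomial representations -/

section PolynomialRepresentations

variable (k : Type u) [Field k]

/-- The vector space `V = ⋃ₙ kⁿ` with basis `e₀, e₁, …`. -/
abbrev StdSpace : Type u := ℕ →₀ k

/-- The subspace `kⁿ ⊆ V` spanned by `e₀, …, eₙ₋₁`. -/
def coordSubspace (n : ℕ) : Submodule k (StdSpace k) :=
  Finsupp.supported k k (Set.Iio n)

/-- The group `GL = ⋃ₙ GLₙ(k)`, as a group of automorphisms of `V`: the elements of `GLₙ(k)` are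
those automorphisms that preserve `kⁿ` and fix the basis vectors `eᵢ` with `i ≥ n`. -/
def GLInf : Subgroup (StdSpace k ≃ₗ[k] StdSpace k) where
  carrier := {g | ∃ n : ℕ,
    (coordSubspace k n).map (g : StdSpace k →ₗ[k] StdSpace k) = coordSubspace k n ∧
    ∀ i, n ≤ i → g (Finsupp.single i 1) = Finsupp.single i 1}
  one_mem' := ⟨0, Submodule.map_id _, fun _ _ => rfl⟩
  mul_mem' := by
    have key : ∀ (g : StdSpace k ≃ₗ[k] StdSpace k) (n m : ℕ), n ≤ m →
        (coordSubspace k n).map (g : StdSpace k →ₗ[k] StdSpace k) = coordSubspace k n →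
        (∀ i, n ≤ i → g (Finsupp.single i 1) = Finsupp.single i 1) →
        (coordSubspace k m).map (g : StdSpace k →ₗ[k] StdSpace k) = coordSubspace k m := by
      intro g n m hnm h1 h2
      have hdec : coordSubspace k m = coordSubspace k n ⊔
          Submodule.span k ((fun i => Finsupp.single i (1 : k)) '' (Set.Ico n m)) := by
        have hU : (Set.Iio m : Set ℕ) = Set.Iio n ∪ Set.Ico n m := by
          ext i; simp only [Set.mem_Iio, Set.mem_union, Set.mem_Ico]; omega
        rw [coordSubspace, coordSubspace, hU, Finsupp.supported_union,
          Finsupp.supported_eq_span_single k (Set.Ico n m)]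
      have hspan : (Submodule.span k ((fun i => Finsupp.single i (1 : k)) '' (Set.Ico n m))).map
          (g : StdSpace k →ₗ[k] StdSpace k) =
          Submodule.span k ((fun i => Finsupp.single i (1 : k)) '' (Set.Ico n m)) := by
        rw [Submodule.map_span, Set.image_image]
        congr 1
        exact Set.image_congr fun i hi => h2 i hi.1
      rw [hdec, Submodule.map_sup, h1, hspan]
    rintro a b ⟨n, ha1, ha2⟩ ⟨m, hb1, hb2⟩
    refine ⟨max n m, ?_, fun i hi => ?_⟩
    · have h := key b m (max n m) (le_max_right _ _) hb1 hb2
      have h' := key a n (max n m) (le_max_left _ _) ha1 ha2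
      calc _ = ((coordSubspace k (max n m)).map (b : StdSpace k →ₗ[k] StdSpace k)).map
            (a : StdSpace k →ₗ[k] StdSpace k) := Submodule.map_comp _ _ _
        _ = _ := by rw [h, h']
    · rw [LinearEquiv.mul_apply, hb2 i (le_trans (le_max_right _ _) hi),
        ha2 i (le_trans (le_max_left _ _) hi)]
  inv_mem' := by
    rintro a ⟨n, h1, h2⟩
    refine ⟨n, ?_, fun i hi => ?_⟩
    · conv_lhs => rw [← h1]
      rw [← Submodule.map_comp]
      have : ((a⁻¹ : StdSpace k ≃ₗ[k] StdSpace k) : StdSpace k →ₗ[k] StdSpace k) ∘ₗ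
          (a : StdSpace k →ₗ[k] StdSpace k) = LinearMap.id := by
        ext1 x
        exact LinearMap.ext fun y => a.symm_apply_apply _
      rw [this, Submodule.map_id]
    · conv_lhs => rw [← h2 i hi]
      exact a.symm_apply_apply _

/-- The standard representation of `GL` on `V`. -/
def stdRep : Representation k (GLInf k) (StdSpace k) where
  toFun g := (g : StdSpace k ≃ₗ[k] StdSpace k).toLinearMap
  map_one' := rfl
  map_mul' _ _ := rfl

/-- The tensor power `V^{⊗ι}` of the standard representation, for an index type `ι`. -/
noncomputable def tensorRep (ι : Type*) : Representation k (GLInf k) (⨂[k] _ : ι, StdSpace k) where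
  toFun g := PiTensorProduct.map fun _ => stdRep k g
  map_one' := by simp only [map_one]; exact PiTensorProduct.map_one
  map_mul' g h := by simp only [map_mul]; exact PiTensorProduct.map_mul _ _

/-- The direct sum `⨁ᵢ V^{⊗ nᵢ}` of tensor powers of the standard representation. -/
noncomputable def tensorSum {ι : Type u} (n : ι → ℕ) :
    Representation k (GLInf k) (⨁ i, ⨂[k] _ : Fin (n i), StdSpace k) :=
  Representation.directSum fun i => tensorRep k (Fin (n i))

variable {k}

/-- A representation of `GL` is polynomial if it is a subquotient (a quotient of a
subrepresentation) of a possibly infinite direct sum of tensor powers of the standard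
representation. -/
def IsPolynomial {M : Type u} [AddCommMonoid M] [Module k M]
    (ρ : Representation k (GLInf k) M) : Prop :=
  ∃ (ι : Type u) (n : ι → ℕ) (A : Subrepresentation (tensorSum k n))
    (f : Representation.IntertwiningMap A.toRepresentation ρ), Function.Surjective f

/-- The subrepresentation generated by an element. -/
def generated {G M : Type*} [Monoid G] [AddCommMonoid M] [Module k M]
    (ρ : Representation k G M) (x : M) : Subrepresentation ρ where
  toSubmodule := Submodule.span k (Set.range fun g => ρ g x)
  apply_mem_toSubmodule g v hv := by
    induction hv using Submodule.span_induction with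
    | mem y hy =>
      obtain ⟨h, rfl⟩ := hy
      exact Submodule.subset_span ⟨g * h, by simp⟩
    | zero => simp
    | add y z _ _ hy hz => rw [map_add]; exact Submodule.add_mem _ hy hz
    | smul c y _ hy => rw [map_smul]; exact Submodule.smul_mem _ _ hy

/-- An element of a representation of `GL` is polynomial if the subrepresentation it generates is
polynomial. -/
def IsPolynomialElement {M : Type u} [AddCommMonoid M] [Module k M]
    (ρ : Representation k (GLInf k) M) (x : M) : Prop :=
  IsPolynomial (generated ρ x).toRepresentation

theorem free_of_field (k M : Type*) [Field k] [AddCommMonoid M] [Module k M] : Module.Free k M :=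
  letI := Module.addCommMonoidToAddCommGroup (M := M) k
  Module.Free.of_divisionRing k M

section closure

variable {M N P W : Type u} [AddCommMonoid M] [Module k M] [AddCommMonoid N] [Module k N]
  [AddCommMonoid P] [Module k P] [AddCommMonoid W] [Module k W]
  {ρ : Representation k (GLInf k) M} {ρ' : Representation k (GLInf k) N}
  {ρ'' : Representation k (GLInf k) P} {τ : Representation k (GLInf k) W}

theorem generated_mem (x : M) : x ∈ (generated ρ x).toSubmodule :=
  Submodule.subset_span ⟨1, by simp⟩

theorem isPolynomial_of_span {ι : Type u} {n : ι → ℕ}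
    (j : W →ₗ[k] (⨁ i, ⨂[k] _ : Fin (n i), StdSpace k))
    (hj : Function.Injective j) (hjc : ∀ g w, j (τ g w) = tensorSum k n g (j w))
    (f : W →ₗ[k] M) (hf : Function.Surjective f) (hfc : ∀ g w, f (τ g w) = ρ g (f w)) :
    IsPolynomial ρ := by
  let e := LinearEquiv.ofInjective j hj
  let A : Subrepresentation (tensorSum k n) :=
    { toSubmodule := LinearMap.range j
      apply_mem_toSubmodule := by
        rintro g _ ⟨w, rfl⟩
        exact ⟨τ g w, hjc g w⟩ }
  let F : A.toSubmodule →ₗ[k] M := f ∘ₗ e.symm.toLinearMap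
  have hF : ∀ w, F (e w) = f w := fun w => congrArg f (e.symm_apply_apply w)
  refine ⟨ι, n, A, ⟨F, fun g => LinearMap.ext fun v => ?_⟩, fun m => ?_⟩
  · obtain ⟨w, rfl⟩ := e.surjective v
    have h1 : A.toRepresentation g (e w) = e (τ g w) := Subtype.ext (hjc g w).symm
    change F (A.toRepresentation g (e w)) = ρ g (F (e w))
    rw [h1, hF, hF, hfc]
  · obtain ⟨w, rfl⟩ := hf m
    exact ⟨e w, hF w⟩

theorem IsPolynomial.of_surjective (h : IsPolynomial ρ) (f : M →ₗ[k] N)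
    (hf : Function.Surjective f) (hfc : ∀ g w, f (ρ g w) = ρ' g (f w)) : IsPolynomial ρ' := by
  obtain ⟨ι, n, A, p, hp⟩ := h
  refine isPolynomial_of_span (τ := A.toRepresentation) A.toSubmodule.subtype
    Subtype.val_injective (fun _ _ => rfl) (f ∘ₗ p.toLinearMap) (hf.comp hp) fun g w => ?_
  have := p.isIntertwining _ _ g w
  simp only [LinearMap.comp_apply, Representation.IntertwiningMap.toLinearMap_apply, this, hfc]

theorem IsPolynomial.of_injective (h : IsPolynomial ρ) (f : N →ₗ[k] M)
    (hf : Function.Injective f) (hfc : ∀ g w, f (ρ' g w) = ρ g (f w)) : IsPolynomial ρ' := by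
  obtain ⟨ι, n, A, p, hp⟩ := h
  let e := LinearEquiv.ofInjective f hf
  let B : Subrepresentation A.toRepresentation :=
    { toSubmodule := (LinearMap.range f).comap p.toLinearMap
      apply_mem_toSubmodule := by
        rintro g v ⟨w, hw⟩
        refine ⟨ρ' g w, ?_⟩
        rw [hfc, hw]
        exact (p.isIntertwining _ _ g v).symm }
  let q : B.toSubmodule →ₗ[k] N :=
    e.symm.toLinearMap ∘ₗ (p.toLinearMap.restrict (q := LinearMap.range f) fun x hx => hx)
  have hq : ∀ b, f (q b) = p b.1 := by
    intro b
    have := LinearEquiv.apply_symm_apply e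
      ((p.toLinearMap.restrict (p := B.toSubmodule) (q := LinearMap.range f) fun x hx => hx) b)
    exact congrArg Subtype.val this
  refine isPolynomial_of_span (τ := B.toRepresentation)
    (A.toSubmodule.subtype ∘ₗ B.toSubmodule.subtype)
    (Subtype.val_injective.comp Subtype.val_injective) (fun _ _ => rfl) q ?_ ?_
  · intro x
    obtain ⟨a, ha⟩ := hp (f x)
    exact ⟨⟨a, x, ha.symm⟩, hf (by rw [hq]; exact ha)⟩
  · intro g w
    apply hf
    rw [hfc, hq, hq]
    exact p.isIntertwining _ _ g w.1

theorem IsPolynomial.prod (h : IsPolynomial ρ) (h' : IsPolynomial ρ') :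
    IsPolynomial (ρ.prod ρ') := by
  classical
  obtain ⟨ι, n, A, p, hp⟩ := h
  obtain ⟨ι', n', A', p', hp'⟩ := h'
  let T : ι ⊕ ι' → Type u := fun i => ⨂[k] _ : Fin (Sum.elim n n' i), StdSpace k
  let a : (⨁ i, ⨂[k] _ : Fin (n i), StdSpace k) →ₗ[k] (⨁ i, T i) :=
    DirectSum.toModule k ι _ fun i => DirectSum.lof k (ι ⊕ ι') T (Sum.inl i)
  let a' : (⨁ i, ⨂[k] _ : Fin (n' i), StdSpace k) →ₗ[k] (⨁ i, T i) :=
    DirectSum.toModule k ι' _ fun i => DirectSum.lof k (ι ⊕ ι') T (Sum.inr i)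
  let b : (⨁ i, T i) →ₗ[k] (⨁ i, ⨂[k] _ : Fin (n i), StdSpace k) ×
      (⨁ i, ⨂[k] _ : Fin (n' i), StdSpace k) :=
    DirectSum.toModule k (ι ⊕ ι') _ fun i => match i with
      | Sum.inl i => LinearMap.inl k _ _ ∘ₗ
          DirectSum.lof k ι (fun i => ⨂[k] _ : Fin (n i), StdSpace k) i
      | Sum.inr i => LinearMap.inr k _ _ ∘ₗ
          DirectSum.lof k ι' (fun i => ⨂[k] _ : Fin (n' i), StdSpace k) i
  have hb : b ∘ₗ a.coprod a' = LinearMap.id := by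
    apply LinearMap.prod_ext
    · ext i : 1
      apply LinearMap.ext
      intro x
      simp only [a, b, LinearMap.comp_apply, LinearMap.inl_apply, LinearMap.coprod_apply, map_zero,
        add_zero, LinearMap.id_apply]
      erw [DirectSum.toModule_lof, DirectSum.toModule_lof]
      rfl
    · ext i : 1
      apply LinearMap.ext
      intro x
      simp only [a', b, LinearMap.comp_apply, LinearMap.inr_apply, LinearMap.coprod_apply, map_zero,
        zero_add, LinearMap.id_apply]
      erw [DirectSum.toModule_lof, DirectSum.toModule_lof]
      rfl
  have hinj : Function.Injective (a.coprod a') :=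
    Function.LeftInverse.injective (g := b) fun x => LinearMap.congr_fun hb x
  have ha : ∀ g x, a (tensorSum k n g x) = tensorSum k (Sum.elim n n') g (a x) := by
    intro g x
    have : a ∘ₗ tensorSum k n g = tensorSum k (Sum.elim n n') g ∘ₗ a := by
      ext i : 1
      apply LinearMap.ext
      intro x
      simp only [a, tensorSum, LinearMap.comp_apply, Representation.directSum_apply]
      erw [DirectSum.lmap_lof, DirectSum.toModule_lof, DirectSum.toModule_lof, DirectSum.lmap_lof]
      rfl
    exact LinearMap.congr_fun this x
  have ha' : ∀ g x, a' (tensorSum k n' g x) = tensorSum k (Sum.elim n n') g (a' x) := by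
    intro g x
    have : a' ∘ₗ tensorSum k n' g = tensorSum k (Sum.elim n n') g ∘ₗ a' := by
      ext i : 1
      apply LinearMap.ext
      intro x
      simp only [a', tensorSum, LinearMap.comp_apply, Representation.directSum_apply]
      erw [DirectSum.lmap_lof, DirectSum.toModule_lof, DirectSum.toModule_lof, DirectSum.lmap_lof]
      rfl
    exact LinearMap.congr_fun this x
  refine isPolynomial_of_span (τ := A.toRepresentation.prod A'.toRepresentation)
    (n := Sum.elim n n')
    (a.coprod a' ∘ₗ A.toSubmodule.subtype.prodMap A'.toSubmodule.subtype)
    (hinj.comp (Prod.map_injective.2 ⟨Subtype.val_injective, Subtype.val_injective⟩)) ?_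
    (p.toLinearMap.prodMap p'.toLinearMap) (Prod.map_surjective.2 ⟨hp, hp'⟩) ?_
  · rintro g ⟨x, y⟩
    change a (tensorSum k n g x.1) + a' (tensorSum k n' g y.1) = _
    rw [ha, ha', ← map_add]
    rfl
  · rintro g ⟨x, y⟩
    exact Prod.ext (p.isIntertwining _ _ g x) (p'.isIntertwining _ _ g y)

theorem IsPolynomial.tprod (h : IsPolynomial ρ) (h' : IsPolynomial ρ') :
    IsPolynomial (ρ.tprod ρ') := by
  classical
  obtain ⟨ι, n, A, p, hp⟩ := h
  obtain ⟨ι', n', A', p', hp'⟩ := h'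
  let m : ι × ι' → ℕ := fun i => n i.1 + n' i.2
  let e₁ := TensorProduct.directSum k k (fun i => ⨂[k] _ : Fin (n i), StdSpace k)
    (fun i => ⨂[k] _ : Fin (n' i), StdSpace k)
  let e₂ : (⨁ i : ι × ι', (⨂[k] _ : Fin (n i.1), StdSpace k) ⊗[k]
      (⨂[k] _ : Fin (n' i.2), StdSpace k)) →ₗ[k] ⨁ i, ⨂[k] _ : Fin (m i), StdSpace k :=
    DirectSum.lmap fun i => (TensorPower.mulEquiv (R := k) (M := StdSpace k)).toLinearMap
  have he₂ : Function.Injective e₂ :=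
    (DirectSum.lmap_injective _).2 fun i => LinearEquiv.injective _
  have hc : ∀ g x, e₂ (e₁ (TensorProduct.map (tensorSum k n g) (tensorSum k n' g) x)) =
      tensorSum k m g (e₂ (e₁ x)) := by
    intro g x
    have : e₂ ∘ₗ e₁.toLinearMap ∘ₗ TensorProduct.map (tensorSum k n g) (tensorSum k n' g) =
        tensorSum k m g ∘ₗ e₂ ∘ₗ e₁.toLinearMap := by
      apply TensorProduct.ext
      ext i : 1
      apply LinearMap.ext
      intro x
      ext j : 1
      apply LinearMap.ext
      intro y
      change e₂ (e₁ (tensorSum k n g (DirectSum.lof k ι _ i x) ⊗ₜ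
        tensorSum k n' g (DirectSum.lof k ι' _ j y))) = tensorSum k m g (e₂ (e₁
          (DirectSum.lof k ι _ i x ⊗ₜ DirectSum.lof k ι' _ j y)))
      simp only [tensorSum, Representation.directSum_apply, e₁, e₂, DirectSum.lmap_lof,
        TensorProduct.directSum_lof_tmul_lof]
      congr 1
      have h3 : (TensorPower.mulEquiv (R := k) (M := StdSpace k)).toLinearMap ∘ₗ
          TensorProduct.map (tensorRep k (Fin (n i)) g) (tensorRep k (Fin (n' j)) g) =
          tensorRep k (Fin (n i + n' j)) g ∘ₗ
          (TensorPower.mulEquiv (R := k) (M := StdSpace k)).toLinearMap := by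
        apply TensorProduct.ext
        ext v w
        have hm := fun (a : Fin (n i) → StdSpace k) (b : Fin (n' j) → StdSpace k) =>
          TensorPower.tprod_mul_tprod k a b
        simp only [TensorPower.gMul_def] at hm
        change TensorPower.mulEquiv (PiTensorProduct.map (fun _ => stdRep k g)
          (PiTensorProduct.tprod k v) ⊗ₜ PiTensorProduct.map (fun _ => stdRep k g)
          (PiTensorProduct.tprod k w)) = PiTensorProduct.map (fun _ => stdRep k g)
          (TensorPower.mulEquiv (PiTensorProduct.tprod k v ⊗ₜ PiTensorProduct.tprod k w))
        rw [PiTensorProduct.map_tprod, PiTensorProduct.map_tprod, hm, hm,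
          PiTensorProduct.map_tprod]
        congr 1
        funext l
        refine Fin.addCases (fun l => ?_) (fun l => ?_) l <;> simp
      exact LinearMap.congr_fun h3 (x ⊗ₜ y)
    exact LinearMap.congr_fun this x
  refine isPolynomial_of_span (τ := A.toRepresentation.tprod A'.toRepresentation) (n := m)
    (e₂ ∘ₗ e₁.toLinearMap ∘ₗ TensorProduct.map A.toSubmodule.subtype A'.toSubmodule.subtype)
    (he₂.comp (e₁.injective.comp ?_)) ?_
    (TensorProduct.map p.toLinearMap p'.toLinearMap) (TensorProduct.map_surjective hp hp') ?_
  · have := free_of_field k (⨁ i, ⨂[k] _ : Fin (n i), StdSpace k)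
    have := free_of_field k A'.toSubmodule
    exact TensorProduct.map_injective_of_flat_flat _ _ Subtype.val_injective Subtype.val_injective
  · intro g x
    simp only [LinearMap.comp_apply, LinearEquiv.coe_coe]
    rw [← hc]
    congr 2
    rw [Representation.tprod_apply, ← LinearMap.comp_apply, ← LinearMap.comp_apply,
      ← TensorProduct.map_comp, ← TensorProduct.map_comp]
    rfl
  · intro g x
    rw [Representation.tprod_apply, Representation.tprod_apply, ← LinearMap.comp_apply,
      ← LinearMap.comp_apply, ← TensorProduct.map_comp, ← TensorProduct.map_comp, p.2, p'.2]

theorem isPolynomial_tensorSum {ι : Type u} (n : ι → ℕ) : IsPolynomial (tensorSum k n) :=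
  isPolynomial_of_span (τ := tensorSum k n) LinearMap.id Function.injective_id (fun _ _ => rfl)
    LinearMap.id Function.surjective_id (fun _ _ => rfl)

theorem isPolynomial_tensorRep (ι : Type) [Fintype ι] : IsPolynomial (tensorRep k ι) := by
  classical
  let e := PiTensorProduct.reindex k (fun _ : ι => StdSpace k) (Fintype.equivFin ι)
  let n : PUnit.{u + 1} → ℕ := fun _ => Fintype.card ι
  refine (isPolynomial_tensorSum (k := k) n).of_injective
    (DirectSum.lof k PUnit (fun i => ⨂[k] _ : Fin (n i), StdSpace k) PUnit.unit ∘ₗ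
      e.toLinearMap) ((DirectSum.of_injective _).comp e.injective) fun g w => ?_
  simp only [LinearMap.comp_apply, LinearEquiv.coe_coe, tensorSum, Representation.directSum_apply]
  rw [DirectSum.lmap_lof]
  congr 1
  exact (PiTensorProduct.map_reindex (fun _ : ι => stdRep k g) (Fintype.equivFin ι) w).symm

theorem IsPolynomialElement.of_map (h : IsPolynomial τ) (f : W →ₗ[k] M)
    (hf : ∀ g w, f (τ g w) = ρ g (f w)) (w : W) : IsPolynomialElement ρ (f w) := by
  have hmem : ∀ y ∈ (generated τ w).toSubmodule, f y ∈ (generated ρ (f w)).toSubmodule := by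
    intro y hy
    induction hy using Submodule.span_induction with
    | mem y hy =>
      obtain ⟨g, rfl⟩ := hy
      exact Submodule.subset_span ⟨g, (hf g w).symm⟩
    | zero => simp
    | add y z _ _ hy hz => rw [map_add]; exact Submodule.add_mem _ hy hz
    | smul c y _ hy => rw [map_smul]; exact Submodule.smul_mem _ _ hy
  have h1 : IsPolynomial (generated τ w).toRepresentation :=
    h.of_injective (generated τ w).toSubmodule.subtype Subtype.val_injective fun _ _ => rfl
  refine h1.of_surjective (f.restrict hmem) ?_ fun g x => Subtype.ext (hf g x)
  rintro ⟨y, hy⟩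
  have : y ∈ (generated τ w).toSubmodule.map f := by
    have h2 : (generated ρ (f w)).toSubmodule ≤ (generated τ w).toSubmodule.map f := by
      refine Submodule.span_le.2 ?_
      rintro _ ⟨g, rfl⟩
      exact ⟨τ g w, Submodule.subset_span ⟨g, rfl⟩, hf g w⟩
    exact h2 hy
  obtain ⟨x, hx, rfl⟩ := this
  exact ⟨⟨x, hx⟩, rfl⟩

theorem IsPolynomialElement.map {x : M} (h : IsPolynomialElement ρ x) (f : M →ₗ[k] N)
    (hf : ∀ g w, f (ρ g w) = ρ' g (f w)) : IsPolynomialElement ρ' (f x) :=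
  IsPolynomialElement.of_map (τ := (generated ρ x).toRepresentation) h
    (f ∘ₗ (generated ρ x).toSubmodule.subtype) (fun g w => hf g w) ⟨x, generated_mem x⟩

theorem IsPolynomialElement.of_injective {x : N} (f : N →ₗ[k] M)
    (hi : Function.Injective f) (hf : ∀ g w, f (ρ' g w) = ρ g (f w))
    (h : IsPolynomialElement ρ (f x)) : IsPolynomialElement ρ' x := by
  have hmem : ∀ y ∈ (generated ρ' x).toSubmodule, f y ∈ (generated ρ (f x)).toSubmodule := by
    intro y hy
    induction hy using Submodule.span_induction with
    | mem y hy =>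
      obtain ⟨g, rfl⟩ := hy
      exact Submodule.subset_span ⟨g, (hf g x).symm⟩
    | zero => simp
    | add y z _ _ hy hz => rw [map_add]; exact Submodule.add_mem _ hy hz
    | smul c y _ hy => rw [map_smul]; exact Submodule.smul_mem _ _ hy
  exact IsPolynomial.of_injective (ρ := (generated ρ (f x)).toRepresentation) h
    (f.restrict hmem) (fun a b hab => Subtype.ext (hi (congrArg Subtype.val hab)))
    fun g y => Subtype.ext (hf g y)

theorem IsPolynomialElement.map₂ {x : M} {y : N} (h : IsPolynomialElement ρ x)
    (h' : IsPolynomialElement ρ' y) (b : M ⊗[k] N →ₗ[k] P)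
    (hb : ∀ g v w, b (ρ g v ⊗ₜ ρ' g w) = ρ'' g (b (v ⊗ₜ w))) :
    IsPolynomialElement ρ'' (b (x ⊗ₜ y)) := by
  have ht := IsPolynomial.tprod (ρ := (generated ρ x).toRepresentation)
    (ρ' := (generated ρ' y).toRepresentation) h h'
  refine IsPolynomialElement.of_map ht
    (b ∘ₗ TensorProduct.map (generated ρ x).toSubmodule.subtype
      (generated ρ' y).toSubmodule.subtype) ?_ (⟨x, generated_mem x⟩ ⊗ₜ ⟨y, generated_mem y⟩)
  intro g w
  induction w using TensorProduct.induction_on with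
  | zero => simp
  | add v w hv hw => simp only [map_add, hv, hw]
  | tmul v w => exact hb g v.1 w.1

theorem IsPolynomialElement.add {x y : M} (h : IsPolynomialElement ρ x)
    (h' : IsPolynomialElement ρ y) : IsPolynomialElement ρ (x + y) := by
  have ht := IsPolynomial.prod (ρ := (generated ρ x).toRepresentation)
    (ρ' := (generated ρ y).toRepresentation) h h'
  refine IsPolynomialElement.of_map ht
    ((generated ρ x).toSubmodule.subtype.coprod (generated ρ y).toSubmodule.subtype) ?_
    (⟨x, generated_mem x⟩, ⟨y, generated_mem y⟩)
  intro g w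
  exact (map_add (ρ g) _ _).symm

theorem IsPolynomialElement.zero : IsPolynomialElement ρ 0 :=
  IsPolynomialElement.of_map (isPolynomial_tensorRep (k := k) PEmpty)
    (0 : _ →ₗ[k] M) (by simp) 0

/-- Invariant elements are polynomial. -/
theorem IsPolynomialElement.of_invariant {x : M} (h : ∀ g, ρ g x = x) :
    IsPolynomialElement ρ x := by
  let e := PiTensorProduct.isEmptyEquiv (R := k) (s := fun _ : PEmpty => StdSpace k) PEmpty
  have := IsPolynomialElement.of_map (ρ := ρ) (isPolynomial_tensorRep (k := k) PEmpty)
    (LinearMap.toSpanSingleton k M x ∘ₗ e.toLinearMap) (fun g w => ?_) (e.symm 1)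
  · simpa using this
  · have h1 : tensorRep k PEmpty g w = w := by
      have : tensorRep k PEmpty g = LinearMap.id := by
        ext v
        simp only [tensorRep, MonoidHom.coe_mk, OneHom.coe_mk, LinearMap.compMultilinearMap_apply,
          PiTensorProduct.map_tprod, LinearMap.id_apply]
        congr 1
        funext i
        exact i.elim
      rw [this]; rfl
    rw [h1]
    simp [h]

end closure

end PolynomialRepresentations

/-! ### Schur functors applied to the standard representation -/

section Schur

variable (k : Type u) [Field k]

/-- The Young symmetrizer `c_μ = ∑_{p, q} sgn(q) p q` acting on `V^{⊗|μ|}`. Tensor factors are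
indexed by the cells of `μ`; `p` runs over the permutations of the cells preserving every row and
`q` over those preserving every column. -/
noncomputable def youngSymmetrizer (μ : YoungDiagram) :
    (⨂[k] _ : μ.cells, StdSpace k) →ₗ[k] (⨂[k] _ : μ.cells, StdSpace k) :=
  ∑ p : Equiv.Perm μ.cells with ∀ c, (p c).1.1 = c.1.1,
    ∑ q : Equiv.Perm μ.cells with ∀ c, (q c).1.2 = c.1.2,
      ((Equiv.Perm.sign q : ℤ) : k) •
        ((PiTensorProduct.reindex k (fun _ => StdSpace k) p).toLinearMap ∘ₗ
          (PiTensorProduct.reindex k (fun _ => StdSpace k) q).toLinearMap)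

theorem youngSymmetrizer_comm (μ : YoungDiagram) (g : GLInf k)
    (x : ⨂[k] _ : μ.cells, StdSpace k) :
    youngSymmetrizer k μ (tensorRep k μ.cells g x) =
      tensorRep k μ.cells g (youngSymmetrizer k μ x) := by
  have hr : ∀ (e : Equiv.Perm μ.cells) (y : ⨂[k] _ : μ.cells, StdSpace k),
      PiTensorProduct.reindex k (fun _ => StdSpace k) e (tensorRep k μ.cells g y) =
        tensorRep k μ.cells g (PiTensorProduct.reindex k (fun _ => StdSpace k) e y) :=
    fun e y => (PiTensorProduct.map_reindex (fun _ : μ.cells => stdRep k g) e y).symm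
  rw [youngSymmetrizer, LinearMap.sum_apply, LinearMap.sum_apply, map_sum]
  refine Finset.sum_congr rfl fun p _ => ?_
  rw [LinearMap.sum_apply, LinearMap.sum_apply, map_sum]
  refine Finset.sum_congr rfl fun q _ => ?_
  rw [LinearMap.smul_apply, LinearMap.smul_apply, map_smul]
  congr 1
  simp only [LinearMap.comp_apply, LinearEquiv.coe_coe, hr]

/-- The Schur functor `S_μ` evaluated on `V`, as a subrepresentation of `V^{⊗|μ|}`: the image of
the Young symmetrizer. -/
noncomputable def schurSub (μ : YoungDiagram) : Subrepresentation (tensorRep k μ.cells) where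
  toSubmodule := LinearMap.range (youngSymmetrizer k μ)
  apply_mem_toSubmodule := by
    rintro g _ ⟨x, rfl⟩
    exact ⟨tensorRep k μ.cells g x, youngSymmetrizer_comm k μ g x⟩

/-- The underlying space of `k^{⊕μ} = S_μ(V)`. -/
def SchurSpace (μ : YoungDiagram) : Type u := (schurSub k μ).toSubmodule

noncomputable instance (μ : YoungDiagram) : AddCommGroup (SchurSpace k μ) :=
  Module.addCommMonoidToAddCommGroup (M := (schurSub k μ).toSubmodule) k

noncomputable instance (μ : YoungDiagram) : Module k (SchurSpace k μ) :=
  inferInstanceAs (Module k (schurSub k μ).toSubmodule)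

/-- The polynomial representation `k^{⊕μ} = S_μ(V)` of `GL`. -/
noncomputable def schurRep (μ : YoungDiagram) : Representation k (GLInf k) (SchurSpace k μ) :=
  (schurSub k μ).toRepresentation

/-- The underlying space of `k^{⊕σ} = ⨁ᵢ k^{⊕σᵢ}`. -/
def TupleSpace {r : ℕ} (σ : Fin r → YoungDiagram) : Type u := ⨁ i, SchurSpace k (σ i)

noncomputable instance {r : ℕ} (σ : Fin r → YoungDiagram) : AddCommGroup (TupleSpace k σ) :=
  inferInstanceAs (AddCommGroup (⨁ i, SchurSpace k (σ i)))

noncomputable instance {r : ℕ} (σ : Fin r → YoungDiagram) : Module k (TupleSpace k σ) :=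
  inferInstanceAs (Module k (⨁ i, SchurSpace k (σ i)))

/-- The polynomial representation `k^{⊕σ} = ⨁ᵢ k^{⊕σᵢ}` attached to a tuple `σ` of partitions. -/
noncomputable def tupleRep {r : ℕ} (σ : Fin r → YoungDiagram) :
    Representation k (GLInf k) (TupleSpace k σ) :=
  Representation.directSum fun i => schurRep k (σ i)

theorem isPolynomial_schurRep (μ : YoungDiagram) : IsPolynomial (schurRep k μ) :=
  (isPolynomial_tensorRep (k := k) μ.cells).of_injective ((schurSub k μ).toSubmodule.subtype : SchurSpace k μ →ₗ[k] _)
    Subtype.val_injective fun _ _ => rfl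

theorem isPolynomialElement_tupleRep {r : ℕ} (σ : Fin r → YoungDiagram)
    (x : TupleSpace k σ) : IsPolynomialElement (tupleRep k σ) x := by
  induction x using DirectSum.induction_on with
  | zero => exact IsPolynomialElement.zero
  | add x y hx hy => exact hx.add hy
  | of i x =>
    refine IsPolynomialElement.of_map (isPolynomial_schurRep k (σ i))
      (DirectSum.lof k (Fin r) (fun i => SchurSpace k (σ i)) i) (fun g w => ?_) x
    simp only [tupleRep, Representation.directSum_apply, DirectSum.lmap_lof]

end Schur

/-! ### Exterior powers and symmetric algebras of representations -/

section Functorial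

variable {k G M : Type*} [Field k] [Group G] [AddCommGroup M] [Module k M]
  (ρ : Representation k G M)

/-- The exterior power `⋀ⁿ M` of a representation. -/
noncomputable def exteriorRep (n : ℕ) : Representation k G (⋀[k]^n M) where
  toFun g := exteriorPower.map n (ρ g)
  map_one' := (congrArg (exteriorPower.map n) (map_one ρ)).trans exteriorPower.map_id
  map_mul' g h := (congrArg (exteriorPower.map n) (map_mul ρ g h)).trans
    (exteriorPower.map_comp (ρ h) (ρ g))

/-- The action of a group on the symmetric algebra of a representation. -/
noncomputable def symHom : G →* (SymmetricAlgebra k M →ₐ[k] SymmetricAlgebra k M) where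
  toFun g := SymmetricAlgebra.lift (SymmetricAlgebra.ι k M ∘ₗ ρ g)
  map_one' := by
    apply SymmetricAlgebra.algHom_ext
    ext x
    simp
  map_mul' g h := by
    apply SymmetricAlgebra.algHom_ext
    ext x
    simp

end Functorial

/-! ### `GL`-fields -/

section GLFields

variable (k : Type u) [Field k]

/-- A `GL`-field over `k`: an extension `K` of `k` with an action of `GL` by `k`-automorphisms such
that every element is a quotient of two polynomial elements. -/
class IsGLField (K : Type u) [Field K] [Algebra k K] [MulSemiringAction (GLInf k) K]
    [SMulCommClass (GLInf k) k K] : Prop where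
  exists_div (a : K) : ∃ b c : K,
    IsPolynomialElement (Representation.ofDistribMulAction k (GLInf k) K) b ∧
    IsPolynomialElement (Representation.ofDistribMulAction k (GLInf k) K) c ∧
    c ≠ 0 ∧ a = b / c

variable {r : ℕ} (σ : Fin r → YoungDiagram)

/-- The `GL`-algebra `R = Sym(k^{⊕σ})`. -/
abbrev SymRing : Type u := SymmetricAlgebra k (TupleSpace k σ)

noncomputable instance : MulSemiringAction (GLInf k) (SymRing k σ) where
  smul g x := symHom (tupleRep k σ) g x
  one_smul x := by
    change symHom (tupleRep k σ) 1 x = x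
    rw [map_one]; rfl
  mul_smul g h x := by
    change symHom (tupleRep k σ) (g * h) x = _
    rw [map_mul]; rfl
  smul_zero g := map_zero (symHom (tupleRep k σ) g)
  smul_add g := map_add (symHom (tupleRep k σ) g)
  smul_one g := map_one (symHom (tupleRep k σ) g)
  smul_mul g := map_mul (symHom (tupleRep k σ) g)

instance : SMulCommClass (GLInf k) k (SymRing k σ) where
  smul_comm g c x := map_smul (symHom (tupleRep k σ) g) c x

instance : IsDomain (SymRing k σ) :=
  SymmetricAlgebra.instIsDomain

/-- The rational `GL`-field `K = Frac(Sym(k^{⊕σ}))`. -/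
abbrev RatField : Type u := FractionRing (SymRing k σ)

noncomputable instance : MulSemiringAction (GLInf k) (RatField k σ) :=
  IsFractionRing.mulSemiringAction (GLInf k) (SymRing k σ) (RatField k σ)

theorem smul_algebraMap_symRing (g : GLInf k) (x : SymRing k σ) :
    g • algebraMap (SymRing k σ) (RatField k σ) x =
      algebraMap (SymRing k σ) (RatField k σ) (g • x) :=
  IsFractionRing.ringEquivOfRingEquiv_algebraMap _ x

instance : SMulCommClass (GLInf k) k (RatField k σ) where
  smul_comm g c x := by
    have h : g • algebraMap k (RatField k σ) c = algebraMap k (RatField k σ) c := by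
      rw [IsScalarTower.algebraMap_apply k (SymRing k σ) (RatField k σ), smul_algebraMap_symRing]
      congr 1
      rw [Algebra.algebraMap_eq_smul_one, smul_comm, smul_one]
    rw [Algebra.smul_def, Algebra.smul_def, smul_mul', h]

theorem isPolynomialElement_symRing (x : SymRing k σ) :
    IsPolynomialElement (Representation.ofDistribMulAction k (GLInf k) (SymRing k σ)) x := by
  induction x using SymmetricAlgebra.induction with
  | algebraMap c =>
    refine IsPolynomialElement.of_invariant fun g => ?_
    exact (symHom (tupleRep k σ) g).commutes c
  | ι x =>
    refine (isPolynomialElement_tupleRep k σ x).map (SymmetricAlgebra.ι k _) fun g w => ?_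
    exact (SymmetricAlgebra.lift_ι_apply (SymmetricAlgebra.ι k (TupleSpace k σ) ∘ₗ tupleRep k σ g) w).symm
  | mul a b ha hb =>
    have := ha.map₂ hb (LinearMap.mul' k (SymRing k σ))
      (ρ'' := Representation.ofDistribMulAction k (GLInf k) (SymRing k σ)) fun g v w => by
        simp
    simpa using this
  | add a b ha hb => exact ha.add hb

instance : IsGLField k (RatField k σ) where
  exists_div a := by
    have key : ∀ x : SymRing k σ, IsPolynomialElement
        (Representation.ofDistribMulAction k (GLInf k) (RatField k σ))
        (algebraMap (SymRing k σ) (RatField k σ) x) := fun x =>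
      (isPolynomialElement_symRing k σ x).map
        (IsScalarTower.toAlgHom k (SymRing k σ) (RatField k σ)).toLinearMap
        fun g w => (smul_algebraMap_symRing k σ g w).symm
    obtain ⟨b, c, hc, rfl⟩ := IsFractionRing.div_surjective (A := SymRing k σ) a
    refine ⟨_, _, key b, key c, ?_, rfl⟩
    exact (map_ne_zero_iff _ (IsFractionRing.injective (SymRing k σ) (RatField k σ))).2
      (nonZeroDivisors.ne_zero hc)

end GLFields

/-! ### Modules over `GL`-fields -/

section Semilinear

variable {k : Type u} [Field k] {K : Type u} [Field K] [Algebra k K]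
  [MulSemiringAction (GLInf k) K] [SMulCommClass (GLInf k) k K]
  {M : Type u} [AddCommGroup M] [Module K M] [Module k M] [IsScalarTower k K M]
  {ρ : Representation k (GLInf k) M}

theorem IsPolynomialElement.smul (hρ : ∀ g (a : K) m, ρ g (a • m) = (g • a) • ρ g m) {a : K}
    (ha : IsPolynomialElement (Representation.ofDistribMulAction k (GLInf k) K) a) {x : M}
    (hx : IsPolynomialElement ρ x) : IsPolynomialElement ρ (a • x) :=
  ha.map₂ hx (TensorProduct.lift (Algebra.lsmul k k M : K →ₐ[k] Module.End k M).toLinearMap)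
    fun g v w => (hρ g v w).symm

theorem exists_smul_add [IsGLField k K]
    (hρ : ∀ g (a : K) m, ρ g (a • m) = (g • a) • ρ g m) {x y : M}
    (hx : ∃ (a : K) (z : M), IsPolynomialElement ρ z ∧ x = a • z)
    (hy : ∃ (a : K) (z : M), IsPolynomialElement ρ z ∧ y = a • z) :
    ∃ (a : K) (z : M), IsPolynomialElement ρ z ∧ x + y = a • z := by
  obtain ⟨a, x, hx, rfl⟩ := hx
  obtain ⟨b, y, hy, rfl⟩ := hy
  obtain ⟨a₁, a₂, h1, h2, ha, rfl⟩ := IsGLField.exists_div (k := k) a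
  obtain ⟨b₁, b₂, h3, h4, hb, rfl⟩ := IsGLField.exists_div (k := k) b
  refine ⟨(a₂ * b₂)⁻¹, b₂ • (a₁ • x) + a₂ • (b₁ • y),
    (IsPolynomialElement.smul hρ h4 (IsPolynomialElement.smul hρ h1 hx)).add
      (IsPolynomialElement.smul hρ h2 (IsPolynomialElement.smul hρ h3 hy)), ?_⟩
  simp only [smul_add, smul_smul]
  congr 2 <;> field_simp

end Semilinear

set_option linter.unusedSectionVars false

section Modules

variable (k : Type u) [Field k] (K : Type u) [Field K] [Algebra k K]
  [MulSemiringAction (GLInf k) K] [SMulCommClass (GLInf k) k K]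

/-- A `K`-module, for a `GL`-field `K`: a semilinear representation of `GL` over `K` in which every
element is of the form `a • x` with `a ∈ K` and `x` polynomial. -/
structure GLMod where
  /-- the underlying type -/
  carrier : Type u
  [addCommGroup : AddCommGroup carrier]
  [moduleField : Module K carrier]
  [moduleBase : Module k carrier]
  [isScalarTower : IsScalarTower k K carrier]
  /-- the action of `GL` -/
  ρ : Representation k (GLInf k) carrier
  ρ_smul : ∀ (g : GLInf k) (a : K) (m : carrier), ρ g (a • m) = (g • a) • ρ g m
  exists_smul : ∀ m : carrier, ∃ (a : K) (x : carrier), IsPolynomialElement ρ x ∧ m = a • x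

namespace GLMod

attribute [instance] GLMod.addCommGroup GLMod.moduleField GLMod.moduleBase GLMod.isScalarTower

variable {k K}

instance (M : GLMod k K) : SMulCommClass K k M.carrier := IsScalarTower.to_smulCommClass'

/-- Morphisms of `K`-modules: the `K`-linear maps commuting with `GL`, as a `k`-subspace of the
space of all `K`-linear maps. -/
def homSubmodule (M N : GLMod k K) : Submodule k (M.carrier →ₗ[K] N.carrier) where
  carrier := {f | ∀ g m, f (M.ρ g m) = N.ρ g (f m)}
  zero_mem' g m := by simp
  add_mem' hf hf' g m := by simp only [LinearMap.add_apply, hf g m, hf' g m, map_add]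
  smul_mem' c f hf g m := by simp only [LinearMap.smul_apply, hf g m, map_smul]

instance : Category.{u} (GLMod k K) where
  Hom M N := homSubmodule M N
  id M := ⟨LinearMap.id, fun _ _ => rfl⟩
  comp f g := ⟨g.1 ∘ₗ f.1, fun h m => by
    rw [LinearMap.comp_apply, f.2, g.2]; rfl⟩

/-- The `K`-linear map underlying a morphism. -/
def Hom.lin {M N : GLMod k K} (f : M ⟶ N) : M.carrier →ₗ[K] N.carrier := f.1

theorem Hom.comm {M N : GLMod k K} (f : M ⟶ N) (g : GLInf k) (m : M.carrier) :
    Hom.lin f (M.ρ g m) = N.ρ g (Hom.lin f m) := f.2 g m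

/-- Build a morphism from an equivariant `K`-linear map. -/
def homMk {M N : GLMod k K} (f : M.carrier →ₗ[K] N.carrier)
    (hf : ∀ g m, f (M.ρ g m) = N.ρ g (f m)) : M ⟶ N := ⟨f, hf⟩

theorem hom_ext {M N : GLMod k K} {f f' : M ⟶ N} (h : ∀ m, Hom.lin f m = Hom.lin f' m) : f = f' :=
  Subtype.ext (LinearMap.ext h)

noncomputable instance : Preadditive (GLMod k K) where
  homGroup M N := inferInstanceAs (AddCommGroup (homSubmodule M N))
  add_comp _ _ _ _ _ h := Subtype.ext (LinearMap.comp_add _ _ h.1)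
  comp_add _ _ _ f _ _ := Subtype.ext (LinearMap.add_comp f.1 _ _)

noncomputable instance : Linear k (GLMod k K) where
  homModule M N := inferInstanceAs (Module k (homSubmodule M N))
  smul_comp _ _ _ c f h := hom_ext fun m => by
    change h.1 (c • f.1 m) = c • h.1 (f.1 m)
    rw [← algebraMap_smul K c (f.1 m), map_smul, algebraMap_smul]
  comp_smul _ _ _ _ _ _ := rfl

theorem lin_zero {M N : GLMod k K} (m : M.carrier) : Hom.lin (0 : M ⟶ N) m = 0 := rfl

theorem lin_comp {M N P : GLMod k K} (f : M ⟶ N) (g : N ⟶ P) (m : M.carrier) :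
    Hom.lin (f ≫ g) m = Hom.lin g (Hom.lin f m) := rfl

theorem lin_id {M : GLMod k K} (m : M.carrier) : Hom.lin (𝟙 M) m = m := rfl

theorem lin_add {M N : GLMod k K} (f f' : M ⟶ N) (m : M.carrier) :
    Hom.lin (f + f') m = Hom.lin f m + Hom.lin f' m := rfl

/-- A `GL`-stable `K`-subspace of a `K`-module is again a `K`-module. -/
noncomputable def sub (M : GLMod k K) (N : Submodule K M.carrier) (hN : ∀ g, ∀ n ∈ N, M.ρ g n ∈ N) :
    GLMod k K where
  carrier := N
  moduleBase := inferInstanceAs (Module k (N.restrictScalars k))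
  isScalarTower := inferInstanceAs (IsScalarTower k K N)
  ρ := M.ρ.subrepresentation (N.restrictScalars k) hN
  ρ_smul g a n := Subtype.ext (M.ρ_smul g a n.1)
  exists_smul := by
    rintro ⟨n, hn⟩
    by_cases h0 : n = 0
    · subst h0
      exact ⟨0, 0, IsPolynomialElement.zero, by rw [smul_zero]; rfl⟩
    · obtain ⟨a, x, hx, rfl⟩ := M.exists_smul n
      have ha : a ≠ 0 := by rintro rfl; exact h0 (zero_smul _ _)
      have hxN : x ∈ N := by
        have := N.smul_mem a⁻¹ hn
        rwa [smul_smul, inv_mul_cancel₀ ha, one_smul] at this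
      refine ⟨a, ⟨x, hxN⟩, ?_, rfl⟩
      exact IsPolynomialElement.of_injective (x := (⟨x, hxN⟩ : N.restrictScalars k))
        (N.restrictScalars k).subtype Subtype.val_injective (fun _ _ => rfl) hx

/-- The quotient of a `K`-module by a `GL`-stable `K`-subspace. -/
noncomputable def quot (M : GLMod k K) (N : Submodule K M.carrier) (hN : ∀ g, ∀ n ∈ N, M.ρ g n ∈ N) :
    GLMod k K where
  carrier := M.carrier ⧸ N
  moduleBase := Submodule.Quotient.module' N
  isScalarTower := ⟨fun c a m => by
    obtain ⟨m, rfl⟩ := N.mkQ_surjective m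
    exact congrArg N.mkQ (smul_assoc c a m)⟩
  ρ := M.ρ.quotient (N.restrictScalars k) hN
  ρ_smul g a m := by
    obtain ⟨m, rfl⟩ := N.mkQ_surjective m
    exact congrArg N.mkQ (M.ρ_smul g a m)
  exists_smul m := by
    obtain ⟨m, rfl⟩ := N.mkQ_surjective m
    obtain ⟨a, x, hx, rfl⟩ := M.exists_smul m
    exact ⟨a, N.mkQ x, hx.map (N.mkQ.restrictScalars k) fun _ _ => rfl, map_smul _ _ _⟩

/-- The product of two `K`-modules. -/
noncomputable def prod [IsGLField k K] (M N : GLMod k K) : GLMod k K where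
  carrier := M.carrier × N.carrier
  ρ := M.ρ.prod N.ρ
  ρ_smul g a m := Prod.ext (M.ρ_smul g a m.1) (N.ρ_smul g a m.2)
  exists_smul := by
    rintro ⟨m, n⟩
    have h : ((m, n) : M.carrier × N.carrier) = (m, 0) + (0, n) := by simp
    rw [h]
    refine exists_smul_add
      (fun g a m => Prod.ext (M.ρ_smul g a m.1) (N.ρ_smul g a m.2)) ?_ ?_
    · obtain ⟨a, x, hx, rfl⟩ := M.exists_smul m
      exact ⟨a, (x, 0), hx.map (LinearMap.inl k _ _) fun g w => by simp, by simp⟩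
    · obtain ⟨a, x, hx, rfl⟩ := N.exists_smul n
      exact ⟨a, (0, x), hx.map (LinearMap.inr k _ _) fun g w => by simp, by simp⟩

/-- The zero `K`-module. -/
noncomputable def zero : GLMod k K where
  carrier := PUnit
  ρ := 1
  ρ_smul _ _ _ := rfl
  exists_smul _ := ⟨0, 0, IsPolynomialElement.zero, rfl⟩

instance : HasZeroObject (GLMod k K) where
  zero := ⟨zero,
    { unique_to := fun _ => ⟨⟨⟨0⟩, fun q => hom_ext fun m => map_zero (Hom.lin q)⟩⟩
      unique_from := fun _ => ⟨⟨⟨0⟩, fun _ => hom_ext fun _ => rfl⟩⟩ }⟩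

instance : HasTerminal (GLMod k K) := HasZeroObject.hasTerminal

instance [IsGLField k K] : HasBinaryProducts (GLMod k K) :=
  have : ∀ M N : GLMod k K, HasLimit (Limits.pair M N) := fun M N =>
    ⟨⟨{ cone := BinaryFan.mk (P := prod M N)
          (homMk (LinearMap.fst K _ _) fun _ _ => rfl)
          (homMk (LinearMap.snd K _ _) fun _ _ => rfl)
        isLimit := BinaryFan.IsLimit.mk _
          (fun {_} f g => homMk (N := prod M N) ((Hom.lin f).prod (Hom.lin g)) fun h m =>
            Prod.ext (Hom.comm f h m) (Hom.comm g h m))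
          (fun _ _ => rfl) (fun _ _ => rfl)
          (fun _ _ _ hf hg => hom_ext fun x => Prod.ext
            (congrArg (fun q => Hom.lin q x) hf) (congrArg (fun q => Hom.lin q x) hg)) }⟩⟩
  hasBinaryProducts_of_hasLimit_pair _

instance [IsGLField k K] : HasFiniteProducts (GLMod k K) :=
  hasFiniteProducts_of_has_binary_and_terminal

theorem ker_stable {M N : GLMod k K} (f : M ⟶ N) :
    ∀ g, ∀ m ∈ LinearMap.ker (Hom.lin f), M.ρ g m ∈ LinearMap.ker (Hom.lin f) := by
  intro g m hm
  rw [LinearMap.mem_ker] at hm ⊢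
  rw [Hom.comm, hm, map_zero]

theorem range_stable {M N : GLMod k K} (f : M ⟶ N) :
    ∀ g, ∀ m ∈ LinearMap.range (Hom.lin f), N.ρ g m ∈ LinearMap.range (Hom.lin f) := by
  rintro g _ ⟨m, rfl⟩
  exact ⟨M.ρ g m, Hom.comm f g m⟩

/-- The inclusion of the kernel. -/
noncomputable def kerι {M N : GLMod k K} (f : M ⟶ N) : M.sub _ (ker_stable f) ⟶ M :=
  homMk (LinearMap.ker (Hom.lin f)).subtype fun _ _ => rfl

/-- The projection to the cokernel. -/
noncomputable def cokerπ {M N : GLMod k K} (f : M ⟶ N) : N ⟶ N.quot _ (range_stable f) :=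
  homMk (LinearMap.range (Hom.lin f)).mkQ fun _ _ => rfl

theorem kerι_comp {M N : GLMod k K} (f : M ⟶ N) : kerι f ≫ f = 0 :=
  hom_ext fun m => LinearMap.mem_ker.1 m.2

theorem comp_cokerπ {M N : GLMod k K} (f : M ⟶ N) : f ≫ cokerπ f = 0 :=
  hom_ext fun m => (Submodule.Quotient.mk_eq_zero _).2 ⟨m, rfl⟩

instance : HasKernels (GLMod k K) where
  has_limit {M _} f := ⟨⟨{
    cone := KernelFork.ofι (kerι f) (kerι_comp f)
    isLimit := KernelFork.IsLimit.ofι _ _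
      (fun {W} h hh => homMk (N := M.sub _ (ker_stable f))
        ((Hom.lin h).codRestrict (LinearMap.ker (Hom.lin f))
          fun w => congrArg (fun q => Hom.lin q w) hh)
        fun g w => Subtype.ext (Hom.comm h g w))
      (fun _ _ => rfl)
      (fun _ _ m hm => hom_ext fun w => Subtype.ext (congrArg (fun q => Hom.lin q w) hm)) }⟩⟩

instance : HasCokernels (GLMod k K) where
  has_colimit {_ N} f := ⟨⟨{
    cocone := CokernelCofork.ofπ (cokerπ f) (comp_cokerπ f)
    isColimit := CokernelCofork.IsColimit.ofπ _ _
      (fun {_} h hh => homMk (M := N.quot _ (range_stable f))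
        ((LinearMap.range (Hom.lin f)).liftQ (Hom.lin h) (by
          rintro _ ⟨m, rfl⟩
          exact congrArg (fun q => Hom.lin q m) hh))
        fun g w => by
          obtain ⟨w, rfl⟩ := (LinearMap.range (Hom.lin f)).mkQ_surjective w
          exact Hom.comm h g w)
      (fun _ _ => rfl)
      (fun _ _ _ hm => hom_ext fun w => by
        obtain ⟨w, rfl⟩ := (LinearMap.range (Hom.lin f)).mkQ_surjective w
        exact congrArg (fun q => Hom.lin q w) hm) }⟩⟩

theorem injective_of_mono {M N : GLMod k K} (f : M ⟶ N) [Mono f] :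
    Function.Injective (Hom.lin f) := by
  rw [← LinearMap.ker_eq_bot, LinearMap.ker_eq_bot']
  intro m hm
  have h : kerι f = 0 := by
    rw [← cancel_mono f, kerι_comp, zero_comp]
  exact congrArg (fun q => Hom.lin q (⟨m, hm⟩ : LinearMap.ker (Hom.lin f))) h

theorem surjective_of_epi {M N : GLMod k K} (f : M ⟶ N) [Epi f] :
    Function.Surjective (Hom.lin f) := by
  intro n
  have h : cokerπ f = 0 := by
    rw [← cancel_epi f, comp_cokerπ, comp_zero]
  exact (Submodule.Quotient.mk_eq_zero (LinearMap.range (Hom.lin f))).1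
    (congrArg (fun q => Hom.lin q n) h)

instance : IsNormalMonoCategory (GLMod k K) where
  normalMonoOfMono {M N} f _ := by
    let e := LinearEquiv.ofInjective (Hom.lin f) (injective_of_mono f)
    have he : ∀ y, Hom.lin f (e.symm y) = y.1 := fun y =>
      congrArg Subtype.val (e.apply_symm_apply y)
    have hr : ∀ {W : GLMod k K} (h : W ⟶ N), h ≫ cokerπ f = 0 →
        ∀ w, Hom.lin h w ∈ LinearMap.range (Hom.lin f) := fun h hh w =>
      (Submodule.Quotient.mk_eq_zero _).1 (congrArg (fun q => Hom.lin q w) hh)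
    exact ⟨{
      Z := N.quot _ (range_stable f)
      g := cokerπ f
      w := comp_cokerπ f
      isLimit := KernelFork.IsLimit.ofι _ _
        (fun {W} h hh => homMk
          (e.symm.toLinearMap ∘ₗ (Hom.lin h).codRestrict (LinearMap.range (Hom.lin f)) (hr h hh))
          fun g w => injective_of_mono f (by
            rw [Hom.comm]
            simp only [LinearMap.comp_apply, LinearEquiv.coe_coe, he]
            exact Hom.comm h g w))
        (fun h hh => hom_ext fun w => he _)
        (fun h hh m hm => hom_ext fun w => injective_of_mono f (by
          refine (congrArg (fun q => Hom.lin q w) hm).trans ?_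
          exact (he ((Hom.lin h).codRestrict (LinearMap.range (Hom.lin f)) (hr h hh) w)).symm)) }⟩

instance : IsNormalEpiCategory (GLMod k K) where
  normalEpiOfEpi {M N} f _ := by
    let e := (Hom.lin f).quotKerEquivOfSurjective (surjective_of_epi f)
    have he : ∀ m, e.symm (Hom.lin f m) = (LinearMap.ker (Hom.lin f)).mkQ m := fun m =>
      (LinearEquiv.symm_apply_eq e).2 rfl
    have hk : ∀ {W : GLMod k K} (h : M ⟶ W), kerι f ≫ h = 0 →
        LinearMap.ker (Hom.lin f) ≤ LinearMap.ker (Hom.lin h) := by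
      intro W h hh m hm
      have h1 := congrArg (fun q : M.sub _ (ker_stable f) ⟶ W =>
        Hom.lin q (⟨m, hm⟩ : LinearMap.ker (Hom.lin f))) hh
      exact LinearMap.mem_ker.2 h1
    have hd : ∀ {W : GLMod k K} (h : M ⟶ W) (hh : kerι f ≫ h = 0) (m : M.carrier),
        ((LinearMap.ker (Hom.lin f)).liftQ (Hom.lin h) (hk h hh) ∘ₗ e.symm.toLinearMap)
          (Hom.lin f m) = Hom.lin h m := by
      intro W h hh m
      rw [LinearMap.comp_apply, LinearEquiv.coe_coe, he]
      rfl
    exact ⟨{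
      W := M.sub _ (ker_stable f)
      g := kerι f
      w := kerι_comp f
      isColimit := CokernelCofork.IsColimit.ofπ _ _
        (fun {W} h hh => homMk
          ((LinearMap.ker (Hom.lin f)).liftQ (Hom.lin h) (hk h hh) ∘ₗ e.symm.toLinearMap)
          fun g n => by
            obtain ⟨m, rfl⟩ := surjective_of_epi f n
            rw [← Hom.comm, hd h hh, hd h hh, Hom.comm])
        (fun h hh => hom_ext fun m => hd h hh m)
        (fun h hh q hq => hom_ext fun n => by
          obtain ⟨m, rfl⟩ := surjective_of_epi f n
          exact (congrArg (fun q => Hom.lin q m) hq).trans (hd h hh m).symm) }⟩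

noncomputable instance [IsGLField k K] : Abelian (GLMod k K) where

instance [IsGLField k K] : HasExt.{u + 1} (GLMod k K) := HasExt.standard _

variable (K) in
/-- The `K`-module `K ⊗ V` attached to a polynomial representation `V`, with the diagonal action of
`GL`. -/
noncomputable def baseChange [IsGLField k K] {V : Type u} [AddCommGroup V] [Module k V]
    (ρ : Representation k (GLInf k) V) (hρ : IsPolynomial ρ) : GLMod k K where
  carrier := K ⊗[k] V
  ρ := (Representation.ofDistribMulAction k (GLInf k) K).tprod ρ
  ρ_smul g a m := by
    induction m using TensorProduct.induction_on with
    | zero => simp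
    | add x y hx hy => simp only [smul_add, map_add, hx, hy]
    | tmul b v => simp [TensorProduct.smul_tmul']
  exists_smul m := by
    have hs : ∀ (g : GLInf k) (a : K) (m : K ⊗[k] V),
        (Representation.ofDistribMulAction k (GLInf k) K).tprod ρ g (a • m) =
        (g • a) • (Representation.ofDistribMulAction k (GLInf k) K).tprod ρ g m := by
      intro g a m
      induction m using TensorProduct.induction_on with
      | zero => simp
      | add x y hx hy => simp only [smul_add, map_add, hx, hy]
      | tmul b v => simp [TensorProduct.smul_tmul']
    induction m using TensorProduct.induction_on with
    | zero => exact ⟨0, 0, IsPolynomialElement.zero, by simp⟩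
    | add x y hx hy => exact exists_smul_add hs hx hy
    | tmul b v =>
      exact ⟨b, 1 ⊗ₜ v, IsPolynomialElement.of_map hρ (TensorProduct.mk k K V 1)
        (fun g w => by simp) v, by simp [TensorProduct.smul_tmul']⟩

variable (k K) in
/-- The `K`-module `K^{⊕μ} = K ⊗ S_μ(V)`. -/
noncomputable def schur [IsGLField k K] (μ : YoungDiagram) : GLMod k K :=
  baseChange K (schurRep k μ) (isPolynomial_schurRep k μ)

variable (k K) in
/-- The `K`-module `L_μ`: the intersection of the kernels of all maps `K^{⊕μ} → K^{⊕ν}` with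
`|ν| < |μ|`. -/
noncomputable def simple [IsGLField k K] (μ : YoungDiagram) : GLMod k K :=
  (schur k K μ).sub
    (⨅ (ν : YoungDiagram) (_ : ν.card < μ.card) (f : schur k K μ ⟶ schur k K ν),
      LinearMap.ker (Hom.lin f)) (by
    intro g m hm
    simp only [Submodule.mem_iInf] at hm ⊢
    exact fun ν hν f => ker_stable f g m (hm ν hν f))

end GLMod

end Modules

end GLRep

namespace GLRep

/-! ### Vector-valued polynomial functions -/

section PolyFun

variable {k : Type*} [Field k] {N N' N'' : Type*} [AddCommMonoid N] [Module k N]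
  [AddCommMonoid N'] [Module k N'] [AddCommMonoid N''] [Module k N'']

/-- Evaluation at `t` of a polynomial with coefficients in a vector space. -/
noncomputable def polyEval (t : k) : (ℕ →₀ N) →ₗ[k] N :=
  Finsupp.lsum k fun j => t ^ j • LinearMap.id

theorem polyEval_apply (t : k) (p : ℕ →₀ N) : polyEval t p = p.sum fun j v => t ^ j • v := rfl

theorem polyEval_single (t : k) (j : ℕ) (v : N) :
    polyEval t (Finsupp.single j v) = t ^ j • v := by
  simp [polyEval]

theorem polyEval_zero_eq (p : ℕ →₀ N) : polyEval (0 : k) p = p 0 := by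
  rw [polyEval_apply, Finsupp.sum, Finset.sum_eq_single 0]
  · simp
  · intro j _ hj; simp [hj]
  · intro h; simpa using h

theorem map_polyEval (f : N →ₗ[k] N') (t : k) (p : ℕ →₀ N) :
    f (polyEval t p) = polyEval t (Finsupp.mapRange.linearMap f p) := by
  induction p using Finsupp.induction_linear with
  | zero => simp
  | add p q hp hq => simp only [map_add, hp, hq]
  | single j v => simp [polyEval_single]

theorem coeff_mem_of_polyEval_mem [CharZero k] (U : Submodule k N) (p : ℕ →₀ N)
    (h : ∀ t : k, t ≠ 0 → polyEval t p ∈ U) (j : ℕ) : p j ∈ U := by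
  let _ := Module.addCommMonoidToAddCommGroup (M := N) k
  rw [← Submodule.Quotient.mk_eq_zero, ← Submodule.mkQ_apply,
    ← Module.forall_dual_apply_eq_zero_iff k]
  intro φ
  let ψ : N →ₗ[k] k := φ ∘ₗ U.mkQ
  let q : Polynomial k := p.sum fun j v => Polynomial.monomial j (ψ v)
  have hq : ∀ t : k, t ≠ 0 → q.IsRoot t := by
    intro t ht
    have h1 : ψ (polyEval t p) = 0 := by
      have : U.mkQ (polyEval t p) = 0 := (Submodule.Quotient.mk_eq_zero U).2 (h t ht)
      simp [ψ, this]
    rw [Polynomial.IsRoot, ← h1, polyEval_apply, Finsupp.sum, map_sum]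
    simp only [q, Finsupp.sum, Polynomial.eval_finsetSum, Polynomial.eval_monomial, map_smul,
      smul_eq_mul, mul_comm]
  have h0 : q = 0 := by
    refine Polynomial.eq_zero_of_infinite_isRoot q (Set.Infinite.mono (s := {0}ᶜ) ?_ ?_)
    · intro t ht; exact hq t ht
    · exact (Set.finite_singleton (0 : k)).infinite_compl
  have h2 : q.coeff j = ψ (p j) := by
    simp only [q, Finsupp.sum, Polynomial.finsetSum_coeff, Polynomial.coeff_monomial]
    rw [Finset.sum_ite_eq']
    split_ifs with h
    · rfl
    · rw [Finsupp.notMem_support_iff.1 h, map_zero]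
  rw [h0] at h2
  exact h2.symm

theorem polyEval_injective [CharZero k] {p q : ℕ →₀ N}
    (h : ∀ t : k, t ≠ 0 → polyEval t p = polyEval t q) : p = q := by
  let _ := Module.addCommMonoidToAddCommGroup (M := N) k
  ext j
  have := coeff_mem_of_polyEval_mem (k := k) (⊥ : Submodule k N) (p - q)
    (fun t ht => by rw [map_sub, h t ht, sub_self]; exact zero_mem _) j
  rw [Submodule.mem_bot, Finsupp.sub_apply, sub_eq_zero] at this
  exact this

/-- A function of one variable with values in a vector space that is given by a polynomial. -/
def IsPolyFun (f : k → N) : Prop := ∃ p : ℕ →₀ N, ∀ t, f t = polyEval t p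

theorem IsPolyFun.monomial (j : ℕ) (v : N) : IsPolyFun fun t : k => t ^ j • v :=
  ⟨Finsupp.single j v, fun t => (polyEval_single t j v).symm⟩

theorem IsPolyFun.const (v : N) : IsPolyFun fun _ : k => v := by
  simpa using IsPolyFun.monomial (k := k) 0 v

theorem IsPolyFun.add {f g : k → N} (hf : IsPolyFun f) (hg : IsPolyFun g) :
    IsPolyFun fun t => f t + g t := by
  obtain ⟨p, hp⟩ := hf
  obtain ⟨q, hq⟩ := hg
  exact ⟨p + q, fun t => by simp only [hp, hq, map_add]⟩

theorem IsPolyFun.sum {ι : Type*} (s : Finset ι) {f : ι → k → N} (h : ∀ i ∈ s, IsPolyFun (f i)) :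
    IsPolyFun fun t => ∑ i ∈ s, f i t := by
  classical
  induction s using Finset.induction_on with
  | empty => simpa using IsPolyFun.const (k := k) (0 : N)
  | insert a s ha ih =>
    simp only [Finset.sum_insert ha]
    exact (h a (by simp)).add (ih fun i hi => h i (by simp [hi]))

theorem IsPolyFun.map {f : k → N} (hf : IsPolyFun f) (A : N →ₗ[k] N') :
    IsPolyFun fun t => A (f t) := by
  obtain ⟨p, hp⟩ := hf
  exact ⟨Finsupp.mapRange.linearMap A p, fun t => by simp only [hp, map_polyEval]⟩

theorem IsPolyFun.map₂ {f : k → N} {g : k → N'} (hf : IsPolyFun f) (hg : IsPolyFun g)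
    (B : N →ₗ[k] N' →ₗ[k] N'') : IsPolyFun fun t => B (f t) (g t) := by
  obtain ⟨p, hp⟩ := hf
  obtain ⟨q, hq⟩ := hg
  have : ∀ t, B (f t) (g t) = ∑ i ∈ p.support, ∑ j ∈ q.support, t ^ (i + j) • B (p i) (q j) := by
    intro t
    rw [hp, hq, polyEval_apply, polyEval_apply, Finsupp.sum, Finsupp.sum, map_sum B,
      LinearMap.sum_apply]
    refine Finset.sum_congr rfl fun i _ => ?_
    rw [map_sum]
    refine Finset.sum_congr rfl fun j _ => ?_
    rw [map_smul, map_smul, LinearMap.smul_apply, smul_smul, pow_add, mul_comm]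
  simp only [this]
  exact IsPolyFun.sum _ fun i _ => IsPolyFun.sum _ fun j _ => IsPolyFun.monomial _ _

theorem IsPolyFun.multilinear {n : ℕ} {M : Fin n → Type*} [∀ i, AddCommMonoid (M i)]
    [∀ i, Module k (M i)] (Φ : MultilinearMap k M N) {f : ∀ i, k → M i}
    (hf : ∀ i, IsPolyFun (f i)) : IsPolyFun fun t => Φ fun i => f i t := by
  classical
  choose p hp using hf
  have : ∀ t, (Φ fun i => f i t) = ∑ r ∈ Fintype.piFinset fun i => (p i).support,
      t ^ (∑ i, r i) • Φ fun i => p i (r i) := by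
    intro t
    simp only [hp, polyEval_apply, Finsupp.sum]
    rw [MultilinearMap.map_sum_finset]
    refine Finset.sum_congr rfl fun r _ => ?_
    rw [MultilinearMap.map_smul_univ, Finset.prod_pow_eq_pow_sum]
  simp only [this]
  exact IsPolyFun.sum _ fun i _ => IsPolyFun.monomial _ _

/-- The coefficients of a polynomial family of linear maps. -/
noncomputable def polyCoeff [CharZero k] (L : k → N →ₗ[k] N')
    (hL : ∀ x, IsPolyFun fun t => L t x) : N →ₗ[k] (ℕ →₀ N') where
  toFun x := (hL x).choose
  map_add' x y := polyEval_injective (k := k) fun t _ => by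
    rw [map_add, ← (hL x).choose_spec, ← (hL y).choose_spec, ← (hL (x + y)).choose_spec]
    exact map_add _ _ _
  map_smul' c x := polyEval_injective (k := k) fun t _ => by
    rw [RingHom.id_apply, map_smul, ← (hL x).choose_spec, ← (hL (c • x)).choose_spec]
    exact map_smul _ _ _

variable [CharZero k]

theorem polyEval_polyCoeff (L : k → N →ₗ[k] N') (hL : ∀ x, IsPolyFun fun t => L t x) (t : k)
    (x : N) : polyEval t (polyCoeff L hL x) = L t x := ((hL x).choose_spec t).symm

theorem polyCoeff_eq (L : k → N →ₗ[k] N') (hL : ∀ x, IsPolyFun fun t => L t x) {x : N}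
    {p : ℕ →₀ N'} (h : ∀ t : k, t ≠ 0 → L t x = polyEval t p) : polyCoeff L hL x = p :=
  polyEval_injective (k := k) fun t ht => by rw [polyEval_polyCoeff, h t ht]

theorem polyCoeff_natural {M M' : Type*} [AddCommMonoid M] [Module k M] [AddCommMonoid M']
    [Module k M'] (L : k → N →ₗ[k] N') (hL : ∀ x, IsPolyFun fun t => L t x)
    (L' : k → M →ₗ[k] M') (hL' : ∀ x, IsPolyFun fun t => L' t x) (A : N →ₗ[k] M)
    (B : N' →ₗ[k] M') {x : N} (h : ∀ t : k, t ≠ 0 → B (L t x) = L' t (A x)) (j : ℕ) :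
    B (polyCoeff L hL x j) = polyCoeff L' hL' (A x) j := by
  rw [polyCoeff_eq L' hL' (p := Finsupp.mapRange.linearMap B (polyCoeff L hL x)) fun t ht => by
    rw [← map_polyEval, polyEval_polyCoeff, h t ht]]
  simp

theorem polyCoeff_mem (L : k → N →ₗ[k] N') (hL : ∀ x, IsPolyFun fun t => L t x)
    (U : Submodule k N') {x : N} (h : ∀ t : k, t ≠ 0 → L t x ∈ U) (j : ℕ) :
    polyCoeff L hL x j ∈ U :=
  coeff_mem_of_polyEval_mem (k := k) U _ (fun t ht => by rw [polyEval_polyCoeff]; exact h t ht) j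

theorem polyCoeff_sum (L : k → N →ₗ[k] N') (hL : ∀ x, IsPolyFun fun t => L t x) (x : N) :
    ((polyCoeff L hL x).sum fun _ v => v) = L 1 x := by
  rw [← polyEval_polyCoeff L hL]
  simp [polyEval_apply]

theorem polyCoeff_of_monomial (L : k → N →ₗ[k] N') (hL : ∀ x, IsPolyFun fun t => L t x) {x : N}
    {d : ℕ} {v : N'} (h : ∀ t : k, t ≠ 0 → L t x = t ^ d • v) :
    polyCoeff L hL x = Finsupp.single d v :=
  polyCoeff_eq L hL fun t ht => by rw [h t ht, polyEval_single]

/-- A homogeneous function of degree one that is polynomial on lines is additive. -/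
theorem map_add_of_homogeneous_one {f : N → N'} (h1 : ∀ (t : k) x, f (t • x) = t • f x)
    (h2 : ∀ x y, IsPolyFun fun t : k => f (x + t • y)) (x y : N) : f (x + y) = f x + f y := by
  let _ := Module.addCommMonoidToAddCommGroup (M := N') k
  obtain ⟨p, hp⟩ := h2 x y
  obtain ⟨q, hq⟩ := h2 y x
  beta_reduce at hp hq
  rw [← sub_eq_zero, ← Module.forall_dual_apply_eq_zero_iff k]
  intro φ
  let P : Polynomial k := p.sum fun j v => Polynomial.monomial j (φ v)
  let Q : Polynomial k := q.sum fun j v => Polynomial.monomial j (φ v)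
  have hev : ∀ (p : ℕ →₀ N') (t : k), φ (polyEval t p) =
      (p.sum fun j v => Polynomial.monomial j (φ v)).eval t := by
    intro p t
    rw [polyEval_apply, Finsupp.sum, map_sum, Finsupp.sum, Polynomial.eval_finsetSum]
    simp [mul_comm]
  have hP : ∀ t, φ (f (x + t • y)) = P.eval t := fun t => by rw [hp, hev]
  have hQ : ∀ t, φ (f (y + t • x)) = Q.eval t := fun t => by rw [hq, hev]
  have key : ∀ s : k, s ≠ 0 → Q.eval s = s * P.eval s⁻¹ := by
    intro s hs
    rw [← hP, ← hQ, ← smul_eq_mul, ← map_smul, ← h1, smul_add, smul_smul, mul_inv_cancel₀ hs,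
      one_smul, add_comm]
  have key2 : Polynomial.X ^ P.natDegree * Q = Polynomial.X * P.reverse := by
    rw [← sub_eq_zero]
    refine Polynomial.eq_zero_of_infinite_isRoot _ (Set.Infinite.mono (s := {0}ᶜ) ?_
      (Set.finite_singleton (0 : k)).infinite_compl)
    intro s hs
    have hs : s ≠ 0 := hs
    let _ := invertibleOfNonzero (inv_ne_zero hs)
    have h3 := Polynomial.eval₂_reverse_mul_pow (RingHom.id k) s⁻¹ P
    simp only [Set.mem_ofPred_eq, Polynomial.IsRoot, Polynomial.eval_sub, Polynomial.eval_mul,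
      Polynomial.eval_pow, Polynomial.eval_X, key s hs]
    simp only [invOf_eq_inv, inv_inv, Polynomial.eval₂_id] at h3
    rw [← h3, inv_pow]
    field_simp
    ring
  have hd : P.natDegree ≤ 1 := by
    by_contra hlt
    have h4 := congrArg (fun q => Polynomial.coeff q 1) key2
    simp only [Polynomial.coeff_X_mul, Polynomial.coeff_X_pow_mul'] at h4
    rw [if_neg (by omega)] at h4
    rw [Polynomial.coeff_zero_reverse] at h4
    have : P = 0 := Polynomial.leadingCoeff_eq_zero.1 h4.symm
    rw [this] at hlt
    simp at hlt
  have hPe : P = Polynomial.C (P.coeff 1) * Polynomial.X + Polynomial.C (P.coeff 0) :=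
    Polynomial.eq_X_add_C_of_natDegree_le_one hd
  have hQ2 : Q = Polynomial.C (P.coeff 0) * Polynomial.X + Polynomial.C (P.coeff 1) := by
    rw [← sub_eq_zero]
    refine Polynomial.eq_zero_of_infinite_isRoot _ (Set.Infinite.mono (s := {0}ᶜ) ?_
      (Set.finite_singleton (0 : k)).infinite_compl)
    intro s hs
    have hs : s ≠ 0 := hs
    simp only [Set.mem_ofPred_eq, Polynomial.IsRoot, Polynomial.eval_sub, key s hs]
    rw [hPe]
    simp
    field_simp
    ring
  have e1 := hP 1
  have e0 := hP 0
  have e2 := hQ 0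
  rw [hPe] at e1 e0
  rw [hQ2] at e2
  simp only [one_smul, zero_smul, add_zero, Polynomial.eval_add, Polynomial.eval_mul,
    Polynomial.eval_C, Polynomial.eval_X, mul_one, mul_zero, zero_add] at e1 e0 e2
  rw [map_sub, map_add, e1, e0, e2]
  ring

end PolyFun

/-! ### Polynomial laws on the endomorphisms of `V` -/

section Laws

variable {k : Type u} [Field k]

variable (k) in
/-- The monoid of all endomorphisms of `V`. -/
abbrev VEnd : Type u := Module.End k (StdSpace k)

variable (k) in
/-- The basis vector `eᵢ`. -/
noncomputable abbrev bv (i : ℕ) : StdSpace k := Finsupp.single i 1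

/-- The endomorphism with `eᵢ ↦ vᵢ`. -/
noncomputable def ofVecs (v : ℕ → StdSpace k) : VEnd k := Finsupp.linearCombination k v

@[simp] theorem ofVecs_bv (v : ℕ → StdSpace k) (i : ℕ) : ofVecs v (bv k i) = v i := by
  simp [ofVecs]

theorem vEnd_ext {a b : VEnd k} (h : ∀ i, a (bv k i) = b (bv k i)) : a = b :=
  Finsupp.lhom_ext' fun i => LinearMap.ext_ring (h i)

theorem exists_coord (s : Finset ℕ) (v : ℕ → StdSpace k) :
    ∃ m, ∀ i ∈ s, v i ∈ coordSubspace k m := by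
  classical
  refine ⟨(s.biUnion fun i => (v i).support).sup id + 1, fun i hi => ?_⟩
  rw [coordSubspace, Finsupp.mem_supported]
  intro j hj
  have : j ≤ (s.biUnion fun i => (v i).support).sup id :=
    Finset.le_sup (f := id) (Finset.mem_biUnion.2 ⟨i, hi, hj⟩)
  exact Nat.lt_succ_of_le this

theorem bv_mem_coord {i n : ℕ} (h : i < n) : bv k i ∈ coordSubspace k n :=
  Finsupp.single_mem_supported k 1 h

theorem coord_induction {n : ℕ} {U : Submodule k (StdSpace k)} (h : ∀ i < n, bv k i ∈ U) :
    coordSubspace k n ≤ U := by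
  rw [coordSubspace, Finsupp.supported_eq_span_single, Submodule.span_le]
  rintro _ ⟨i, hi, rfl⟩
  exact h i hi

theorem eqOn_coord {n : ℕ} {N : Type*} [AddCommMonoid N] [Module k N] {a b : StdSpace k →ₗ[k] N}
    (h : ∀ i < n, a (bv k i) = b (bv k i)) {x : StdSpace k} (hx : x ∈ coordSubspace k n) :
    a x = b x :=
  coord_induction (U := LinearMap.eqLocus a b) h hx

variable {N N' N'' : Type*} [AddCommMonoid N] [Module k N]
  [AddCommMonoid N'] [Module k N'] [AddCommMonoid N''] [Module k N'']

/-- Polynomial laws: functions on `End V` that only depend on the values of an endomorphism at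
finitely many basis vectors and that are polynomial on lines. -/
structure IsLaw (F : VEnd k → N) : Prop where
  fin : ∃ n : ℕ, ∀ a b : VEnd k, (∀ i < n, a (bv k i) = b (bv k i)) → F a = F b
  line : ∀ a b : VEnd k, IsPolyFun fun t : k => F (a + t • b)

theorem IsLaw.const (x : N) : IsLaw fun _ : VEnd k => x :=
  ⟨⟨0, fun _ _ _ => rfl⟩, fun _ _ => IsPolyFun.const x⟩

theorem IsLaw.add {F G : VEnd k → N} (hF : IsLaw F) (hG : IsLaw G) :
    IsLaw fun a => F a + G a := by
  obtain ⟨n, hn⟩ := hF.fin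
  obtain ⟨m, hm⟩ := hG.fin
  refine ⟨⟨max n m, fun a b h => ?_⟩, fun a b => (hF.line a b).add (hG.line a b)⟩
  rw [hn a b fun i hi => h i (lt_max_of_lt_left hi), hm a b fun i hi => h i (lt_max_of_lt_right hi)]

theorem IsLaw.map {F : VEnd k → N} (hF : IsLaw F) (A : N →ₗ[k] N') : IsLaw fun a => A (F a) := by
  obtain ⟨n, hn⟩ := hF.fin
  exact ⟨⟨n, fun a b h => by rw [hn a b h]⟩, fun a b => (hF.line a b).map A⟩

theorem IsLaw.map₂ {F : VEnd k → N} {G : VEnd k → N'} (hF : IsLaw F) (hG : IsLaw G)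
    (B : N →ₗ[k] N' →ₗ[k] N'') : IsLaw fun a => B (F a) (G a) := by
  obtain ⟨n, hn⟩ := hF.fin
  obtain ⟨m, hm⟩ := hG.fin
  refine ⟨⟨max n m, fun a b h => ?_⟩, fun a b => (hF.line a b).map₂ (hG.line a b) B⟩
  rw [hn a b fun i hi => h i (lt_max_of_lt_left hi), hm a b fun i hi => h i (lt_max_of_lt_right hi)]

theorem IsLaw.multilinear {n : ℕ} {M : Fin n → Type*} [∀ i, AddCommMonoid (M i)]
    [∀ i, Module k (M i)] (Φ : MultilinearMap k M N) {F : ∀ i, VEnd k → M i}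
    (hF : ∀ i, IsLaw (F i)) : IsLaw fun a => Φ fun i => F i a := by
  choose m hm using fun i => (hF i).fin
  refine ⟨⟨Finset.univ.sup m, fun a b h => ?_⟩,
    fun a b => IsPolyFun.multilinear Φ fun i => (hF i).line a b⟩
  congr 1
  funext i
  exact hm i a b fun j hj => h j (lt_of_lt_of_le hj (Finset.le_sup (Finset.mem_univ i)))

theorem IsLaw.eval (v : StdSpace k) : IsLaw fun a : VEnd k => a v := by
  obtain ⟨m, hm⟩ := exists_coord {0} fun _ => v
  refine ⟨⟨m, fun a b h => eqOn_coord h (hm 0 (by simp))⟩, fun a b => ?_⟩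
  have : ∀ t : k, (a + t • b) v = a v + t ^ 1 • b v := fun t => by simp
  simp only [this]
  exact (IsPolyFun.const _).add (IsPolyFun.monomial _ _)

theorem IsLaw.comp_affine {F : VEnd k → N} (hF : IsLaw F) (A B : VEnd k → VEnd k)
    (hA : ∀ a b (t : k), A (a + t • b) = A a + t • B b)
    (hfin : ∀ n : ℕ, ∃ m : ℕ, ∀ a b, (∀ i < m, a (bv k i) = b (bv k i)) →
      ∀ i < n, A a (bv k i) = A b (bv k i)) : IsLaw fun a => F (A a) := by
  obtain ⟨n, hn⟩ := hF.fin
  obtain ⟨m, hm⟩ := hfin n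
  refine ⟨⟨m, fun a b h => hn _ _ (hm a b h)⟩, fun a b => ?_⟩
  simp only [hA]
  exact hF.line _ _

theorem IsLaw.comp_mul_left {F : VEnd k → N} (hF : IsLaw F) (c : VEnd k) :
    IsLaw fun a => F (c * a) :=
  hF.comp_affine (c * ·) (c * ·) (fun a b t => by rw [mul_add, mul_smul_comm])
    fun n => ⟨n, fun a b h i hi => by simp only [Module.End.mul_apply, h i hi]⟩

theorem IsLaw.comp_mul_right {F : VEnd k → N} (hF : IsLaw F) (c : VEnd k) :
    IsLaw fun a => F (a * c) :=
  hF.comp_affine (· * c) (· * c) (fun a b t => by rw [add_mul, smul_mul_assoc])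
    fun n => by
      obtain ⟨m, hm⟩ := exists_coord (Finset.range n) fun i => c (bv k i)
      exact ⟨m, fun a b h i hi => eqOn_coord h (hm i (Finset.mem_range.2 hi))⟩

theorem exists_glInf {a b : VEnd k} (hab : a * b = 1) (hba : b * a = 1) (n : ℕ)
    (ha : ∀ i < n, a (bv k i) ∈ coordSubspace k n) (hb : ∀ i < n, b (bv k i) ∈ coordSubspace k n)
    (hi : ∀ i, n ≤ i → a (bv k i) = bv k i) : ∃ g : GLInf k, stdRep k g = a := by
  let g : StdSpace k ≃ₗ[k] StdSpace k := LinearEquiv.ofLinearMap a b hab hba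
  refine ⟨⟨g, n, le_antisymm ?_ ?_, hi⟩, LinearMap.ext fun x => rfl⟩
  · rw [Submodule.map_le_iff_le_comap]
    exact coord_induction (U := (coordSubspace k n).comap a) ha
  · intro x hx
    refine ⟨b x, coord_induction (U := (coordSubspace k n).comap b) hb hx, ?_⟩
    exact LinearMap.congr_fun hab x

theorem exists_glInf_approx (a : VEnd k) (n : ℕ) : ∃ b : VEnd k, ∀ t : k, t ≠ 0 →
    ∃ g : GLInf k, ∀ i < n, stdRep k g (bv k i) = (a + t • b) (bv k i) := by
  obtain ⟨m', hm'⟩ := exists_coord (Finset.range n) fun i => a (bv k i)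
  obtain ⟨m, hnm, hm⟩ : ∃ m, n ≤ m ∧ ∀ i < n, a (bv k i) ∈ coordSubspace k m :=
    ⟨max n m', le_max_left _ _, fun i hi => Finsupp.supported_mono
      (Set.Iio_subset_Iio (le_max_right _ _)) (hm' i (Finset.mem_range.2 hi))⟩
  refine ⟨ofVecs fun i => bv k (m + i), fun t ht => ?_⟩
  let D : VEnd k := ofVecs fun j => if m ≤ j ∧ j < m + n then a (bv k (j - m)) else 0
  have hD0 : ∀ x ∈ coordSubspace k m, D x = 0 := by
    intro x hx
    refine eqOn_coord (a := D) (b := 0) (fun i hi => ?_) hx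
    simp only [D, ofVecs_bv, LinearMap.zero_apply]
    rw [if_neg (by omega)]
  have hDm : ∀ i, D (bv k i) ∈ coordSubspace k m := by
    intro i
    simp only [D, ofVecs_bv]
    split_ifs with h
    · exact hm _ (by omega)
    · exact zero_mem _
  have hDD : D * D = 0 := vEnd_ext fun i => hD0 _ (hDm i)
  have hmono : coordSubspace k m ≤ coordSubspace k (m + n) :=
    Finsupp.supported_mono (Set.Iio_subset_Iio (by omega))
  have hu : ∃ g : GLInf k, stdRep k g = 1 + t⁻¹ • D := by
    refine exists_glInf (b := 1 - t⁻¹ • D) ?_ ?_ (m + n) ?_ ?_ ?_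
    · refine LinearMap.ext fun x => ?_
      have := LinearMap.congr_fun hDD x
      simp only [Module.End.mul_apply, LinearMap.zero_apply] at this
      simp [this]
    · refine LinearMap.ext fun x => ?_
      have := LinearMap.congr_fun hDD x
      simp only [Module.End.mul_apply, LinearMap.zero_apply] at this
      simp [this]
    · intro i hi
      exact add_mem (bv_mem_coord hi) (Submodule.smul_mem _ _ (hmono (hDm i)))
    · intro i hi
      exact sub_mem (bv_mem_coord hi) (Submodule.smul_mem _ _ (hmono (hDm i)))
    · intro i hi
      simp only [LinearMap.add_apply, Module.End.one_apply, LinearMap.smul_apply, D, ofVecs_bv]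
      rw [if_neg (by omega)]; simp
  have hd : ∃ g : GLInf k, stdRep k g =
      ofVecs fun j => if m ≤ j ∧ j < m + n then t • bv k j else bv k j := by
    refine exists_glInf (b := ofVecs fun j => if m ≤ j ∧ j < m + n then t⁻¹ • bv k j else bv k j)
      ?_ ?_ (m + n) ?_ ?_ ?_
    · refine vEnd_ext fun i => ?_
      rw [Module.End.mul_apply, ofVecs_bv]
      split_ifs with h
      · rw [map_smul, ofVecs_bv, if_pos h, smul_smul, inv_mul_cancel₀ ht, one_smul]; rfl
      · rw [ofVecs_bv, if_neg h]; rfl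
    · refine vEnd_ext fun i => ?_
      rw [Module.End.mul_apply, ofVecs_bv]
      split_ifs with h
      · rw [map_smul, ofVecs_bv, if_pos h, smul_smul, mul_inv_cancel₀ ht, one_smul]; rfl
      · rw [ofVecs_bv, if_neg h]; rfl
    · intro i hi
      rw [ofVecs_bv]
      split_ifs
      · exact Submodule.smul_mem _ _ (bv_mem_coord hi)
      · exact bv_mem_coord hi
    · intro i hi
      rw [ofVecs_bv]
      split_ifs
      · exact Submodule.smul_mem _ _ (bv_mem_coord hi)
      · exact bv_mem_coord hi
    · intro i hi
      rw [ofVecs_bv, if_neg (by omega)]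
  let f : ℕ → ℕ := fun j => if j < n then m + j else if m ≤ j ∧ j < m + n then j - m else j
  have hff : ∀ j, f (f j) = j := by
    intro j
    simp only [f]
    split_ifs <;> omega
  have hs : ∃ g : GLInf k, stdRep k g = ofVecs fun j => bv k (f j) := by
    have h1 : (ofVecs fun j => bv k (f j)) * (ofVecs fun j => bv k (f j)) = 1 :=
      vEnd_ext fun i => by rw [Module.End.mul_apply, ofVecs_bv, ofVecs_bv, hff]; rfl
    refine exists_glInf h1 h1 (m + n) ?_ ?_ ?_
    · intro i hi
      rw [ofVecs_bv]
      exact bv_mem_coord (by simp only [f]; split_ifs <;> omega)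
    · intro i hi
      rw [ofVecs_bv]
      exact bv_mem_coord (by simp only [f]; split_ifs <;> omega)
    · intro i hi
      rw [ofVecs_bv]
      congr 1
      simp only [f]; split_ifs <;> omega
  obtain ⟨u, hu⟩ := hu
  obtain ⟨d, hd⟩ := hd
  obtain ⟨s, hs⟩ := hs
  refine ⟨u * (d * s), fun i hi => ?_⟩
  rw [map_mul, map_mul, Module.End.mul_apply, Module.End.mul_apply, hu, hd, hs, ofVecs_bv]
  have : f i = m + i := by simp [f, hi]
  rw [this, ofVecs_bv, if_pos (by omega), map_smul]
  simp only [LinearMap.add_apply, Module.End.one_apply, LinearMap.smul_apply, D, ofVecs_bv]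
  rw [if_pos (by omega), smul_add, smul_smul, mul_inv_cancel₀ ht, one_smul, Nat.add_sub_cancel_left,
    add_comm]

/-- A polynomial law with values in a subspace on `GL` has all its values in the subspace. -/
theorem IsLaw.mem [CharZero k] {F : VEnd k → N} (hF : IsLaw F) (U : Submodule k N)
    (h : ∀ g : GLInf k, F (stdRep k g) ∈ U) (a : VEnd k) : F a ∈ U := by
  obtain ⟨n, hn⟩ := hF.fin
  obtain ⟨b, hb⟩ := exists_glInf_approx a n
  obtain ⟨p, hp⟩ := hF.line a b
  beta_reduce at hp
  have h0 := coeff_mem_of_polyEval_mem U p (fun t ht => by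
    obtain ⟨g, hg⟩ := hb t ht
    rw [← hp, ← hn _ _ hg]
    exact h g) 0
  rwa [← polyEval_zero_eq (k := k), ← hp, zero_smul, add_zero] at h0

theorem IsLaw.ext [CharZero k] {F G : VEnd k → N} (hF : IsLaw F) (hG : IsLaw G)
    (h : ∀ g : GLInf k, F (stdRep k g) = G (stdRep k g)) (a : VEnd k) : F a = G a := by
  let _ := Module.addCommMonoidToAddCommGroup (M := N) k
  have := (hF.add (hG.map (-LinearMap.id))).mem ⊥ (fun g => by simp [h g]) a
  simpa [add_neg_eq_zero] using this

theorem IsLaw.codRestrict [CharZero k] {F : VEnd k → N} (hF : IsLaw F) (U : Submodule k N)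
    (h : ∀ a, F a ∈ U) : IsLaw fun a => (⟨F a, h a⟩ : U) := by
  obtain ⟨n, hn⟩ := hF.fin
  refine ⟨⟨n, fun a b hab => Subtype.ext (hn a b hab)⟩, fun a b => ?_⟩
  obtain ⟨p, hp⟩ := hF.line a b
  have hpU := coeff_mem_of_polyEval_mem U p fun t _ => by rw [← hp]; exact h _
  refine ⟨Finsupp.onFinset p.support (fun j => ⟨p j, hpU j⟩) fun j hj => ?_, fun t => ?_⟩
  · rw [Finsupp.mem_support_iff]
    exact fun h0 => hj (Subtype.ext h0)
  · apply Subtype.ext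
    change F (a + t • b) = U.subtype _
    rw [map_polyEval]
    refine (hp t).trans ?_
    congr 1
    ext j
    simp

end Laws

/-! ### Lawful representations -/

section Lawful

variable {k : Type u} [Field k] {N N' N'' : Type*} [AddCommMonoid N] [Module k N]
  [AddCommMonoid N'] [Module k N'] [AddCommMonoid N''] [Module k N'']

/-- A representation of the monoid `End V` all of whose orbit maps are polynomial laws. -/
def Lawful (τ : Representation k (VEnd k) N) : Prop := ∀ x, IsLaw fun a => τ a x

/-- An element of a representation of `GL` whose orbit map extends to a polynomial law. -/
def PolyElt (ρ : Representation k (GLInf k) N) (x : N) : Prop :=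
  ∃ F : VEnd k → N, IsLaw F ∧ ∀ g, F (stdRep k g) = ρ g x

theorem PolyElt.add {ρ : Representation k (GLInf k) N} {x y : N} (hx : PolyElt ρ x)
    (hy : PolyElt ρ y) : PolyElt ρ (x + y) := by
  obtain ⟨F, hF, hF'⟩ := hx
  obtain ⟨G, hG, hG'⟩ := hy
  exact ⟨_, hF.add hG, fun g => by rw [hF', hG', map_add]⟩

theorem PolyElt.zero {ρ : Representation k (GLInf k) N} : PolyElt ρ 0 :=
  ⟨_, IsLaw.const 0, fun g => (map_zero _).symm⟩

theorem PolyElt.map {ρ : Representation k (GLInf k) N} {ρ' : Representation k (GLInf k) N'} {x : N}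
    (hx : PolyElt ρ x) (f : N →ₗ[k] N') (hf : ∀ g y, f (ρ g y) = ρ' g (f y)) :
    PolyElt ρ' (f x) := by
  obtain ⟨F, hF, hF'⟩ := hx
  exact ⟨_, hF.map f, fun g => by rw [hF', hf]⟩

theorem PolyElt.of_injective [CharZero k] {ρ : Representation k (GLInf k) N}
    {ρ' : Representation k (GLInf k) N'} {x : N} (f : N →ₗ[k] N') (hi : Function.Injective f)
    (hf : ∀ g y, f (ρ g y) = ρ' g (f y)) (hx : PolyElt ρ' (f x)) : PolyElt ρ x := by
  obtain ⟨F, hF, hF'⟩ := hx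
  have hmem : ∀ a, F a ∈ LinearMap.range f := hF.mem _ fun g => ⟨ρ g x, by rw [hf, hF']⟩
  let e := LinearEquiv.ofInjective f hi
  refine ⟨_, (hF.codRestrict _ hmem).map e.symm.toLinearMap, fun g => ?_⟩
  rw [LinearEquiv.coe_coe, LinearEquiv.symm_apply_eq]
  exact Subtype.ext ((hF' g).trans (hf g x).symm)

theorem polyElt_tensorRep (n : ℕ) (x : ⨂[k] _ : Fin n, StdSpace k) :
    PolyElt (tensorRep k (Fin n)) x := by
  induction x using PiTensorProduct.induction_on with
  | add x y hx hy => exact hx.add hy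
  | smul_tprod r v =>
    refine ⟨fun a => r • PiTensorProduct.tprod k fun i => a (v i),
      (IsLaw.multilinear (PiTensorProduct.tprod k) fun i => IsLaw.eval (v i)).map
        (LinearMap.lsmul k _ r), fun g => ?_⟩
    rw [map_smul]
    exact congrArg (r • ·) (PiTensorProduct.map_tprod (fun _ : Fin n => stdRep k g) v).symm

theorem polyElt_tensorSum {ι : Type u} (n : ι → ℕ) (x : ⨁ i, ⨂[k] _ : Fin (n i), StdSpace k) :
    PolyElt (tensorSum k n) x := by
  classical
  induction x using DirectSum.induction_on with
  | zero => exact PolyElt.zero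
  | add x y hx hy => exact hx.add hy
  | of i x =>
    refine (polyElt_tensorRep (n i) x).map
      (DirectSum.lof k ι (fun i => ⨂[k] _ : Fin (n i), StdSpace k) i) fun g y => ?_
    simp only [tensorSum, Representation.directSum_apply, DirectSum.lmap_lof]

theorem IsPolynomial.polyElt [CharZero k] {N : Type u} [AddCommMonoid N] [Module k N]
    {ρ : Representation k (GLInf k) N}
    (h : IsPolynomial ρ) (x : N) : PolyElt ρ x := by
  obtain ⟨ι, n, A, f, hf⟩ := h
  obtain ⟨y, rfl⟩ := hf x
  exact ((polyElt_tensorSum n y.1).of_injective (ρ := A.toRepresentation) A.toSubmodule.subtype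
    Subtype.val_injective (fun _ _ => rfl)).map f.toLinearMap fun g y => f.isIntertwining _ _ g y

theorem IsPolynomialElement.polyElt [CharZero k] {N : Type u} [AddCommMonoid N] [Module k N]
    {ρ : Representation k (GLInf k) N} {x : N} (h : IsPolynomialElement ρ x) : PolyElt ρ x := by
  exact (IsPolynomial.polyElt h ⟨x, generated_mem x⟩).map (generated ρ x).toSubmodule.subtype
    fun _ _ => rfl

variable [CharZero k]

/-- The extension to `End V` of a representation of `GL` with polynomial orbit maps. -/
noncomputable def ext (ρ : Representation k (GLInf k) N) (h : ∀ x, PolyElt ρ x) :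
    Representation k (VEnd k) N where
  toFun a :=
    { toFun x := (h x).choose a
      map_add' x y := IsLaw.ext (h (x + y)).choose_spec.1
        ((h x).choose_spec.1.add (h y).choose_spec.1) (fun g => by
          rw [(h (x + y)).choose_spec.2, (h x).choose_spec.2, (h y).choose_spec.2, map_add]) a
      map_smul' c x := IsLaw.ext (h (c • x)).choose_spec.1
        ((h x).choose_spec.1.map (c • LinearMap.id)) (fun g => by
          rw [(h (c • x)).choose_spec.2, (h x).choose_spec.2, map_smul]; rfl) a }
  map_one' := LinearMap.ext fun x => by
    have := (h x).choose_spec.2 1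
    rw [map_one, map_one] at this
    exact this
  map_mul' a b := LinearMap.ext fun x => by
    refine IsLaw.ext ((h x).choose_spec.1.comp_mul_right b)
      (h ((h x).choose b)).choose_spec.1 (fun g => ?_) a
    rw [(h ((h x).choose b)).choose_spec.2]
    refine IsLaw.ext ((h x).choose_spec.1.comp_mul_left (stdRep k g))
      ((h x).choose_spec.1.map (ρ g)) (fun g' => ?_) b
    rw [← map_mul, (h x).choose_spec.2, (h x).choose_spec.2, map_mul]; rfl

theorem lawful_ext (ρ : Representation k (GLInf k) N) (h : ∀ x, PolyElt ρ x) :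
    Lawful (ext ρ h) := fun x => (h x).choose_spec.1

theorem ext_stdRep (ρ : Representation k (GLInf k) N) (h : ∀ x, PolyElt ρ x) (g : GLInf k) :
    ext ρ h (stdRep k g) = ρ g := LinearMap.ext fun x => (h x).choose_spec.2 g

/-- Restriction to `GL` of a representation of `End V`. -/
noncomputable def res (τ : Representation k (VEnd k) N) : Representation k (GLInf k) N :=
  MonoidHom.comp τ (stdRep k)

theorem res_apply (τ : Representation k (VEnd k) N) (g : GLInf k) : res τ g = τ (stdRep k g) := rfl

theorem res_ext (ρ : Representation k (GLInf k) N) (h : ∀ x, PolyElt ρ x) : res (ext ρ h) = ρ :=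
  MonoidHom.ext fun g => ext_stdRep ρ h g

theorem Lawful.map_of_res {τ : Representation k (VEnd k) N} {τ' : Representation k (VEnd k) N'}
    (h : Lawful τ) (h' : Lawful τ') (f : N →ₗ[k] N')
    (hf : ∀ (g : GLInf k) x, f (τ (stdRep k g) x) = τ' (stdRep k g) (f x)) (a : VEnd k) (x : N) :
    f (τ a x) = τ' a (f x) :=
  IsLaw.ext ((h x).map f) (h' (f x)) (fun g => hf g x) a

theorem Lawful.mem_of_res {τ : Representation k (VEnd k) N} (h : Lawful τ) (U : Submodule k N)
    (hU : ∀ (g : GLInf k), ∀ x ∈ U, τ (stdRep k g) x ∈ U) (a : VEnd k) {x : N} (hx : x ∈ U) :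
    τ a x ∈ U := (h x).mem U (fun g => hU g x hx) a

end Lawful

end GLRep

namespace GLRep

/-! ### Weights and multilinear vectors -/

section Weights

variable {k : Type u} [Field k]

/-- The endomorphism of `V` scaling `eᵢ` by `t` and fixing the other basis vectors. -/
noncomputable def scl (i : ℕ) (t : k) : VEnd k :=
  ofVecs fun j => if j = i then t • bv k j else bv k j

variable (k) in
/-- The projection of `V` onto the span of the `eᵢ` with `i ∈ S`. -/
noncomputable def proj (S : Finset ℕ) : VEnd k := ofVecs fun j => if j ∈ S then bv k j else 0

variable (k) in
/-- The endomorphism of `V` mapping `eᵢ` to the basis vector with index `f i`. -/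
noncomputable def ren (f : ℕ → ℕ) : VEnd k := ofVecs fun j => bv k (f j)

@[simp] theorem scl_bv (i j : ℕ) (t : k) :
    scl i t (bv k j) = if j = i then t • bv k j else bv k j := ofVecs_bv _ _

@[simp] theorem proj_bv (S : Finset ℕ) (j : ℕ) :
    proj k S (bv k j) = if j ∈ S then bv k j else 0 := ofVecs_bv _ _

@[simp] theorem ren_bv (f : ℕ → ℕ) (j : ℕ) : ren k f (bv k j) = bv k (f j) := ofVecs_bv _ _

theorem scl_line (i : ℕ) (t : k) : scl i t = scl i 0 + t • proj k {i} := vEnd_ext fun j => by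
  simp only [LinearMap.add_apply, LinearMap.smul_apply, scl_bv, proj_bv, Finset.mem_singleton]
  split_ifs <;> simp

theorem scl_mul_proj {i : ℕ} {S : Finset ℕ} (h : i ∉ S) (t : k) :
    scl i t * proj k S = proj k S := vEnd_ext fun j => by
  simp only [Module.End.mul_apply, proj_bv]
  split_ifs with hj
  · rw [scl_bv, if_neg (by rintro rfl; exact h hj)]
  · simp

theorem scl_comm {i j : ℕ} (h : i ≠ j) (s t : k) : scl i s * scl j t = scl j t * scl i s :=
  vEnd_ext fun l => by
    simp only [Module.End.mul_apply, scl_bv]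
    split_ifs <;> simp_all [-Finsupp.smul_single]

theorem scl_proj_comm (i : ℕ) (s : k) (S : Finset ℕ) : scl i s * proj k S = proj k S * scl i s :=
  vEnd_ext fun l => by
    simp only [Module.End.mul_apply, scl_bv, proj_bv]
    split_ifs <;> simp_all [-Finsupp.smul_single]

variable {N : Type*} [AddCommGroup N] [Module k N] {τ : Representation k (VEnd k) N}

theorem mul_app (a b : VEnd k) (x : N) : τ (a * b) x = τ a (τ b x) := by
  rw [map_mul]; rfl

theorem one_app (x : N) : τ 1 x = x := by rw [map_one]; rfl

theorem Lawful.isPolyFun_scl (h : Lawful τ) (i : ℕ) (x : N) :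
    IsPolyFun fun t => τ (scl i t) x := by
  have := (h x).line (scl i 0) (proj k {i})
  simp only [← scl_line] at this
  exact this

theorem Lawful.exists_proj (h : Lawful τ) (x : N) :
    ∃ n, ∀ m, n ≤ m → τ (proj k (Finset.range m)) x = x := by
  obtain ⟨n, hn⟩ := (h x).fin
  refine ⟨n, fun m hm => ?_⟩
  rw [hn (proj k (Finset.range m)) 1 fun i hi => ?_, one_app]
  rw [proj_bv, if_pos (by simpa using hi.trans_le hm)]; rfl

/-- `x` has weight `d` for the `i`-th basis vector. -/
def IsWt (τ : Representation k (VEnd k) N) (i d : ℕ) (x : N) : Prop :=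
  ∀ t : k, τ (scl i t) x = t ^ d • x

variable [CharZero k]

/-- The component of weight `d` for the `i`-th basis vector. -/
noncomputable def Lawful.wt (h : Lawful τ) (i d : ℕ) : N →ₗ[k] N :=
  Finsupp.lapply d ∘ₗ polyCoeff (fun t => τ (scl i t)) (h.isPolyFun_scl i)

theorem polyCoeff_rescale {N' : Type*} [AddCommGroup N'] [Module k N'] (L : k → N →ₗ[k] N')
    (hL : ∀ x, IsPolyFun fun t => L t x) (L' : k → N →ₗ[k] N') (hL' : ∀ x, IsPolyFun fun t => L' t x)
    (s : k) {x x' : N} (h : ∀ t : k, t ≠ 0 → L' t x' = L (s * t) x) (j : ℕ) :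
    polyCoeff L' hL' x' j = s ^ j • polyCoeff L hL x j := by
  rw [polyCoeff_eq L' hL' (p := Finsupp.onFinset (polyCoeff L hL x).support
    (fun j => s ^ j • polyCoeff L hL x j) (fun j hj => by
      rw [Finsupp.mem_support_iff]; intro h0; rw [h0, smul_zero] at hj; exact hj rfl))]
  · rfl
  · intro t ht
    rw [h t ht, ← polyEval_polyCoeff L hL, polyEval_apply, polyEval_apply,
      Finsupp.onFinset_sum _ (fun _ => smul_zero _)]
    refine Finset.sum_congr rfl fun j _ => ?_
    beta_reduce
    rw [smul_smul, mul_pow, mul_comm]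

theorem IsWt.of_ne_zero (h : Lawful τ) {i d : ℕ} {x : N}
    (hx : ∀ t : k, t ≠ 0 → τ (scl i t) x = t ^ d • x) : IsWt τ i d x := fun t => by
  rw [← polyEval_polyCoeff (fun t => τ (scl i t)) (h.isPolyFun_scl i),
    polyCoeff_of_monomial (fun t => τ (scl i t)) (h.isPolyFun_scl i) hx, polyEval_single]

theorem scl_mul_scl (i : ℕ) (s t : k) : scl i s * scl i t = scl i (s * t) := vEnd_ext fun j => by
  simp only [Module.End.mul_apply, scl_bv]
  split_ifs with hj
  · rw [map_smul, scl_bv, if_pos hj, smul_smul, mul_comm]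
  · rw [scl_bv, if_neg hj]

theorem Lawful.isWt_wt (h : Lawful τ) (i d : ℕ) (x : N) : IsWt τ i d (h.wt i d x) := fun s => by
  have h1 := polyCoeff_natural (fun t => τ (scl i t)) (h.isPolyFun_scl i)
    (fun t => τ (scl i s) ∘ₗ τ (scl i t)) (fun x => (h.isPolyFun_scl i x).map (τ (scl i s)))
    LinearMap.id (τ (scl i s)) (x := x) (fun t _ => rfl) d
  have h2 := polyCoeff_rescale (fun t => τ (scl i t)) (h.isPolyFun_scl i)
    (fun t => τ (scl i s) ∘ₗ τ (scl i t)) (fun x => (h.isPolyFun_scl i x).map (τ (scl i s))) s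
    (x := x) (x' := x) (fun t _ => by rw [← scl_mul_scl, mul_app]; rfl) d
  exact h1.trans h2

theorem Lawful.wt_of_isWt (h : Lawful τ) {i d : ℕ} {x : N} (hx : IsWt τ i d x) (e : ℕ) :
    h.wt i e x = if e = d then x else 0 := by
  have := polyCoeff_of_monomial (fun t => τ (scl i t)) (h.isPolyFun_scl i) (x := x)
    (fun t _ => hx t)
  simp only [wt, LinearMap.comp_apply, this, Finsupp.lapply_apply, Finsupp.single_apply]
  simp only [eq_comm]

theorem Lawful.wt_mem (h : Lawful τ) {U : Submodule k N} (hU : ∀ a, ∀ x ∈ U, τ a x ∈ U) (i d : ℕ)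
    {x : N} (hx : x ∈ U) : h.wt i d x ∈ U :=
  polyCoeff_mem (fun t => τ (scl i t)) (h.isPolyFun_scl i) U (fun t _ => hU _ _ hx) d

theorem Lawful.wt_comm (h : Lawful τ) {i : ℕ} (a : VEnd k) (ha : ∀ t, a * scl i t = scl i t * a)
    (d : ℕ) (x : N) : τ a (h.wt i d x) = h.wt i d (τ a x) :=
  polyCoeff_natural (fun t => τ (scl i t)) (h.isPolyFun_scl i) (fun t => τ (scl i t))
    (h.isPolyFun_scl i) (τ a) (τ a) (fun t _ => by rw [← mul_app, ha, mul_app]) d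

theorem Lawful.sum_wt (h : Lawful τ) (i : ℕ) (x : N) :
    ∃ s : Finset ℕ, x = ∑ d ∈ s, h.wt i d x := by
  refine ⟨(polyCoeff (fun t => τ (scl i t)) (h.isPolyFun_scl i) x).support, ?_⟩
  have h1 := polyCoeff_sum (fun t => τ (scl i t)) (h.isPolyFun_scl i) x
  have : scl i (1 : k) = 1 := vEnd_ext fun j => by simp
  simp only [this, one_app] at h1
  exact h1.symm

theorem Lawful.mem_span_isWt (h : Lawful τ) {U : Submodule k N} (hU : ∀ a, ∀ x ∈ U, τ a x ∈ U)
    {x : N} (hx : x ∈ U) :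
    x ∈ Submodule.span k {y | y ∈ U ∧ ∃ α : ℕ →₀ ℕ, ∀ i, IsWt τ i (α i) y} := by
  obtain ⟨n, hn⟩ := h.exists_proj x
  have hn := hn n le_rfl
  have key : ∀ j, x ∈ Submodule.span k {y | (y ∈ U ∧ τ (proj k (Finset.range n)) y = y) ∧
      ∃ α : ℕ → ℕ, ∀ i < j, IsWt τ i (α i) y} := by
    intro j
    induction j with
    | zero => exact Submodule.subset_span ⟨⟨hx, hn⟩, 0, fun i hi => absurd hi (Nat.not_lt_zero i)⟩
    | succ j ih =>
      refine Submodule.span_le.2 ?_ ih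
      rintro y ⟨⟨hyU, hyn⟩, α, hα⟩
      obtain ⟨s, hs⟩ := h.sum_wt j y
      rw [SetLike.mem_coe, hs]
      refine Submodule.sum_mem _ fun d _ => Submodule.subset_span
        ⟨⟨h.wt_mem hU j d hyU, ?_⟩, fun i => if i = j then d else α i, fun i hi => ?_⟩
      · rw [h.wt_comm _ fun t => (scl_proj_comm _ _ _).symm, hyn]
      · beta_reduce
        split_ifs with hij
        · subst hij
          exact h.isWt_wt i d y
        · intro t
          rw [h.wt_comm _ fun t' => scl_comm hij _ _, hα i (by omega), map_smul]
  refine Submodule.span_mono ?_ (key n)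
  rintro y ⟨⟨hyU, hyn⟩, α, hα⟩
  refine ⟨hyU, Finsupp.onFinset (Finset.range n) (fun i => if i < n then α i else 0) (by simp; tauto),
    fun i => ?_⟩
  simp only [Finsupp.onFinset_apply]
  split_ifs with hi
  · exact hα i hi
  · intro t
    rw [pow_zero, one_smul, ← hyn, ← mul_app, scl_mul_proj (by simpa using hi)]

/-- The space of multilinear vectors: those of weight one for `e₀, …, eₙ₋₁` that involve no other
basis vector. -/
def mlin (τ : Representation k (VEnd k) N) (n : ℕ) : Submodule k N where
  carrier := {x | (∀ i < n, ∀ t : k, τ (scl i t) x = t • x) ∧ τ (proj k (Finset.range n)) x = x}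
  add_mem' hx hy := ⟨fun i hi t => by rw [map_add, hx.1 i hi, hy.1 i hi, smul_add],
    by rw [map_add, hx.2, hy.2]⟩
  zero_mem' := ⟨fun i hi t => by simp, by simp⟩
  smul_mem' c x hx := ⟨fun i hi t => by rw [map_smul, hx.1 i hi, smul_comm],
    by rw [map_smul, hx.2]⟩

theorem Lawful.proj_support (h : Lawful τ) {x : N} {α : ℕ →₀ ℕ} (hα : ∀ i, IsWt τ i (α i) x) :
    τ (proj k α.support) x = x := by
  obtain ⟨n, hn⟩ := h.exists_proj x
  obtain ⟨m, hm⟩ := α.support.exists_nat_subset_range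
  have hN := hn (max n m) (le_max_left _ _)
  set A := Finset.range (max n m) with hA
  have hs : α.support ⊆ A := hm.trans (Finset.range_subset_range.2 (le_max_right _ _))
  have key : ∀ T : Finset ℕ, Disjoint T α.support → τ (proj k (A \ T)) x = x := by
    intro T
    induction T using Finset.induction_on with
    | empty => intro _; simpa using hN
    | insert i T hi ih =>
      intro hd
      rw [Finset.disjoint_insert_left] at hd
      have : proj k (A \ insert i T) = scl i 0 * proj k (A \ T) := vEnd_ext fun j => by
        simp only [Module.End.mul_apply, proj_bv, Finset.mem_sdiff, Finset.mem_insert]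
        by_cases hj : j ∈ A ∧ j ∉ T
        · rw [if_pos hj, scl_bv]
          by_cases hji : j = i <;> simp [hji, hj]
        · rw [if_neg hj, if_neg (by tauto), map_zero]
      rw [this, mul_app, ih hd.2, hα i 0, Finsupp.notMem_support_iff.1 hd.1, pow_zero, one_smul]
  have := key (A \ α.support) Finset.sdiff_disjoint
  rwa [Finset.sdiff_sdiff_eq_self hs] at this

theorem Lawful.mem_span_of_isWt_le_one (h : Lawful τ) {U : Submodule k N}
    (hU : ∀ a, ∀ x ∈ U, τ a x ∈ U) {x : N} (hx : x ∈ U) {α : ℕ →₀ ℕ}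
    (hα : ∀ i, IsWt τ i (α i) x) (h1 : ∀ i, α i ≤ 1) :
    ∃ n, ∃ c ∈ mlin τ n, c ∈ U ∧ ∃ a, x = τ a c := by
  have hp := h.proj_support hα
  set S := α.support with hS
  let e := S.equivFin
  let f : ℕ → ℕ := fun j => if h : j ∈ S then e ⟨j, h⟩ else 0
  let g : ℕ → ℕ := fun j => if h : j < S.card then e.symm ⟨j, h⟩ else 0
  have hgf : ∀ j ∈ S, g (f j) = j := by
    intro j hj
    have : f j = e ⟨j, hj⟩ := dif_pos hj
    rw [this]
    simp [g]
  have hfS : ∀ j ∈ S, f j < S.card := by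
    intro j hj
    have : f j = e ⟨j, hj⟩ := dif_pos hj
    rw [this]; exact (e ⟨j, hj⟩).2
  have hgS : ∀ i < S.card, g i ∈ S := by
    intro i hi
    have : g i = e.symm ⟨i, hi⟩ := dif_pos hi
    rw [this]; exact (e.symm ⟨i, hi⟩).2
  have hfg : ∀ i < S.card, f (g i) = i := by
    intro i hi
    have : g i = e.symm ⟨i, hi⟩ := dif_pos hi
    rw [this]
    simp [f]
  refine ⟨S.card, τ (ren k f) x, ⟨fun i hi t => ?_, ?_⟩, hU _ _ hx, ren k g, ?_⟩
  · have h2 : α (g i) = 1 := le_antisymm (h1 _) (Nat.one_le_iff_ne_zero.2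
      (Finsupp.mem_support_iff.1 (hgS i hi)))
    have h3 : scl i t * (ren k f * proj k S) = ren k f * (scl (g i) t * proj k S) :=
      vEnd_ext fun j => by
        simp only [Module.End.mul_apply, proj_bv]
        split_ifs with hj
        · rw [ren_bv, scl_bv, scl_bv]
          have : f j = i ↔ j = g i :=
            ⟨fun h => by rw [← h, hgf j hj], fun h => by rw [h, hfg i hi]⟩
          by_cases hji : j = g i
          · rw [if_pos (this.2 hji), if_pos hji, map_smul, ren_bv]
          · rw [if_neg (mt this.1 hji), if_neg hji, ren_bv]
        · simp
    conv_lhs => rw [← hp]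
    rw [← mul_app, ← mul_app, mul_assoc, h3, mul_app, mul_app, hp, hα (g i) t, h2, pow_one, map_smul]
  · have h3 : proj k (Finset.range S.card) * (ren k f * proj k S) = ren k f * proj k S :=
      vEnd_ext fun j => by
        simp only [Module.End.mul_apply, proj_bv]
        split_ifs with hj
        · rw [ren_bv, proj_bv, if_pos (by simpa using hfS j hj)]
        · simp
    conv_lhs => rw [← hp]
    rw [← mul_app, ← mul_app, mul_assoc, h3, mul_app, hp]
  · have h3 : ren k g * (ren k f * proj k S) = proj k S :=
      vEnd_ext fun j => by
        simp only [Module.End.mul_apply, proj_bv]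
        split_ifs with hj
        · rw [ren_bv, ren_bv, hgf j hj]
        · simp
    conv_lhs => rw [← hp, ← h3, mul_app, mul_app, hp]

end Weights

end GLRep

namespace GLRep

section Multilinear

variable {k : Type u} [Field k] {N : Type*} [AddCommGroup N] [Module k N]
  {τ : Representation k (VEnd k) N}

/-- The endomorphism of `V` adding `t` times `e_j` to the image of `e_i`. -/
noncomputable def shear (i j : ℕ) (t : k) : VEnd k :=
  ofVecs fun l => if l = i then bv k i + t • bv k j else bv k l

@[simp] theorem shear_bv (i j l : ℕ) (t : k) :
    shear i j t (bv k l) = if l = i then bv k i + t • bv k j else bv k l := ofVecs_bv _ _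

theorem shear_line (i j : ℕ) (t : k) :
    shear i j t = 1 + t • ofVecs fun l => if l = i then bv k j else 0 := vEnd_ext fun l => by
  simp only [LinearMap.add_apply, LinearMap.smul_apply, shear_bv, ofVecs_bv, Module.End.one_apply]
  split_ifs with h
  · rw [h]
  · simp

theorem Lawful.isPolyFun_shear (h : Lawful τ) (i j : ℕ) (x : N) :
    IsPolyFun fun t => τ (shear i j t) x := by
  simp only [shear_line]
  exact (h x).line _ _

variable [CharZero k]

/-- The derivative of the action of `1 + t E_{j,i}` at `t = 0`. -/
noncomputable def Lawful.polar (h : Lawful τ) (i j : ℕ) : N →ₗ[k] N :=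
  Finsupp.lapply 1 ∘ₗ polyCoeff (fun t => τ (shear i j t)) (h.isPolyFun_shear i j)

theorem Lawful.polar_isWt_of_ne (h : Lawful τ) {i j l : ℕ} (hi : l ≠ i) (hj : l ≠ j) {d : ℕ} {x : N}
    (hx : IsWt τ l d x) : IsWt τ l d (h.polar i j x) := fun s => by
  have := polyCoeff_natural (fun t => τ (shear i j t)) (h.isPolyFun_shear i j)
    (fun t => τ (shear i j t)) (h.isPolyFun_shear i j) (τ (scl l s)) (τ (scl l s)) (x := x)
    (fun t _ => by
      rw [← mul_app, ← mul_app]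
      congr 1
      congr 1
      refine vEnd_ext fun m => ?_
      simp only [Module.End.mul_apply, scl_bv, shear_bv]
      by_cases h1 : m = i
      · subst h1
        rw [if_pos rfl, if_neg hi.symm, shear_bv, if_pos rfl, map_add, map_smul, scl_bv, scl_bv,
          if_neg hi.symm, if_neg hj.symm]
      · rw [if_neg h1, scl_bv]
        split_ifs with h2
        · rw [map_smul, shear_bv, if_neg h1]
        · rw [shear_bv, if_neg h1]) 1
  refine this.trans ?_
  rw [hx s, map_smul]
  rfl

theorem Lawful.polar_isWt_right (h : Lawful τ) {i j : ℕ} (hij : i ≠ j) {d : ℕ} {x : N}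
    (hx : IsWt τ j d x) : IsWt τ j (d + 1) (h.polar i j x) := by
  refine IsWt.of_ne_zero h fun s hs => ?_
  have h1 := polyCoeff_natural (fun t => τ (shear i j t)) (h.isPolyFun_shear i j)
    (fun t => τ (scl j s) ∘ₗ τ (shear i j t))
    (fun x => (h.isPolyFun_shear i j x).map (τ (scl j s))) LinearMap.id (τ (scl j s)) (x := x)
    (fun t _ => rfl) 1
  have h2 := polyCoeff_rescale (fun t => τ (shear i j t)) (h.isPolyFun_shear i j)
    (fun t => τ (scl j s) ∘ₗ τ (shear i j t))
    (fun x => (h.isPolyFun_shear i j x).map (τ (scl j s))) s (x := s ^ d • x) (x' := x)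
    (fun t _ => by
      rw [← hx s, LinearMap.comp_apply, ← mul_app, ← mul_app]
      congr 1
      congr 1
      refine vEnd_ext fun m => ?_
      simp only [Module.End.mul_apply, scl_bv, shear_bv]
      by_cases h1 : m = i
      · subst h1
        rw [if_pos rfl, if_neg hij, shear_bv, if_pos rfl, map_add, map_smul, scl_bv, scl_bv,
          if_neg hij, if_pos rfl, smul_smul, mul_comm]
      · rw [if_neg h1, scl_bv]
        split_ifs with h2
        · rw [map_smul, shear_bv, if_neg h1]
        · rw [shear_bv, if_neg h1]) 1
  refine (h1.trans h2).trans ?_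
  rw [map_smul, Finsupp.smul_apply, smul_smul, pow_one, pow_succ']
  rfl

theorem Lawful.polar_isWt_left (h : Lawful τ) {i j : ℕ} (hij : i ≠ j) {d : ℕ} {x : N}
    (hx : IsWt τ i (d + 1) x) : IsWt τ i d (h.polar i j x) := by
  refine IsWt.of_ne_zero h fun s hs => ?_
  have h1 := polyCoeff_natural (fun t => τ (shear i j t)) (h.isPolyFun_shear i j)
    (fun t => τ (scl i s) ∘ₗ τ (shear i j t))
    (fun x => (h.isPolyFun_shear i j x).map (τ (scl i s))) LinearMap.id (τ (scl i s)) (x := x)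
    (fun t _ => rfl) 1
  have h2 := polyCoeff_rescale (fun t => τ (shear i j t)) (h.isPolyFun_shear i j)
    (fun t => τ (scl i s) ∘ₗ τ (shear i j t))
    (fun x => (h.isPolyFun_shear i j x).map (τ (scl i s))) s⁻¹ (x := s ^ (d + 1) • x) (x' := x)
    (fun t _ => by
      rw [← hx s, LinearMap.comp_apply, ← mul_app, ← mul_app]
      congr 1
      congr 1
      refine vEnd_ext fun m => ?_
      simp only [Module.End.mul_apply, scl_bv, shear_bv]
      by_cases h1 : m = i
      · subst h1
        rw [if_pos rfl, if_pos rfl, map_smul, shear_bv, if_pos rfl, map_add, map_smul, scl_bv,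
          scl_bv, if_pos rfl, if_neg hij.symm, smul_add, smul_smul, ← mul_assoc, mul_inv_cancel₀ hs,
          one_mul]
      · rw [if_neg h1, if_neg h1, scl_bv, if_neg h1, shear_bv, if_neg h1]) 1
  refine (h1.trans h2).trans ?_
  rw [map_smul, Finsupp.smul_apply, smul_smul, pow_one, pow_succ', ← mul_assoc, inv_mul_cancel₀ hs,
    one_mul]
  rfl

theorem Lawful.fold_polar (h : Lawful τ) {i j : ℕ} (hij : i ≠ j) {d : ℕ} {x : N}
    (hi : IsWt τ i d x) (hj : IsWt τ j 0 x) :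
    τ (ren k fun l => if l = j then i else l) (h.polar i j x) = (d : k) • x := by
  set φ := ren k fun l => if l = j then i else l with hφ
  have hφx : τ φ x = x := by
    have h0 : τ (scl j 0) x = x := by rw [hj 0, pow_zero, one_smul]
    conv_lhs => rw [← h0]
    rw [← mul_app]
    conv_rhs => rw [← h0]
    congr 2
    refine vEnd_ext fun m => ?_
    simp only [Module.End.mul_apply, scl_bv]
    split_ifs with h1
    · simp
    · rw [hφ, ren_bv, if_neg h1]
  have h1 := polyCoeff_natural (fun t => τ (shear i j t)) (h.isPolyFun_shear i j)
    (fun t => τ φ ∘ₗ τ (shear i j t))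
    (fun x => (h.isPolyFun_shear i j x).map (τ φ)) LinearMap.id (τ φ) (x := x)
    (fun t _ => rfl) 1
  have h2 := polyCoeff_eq (fun t => τ φ ∘ₗ τ (shear i j t))
    (fun x => (h.isPolyFun_shear i j x).map (τ φ)) (x := x)
    (p := ∑ m ∈ Finset.range (d + 1), Finsupp.single m ((d.choose m : k) • x)) (fun t _ => by
      have h3 : φ * shear i j t = φ * scl i (1 + t) := vEnd_ext fun m => by
        simp only [Module.End.mul_apply, shear_bv, scl_bv]
        split_ifs with h1
        · subst h1
          rw [map_add, map_smul, map_smul, hφ, ren_bv, ren_bv, if_neg hij, if_pos rfl, add_smul,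
            one_smul]
        · rfl
      rw [LinearMap.comp_apply, ← mul_app, h3, mul_app, hi, map_smul, hφx, map_sum]
      simp only [polyEval_single]
      rw [add_comm, add_pow, Finset.sum_smul]
      refine Finset.sum_congr rfl fun m _ => ?_
      rw [one_pow, mul_one, smul_smul])
  have h4 : τ φ (h.polar i j x) = polyCoeff (fun t => τ φ ∘ₗ τ (shear i j t))
    (fun x => (h.isPolyFun_shear i j x).map (τ φ)) x 1 := h1
  rw [h4, h2, Finsupp.finsetSum_apply]
  simp only [Finsupp.single_apply]
  rw [Finset.sum_ite_eq']
  split_ifs with hd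
  · simp
  · have : d = 0 := by simpa using hd
    simp [this]

theorem Lawful.polar_mem (h : Lawful τ) {U : Submodule k N} (hU : ∀ a, ∀ x ∈ U, τ a x ∈ U) (i j : ℕ)
    {x : N} (hx : x ∈ U) : h.polar i j x ∈ U :=
  polyCoeff_mem (fun t => τ (shear i j t)) (h.isPolyFun_shear i j) U (fun t _ => hU _ _ hx) 1

theorem Lawful.mem_span_of_isWt (h : Lawful τ) {U : Submodule k N}
    (hU : ∀ a, ∀ x ∈ U, τ a x ∈ U) (r : ℕ) {x : N} (hx : x ∈ U) {α : ℕ →₀ ℕ}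
    (hα : ∀ i, IsWt τ i (α i) x) (hr : (∑ i ∈ α.support, (α i - 1)) = r) :
    ∃ n, ∃ c ∈ mlin τ n, c ∈ U ∧ ∃ a, x = τ a c := by
  induction r generalizing x α with
  | zero =>
    refine h.mem_span_of_isWt_le_one hU hx hα fun i => ?_
    by_cases hi : i ∈ α.support
    · have := Finset.sum_eq_zero_iff.1 hr i hi
      omega
    · rw [Finsupp.notMem_support_iff.1 hi]; exact Nat.zero_le _
  | succ r ih =>
    obtain ⟨i, hi, hi1⟩ : ∃ i ∈ α.support, α i - 1 ≠ 0 := by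
      by_contra! hc
      rw [Finset.sum_eq_zero hc] at hr
      omega
    obtain ⟨j, hj⟩ := Infinite.exists_notMem_finset α.support
    have hij : i ≠ j := by rintro rfl; exact hj hi
    have hj0 : α j = 0 := Finsupp.notMem_support_iff.1 hj
    obtain ⟨d, hd⟩ : ∃ d, α i = d + 1 + 1 := ⟨α i - 2, by omega⟩
    have hx' := h.polar_mem hU i j hx
    obtain ⟨n, c, hc, hcU, a, ha⟩ := ih (α := (α.update i (d + 1)).update j 1) hx' (fun l => by
      simp only [Finsupp.coe_update, Function.update_apply]
      split_ifs with h1 h2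
      · subst h1
        have := h.polar_isWt_right hij (hα l)
        rwa [hj0] at this
      · subst h2
        exact h.polar_isWt_left hij (by rw [← hd]; exact hα l)
      · exact h.polar_isWt_of_ne h2 h1 (hα l)) (by
      have hs : ((α.update i (d + 1)).update j 1).support = insert j α.support := by
        ext l
        simp only [Finsupp.mem_support_iff, Finsupp.coe_update, Function.update_apply,
          Finset.mem_insert]
        split_ifs with h1 h2
        · simp [h1]
        · subst h2; simp [hd]
        · simp [h1]
      rw [hs, Finset.sum_insert hj]
      rw [← Finset.add_sum_erase _ _ hi] at hr ⊢
      have : ∑ l ∈ α.support.erase i, (((α.update i (d + 1)).update j 1) l - 1) =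
          ∑ l ∈ α.support.erase i, (α l - 1) := by
        refine Finset.sum_congr rfl fun l hl => ?_
        rw [Finset.mem_erase] at hl
        rw [Finsupp.coe_update, Finsupp.coe_update, Function.update_of_ne, Function.update_of_ne hl.1]
        rintro rfl; exact hj hl.2
      rw [this]
      simp only [Finsupp.coe_update, Function.update_apply, if_neg hij, if_true] at hr ⊢
      omega)
    have hf := h.fold_polar hij (hα i) (by have := hα j; rwa [hj0] at this)
    have hne : (α i : k) ≠ 0 := by rw [hd]; exact Nat.cast_ne_zero.2 (Nat.succ_ne_zero (d + 1))
    refine ⟨n, (α i : k)⁻¹ • c, (mlin τ n).smul_mem _ hc, U.smul_mem _ hcU,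
      (ren k fun l => if l = j then i else l) * a, ?_⟩
    rw [map_smul, mul_app, ← ha, hf, smul_smul, inv_mul_cancel₀ hne, one_smul]

/-- Every stable subspace is generated by its multilinear vectors. -/
theorem Lawful.mem_span_mlin (h : Lawful τ) {U : Submodule k N} (hU : ∀ a, ∀ x ∈ U, τ a x ∈ U)
    {x : N} (hx : x ∈ U) :
    x ∈ Submodule.span k {y | ∃ n, ∃ c ∈ mlin τ n, c ∈ U ∧ ∃ a, y = τ a c} := by
  refine Submodule.span_mono ?_ (h.mem_span_isWt hU hx)
  rintro y ⟨hy, α, hα⟩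
  exact h.mem_span_of_isWt hU _ hy hα rfl

end Multilinear

end GLRep

namespace GLRep

section Theta

variable {k : Type u} [Field k]

/-- The endomorphism mapping the first `n` basis vectors to `v` and the others to zero. -/
noncomputable def firstVecs {n : ℕ} (v : Fin n → StdSpace k) : VEnd k :=
  ofVecs fun i => if h : i < n then v ⟨i, h⟩ else 0

@[simp] theorem firstVecs_bv {n : ℕ} (v : Fin n → StdSpace k) (i : ℕ) :
    firstVecs v (bv k i) = if h : i < n then v ⟨i, h⟩ else 0 := ofVecs_bv _ _

theorem mul_firstVecs {n : ℕ} (a : VEnd k) (v : Fin n → StdSpace k) :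
    a * firstVecs v = firstVecs fun i => a (v i) := vEnd_ext fun i => by
  simp only [Module.End.mul_apply, firstVecs_bv]
  split_ifs <;> simp

theorem mul_proj_range (a : VEnd k) (n : ℕ) :
    a * proj k (Finset.range n) = firstVecs fun i : Fin n => a (bv k i) := vEnd_ext fun i => by
  simp only [Module.End.mul_apply, firstVecs_bv, proj_bv, Finset.mem_range]
  split_ifs <;> simp

theorem firstVecs_bv_eq_proj (n : ℕ) :
    firstVecs (fun i : Fin n => bv k i) = proj k (Finset.range n) := by
  rw [← one_mul (proj k _), mul_proj_range]; rfl

variable {N N' : Type*} [AddCommGroup N] [Module k N] [AddCommGroup N'] [Module k N']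
  {τ : Representation k (VEnd k) N} {τ' : Representation k (VEnd k) N'} [CharZero k]

/-- The multilinear map attached to a multilinear vector. -/
noncomputable def Lawful.theta (h : Lawful τ) {n : ℕ} (c : mlin τ n) :
    MultilinearMap k (fun _ : Fin n => StdSpace k) N :=
  haveI hs : ∀ (v : Fin n → StdSpace k) (i : Fin n) (t : k) (x : StdSpace k),
      τ (firstVecs (Function.update v i (t • x))) c =
        t • τ (firstVecs (Function.update v i x)) c := by
    intro v i t x
    have : firstVecs (Function.update v i (t • x)) =
        firstVecs (Function.update v i x) * scl i t := vEnd_ext fun j => by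
      rw [Module.End.mul_apply, firstVecs_bv, scl_bv]
      by_cases hj : j = i
      · subst hj
        simp [-Finsupp.smul_single]
      · rw [if_neg hj, firstVecs_bv]
        split_ifs with h1
        · rw [Function.update_of_ne (by rintro rfl; exact hj rfl),
            Function.update_of_ne (by rintro rfl; exact hj rfl)]
        · rfl
    rw [this, mul_app, c.2.1 i i.2, map_smul]
  MultilinearMap.mk' (fun v => τ (firstVecs v) c)
    (fun v i x y => by
      refine map_add_of_homogeneous_one (k := k)
        (f := fun x => τ (firstVecs (Function.update v i x)) c.1) (hs v i) (fun x y => ?_) x y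
      have := (h c.1).line (firstVecs (Function.update v i x))
        (firstVecs (Function.update 0 i y))
      have h2 : ∀ t : k, firstVecs (Function.update v i (x + t • y)) =
          firstVecs (Function.update v i x) + t • firstVecs (Function.update 0 i y) := by
        intro t
        refine vEnd_ext fun j => ?_
        simp only [LinearMap.add_apply, LinearMap.smul_apply, firstVecs_bv]
        split_ifs with h1
        · by_cases hj : (⟨j, h1⟩ : Fin n) = i
          · subst hj; simp
          · simp [Function.update_of_ne hj]
        · simp
      simp only [h2]
      exact this) hs

theorem Lawful.theta_apply (h : Lawful τ) {n : ℕ} (c : mlin τ n) (v : Fin n → StdSpace k) :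
    h.theta c v = τ (firstVecs v) c := rfl

theorem apply_mlin {n : ℕ} {c : N} (hc : c ∈ mlin τ n) (a : VEnd k) :
    τ a c = τ (firstVecs fun i : Fin n => a (bv k i)) c := by
  rw [← mul_proj_range, mul_app, hc.2]

/-- The projection onto the multilinear vectors, up to stage `j`. -/
noncomputable def Lawful.piAux (h : Lawful τ) (n : ℕ) : ℕ → N →ₗ[k] N
  | 0 => τ (proj k (Finset.range n))
  | j + 1 => h.wt j 1 ∘ₗ h.piAux n j

theorem Lawful.piAux_of_isWt (h : Lawful τ) (n j : ℕ) {x : N} {α : ℕ → ℕ}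
    (hα : ∀ i, IsWt τ i (α i) x) (hx : τ (proj k (Finset.range n)) x = x) :
    h.piAux n j x = if ∀ i < j, α i = 1 then x else 0 := by
  induction j with
  | zero => simp [piAux, hx]
  | succ j ih =>
    rw [piAux, LinearMap.comp_apply, ih]
    split_ifs with h1 h2 h2
    · rw [h.wt_of_isWt (hα j), h2 j (by omega), if_pos rfl]
    · rw [h.wt_of_isWt (hα j), if_neg]
      intro h3
      exact h2 fun i hi => by
        rcases Nat.lt_succ_iff_lt_or_eq.1 hi with h4 | rfl
        · exact h1 i h4
        · exact h3.symm
    · exact absurd (fun i hi => h2 i (by omega)) h1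
    · simp

theorem isWt_of_mem_mlin {n : ℕ} {c : N} (hc : c ∈ mlin τ n) (i : ℕ) :
    IsWt τ i (if i < n then 1 else 0) c := fun t => by
  split_ifs with hi
  · rw [hc.1 i hi, pow_one]
  · conv_lhs => rw [← hc.2]
    rw [← mul_app, scl_mul_proj (by simpa using hi), hc.2, pow_zero, one_smul]

theorem Lawful.piAux_of_mem (h : Lawful τ) {n : ℕ} {c : N} (hc : c ∈ mlin τ n) :
    h.piAux n n c = c := by
  rw [h.piAux_of_isWt n n (isWt_of_mem_mlin hc) hc.2, if_pos]
  intro i hi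
  rw [if_pos hi]

variable (k) in
/-- The permutation of the first `n` basis vectors, killing the other ones. -/
noncomputable def permEnd {n : ℕ} (s : Equiv.Perm (Fin n)) : VEnd k :=
  firstVecs fun i => bv k (s i)

theorem permEnd_mul {n : ℕ} (s t : Equiv.Perm (Fin n)) :
    permEnd k (s * t) = permEnd k s * permEnd k t := by
  rw [permEnd, permEnd, permEnd, mul_firstVecs]
  congr 1
  funext i
  simp

theorem permEnd_one (n : ℕ) : permEnd k (1 : Equiv.Perm (Fin n)) = proj k (Finset.range n) :=
  firstVecs_bv_eq_proj n

theorem permEnd_mem_mlin {n : ℕ} (s : Equiv.Perm (Fin n)) {c : N} (hc : c ∈ mlin τ n) :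
    τ (permEnd k s) c ∈ mlin τ n := by
  refine ⟨fun i hi t => ?_, ?_⟩
  · have : scl i t * permEnd k s = permEnd k s * scl (s.symm ⟨i, hi⟩) t := by
      refine vEnd_ext fun j => ?_
      simp only [permEnd, Module.End.mul_apply, firstVecs_bv, scl_bv]
      split_ifs with h1 h2 h2
      · subst h2; simp [-Finsupp.smul_single]
      · rw [scl_bv, if_neg, firstVecs_bv, dif_pos h1]
        rintro h3
        apply h2
        have : s ⟨j, h1⟩ = ⟨i, hi⟩ := Fin.ext h3
        rw [← this]; simp
      · exact absurd (h2 ▸ (s.symm ⟨i, hi⟩).2) h1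
      · rw [map_zero, firstVecs_bv, dif_neg h1]
    rw [← mul_app, this, mul_app, hc.1 _ (s.symm ⟨i, hi⟩).2, map_smul]
  · rw [← mul_app, ← permEnd_one, ← permEnd_mul, one_mul]

/-- The action of the symmetric group on the multilinear vectors. -/
noncomputable def permRep (τ : Representation k (VEnd k) N) (n : ℕ) :
    Representation k (Equiv.Perm (Fin n)) (mlin τ n) where
  toFun s := (τ (permEnd k s)).restrict fun _ hc => permEnd_mem_mlin s hc
  map_one' := LinearMap.ext fun c => Subtype.ext (by
    change τ (permEnd k 1) c = c
    rw [permEnd_one, c.2.2])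
  map_mul' s t := LinearMap.ext fun c => Subtype.ext (by
    change τ (permEnd k (s * t)) c = _
    rw [permEnd_mul, mul_app]; rfl)

theorem permRep_coe {n : ℕ} (s : Equiv.Perm (Fin n)) (c : mlin τ n) :
    (permRep τ n s c : N) = τ (permEnd k s) c := rfl

theorem Lawful.piAux_theta (h : Lawful τ) (D : ∀ m, Submodule k N) (hD : ∀ m, D m ≤ mlin τ m)
    (hDs : ∀ m (s : Equiv.Perm (Fin m)), ∀ c ∈ D m, τ (permEnd k s) c ∈ D m) {m n : ℕ}
    {c : N} (hc : c ∈ D m) (f : Fin m → ℕ) :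
    h.piAux n n (h.theta ⟨c, hD m hc⟩ fun i => bv k (f i)) ∈ D n := by
  set c' : mlin τ m := ⟨c, hD m hc⟩ with hc'
  set x := h.theta c' fun i => bv k (f i) with hx
  have hcomp : ∀ a, τ a x = h.theta c' fun i => a (bv k (f i)) := by
    intro a
    rw [hx, theta_apply, ← mul_app, mul_firstVecs, theta_apply]
  by_cases hf : ∃ i, n ≤ f i
  · obtain ⟨i, hi⟩ := hf
    have h0 : h.piAux n 0 x = 0 := by
      rw [piAux, hcomp]
      refine MultilinearMap.map_coord_zero _ i ?_
      rw [proj_bv, if_neg (by simpa using hi)]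
    have : ∀ j, h.piAux n j x = 0 := by
      intro j
      induction j with
      | zero => exact h0
      | succ j ih => rw [piAux, LinearMap.comp_apply, ih, map_zero]
    rw [this]
    exact zero_mem _
  push Not at hf
  have hwt : ∀ l, IsWt τ l (Finset.univ.filter fun i => f i = l).card x := by
    intro l t
    rw [hcomp]
    have : (fun i => scl l t (bv k (f i))) = fun i => (if f i = l then t else 1) • bv k (f i) := by
      funext i
      rw [scl_bv]
      split_ifs <;> simp
    rw [this, MultilinearMap.map_smul_univ, Finset.prod_ite]
    simp [hx]
  have hpx : τ (proj k (Finset.range n)) x = x := by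
    rw [hcomp, hx]
    congr 1
    funext i
    rw [proj_bv, if_pos (by simpa using hf i)]
  rw [h.piAux_of_isWt n n hwt hpx]
  split_ifs with h1
  · have hbij : Function.Bijective fun i => (⟨f i, hf i⟩ : Fin n) := by
      rw [Function.bijective_iff_existsUnique]
      intro l
      obtain ⟨i, hi⟩ := Finset.card_eq_one.1 (h1 l l.2)
      refine ⟨i, ?_, ?_⟩
      · have : i ∈ Finset.univ.filter fun i => f i = l := by rw [hi]; simp
        exact Fin.ext (by simpa using this)
      · intro j hj
        have : j ∈ Finset.univ.filter fun i => f i = l := by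
          simpa using congrArg Fin.val hj
        rw [hi] at this
        simpa using this
    have hmn : m = n := by simpa using Fintype.card_of_bijective hbij
    subst hmn
    exact hDs m (Equiv.ofBijective _ hbij) c hc
  · exact zero_mem _

/-- The multilinear vectors of the subrepresentation generated by stable spaces of multilinear
vectors. -/
theorem Lawful.mem_of_mem_span (h : Lawful τ) (D : ∀ m, Submodule k N) (hD : ∀ m, D m ≤ mlin τ m)
    (hDs : ∀ m (s : Equiv.Perm (Fin m)), ∀ c ∈ D m, τ (permEnd k s) c ∈ D m) {n : ℕ} {x : N}
    (hx : x ∈ Submodule.span k {y | ∃ m, ∃ c ∈ D m, ∃ a, y = τ a c}) (hxn : x ∈ mlin τ n) :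
    x ∈ D n := by
  rw [← h.piAux_of_mem hxn]
  have : Submodule.span k {y | ∃ m, ∃ c ∈ D m, ∃ a, y = τ a c} ≤ (D n).comap (h.piAux n n) := by
    refine Submodule.span_le.2 ?_
    rintro _ ⟨m, c, hc, a, rfl⟩
    have h1 : (((D n).mkQ ∘ₗ h.piAux n n).compMultilinearMap (h.theta ⟨c, hD m hc⟩)) = 0 := by
      refine Module.Basis.ext_multilinear (fun _ => Finsupp.basisSingleOne) fun f => ?_
      simp only [LinearMap.compMultilinearMap_apply, Finsupp.coe_basisSingleOne,
        LinearMap.comp_apply, _root_.zero_apply, Submodule.mkQ_apply,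
        Submodule.Quotient.mk_eq_zero]
      exact h.piAux_theta D hD hDs hc f
    have h2 := congrArg (fun q => q fun i : Fin m => a (bv k i)) h1
    simp only [LinearMap.compMultilinearMap_apply, LinearMap.comp_apply, _root_.zero_apply,
      Submodule.mkQ_apply, Submodule.Quotient.mk_eq_zero, theta_apply] at h2
    rw [SetLike.mem_coe, Submodule.mem_comap, apply_mlin (hD m hc)]
    exact h2
  exact this hx

theorem Lawful.eq_bot_of_mlin (h : Lawful τ) {U : Submodule k N} (hU : ∀ a, ∀ x ∈ U, τ a x ∈ U)
    (h0 : ∀ n, ∀ c ∈ mlin τ n, c ∈ U → c = 0) : U = ⊥ := by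
  rw [eq_bot_iff]
  intro x hx
  have := h.mem_span_mlin hU hx
  refine (Submodule.span_le.2 ?_) this
  rintro _ ⟨n, c, hc, hcU, a, rfl⟩
  rw [h0 n c hc hcU, map_zero]
  exact zero_mem _

theorem span_stable (S : Set N) (hS : ∀ a, ∀ y ∈ S, τ a y ∈ S) (a : VEnd k) {x : N}
    (hx : x ∈ Submodule.span k S) : τ a x ∈ Submodule.span k S := by
  have : Submodule.span k S ≤ (Submodule.span k S).comap (τ a) :=
    Submodule.span_le.2 fun y hy => Submodule.subset_span (hS a y hy)
  exact this hx

end Theta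

end GLRep

namespace GLRep

/-! ### Semisimplicity -/

section Semisimple

variable {k : Type u} [Field k] [CharZero k] {N : Type*} [AddCommGroup N] [Module k N]
  {τ : Representation k (VEnd k) N}

theorem Lawful.exists_isCompl (h : Lawful τ) {F : Type*} [Field F] [Algebra k F] [Module F N]
    [IsScalarTower k F N] (hF : ∀ a (c : F) x, τ a (c • x) = c • τ a x) (U : Submodule F N)
    (hU : ∀ a, ∀ x ∈ U, τ a x ∈ U) :
    ∃ W : Submodule F N, (∀ a, ∀ x ∈ W, τ a x ∈ W) ∧ IsCompl U W := by
  have : CharZero F := charZero_of_injective_algebraMap (algebraMap k F).injective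
  let L : VEnd k → N →ₗ[F] N := fun a => { (τ a) with map_smul' := hF a }
  let mF : ℕ → Submodule F N := fun n =>
    { carrier := mlin τ n
      add_mem' := (mlin τ n).add_mem
      zero_mem' := (mlin τ n).zero_mem
      smul_mem' := fun c x hx => ⟨fun i hi t => by
        rw [hF, hx.1 i hi, ← algebraMap_smul F t, ← algebraMap_smul F t, smul_comm],
        by rw [hF, hx.2]⟩ }
  let ρ : ∀ n, Representation F (Equiv.Perm (Fin n)) (mF n) := fun n =>
    { toFun := fun s => (L (permEnd k s)).restrict fun _ hc => permEnd_mem_mlin s hc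
      map_one' := LinearMap.ext fun c => Subtype.ext (by
        change τ (permEnd k 1) c = c
        rw [permEnd_one, c.2.2])
      map_mul' := fun s t => LinearMap.ext fun c => Subtype.ext (by
        change τ (permEnd k (s * t)) c = _
        rw [permEnd_mul, mul_app]; rfl) }
  let A : ∀ n, Subrepresentation (ρ n) := fun n =>
    { toSubmodule := U.comap (mF n).subtype
      apply_mem_toSubmodule := fun s c hc => hU _ _ hc }
  have hB : ∀ n, ∃ B, IsCompl (A n) B := fun n =>
    (inferInstance : ComplementedLattice (Subrepresentation (ρ n))).exists_isCompl (A n)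
  choose B hB using hB
  let D : ∀ n, Submodule F N := fun n => (B n).toSubmodule.map (mF n).subtype
  have hD : ∀ m, (D m).restrictScalars k ≤ mlin τ m := by
    rintro m _ ⟨x, _, rfl⟩
    exact x.2
  have hDs : ∀ m (s : Equiv.Perm (Fin m)), ∀ c ∈ (D m).restrictScalars k,
      τ (permEnd k s) c ∈ (D m).restrictScalars k := by
    rintro m s _ ⟨x, hx, rfl⟩
    exact ⟨ρ m s x, (B m).apply_mem_toSubmodule s hx, rfl⟩
  let S : Set N := {y | ∃ m, ∃ c ∈ (D m).restrictScalars k, ∃ a, y = τ a c}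
  have hS : ∀ (a : VEnd k), ∀ y ∈ S, τ a y ∈ S := by
    rintro a _ ⟨m, c, hc, b, rfl⟩
    exact ⟨m, c, hc, a * b, (mul_app a b c).symm⟩
  let W : Submodule F N :=
    { (Submodule.span k S) with
      smul_mem' := fun c x hx => by
        induction hx using Submodule.span_induction with
        | mem y hy =>
          obtain ⟨m, d, hd, a, rfl⟩ := hy
          exact Submodule.subset_span ⟨m, c • d, (D m).smul_mem c hd, a, (hF a c d).symm⟩
        | zero => rw [smul_zero]; exact (Submodule.span k S).zero_mem
        | add y z _ _ hy hz => rw [smul_add]; exact (Submodule.span k S).add_mem hy hz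
        | smul t y _ hy =>
          rw [← algebraMap_smul F t, smul_comm, algebraMap_smul]
          exact (Submodule.span k S).smul_mem t hy }
  have hW : ∀ a, ∀ x ∈ W, τ a x ∈ W := fun a x hx => span_stable S hS a hx
  refine ⟨W, hW, ?_⟩
  rw [isCompl_iff, disjoint_iff, codisjoint_iff]
  constructor
  · have := h.eq_bot_of_mlin (U := (U ⊓ W).restrictScalars k)
      (fun a x hx => ⟨hU a x hx.1, hW a x hx.2⟩) (fun n c hc hcU => by
        obtain ⟨d, hd, rfl⟩ := h.mem_of_mem_span (fun m => (D m).restrictScalars k) hD hDs hcU.2 hc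
        have h1 : d ∈ (A n ⊓ B n) := ⟨hcU.1, hd⟩
        rw [(hB n).inf_eq_bot] at h1
        have h2 : d = 0 := h1
        rw [h2, map_zero])
    rw [eq_bot_iff]
    intro x hx
    have h1 : x ∈ (U ⊓ W).restrictScalars k := hx
    rwa [this] at h1
  · rw [eq_top_iff]
    intro x _
    have h1 := h.mem_span_mlin (U := ⊤) (fun _ _ _ => trivial) (x := x) trivial
    have h2 : Submodule.span k {y | ∃ n, ∃ c ∈ mlin τ n, c ∈ (⊤ : Submodule k N) ∧ ∃ a, y = τ a c} ≤
        (U ⊔ W).restrictScalars k := by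
      refine Submodule.span_le.2 ?_
      rintro _ ⟨n, c, hc, -, a, rfl⟩
      have h3 : (⟨c, hc⟩ : mF n) ∈ (A n ⊔ B n) := by rw [(hB n).sup_eq_top]; trivial
      have h4 : (⟨c, hc⟩ : mF n) ∈ (A n).toSubmodule ⊔ (B n).toSubmodule := by
        rw [← Subrepresentation.toSubmodule_sup]; exact h3
      obtain ⟨y, hy, z, hz, hyz⟩ := Submodule.mem_sup.1 h4
      have h5 : c = (y : N) + z := (congrArg Subtype.val hyz).symm
      rw [h5, map_add]
      refine Submodule.add_mem_sup (hU a _ hy) ?_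
      exact Submodule.subset_span ⟨n, z, ⟨z, hz, rfl⟩, a, rfl⟩
    exact h2 h1

theorem Lawful.exists_projection (h : Lawful τ) {F : Type*} [Field F] [Algebra k F] [Module F N]
    [IsScalarTower k F N] (hF : ∀ a (c : F) x, τ a (c • x) = c • τ a x) (U : Submodule F N)
    (hU : ∀ a, ∀ x ∈ U, τ a x ∈ U) :
    ∃ p : N →ₗ[F] N, (∀ x, p x ∈ U) ∧ (∀ x ∈ U, p x = x) ∧ ∀ a x, p (τ a x) = τ a (p x) := by
  obtain ⟨W, hW, hUW⟩ := h.exists_isCompl hF U hU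
  refine ⟨U.projection W hUW, fun x => ?_, fun x hx => ?_, fun a x => ?_⟩
  · rw [← Submodule.coe_projectionOnto_apply]
    exact (U.projectionOnto W hUW x).2
  · exact Submodule.projection_apply_left hUW ⟨x, hx⟩
  · have hx : x ∈ U ⊔ W := by rw [hUW.sup_eq_top]; trivial
    obtain ⟨y, hy, z, hz, rfl⟩ := Submodule.mem_sup.1 hx
    have h1 : ∀ y ∈ U, U.projection W hUW y = y := fun y hy =>
      Submodule.projection_apply_left hUW ⟨y, hy⟩
    have h2 : ∀ z ∈ W, U.projection W hUW z = 0 := fun z hz =>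
      (Submodule.projection_apply_eq_zero_iff hUW).2 hz
    simp only [map_add]
    rw [h1 _ (hU a y hy), h1 y hy, h2 _ (hW a z hz), h2 z hz, map_zero]

end Semisimple

/-! ### Equivariant maps and multilinear vectors -/

section FullyFaithful

variable {k : Type u} [Field k] [CharZero k] {N N' : Type*} [AddCommGroup N] [Module k N]
  [AddCommGroup N'] [Module k N'] {τ : Representation k (VEnd k) N}
  {τ' : Representation k (VEnd k) N'}

theorem Lawful.prod (h : Lawful τ) (h' : Lawful τ') : Lawful (τ.prod τ') := fun x => by
  have := ((h x.1).map (LinearMap.inl k N N')).add ((h' x.2).map (LinearMap.inr k N N'))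
  simpa using this

theorem Lawful.hom_ext_mlin (h : Lawful τ) {f g : N →ₗ[k] N'}
    (hf : ∀ a x, f (τ a x) = τ' a (f x)) (hg : ∀ a x, g (τ a x) = τ' a (g x))
    (hfg : ∀ n, ∀ c ∈ mlin τ n, f c = g c) : f = g := by
  refine LinearMap.ext fun x => ?_
  have h1 := h.mem_span_mlin (U := ⊤) (fun _ _ _ => trivial) (x := x) trivial
  induction h1 using Submodule.span_induction with
  | mem y hy =>
    obtain ⟨n, c, hc, -, a, rfl⟩ := hy
    rw [hf, hg, hfg n c hc]
  | zero => simp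
  | add y z _ _ hy hz => rw [map_add, map_add, hy, hz]
  | smul t y _ hy => rw [map_smul, map_smul, hy]

theorem map_mem_mlin {f : N →ₗ[k] N'} (hf : ∀ a x, f (τ a x) = τ' a (f x)) {n : ℕ} {c : N}
    (hc : c ∈ mlin τ n) : f c ∈ mlin τ' n :=
  ⟨fun i hi t => by rw [← hf, hc.1 i hi, map_smul], by rw [← hf, hc.2]⟩

theorem Lawful.exists_extend (h : Lawful τ) (h' : Lawful τ') (φ : ∀ n, mlin τ n →ₗ[k] mlin τ' n)
    (hφ : ∀ n s c, φ n (permRep τ n s c) = permRep τ' n s (φ n c)) :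
    ∃ f : N →ₗ[k] N', (∀ a x, f (τ a x) = τ' a (f x)) ∧ ∀ n (c : mlin τ n), f c = φ n c := by
  let D : ∀ m, Submodule k (N × N') := fun m =>
    LinearMap.range ((mlin τ m).subtype.prod ((mlin τ' m).subtype ∘ₗ φ m))
  have hD : ∀ m, D m ≤ mlin (τ.prod τ') m := by
    rintro m _ ⟨c, rfl⟩
    exact ⟨fun i hi t => Prod.ext (c.2.1 i hi t) ((φ m c).2.1 i hi t), Prod.ext c.2.2 (φ m c).2.2⟩
  have hDs : ∀ m (s : Equiv.Perm (Fin m)), ∀ c ∈ D m, τ.prod τ' (permEnd k s) c ∈ D m := by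
    rintro m s _ ⟨c, rfl⟩
    exact ⟨permRep τ m s c, Prod.ext rfl (congrArg Subtype.val (hφ m s c))⟩
  let S : Set (N × N') := {y | ∃ m, ∃ c ∈ D m, ∃ a, y = τ.prod τ' a c}
  have hS : ∀ a, ∀ y ∈ S, τ.prod τ' a y ∈ S := by
    rintro a _ ⟨m, c, hc, b, rfl⟩
    exact ⟨m, c, hc, a * b, (mul_app (τ := τ.prod τ') a b c).symm⟩
  let B : Submodule k (N × N') := Submodule.span k S
  have hB : ∀ a, ∀ x ∈ B, τ.prod τ' a x ∈ B := fun a x hx => span_stable S hS a hx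
  let p : B →ₗ[k] N := LinearMap.fst k N N' ∘ₗ B.subtype
  have hinj : Function.Injective p := by
    rw [← LinearMap.ker_eq_bot, LinearMap.ker_eq_bot']
    rintro ⟨x, hx⟩ hx0
    have h1 := (h.prod h').eq_bot_of_mlin (U := B ⊓ LinearMap.ker (LinearMap.fst k N N'))
      (fun a x hx => ⟨hB a x hx.1, by
        have h2 : x.1 = 0 := hx.2
        change τ a x.1 = 0
        rw [h2, map_zero]⟩) (fun n c hc hcU => by
        obtain ⟨d, rfl⟩ := (h.prod h').mem_of_mem_span D hD hDs hcU.1 hc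
        have h2 : (d : N) = 0 := hcU.2
        rw [Subtype.ext (a1 := d) (a2 := 0) h2, map_zero])
    have h2 : x ∈ B ⊓ LinearMap.ker (LinearMap.fst k N N') := ⟨hx, hx0⟩
    rw [h1] at h2
    exact Subtype.ext h2
  have hsurj : Function.Surjective p := by
    intro x
    have h1 := h.mem_span_mlin (U := ⊤) (fun _ _ _ => trivial) (x := x) trivial
    have h2 : Submodule.span k {y | ∃ n, ∃ c ∈ mlin τ n, c ∈ (⊤ : Submodule k N) ∧ ∃ a, y = τ a c} ≤
        LinearMap.range p := by
      refine Submodule.span_le.2 ?_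
      rintro _ ⟨n, c, hc, -, a, rfl⟩
      exact ⟨⟨τ.prod τ' a (c, φ n ⟨c, hc⟩), Submodule.subset_span ⟨n, _, ⟨⟨c, hc⟩, rfl⟩, a, rfl⟩⟩, rfl⟩
    exact h2 h1
  let e := LinearEquiv.ofBijective p ⟨hinj, hsurj⟩
  have he : ∀ b : B, LinearMap.snd k N N' (e.symm (p b)).1 = b.1.2 := fun b => by
    have : e.symm (p b) = b := e.symm_apply_apply b
    rw [this]; rfl
  refine ⟨LinearMap.snd k N N' ∘ₗ B.subtype ∘ₗ e.symm.toLinearMap, fun a x => ?_, fun n c => ?_⟩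
  · obtain ⟨b, rfl⟩ := hsurj x
    have h1 : τ a (p b) = p ⟨τ.prod τ' a b.1, hB a _ b.2⟩ := rfl
    rw [h1]
    exact (he ⟨τ.prod τ' a b.1, hB a _ b.2⟩).trans (congrArg (τ' a) (he b)).symm
  · exact he ⟨(c, φ n c), Submodule.subset_span ⟨n, _, ⟨c, rfl⟩, 1, (one_app (τ := τ.prod τ') _).symm⟩⟩

/-- Restriction of equivariant maps to the multilinear vectors. -/
noncomputable def mlinMap (h : Lawful τ) (h' : Lawful τ') (n : ℕ) :
    Representation.IntertwiningMap (res τ) (res τ') →ₗ[k]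
      Representation.IntertwiningMap (permRep τ n) (permRep τ' n) where
  toFun f := ⟨f.toLinearMap.restrict fun _ hc => map_mem_mlin (h.map_of_res h' f.toLinearMap
    fun g x => f.isIntertwining _ _ g x) hc, fun s => LinearMap.ext fun c => Subtype.ext
      (h.map_of_res h' f.toLinearMap (fun g x => f.isIntertwining _ _ g x) _ _)⟩
  map_add' _ _ := rfl
  map_smul' _ _ := rfl

theorem mlinMap_bijective (h : Lawful τ) (h' : Lawful τ') {n : ℕ}
    (hn : ∀ m ≠ n, (∀ c ∈ mlin τ m, c = 0) ∨ ∀ c ∈ mlin τ' m, c = 0) :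
    Function.Bijective (mlinMap h h' n) := by
  constructor
  · intro f g hfg
    have hf := h.map_of_res h' f.toLinearMap fun g x => f.isIntertwining _ _ g x
    have hg := h.map_of_res h' g.toLinearMap fun g' x => g.isIntertwining _ _ g' x
    have : f.toLinearMap = g.toLinearMap := by
      refine h.hom_ext_mlin hf hg fun m c hc => ?_
      by_cases hm : m = n
      · subst hm
        exact congrArg (fun q => (q ⟨c, hc⟩ : N')) hfg
      · rcases hn m hm with h1 | h1
        · rw [h1 c hc, map_zero, map_zero]
        · rw [h1 _ (map_mem_mlin hf hc), h1 _ (map_mem_mlin hg hc)]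
    exact Representation.IntertwiningMap.toLinearMap_injective _ _ this
  · intro φ
    classical
    obtain ⟨f, hf, hfφ⟩ := h.exists_extend h'
      (fun m => if hm : m = n then hm ▸ φ.toLinearMap else 0) (fun m s c => by
        by_cases hm : m = n
        · subst hm
          simpa using φ.isIntertwining _ _ s c
        · simp [hm])
    refine ⟨⟨f, fun g => LinearMap.ext fun x => hf _ x⟩, ?_⟩
    refine DFunLike.ext _ _ fun c => Subtype.ext ?_
    refine (hfφ n c).trans ?_
    simp

instance {G V W : Type*} [Group G] [AddCommGroup V] [Module k V] [AddCommGroup W] [Module k W]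
    [FiniteDimensional k V] [FiniteDimensional k W] (ρ : Representation k G V)
    (ρ' : Representation k G W) : FiniteDimensional k (Representation.IntertwiningMap ρ ρ') :=
  FiniteDimensional.of_injective
    ({ toFun := fun f => f.toLinearMap, map_add' := fun _ _ => rfl, map_smul' := fun _ _ => rfl } :
      Representation.IntertwiningMap ρ ρ' →ₗ[k] V →ₗ[k] W)
    (Representation.IntertwiningMap.toLinearMap_injective _ _)

theorem finrank_intertwiningMap_comm {G V W : Type*} [Group G] [Finite G] [AddCommGroup V]
    [Module k V] [AddCommGroup W] [Module k W] [FiniteDimensional k V] [FiniteDimensional k W]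
    (ρ : Representation k G V) (ρ' : Representation k G W) :
    Module.finrank k (Representation.IntertwiningMap ρ ρ') =
      Module.finrank k (Representation.IntertwiningMap ρ' ρ) := by
  have := Fintype.ofFinite G
  have : Invertible (Nat.card G : k) :=
    invertibleOfNonzero (Nat.cast_ne_zero.2 Nat.card_pos.ne')
  have h1 := Representation.card_inv_mul_sum_char_mul_char_eq_finrank ρ ρ'
  have h2 := Representation.card_inv_mul_sum_char_mul_char_eq_finrank ρ' ρ
  rw [← Nat.cast_inj (R := k), ← h1, ← h2]
  congr 1
  refine Fintype.sum_equiv (Equiv.inv G) _ _ fun g => ?_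
  simp [mul_comm]

/-- Hom spaces between representations with finitely many multilinear vectors are symmetric. -/
theorem exists_intertwiningMap_comm (h : Lawful τ) (h' : Lawful τ') {n : ℕ}
    (hn : ∀ m ≠ n, (∀ c ∈ mlin τ m, c = 0) ∨ ∀ c ∈ mlin τ' m, c = 0)
    [FiniteDimensional k (mlin τ n)] [FiniteDimensional k (mlin τ' n)] :
    Nonempty (Representation.IntertwiningMap (res τ) (res τ') ≃ₗ[k]
      Representation.IntertwiningMap (res τ') (res τ)) :=
  ⟨(LinearEquiv.ofBijective _ (mlinMap_bijective h h' hn)).trans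
    ((LinearEquiv.ofFinrankEq _ _ (finrank_intertwiningMap_comm _ _)).trans
      (LinearEquiv.ofBijective _ (mlinMap_bijective h' h fun m hm => (hn m hm).symm)).symm)⟩

end FullyFaithful

end GLRep

namespace GLRep

/-! ### Constructions of representations of `End V` -/

section Constructions

variable {k : Type u} [Field k] {N N' : Type*} [AddCommGroup N] [Module k N]
  [AddCommGroup N'] [Module k N'] {τ : Representation k (VEnd k) N}
  {τ' : Representation k (VEnd k) N'}

/-- The vectors whose orbit map is a polynomial law. -/
def lawSub (τ : Representation k (VEnd k) N) : Submodule k N where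
  carrier := {x | IsLaw fun a => τ a x}
  add_mem' hx hy := by
    have := IsLaw.add hx hy
    simp only [← map_add] at this
    exact this
  zero_mem' := by simpa using IsLaw.const (0 : N)
  smul_mem' c x hx := by
    have := IsLaw.map hx (LinearMap.lsmul k N c)
    simp only [LinearMap.lsmul_apply, ← map_smul] at this
    exact this

theorem lawful_of_span {S : Set N} (hS : Submodule.span k S = ⊤) (h : ∀ x ∈ S, IsLaw fun a => τ a x) :
    Lawful τ := fun x => by
  have : Submodule.span k S ≤ lawSub τ := Submodule.span_le.2 h
  rw [hS] at this
  exact this (x := x) trivial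

theorem Lawful.of_surjective (h : Lawful τ) (f : N →ₗ[k] N') (hf : Function.Surjective f)
    (hfc : ∀ a x, f (τ a x) = τ' a (f x)) : Lawful τ' := fun y => by
  obtain ⟨x, rfl⟩ := hf y
  simpa only [hfc] using (h x).map f

theorem Lawful.tprod (h : Lawful τ) (h' : Lawful τ') : Lawful (τ.tprod τ') :=
  lawful_of_span (TensorProduct.span_tmul_eq_top k N N') (by
    rintro _ ⟨x, y, rfl⟩
    simpa using (h x).map₂ (h' y) (TensorProduct.mk k N N'))

variable (k) in
/-- The tensor power `V^{⊗ι}`. -/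
def TPow (ι : Type) : Type u := ⨂[k] _ : ι, StdSpace k

noncomputable instance (ι : Type) : AddCommGroup (TPow k ι) :=
  inferInstanceAs (AddCommGroup (⨂[k] _ : ι, StdSpace k))

noncomputable instance (ι : Type) : Module k (TPow k ι) :=
  inferInstanceAs (Module k (⨂[k] _ : ι, StdSpace k))

variable (k) in
/-- The universal multilinear map to the tensor power. -/
noncomputable def tpr (ι : Type) : MultilinearMap k (fun _ : ι => StdSpace k) (TPow k ι) :=
  PiTensorProduct.tprod k

variable (k) in
/-- The action of `End V` on the tensor powers of `V`. -/
noncomputable def tensorEnd (ι : Type) : Representation k (VEnd k) (TPow k ι) where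
  toFun a := PiTensorProduct.map fun _ => a
  map_one' := PiTensorProduct.map_one
  map_mul' _ _ := PiTensorProduct.map_mul _ _

theorem tensorEnd_tprod (ι : Type) (a : VEnd k) (v : ι → StdSpace k) :
    tensorEnd k ι a (tpr k ι v) = tpr k ι fun i => a (v i) :=
  PiTensorProduct.map_tprod _ _

theorem span_tpr (ι : Type) : Submodule.span k (Set.range (tpr k ι)) = ⊤ :=
  PiTensorProduct.span_tprod_eq_top

theorem lawful_tensorEnd_fin (n : ℕ) : Lawful (tensorEnd k (Fin n)) :=
  lawful_of_span (span_tpr (Fin n)) (by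
    rintro _ ⟨v, rfl⟩
    simpa only [tensorEnd_tprod] using
      IsLaw.multilinear (tpr k (Fin n)) fun i => IsLaw.eval (v i))

theorem lawful_tensorEnd (ι : Type) [Fintype ι] : Lawful (tensorEnd k ι) := by
  let e := PiTensorProduct.reindex k (fun _ : Fin (Fintype.card ι) => StdSpace k)
    (Fintype.equivFin ι).symm
  exact (lawful_tensorEnd_fin (Fintype.card ι)).of_surjective (N' := TPow k ι) e.toLinearMap
    e.surjective fun a x => (PiTensorProduct.map_reindex (fun _ => a) _ x).symm

/-- The action of `End V` on exterior powers. -/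
noncomputable def extEnd (τ : Representation k (VEnd k) N) (n : ℕ) :
    Representation k (VEnd k) (⋀[k]^n N) where
  toFun a := exteriorPower.map n (τ a)
  map_one' := (congrArg (exteriorPower.map n) (map_one τ)).trans exteriorPower.map_id
  map_mul' a b := (congrArg (exteriorPower.map n) (map_mul τ a b)).trans
    (exteriorPower.map_comp (τ b) (τ a))

theorem extEnd_ιMulti (n : ℕ) (a : VEnd k) (v : Fin n → N) :
    extEnd τ n a (exteriorPower.ιMulti k n v) = exteriorPower.ιMulti k n fun i => τ a (v i) :=
  exteriorPower.map_apply_ιMulti _ _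

theorem Lawful.extEnd (h : Lawful τ) (n : ℕ) : Lawful (extEnd τ n) :=
  lawful_of_span (exteriorPower.ιMulti_span k n N) (by
    rintro _ ⟨v, rfl⟩
    simp only [extEnd_ιMulti]
    exact IsLaw.multilinear (exteriorPower.ιMulti k n).toMultilinearMap fun i => h (v i))

section CharZero

variable [CharZero k]

theorem Lawful.of_injective (h : Lawful τ') (f : N →ₗ[k] N') (hf : Function.Injective f)
    (hfc : ∀ a x, f (τ a x) = τ' a (f x)) : Lawful τ := fun x => by
  have hmem : ∀ a, τ' a (f x) ∈ LinearMap.range f := fun a => ⟨τ a x, hfc a x⟩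
  have := ((h (f x)).codRestrict _ hmem).map (LinearEquiv.ofInjective f hf).symm.toLinearMap
  convert this using 2 with a
  rw [LinearEquiv.coe_coe, LinearEquiv.eq_symm_apply]
  exact Subtype.ext (hfc a x)

theorem Lawful.eq_of_res {τ₁ τ₂ : Representation k (VEnd k) N} (h₁ : Lawful τ₁) (h₂ : Lawful τ₂)
    (h : res τ₁ = res τ₂) : τ₁ = τ₂ :=
  MonoidHom.ext fun a => LinearMap.ext fun x => h₁.map_of_res h₂ LinearMap.id
    (fun g x => LinearMap.congr_fun (DFunLike.congr_fun h g) x) a x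

/-- The restriction to `GL` of a lawful representation is polynomial. -/
theorem Lawful.isPolynomial {N : Type u} [AddCommGroup N] [Module k N]
    {τ : Representation k (VEnd k) N} (h : Lawful τ) : IsPolynomial (res τ) := by
  classical
  let ι : Type u := Σ n : ℕ, mlin τ n
  let n : ι → ℕ := fun i => i.1
  let f : (⨁ i : ι, ⨂[k] _ : Fin (n i), StdSpace k) →ₗ[k] N :=
    DirectSum.toModule k ι N fun i => PiTensorProduct.lift (h.theta i.2)
  have hf : ∀ i (x : ⨂[k] _ : Fin (n i), StdSpace k),
      f (DirectSum.lof k ι (fun i => ⨂[k] _ : Fin (n i), StdSpace k) i x) =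
        PiTensorProduct.lift (h.theta i.2) x := fun i x => DirectSum.toModule_lof _ _ _
  refine isPolynomial_of_span (τ := tensorSum k n) LinearMap.id Function.injective_id
    (fun _ _ => rfl) f (fun x => ?_) (fun g w => ?_)
  · have h1 := h.mem_span_mlin (U := ⊤) (fun _ _ _ => trivial) (x := x) trivial
    have h2 : Submodule.span k {y | ∃ n, ∃ c ∈ mlin τ n, c ∈ (⊤ : Submodule k N) ∧ ∃ a, y = τ a c} ≤
        LinearMap.range f := by
      refine Submodule.span_le.2 ?_
      rintro _ ⟨m, c, hc, -, a, rfl⟩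
      refine ⟨DirectSum.lof k ι (fun i => ⨂[k] _ : Fin (n i), StdSpace k) ⟨m, c, hc⟩
        (PiTensorProduct.tprod k fun i : Fin m => a (bv k i)), ?_⟩
      rw [hf, PiTensorProduct.lift.tprod, apply_mlin hc]
      rfl
    exact h2 h1
  · have : f ∘ₗ tensorSum k n g = res τ g ∘ₗ f := by
      refine DirectSum.linearMap_ext _ fun i => ?_
      refine PiTensorProduct.ext (MultilinearMap.ext fun v => ?_)
      simp only [LinearMap.compMultilinearMap_apply, LinearMap.comp_apply, tensorSum,
        Representation.directSum_apply, DirectSum.lmap_lof, hf]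
      rw [show tensorRep k (Fin (n i)) g (PiTensorProduct.tprod k v) =
        PiTensorProduct.tprod k (fun j => stdRep k g (v j)) from
        PiTensorProduct.map_tprod _ _, PiTensorProduct.lift.tprod, PiTensorProduct.lift.tprod,
        h.theta_apply, h.theta_apply, res_apply, ← mul_app, mul_firstVecs]
    exact LinearMap.congr_fun this w

end CharZero

/-! ### Finiteness -/

/-- The spaces `N(kⁿ)` are finite-dimensional. -/
def FinWt (τ : Representation k (VEnd k) N) : Prop :=
  ∀ n, FiniteDimensional k (LinearMap.range (τ (proj k (Finset.range n))))

theorem finWt_of_range_le (h : ∀ n, ∃ (W : Type u) (_ : AddCommGroup W) (_ : Module k W)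
    (_ : FiniteDimensional k W) (f : W →ₗ[k] N),
      LinearMap.range (τ (proj k (Finset.range n))) ≤ LinearMap.range f) : FinWt τ := fun n => by
  obtain ⟨W, _, _, _, f, hf⟩ := h n
  exact Submodule.finiteDimensional_of_le hf

theorem FinWt.mlin (h : FinWt τ) (n : ℕ) : FiniteDimensional k (mlin τ n) :=
  have := h n
  Submodule.finiteDimensional_of_le (S₂ := LinearMap.range (τ (proj k (Finset.range n))))
    fun x hx => ⟨x, hx.2⟩

theorem FinWt.of_injective (h : FinWt τ') (f : N →ₗ[k] N') (hf : Function.Injective f)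
    (hfc : ∀ a x, f (τ a x) = τ' a (f x)) : FinWt τ := fun n => by
  have := h n
  have hm : ∀ x ∈ LinearMap.range (τ (proj k (Finset.range n))),
      f x ∈ LinearMap.range (τ' (proj k (Finset.range n))) := by
    rintro _ ⟨x, rfl⟩
    exact ⟨f x, (hfc _ _).symm⟩
  exact FiniteDimensional.of_injective (f.restrict hm) fun x y hxy =>
    Subtype.ext (hf (congrArg Subtype.val hxy))

end Constructions

section Finiteness

variable {k : Type u} [Field k] {N N' : Type u} [AddCommGroup N] [Module k N]
  [AddCommGroup N'] [Module k N'] {τ : Representation k (VEnd k) N}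
  {τ' : Representation k (VEnd k) N'}

theorem FinWt.tprod (h : FinWt τ) (h' : FinWt τ') : FinWt (τ.tprod τ') :=
  finWt_of_range_le fun n => by
    have := h n
    have := h' n
    refine ⟨_, _, _, inferInstance, TensorProduct.map
      (LinearMap.range (τ (proj k (Finset.range n)))).subtype
      (LinearMap.range (τ' (proj k (Finset.range n)))).subtype, ?_⟩
    rintro _ ⟨x, rfl⟩
    refine ⟨TensorProduct.map (LinearMap.rangeRestrict _) (LinearMap.rangeRestrict _) x, ?_⟩
    rw [← LinearMap.comp_apply, ← TensorProduct.map_comp]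
    rfl

theorem FinWt.extEnd (h : FinWt τ) (i : ℕ) : FinWt (extEnd τ i) :=
  finWt_of_range_le fun n => by
    have := h n
    refine ⟨_, _, _, inferInstance, exteriorPower.map i
      (LinearMap.range (τ (proj k (Finset.range n)))).subtype, ?_⟩
    rintro _ ⟨x, rfl⟩
    refine ⟨exteriorPower.map i (LinearMap.rangeRestrict _) x, ?_⟩
    rw [← LinearMap.comp_apply, ← exteriorPower.map_comp]
    rfl

theorem finWt_tensorEnd (ι : Type) [Finite ι] : FinWt (tensorEnd k ι) :=
  finWt_of_range_le fun n => by
    let W : Type u := ⨂[k] _ : ι, (Fin n →₀ k)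
    let _ : AddCommGroup W := inferInstanceAs (AddCommGroup (⨂[k] _ : ι, (Fin n →₀ k)))
    let _ : Module k W := inferInstanceAs (Module k (⨂[k] _ : ι, (Fin n →₀ k)))
    have : FiniteDimensional k W := inferInstanceAs (Module.Finite k (⨂[k] _ : ι, (Fin n →₀ k)))
    let j : (Fin n →₀ k) →ₗ[k] StdSpace k := Finsupp.linearCombination k fun i => bv k i
    let q : StdSpace k →ₗ[k] (Fin n →₀ k) := Finsupp.linearCombination k fun i =>
      if h : i < n then Finsupp.single ⟨i, h⟩ 1 else 0
    have hjq : j ∘ₗ q = proj k (Finset.range n) := vEnd_ext fun i => by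
      simp only [j, q, LinearMap.comp_apply, Finsupp.linearCombination_single, one_smul, proj_bv,
        Finset.mem_range]
      split_ifs <;> simp
    let f : W →ₗ[k] TPow k ι := PiTensorProduct.map fun _ => j
    refine ⟨W, _, _, this, f, ?_⟩
    rintro _ ⟨x, rfl⟩
    refine ⟨PiTensorProduct.map (fun _ => q) x, ?_⟩
    refine (LinearMap.congr_fun (PiTensorProduct.map_comp
      (fun _ : ι => j) (fun _ : ι => q)).symm x).trans ?_
    rw [hjq]
    rfl

theorem FinWt.directSum {ι : Type} [Fintype ι] [DecidableEq ι] {M : ι → Type u}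
    [∀ i, AddCommGroup (M i)] [∀ i, Module k (M i)] {τ : ∀ i, Representation k (VEnd k) (M i)}
    (h : ∀ i, FinWt (τ i)) : FinWt (Representation.directSum τ) :=
  finWt_of_range_le fun n => by
    have := fun i => h i n
    refine ⟨⨁ i, LinearMap.range (τ i (proj k (Finset.range n))), _, _, inferInstance,
      DirectSum.lmap fun i => (LinearMap.range (τ i (proj k (Finset.range n)))).subtype, ?_⟩
    rintro _ ⟨x, rfl⟩
    refine ⟨DirectSum.lmap (fun i => LinearMap.rangeRestrict _) x, ?_⟩
    rw [← LinearMap.comp_apply, ← DirectSum.lmap_comp]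
    rfl

end Finiteness

/-! ### Degrees -/

section Degree

variable {k : Type u} [Field k] {N N' : Type*} [AddCommGroup N] [Module k N]
  [AddCommGroup N'] [Module k N'] {τ : Representation k (VEnd k) N}
  {τ' : Representation k (VEnd k) N'}

/-- A representation is homogeneous of degree `d` if scalars `t` act by `t ^ d`. -/
def IsHomog (τ : Representation k (VEnd k) N) (d : ℕ) : Prop :=
  ∀ (t : k) x, τ (t • 1) x = t ^ d • x

theorem IsHomog.of_injective {d : ℕ} (h : IsHomog τ' d) (f : N →ₗ[k] N')
    (hf : Function.Injective f) (hfc : ∀ a x, f (τ a x) = τ' a (f x)) : IsHomog τ d :=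
  fun t x => hf (by rw [hfc, h, map_smul])

theorem isHomog_tensorEnd (ι : Type) [Fintype ι] :
    IsHomog (tensorEnd k ι) (Fintype.card ι) := fun t x => by
  have hx : x ∈ Submodule.span k (Set.range (tpr k ι)) := by rw [span_tpr]; trivial
  induction hx using Submodule.span_induction with
  | mem y hy =>
    obtain ⟨v, rfl⟩ := hy
    rw [tensorEnd_tprod]
    have := (tpr k ι).map_smul_univ (fun _ => t) v
    simpa using this
  | zero => simp
  | add x y _ _ hx hy => rw [map_add, hx, hy, smul_add]
  | smul r x _ hx => rw [map_smul, hx, smul_comm]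

variable [CharZero k]

theorem pow_smul_eq_imp {d e : ℕ} (hde : d ≠ e) {x : N} (h : ∀ t : k, t ^ d • x = t ^ e • x) :
    x = 0 := by
  have := polyEval_injective (k := k) (p := Finsupp.single d x) (q := Finsupp.single e x)
    (fun t _ => by rw [polyEval_single, polyEval_single, h])
  have h1 := DFunLike.congr_fun this d
  rwa [Finsupp.single_eq_same, Finsupp.single_eq_of_ne hde] at h1

theorem mlin_scalar (h : Lawful τ) {n : ℕ} {c : N} (hc : c ∈ mlin τ n) (t : k) :
    τ (t • 1) c = t ^ n • c := by
  have h1 : τ (t • 1) c = h.theta ⟨c, hc⟩ fun i : Fin n => t • bv k i := by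
    rw [apply_mlin hc, h.theta_apply]; rfl
  have h2 : c = h.theta ⟨c, hc⟩ fun i : Fin n => bv k i := by
    rw [h.theta_apply, firstVecs_bv_eq_proj]; exact hc.2.symm
  rw [h1, MultilinearMap.map_smul_univ _ (fun _ => t), ← h2]
  simp

theorem IsHomog.mlin_eq_zero {d : ℕ} (hd : IsHomog τ d) (h : Lawful τ) {n : ℕ} (hn : n ≠ d) {c : N}
    (hc : c ∈ mlin τ n) : c = 0 :=
  pow_smul_eq_imp hn fun t => by rw [← hd, ← mlin_scalar h hc]

/-- Equivariant maps between homogeneous representations of different degrees vanish. -/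
theorem IsHomog.hom_eq_zero {d e : ℕ} (hd : IsHomog τ d) (he : IsHomog τ' e) (hde : d ≠ e)
    (f : N →ₗ[k] N') (hf : ∀ a x, f (τ a x) = τ' a (f x)) (x : N) : f x = 0 :=
  pow_smul_eq_imp hde fun t => by rw [← map_smul, ← hd, hf, he]

end Degree

end GLRep

namespace GLRep

/-! ### The polynomial part of a semilinear representation -/

section Extension

/-- Extension of maps from a submodule over a subring to its localization. -/
theorem exists_extend_frac {F M X : Type*} [Field F] [AddCommGroup M] [Module F M] [AddCommGroup X]
    [Module F X] (A : Subring F) (hA : ∀ x : F, ∃ a ∈ A, ∃ b ∈ A, b ≠ 0 ∧ x = a / b)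
    (P : AddSubgroup M) (hP : ∀ a ∈ A, ∀ p ∈ P, a • p ∈ P)
    (hM : ∀ m, ∃ b ∈ A, b ≠ 0 ∧ b • m ∈ P) (ψ : P →+ X)
    (hψ : ∀ a (ha : a ∈ A) (p : P), ψ ⟨a • p.1, hP a ha p p.2⟩ = a • ψ p) :
    ∃ f : M →ₗ[F] X, ∀ p : P, f p = ψ p := by
  choose b hbA hb0 hbP using hM
  let g : M → X := fun m => (b m)⁻¹ • ψ ⟨b m • m, hbP m⟩
  have key : ∀ m c (_ : c ∈ A) (_ : c ≠ 0) (h : c • m ∈ P), g m = c⁻¹ • ψ ⟨c • m, h⟩ := by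
    intro m c hc hc0 h
    have h1 := hψ c hc ⟨b m • m, hbP m⟩
    have h2 := hψ (b m) (hbA m) ⟨c • m, h⟩
    have h3 : (⟨c • b m • m, hP c hc _ (hbP m)⟩ : P) = ⟨b m • c • m, hP _ (hbA m) _ h⟩ :=
      Subtype.ext (smul_comm _ _ _)
    rw [h3, h2] at h1
    rw [eq_inv_smul_iff₀ hc0, smul_comm, ← h1, smul_smul, inv_mul_cancel₀ (hb0 m), one_smul]
  refine ⟨{ toFun := g, map_add' := fun x y => ?_, map_smul' := fun c x => ?_ }, fun p => ?_⟩
  · have hx : (b x * b y) • x ∈ P := by rw [mul_comm, mul_smul]; exact hP _ (hbA y) _ (hbP x)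
    have hy : (b x * b y) • y ∈ P := by rw [mul_smul]; exact hP _ (hbA x) _ (hbP y)
    have hxy : (b x * b y) • (x + y) ∈ P := by rw [smul_add]; exact P.add_mem hx hy
    have hbA' := A.mul_mem (hbA x) (hbA y)
    have hb0' := mul_ne_zero (hb0 x) (hb0 y)
    rw [key _ _ hbA' hb0' hx, key _ _ hbA' hb0' hy, key _ _ hbA' hb0' hxy, ← smul_add, ← map_add]
    congr 2
    exact Subtype.ext (smul_add _ _ _)
  · obtain ⟨a, ha, d, hd, hd0, rfl⟩ := hA c
    have h1 : (d * b x) • (a / d) • x = a • b x • x := by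
      rw [smul_smul, smul_smul]; congr 1; field_simp
    have h2 : (d * b x) • (a / d) • x ∈ P := by rw [h1]; exact hP a ha _ (hbP x)
    rw [key _ _ (A.mul_mem hd (hbA x)) (mul_ne_zero hd0 (hb0 x)) h2]
    have h3 := hψ a ha ⟨b x • x, hbP x⟩
    have h4 : (⟨(d * b x) • (a / d) • x, h2⟩ : P) = ⟨a • b x • x, hP a ha _ (hbP x)⟩ :=
      Subtype.ext h1
    rw [h4, h3, RingHom.id_apply]
    change _ = (a / d) • (b x)⁻¹ • ψ ⟨b x • x, hbP x⟩
    rw [smul_smul, smul_smul]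
    congr 1
    have := hb0 x
    field_simp
  · have h : (1 : F) • (p : M) ∈ P := by rw [one_smul]; exact p.2
    refine (key p 1 A.one_mem one_ne_zero h).trans ?_
    rw [inv_one, one_smul]
    congr 1
    exact Subtype.ext (one_smul _ _)

end Extension

section PolyPart

variable {k : Type u} [Field k] [CharZero k] {r : ℕ} (σ : Fin r → YoungDiagram)

/-- The action of `End V` on `k^{⊕σ}`. -/
noncomputable def tupleEnd : Representation k (VEnd k) (TupleSpace k σ) :=
  ext (tupleRep k σ) fun x => (isPolynomialElement_tupleRep k σ x).polyElt

theorem lawful_tupleEnd : Lawful (tupleEnd (k := k) σ) := lawful_ext _ _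

theorem res_tupleEnd : res (tupleEnd (k := k) σ) = tupleRep k σ := res_ext _ _

/-- The action of `End V` on the symmetric algebra of `k^{⊕σ}`, by algebra endomorphisms. -/
noncomputable def symEnd : VEnd k →* (SymRing k σ →ₐ[k] SymRing k σ) where
  toFun a := SymmetricAlgebra.lift (SymmetricAlgebra.ι k _ ∘ₗ tupleEnd σ a)
  map_one' := by
    apply SymmetricAlgebra.algHom_ext
    ext x
    simp
  map_mul' a b := by
    apply SymmetricAlgebra.algHom_ext
    ext x
    simp

/-- The action of `End V` on the symmetric algebra as a representation. -/
noncomputable def symRep : Representation k (VEnd k) (SymRing k σ) where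
  toFun a := (symEnd σ a).toLinearMap
  map_one' := by rw [map_one]; rfl
  map_mul' a b := by rw [map_mul]; rfl

theorem symRep_apply (a : VEnd k) (x : SymRing k σ) : symRep σ a x = symEnd σ a x := rfl

theorem symEnd_mul_app (a b : VEnd k) (x : SymRing k σ) :
    symEnd σ (a * b) x = symEnd σ a (symEnd σ b x) := by rw [map_mul]; rfl

theorem symEnd_ι (a : VEnd k) (x : TupleSpace k σ) :
    symEnd σ a (SymmetricAlgebra.ι k _ x) = SymmetricAlgebra.ι k _ (tupleEnd σ a x) := by
  simp [symEnd]

theorem symEnd_stdRep (g : GLInf k) (x : SymRing k σ) : symEnd σ (stdRep k g) x = g • x := by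
  have : symEnd σ (stdRep k g) = symHom (tupleRep k σ) g := by
    apply SymmetricAlgebra.algHom_ext
    refine LinearMap.ext fun x => ?_
    have h1 : tupleEnd σ (stdRep k g) = tupleRep k σ g := ext_stdRep _ _ g
    simp [symEnd, symHom, h1]
  rw [this]
  rfl

theorem lawful_symRep : Lawful (symRep (k := k) σ) := fun x => by
  simp only [symRep_apply]
  induction x using SymmetricAlgebra.induction with
  | algebraMap c => simpa only [AlgHom.commutes] using IsLaw.const _
  | ι x => simpa only [symEnd_ι] using (lawful_tupleEnd σ x).map (SymmetricAlgebra.ι k _)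
  | mul x y hx hy => 
    simp only [map_mul]
    exact hx.map₂ hy (LinearMap.mul k (SymRing k σ))
  | add x y hx hy => simpa only [map_add] using hx.add hy

variable {σ} (M : GLMod k (RatField k σ))

/-- The polynomial elements of a semilinear representation. -/
def polyPart : Submodule k M.carrier where
  carrier := {m | PolyElt M.ρ m}
  add_mem' := PolyElt.add
  zero_mem' := PolyElt.zero
  smul_mem' c x hx := hx.map (LinearMap.lsmul k M.carrier c) fun g y => (map_smul _ _ _).symm

theorem law_smul (x : SymRing k σ) {F : VEnd k → M.carrier} (hF : IsLaw F) :
    IsLaw fun a => algebraMap (SymRing k σ) (RatField k σ) (symEnd σ a x) • F a := by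
  have := (lawful_symRep σ x).map₂ hF
    (LinearMap.mk₂ k (fun (x : SymRing k σ) (m : M.carrier) =>
      algebraMap (SymRing k σ) (RatField k σ) x • m)
      (fun x y m => by rw [map_add, add_smul])
      (fun c x m => by
        rw [Algebra.smul_def, map_mul, mul_smul, ← IsScalarTower.algebraMap_apply, algebraMap_smul])
      (fun x m m' => smul_add _ _ _) (fun c x m => smul_comm _ _ _))
  exact this

theorem smul_mem_polyPart (x : SymRing k σ) {m : M.carrier} (hm : m ∈ polyPart M) :
    algebraMap (SymRing k σ) (RatField k σ) x • m ∈ polyPart M := by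
  obtain ⟨F, hF, hF'⟩ := hm
  refine ⟨_, law_smul M x hF, fun g => ?_⟩
  rw [M.ρ_smul, smul_algebraMap_symRing, symEnd_stdRep, hF']

theorem polyPart_stable (g : GLInf k) : polyPart M ≤ (polyPart M).comap (M.ρ g) := by
  rintro m ⟨F, hF, hF'⟩
  refine ⟨_, hF.comp_mul_right (stdRep k g), fun h => ?_⟩
  rw [← map_mul, hF', map_mul]
  rfl

/-- The action of `End V` on the polynomial elements. -/
noncomputable def polyRep : Representation k (VEnd k) (polyPart M) :=
  ext (M.ρ.subrepresentation (polyPart M) (polyPart_stable M)) fun x =>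
    PolyElt.of_injective (polyPart M).subtype Subtype.val_injective (fun _ _ => rfl) x.2

theorem lawful_polyRep : Lawful (polyRep M) := lawful_ext _ _

theorem polyRep_stdRep (g : GLInf k) (p : polyPart M) :
    (polyRep M (stdRep k g) p : M.carrier) = M.ρ g p := by
  rw [polyRep, ext_stdRep]; rfl

theorem polyRep_smul (a : VEnd k) (x : SymRing k σ) (p : polyPart M) :
    (polyRep M a ⟨algebraMap (SymRing k σ) (RatField k σ) x • p.1, smul_mem_polyPart M x p.2⟩ :
      M.carrier) = algebraMap (SymRing k σ) (RatField k σ) (symEnd σ a x) • polyRep M a p := by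
  refine IsLaw.ext ((lawful_polyRep M _).map (polyPart M).subtype)
    (law_smul M x ((lawful_polyRep M p).map (polyPart M).subtype)) (fun g => ?_) a
  rw [Submodule.subtype_apply, Submodule.subtype_apply, polyRep_stdRep, polyRep_stdRep, M.ρ_smul,
    smul_algebraMap_symRing, symEnd_stdRep]

theorem exists_smul_mem_polyPart (m : M.carrier) : ∃ x : SymRing k σ, x ≠ 0 ∧
    algebraMap (SymRing k σ) (RatField k σ) x • m ∈ polyPart M := by
  obtain ⟨a, p, hp, rfl⟩ := M.exists_smul m
  obtain ⟨x, y, hy, rfl⟩ := IsFractionRing.div_surjective (A := SymRing k σ) a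
  have hy0 : algebraMap (SymRing k σ) (RatField k σ) y ≠ 0 :=
    (map_ne_zero_iff _ (IsFractionRing.injective (SymRing k σ) (RatField k σ))).2
      (nonZeroDivisors.ne_zero hy)
  refine ⟨y, nonZeroDivisors.ne_zero hy, ?_⟩
  rw [smul_smul, mul_div_cancel₀ _ hy0]
  exact smul_mem_polyPart M x hp.polyElt

/-- A semilinear map out of the polynomial part extends to a morphism. -/
theorem exists_hom_extend (N : GLMod k (RatField k σ)) (ψ : polyPart M →ₗ[k] N.carrier)
    (hψ : ∀ (x : SymRing k σ) (p : polyPart M),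
      ψ ⟨algebraMap (SymRing k σ) (RatField k σ) x • p.1, smul_mem_polyPart M x p.2⟩ =
        algebraMap (SymRing k σ) (RatField k σ) x • ψ p)
    (hg : ∀ (g : GLInf k) (p : polyPart M), ψ (polyRep M (stdRep k g) p) = N.ρ g (ψ p)) :
    ∃ f : M ⟶ N, ∀ p : polyPart M, GLMod.Hom.lin f p = ψ p := by
  obtain ⟨f, hf⟩ := exists_extend_frac (F := RatField k σ) (X := N.carrier)
    (algebraMap (SymRing k σ) (RatField k σ)).range
    (fun x => by
      obtain ⟨x, y, hy, rfl⟩ := IsFractionRing.div_surjective (A := SymRing k σ) x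
      exact ⟨_, ⟨x, rfl⟩, _, ⟨y, rfl⟩,
        (map_ne_zero_iff _ (IsFractionRing.injective (SymRing k σ) (RatField k σ))).2
          (nonZeroDivisors.ne_zero hy), rfl⟩)
    (polyPart M).toAddSubgroup
    (by rintro _ ⟨x, rfl⟩ p hp; exact smul_mem_polyPart M x hp)
    (fun m => by
      obtain ⟨x, hx, hm⟩ := exists_smul_mem_polyPart M m
      exact ⟨_, ⟨x, rfl⟩,
        (map_ne_zero_iff _ (IsFractionRing.injective (SymRing k σ) (RatField k σ))).2 hx, hm⟩)
    ψ.toAddMonoidHom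
    (by rintro _ ⟨x, rfl⟩ p; exact hψ x p)
  have hf : ∀ p : polyPart M, f p = ψ p := hf
  refine ⟨GLMod.homMk f fun g m => ?_, hf⟩
  obtain ⟨x, hx, hm⟩ := exists_smul_mem_polyPart M m
  have hx0 : algebraMap (SymRing k σ) (RatField k σ) (g • x) ≠ 0 :=
    (map_ne_zero_iff _ (IsFractionRing.injective (SymRing k σ) (RatField k σ))).2
      (fun h => hx ((smul_eq_zero_iff_eq g).1 h))
  have h1 := hg g ⟨_, hm⟩
  rw [← hf, ← hf, polyRep_stdRep] at h1
  simp only [M.ρ_smul, map_smul, N.ρ_smul, smul_algebraMap_symRing] at h1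
  exact smul_right_injective _ hx0 h1

end PolyPart

end GLRep

namespace GLRep

/-! ### Even and odd basis vectors -/

section EvenOdd

variable (k : Type u) [Field k]

/-- The projection of `V` onto the span of the even basis vectors. -/
noncomputable def evenProj : VEnd k := ofVecs fun i => if i % 2 = 0 then bv k i else 0

/-- The projection of `V` onto the span of the odd basis vectors. -/
noncomputable def oddProj : VEnd k := ofVecs fun i => if i % 2 = 0 then 0 else bv k i

/-- The embedding of `V` as the span of the odd basis vectors. -/
noncomputable def toOdd : VEnd k := ofVecs fun i => bv k (2 * i + 1)

/-- The left inverse of `toOdd` killing the even basis vectors. -/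
noncomputable def ofOdd : VEnd k := ofVecs fun i => if i % 2 = 0 then 0 else bv k (i / 2)

variable {k}

@[simp] theorem evenProj_bv (i : ℕ) : evenProj k (bv k i) = if i % 2 = 0 then bv k i else 0 :=
  ofVecs_bv _ _

@[simp] theorem oddProj_bv (i : ℕ) : oddProj k (bv k i) = if i % 2 = 0 then 0 else bv k i :=
  ofVecs_bv _ _

@[simp] theorem toOdd_bv (i : ℕ) : toOdd k (bv k i) = bv k (2 * i + 1) := ofVecs_bv _ _

@[simp] theorem ofOdd_bv (i : ℕ) : ofOdd k (bv k i) = if i % 2 = 0 then 0 else bv k (i / 2) :=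
  ofVecs_bv _ _

theorem odd_mod (i : ℕ) : ¬ (2 * i + 1) % 2 = 0 := by omega

theorem odd_div (i : ℕ) : (2 * i + 1) / 2 = i := by omega

theorem evenProj_mul_evenProj : evenProj k * evenProj k = evenProj k := vEnd_ext fun i => by
  simp only [Module.End.mul_apply, evenProj_bv]
  split_ifs with h <;> simp [h]

theorem oddProj_mul_evenProj : oddProj k * evenProj k = 0 := vEnd_ext fun i => by
  simp only [Module.End.mul_apply, evenProj_bv]
  split_ifs with h <;> simp [h]

theorem oddProj_add_evenProj : oddProj k + evenProj k = 1 := vEnd_ext fun i => by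
  simp only [LinearMap.add_apply, evenProj_bv, oddProj_bv, Module.End.one_apply]
  split_ifs with h <;> simp

theorem ofOdd_mul_toOdd : ofOdd k * toOdd k = 1 := vEnd_ext fun i => by
  simp only [Module.End.mul_apply, toOdd_bv, ofOdd_bv, if_neg (odd_mod i), odd_div]
  rfl

theorem toOdd_mul_ofOdd : toOdd k * ofOdd k = oddProj k := vEnd_ext fun i => by
  simp only [Module.End.mul_apply, oddProj_bv, ofOdd_bv]
  split_ifs with h
  · simp
  · rw [toOdd_bv]
    congr 1
    omega

theorem evenProj_mul_toOdd : evenProj k * toOdd k = 0 := vEnd_ext fun i => by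
  simp only [Module.End.mul_apply, toOdd_bv, evenProj_bv, if_neg (odd_mod i)]
  rfl

theorem ofOdd_mul_evenProj : ofOdd k * evenProj k = 0 := vEnd_ext fun i => by
  simp only [Module.End.mul_apply, evenProj_bv]
  split_ifs with h <;> simp [h]

theorem oddProj_mul_toOdd : oddProj k * toOdd k = toOdd k := by
  rw [← toOdd_mul_ofOdd, mul_assoc, ofOdd_mul_toOdd, mul_one]

/-- The endomorphism of `V` agreeing with `a` on odd basis vectors and fixing the even ones. -/
noncomputable def hat (a : VEnd k) : VEnd k := a * oddProj k + evenProj k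

/-- The action of `a` on the span of the odd basis vectors, extended by the identity. -/
noncomputable def plus (a : VEnd k) : VEnd k := toOdd k * a * ofOdd k + evenProj k

theorem hat_mul_evenProj (a : VEnd k) : hat a * evenProj k = evenProj k := by
  rw [hat, add_mul, mul_assoc, oddProj_mul_evenProj, mul_zero, zero_add, evenProj_mul_evenProj]

theorem hat_of_mul_evenProj {a : VEnd k} (ha : a * evenProj k = evenProj k) : hat a = a := by
  conv_rhs => rw [← mul_one a, ← oddProj_add_evenProj, mul_add, ha]
  rfl

theorem hat_mul_hat (a b : VEnd k) : hat a * hat b = hat (hat a * b) := by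
  conv_lhs => rw [hat.eq_1 b, mul_add, hat_mul_evenProj]
  rw [hat.eq_1 (hat a * b), mul_assoc]

theorem plus_mul_evenProj (a : VEnd k) : plus a * evenProj k = evenProj k := by
  rw [plus, add_mul, mul_assoc, ofOdd_mul_evenProj, mul_zero, zero_add, evenProj_mul_evenProj]

theorem hat_plus (a : VEnd k) : hat (plus a) = plus a := hat_of_mul_evenProj (plus_mul_evenProj a)

theorem evenProj_mul_plus (a : VEnd k) : evenProj k * plus a = evenProj k := by
  rw [plus, mul_add, ← mul_assoc, ← mul_assoc, evenProj_mul_toOdd, zero_mul, zero_mul, zero_add,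
    evenProj_mul_evenProj]

theorem plus_mul_toOdd (a : VEnd k) : plus a * toOdd k = toOdd k * a := by
  rw [plus, add_mul, mul_assoc, ofOdd_mul_toOdd, mul_one, evenProj_mul_toOdd, add_zero]

theorem ofOdd_mul_plus (a : VEnd k) : ofOdd k * plus a = a * ofOdd k := by
  rw [plus, mul_add, ← mul_assoc, ← mul_assoc, ofOdd_mul_toOdd, one_mul, ofOdd_mul_evenProj,
    add_zero]

theorem oddProj_mul_plus (a : VEnd k) : oddProj k * plus a = plus a * oddProj k := by
  rw [← toOdd_mul_ofOdd, mul_assoc, ofOdd_mul_plus, ← mul_assoc, ← mul_assoc, plus_mul_toOdd]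

theorem plus_mul (a b : VEnd k) : plus (a * b) = plus a * plus b := by
  conv_rhs => rw [plus.eq_1 b, mul_add, plus_mul_evenProj, ← mul_assoc, ← mul_assoc,
    plus_mul_toOdd]
  simp only [plus, mul_assoc]

theorem plus_one : plus (1 : VEnd k) = 1 := by
  rw [plus, mul_one, toOdd_mul_ofOdd, oddProj_add_evenProj]

theorem plus_line (a b : VEnd k) (t : k) :
    plus (a + t • b) = plus a + t • (toOdd k * b * ofOdd k) := by
  rw [plus, plus, mul_add, add_mul, mul_smul_comm, smul_mul_assoc, add_right_comm]

theorem hat_line (a b : VEnd k) (t : k) : hat (a + t • b) = hat a + t • (b * oddProj k) := by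
  rw [hat, hat, add_mul, smul_mul_assoc, add_right_comm]

variable {N : Type*} [AddCommMonoid N] [Module k N]

theorem IsLaw.comp_hat {F : VEnd k → N} (hF : IsLaw F) : IsLaw fun a => F (hat a) :=
  hF.comp_affine hat (· * oddProj k) hat_line fun n => ⟨n, fun a b h i hi => by
    simp only [hat, LinearMap.add_apply, Module.End.mul_apply, oddProj_bv]
    split_ifs
    · simp
    · rw [h i hi]⟩

theorem IsLaw.comp_plus {F : VEnd k → N} (hF : IsLaw F) : IsLaw fun a => F (plus a) :=
  hF.comp_affine plus (toOdd k * · * ofOdd k) plus_line fun n => ⟨n, fun a b h i hi => by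
    simp only [plus, LinearMap.add_apply, Module.End.mul_apply, ofOdd_bv]
    split_ifs
    · simp
    · rw [h (i / 2) (by omega)]⟩

end EvenOdd

/-! ### Generic vectors -/

section Generic

variable {k : Type u} [Field k] [CharZero k] {r : ℕ} (σ : Fin r → YoungDiagram)

variable (k) in
/-- The part of the symmetric algebra that only involves even basis vectors. -/
noncomputable def evenAlg : Subalgebra k (SymRing k σ) := (symEnd σ (evenProj k)).range

variable {σ} in
theorem symEnd_evenAlg {a : VEnd k} (ha : a * evenProj k = evenProj k) {b : SymRing k σ}
    (hb : b ∈ evenAlg k σ) : symEnd σ a b = b := by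
  obtain ⟨c, rfl⟩ := hb
  change symEnd σ a (symEnd σ _ c) = symEnd σ _ c
  rw [← symEnd_mul_app, ha]

variable (k) in
/-- The fraction field of `evenAlg`, as a subfield of the rational function field. -/
noncomputable def evenField : IntermediateField k (RatField k σ) :=
  IntermediateField.adjoin k
    ((evenAlg k σ).map (IsScalarTower.toAlgHom k (SymRing k σ) (RatField k σ)) : Set (RatField k σ))

variable {σ}

theorem algebraMap_ne_zero {x : SymRing k σ} (hx : x ≠ 0) :
    algebraMap (SymRing k σ) (RatField k σ) x ≠ 0 :=
  (map_ne_zero_iff _ (IsFractionRing.injective (SymRing k σ) (RatField k σ))).2 hx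

theorem mem_evenField {x : RatField k σ} : x ∈ evenField k σ ↔ ∃ a ∈ evenAlg k σ, ∃ b ∈ evenAlg k σ,
    b ≠ 0 ∧ x = algebraMap (SymRing k σ) (RatField k σ) a / algebraMap (SymRing k σ) (RatField k σ) b := by
  rw [evenField, IntermediateField.mem_adjoin_iff_div, Algebra.adjoin_eq]
  constructor
  · rintro ⟨_, ⟨a, ha, rfl⟩, _, ⟨b, hb, rfl⟩, rfl⟩
    by_cases hb0 : b = 0
    · exact ⟨0, zero_mem _, 1, one_mem _, one_ne_zero, by simp [hb0]⟩
    · exact ⟨a, ha, b, hb, hb0, rfl⟩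
  · rintro ⟨a, ha, b, hb, hb0, rfl⟩
    exact ⟨_, ⟨a, ha, rfl⟩, _, ⟨b, hb, rfl⟩, rfl⟩

variable (k σ) in
/-- The type of elements of `evenField`. -/
def EvenField : Type u := evenField k σ

noncomputable instance : Field (EvenField k σ) := inferInstanceAs (Field (evenField k σ))

noncomputable instance : Algebra k (EvenField k σ) := inferInstanceAs (Algebra k (evenField k σ))

/-- The inclusion of `EvenField` in the rational function field. -/
noncomputable def evenVal : EvenField k σ →ₐ[k] RatField k σ := (evenField k σ).val

noncomputable instance (M : GLMod k (RatField k σ)) : Module (EvenField k σ) M.carrier :=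
  Module.compHom M.carrier (evenVal (k := k) (σ := σ)).toRingHom

theorem evenVal_smul {M : GLMod k (RatField k σ)} (c : EvenField k σ) (m : M.carrier) :
    c • m = evenVal c • m := rfl

instance (M : GLMod k (RatField k σ)) : IsScalarTower k (EvenField k σ) M.carrier :=
  ⟨fun c x m => by rw [evenVal_smul, evenVal_smul, map_smul, smul_assoc]⟩

/-- An element of `evenAlg` as an element of the field `EvenField`. -/
noncomputable def evenC {b : SymRing k σ} (hb : b ∈ evenAlg k σ) : EvenField k σ :=
  ⟨algebraMap (SymRing k σ) (RatField k σ) b,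
    mem_evenField.2 ⟨b, hb, 1, one_mem _, one_ne_zero, by simp⟩⟩

theorem evenVal_evenC {b : SymRing k σ} (hb : b ∈ evenAlg k σ) :
    evenVal (evenC hb) = algebraMap (SymRing k σ) (RatField k σ) b := rfl

theorem evenC_ne_zero {b : SymRing k σ} (hb : b ∈ evenAlg k σ) (h0 : b ≠ 0) : evenC hb ≠ 0 :=
  fun h => algebraMap_ne_zero h0 ((evenVal_evenC hb).symm.trans (by rw [h, map_zero]))

theorem exists_evenC_div (x : EvenField k σ) : ∃ a, ∃ ha : a ∈ evenAlg k σ, ∃ b,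
    ∃ hb : b ∈ evenAlg k σ, b ≠ 0 ∧ x = evenC ha / evenC hb := by
  obtain ⟨x, hx⟩ := x
  obtain ⟨a, ha, b, hb, hb0, rfl⟩ := mem_evenField.1 hx
  exact ⟨a, ha, b, hb, hb0, Subtype.ext rfl⟩

variable (M : GLMod k (RatField k σ))

/-- The elements of `M` that become polynomial after multiplication by a nonzero element of
`evenAlg`. -/
noncomputable def genPart : Submodule (EvenField k σ) M.carrier where
  carrier := {m | ∃ b ∈ evenAlg k σ, b ≠ 0 ∧
    algebraMap (SymRing k σ) (RatField k σ) b • m ∈ polyPart M}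
  add_mem' := by
    rintro m m' ⟨b, hb, hb0, hm⟩ ⟨b', hb', hb0', hm'⟩
    refine ⟨b * b', mul_mem hb hb', mul_ne_zero hb0 hb0', ?_⟩
    rw [smul_add, map_mul]
    refine add_mem ?_ ?_
    · rw [mul_comm, mul_smul]
      exact smul_mem_polyPart M _ hm
    · rw [mul_smul]
      exact smul_mem_polyPart M _ hm'
  zero_mem' := ⟨1, one_mem _, one_ne_zero, by rw [smul_zero]; exact zero_mem _⟩
  smul_mem' := by
    rintro c m ⟨b, hb, hb0, hm⟩
    obtain ⟨x, hx, y, hy, hy0, rfl⟩ := exists_evenC_div c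
    refine ⟨y * b, mul_mem hy hb, mul_ne_zero hy0 hb0, ?_⟩
    have h1 := algebraMap_ne_zero hy0
    have : algebraMap (SymRing k σ) (RatField k σ) (y * b) • ((evenC hx / evenC hy) • m) =
        algebraMap (SymRing k σ) (RatField k σ) x •
          algebraMap (SymRing k σ) (RatField k σ) b • m := by
      rw [evenVal_smul, map_div₀, evenVal_evenC, evenVal_evenC, smul_smul, smul_smul, map_mul]
      congr 1
      field_simp
    rw [this]
    exact smul_mem_polyPart M x hm

/-- The type of elements of `genPart`. -/
def GenPart : Type u := genPart M

noncomputable instance : AddCommGroup (GenPart M) := inferInstanceAs (AddCommGroup (genPart M))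

noncomputable instance : Module (EvenField k σ) (GenPart M) :=
  inferInstanceAs (Module (EvenField k σ) (genPart M))

noncomputable instance : Module k (GenPart M) :=
  inferInstanceAs (Module k ((genPart M).restrictScalars k))

instance : IsScalarTower k (EvenField k σ) (GenPart M) :=
  ⟨fun c x m => Subtype.ext (smul_assoc c x m.1)⟩

/-- The inclusion of `GenPart M` in `M`. -/
noncomputable def genVal : GenPart M →ₗ[EvenField k σ] M.carrier := (genPart M).subtype

theorem genVal_injective : Function.Injective (genVal M) := Subtype.val_injective

theorem genVal_smul (c : k) (q : GenPart M) : genVal M (c • q) = c • genVal M q := rfl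

variable {M} in
theorem mem_genPart_of_polyPart {m : M.carrier} (hm : m ∈ polyPart M) : m ∈ genPart M :=
  ⟨1, one_mem _, one_ne_zero, by rwa [map_one, one_smul]⟩

/-- The inclusion of the polynomial elements. -/
noncomputable def polyIncl : polyPart M →ₗ[k] GenPart M where
  toFun p := ⟨p, mem_genPart_of_polyPart p.2⟩
  map_add' _ _ := rfl
  map_smul' _ _ := rfl

theorem genVal_polyIncl (p : polyPart M) : genVal M (polyIncl M p) = p := rfl

theorem polyIncl_injective : Function.Injective (polyIncl M) := fun x y h =>
  Subtype.ext (congrArg (genVal M) h)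

theorem exists_polyIncl (q : GenPart M) : ∃ (b : SymRing k σ) (hb : b ∈ evenAlg k σ)
    (p : polyPart M), b ≠ 0 ∧ evenC hb • q = polyIncl M p := by
  obtain ⟨q, b, hb, hb0, hq⟩ := q
  exact ⟨b, hb, ⟨_, hq⟩, hb0, rfl⟩

theorem exists_smul_polyIncl (q : GenPart M) : ∃ (c : EvenField k σ) (p : polyPart M),
    q = c • polyIncl M p := by
  obtain ⟨b, hb, p, hb0, h⟩ := exists_polyIncl M q
  exact ⟨(evenC hb)⁻¹, p, by rw [eq_inv_smul_iff₀ (evenC_ne_zero hb hb0), h]⟩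

/-- Multiplication by an element of the symmetric algebra. -/
noncomputable def genMul (x : SymRing k σ) : GenPart M →ₗ[EvenField k σ] GenPart M where
  toFun q := ⟨algebraMap (SymRing k σ) (RatField k σ) x • q.1, by
    obtain ⟨b, hb, hb0, hq⟩ := q.2
    refine ⟨b, hb, hb0, ?_⟩
    rw [smul_comm]
    exact smul_mem_polyPart M x hq⟩
  map_add' _ _ := Subtype.ext (smul_add _ _ _)
  map_smul' c q := Subtype.ext (smul_comm _ (evenVal c) q.1)

theorem genVal_genMul (x : SymRing k σ) (q : GenPart M) :
    genVal M (genMul M x q) = algebraMap (SymRing k σ) (RatField k σ) x • genVal M q := rfl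

theorem genMul_mul (x y : SymRing k σ) (q : GenPart M) :
    genMul M (x * y) q = genMul M x (genMul M y q) :=
  genVal_injective M (by simp only [genVal_genMul, map_mul, mul_smul])

theorem genMul_one (q : GenPart M) : genMul M 1 q = q :=
  genVal_injective M (by simp only [genVal_genMul, map_one, one_smul])

theorem genMul_add (x y : SymRing k σ) (q : GenPart M) :
    genMul M (x + y) q = genMul M x q + genMul M y q :=
  genVal_injective M (by rw [map_add]; simp only [genVal_genMul, map_add, add_smul])

theorem genMul_smul (c : k) (x : SymRing k σ) (q : GenPart M) :
    genMul M (c • x) q = c • genMul M x q :=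
  genVal_injective M (by
    rw [genVal_genMul, genVal_smul, genVal_genMul, Algebra.smul_def, map_mul, mul_smul,
      ← IsScalarTower.algebraMap_apply, algebraMap_smul])

theorem genMul_even {b : SymRing k σ} (hb : b ∈ evenAlg k σ) (q : GenPart M) :
    genMul M b q = evenC hb • q := rfl

theorem genMul_polyIncl (x : SymRing k σ) (p : polyPart M) :
    genMul M x (polyIncl M p) = polyIncl M ⟨_, smul_mem_polyPart M x p.2⟩ := rfl

variable (k σ) in
/-- `evenAlg` as a subring of `EvenField`. -/
noncomputable def evenSubring : Subring (EvenField k σ) where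
  carrier := {x | ∃ b, ∃ hb : b ∈ evenAlg k σ, evenC hb = x}
  mul_mem' := by
    rintro _ _ ⟨b, hb, rfl⟩ ⟨b', hb', rfl⟩
    exact ⟨b * b', mul_mem hb hb', Subtype.ext (map_mul _ _ _)⟩
  one_mem' := ⟨1, one_mem _, Subtype.ext (map_one _)⟩
  add_mem' := by
    rintro _ _ ⟨b, hb, rfl⟩ ⟨b', hb', rfl⟩
    exact ⟨b + b', add_mem hb hb', Subtype.ext (map_add _ _ _)⟩
  zero_mem' := ⟨0, zero_mem _, Subtype.ext (map_zero _)⟩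
  neg_mem' := by
    rintro _ ⟨b, hb, rfl⟩
    exact ⟨-b, neg_mem hb, Subtype.ext (map_neg _ _)⟩

/-- Maps out of the polynomial part that are linear over `evenAlg` extend to `GenPart M`. -/
theorem exists_genPart_extend {X : Type*} [AddCommGroup X] [Module (EvenField k σ) X]
    (ψ : polyPart M →+ X) (hψ : ∀ b (hb : b ∈ evenAlg k σ) (p : polyPart M),
      ψ ⟨_, smul_mem_polyPart M b p.2⟩ = evenC hb • ψ p) :
    ∃ f : GenPart M →ₗ[EvenField k σ] X, ∀ p, f (polyIncl M p) = ψ p := by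
  let e := AddMonoidHom.ofInjective (f := (polyIncl M).toAddMonoidHom) (polyIncl_injective M)
  have he : ∀ (p) (h : polyIncl M p ∈ (polyIncl M).toAddMonoidHom.range),
      e.symm ⟨polyIncl M p, h⟩ = p := fun p _ => e.symm_apply_apply p
  have hS : ∀ a ∈ evenSubring k σ, ∀ q ∈ (polyIncl M).toAddMonoidHom.range,
      a • q ∈ (polyIncl M).toAddMonoidHom.range := by
    rintro _ ⟨b, hb, rfl⟩ _ ⟨p, rfl⟩
    exact ⟨⟨_, smul_mem_polyPart M b p.2⟩, rfl⟩
  obtain ⟨f, hf⟩ := exists_extend_frac (evenSubring k σ)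
    (fun x => by
      obtain ⟨a, ha, b, hb, hb0, rfl⟩ := exists_evenC_div x
      exact ⟨evenC ha, ⟨a, ha, rfl⟩, evenC hb, ⟨b, hb, rfl⟩, evenC_ne_zero hb hb0, rfl⟩)
    (polyIncl M).toAddMonoidHom.range hS
    (fun q => by
      obtain ⟨b, hb, p, hb0, h⟩ := exists_polyIncl M q
      exact ⟨evenC hb, ⟨b, hb, rfl⟩, evenC_ne_zero hb hb0, p, h.symm⟩)
    (ψ.comp e.symm.toAddMonoidHom) (by
      rintro _ ⟨b, hb, rfl⟩ ⟨_, p, rfl⟩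
      exact (congrArg ψ (he ⟨_, smul_mem_polyPart M b p.2⟩ ⟨_, rfl⟩)).trans
        ((hψ b hb p).trans (congrArg (fun q => evenC hb • ψ q) (he p ⟨p, rfl⟩).symm)))
  exact ⟨f, fun p => (hf ⟨polyIncl M p, p, rfl⟩).trans (congrArg ψ (he p ⟨p, rfl⟩))⟩

theorem exists_genAct (a : VEnd k) : ∃ f : GenPart M →ₗ[EvenField k σ] GenPart M,
    ∀ p, f (polyIncl M p) = polyIncl M (polyRep M (hat a) p) := by
  refine exists_genPart_extend M (polyIncl M ∘ₗ polyRep M (hat a)).toAddMonoidHom fun b hb p => ?_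
  refine genVal_injective M ((polyRep_smul M (hat a) b p).trans ?_)
  rw [symEnd_evenAlg (hat_mul_evenProj a) hb]
  rfl

/-- The action on generic elements of the endomorphisms of `V` that fix the even basis vectors. -/
noncomputable def genAct (a : VEnd k) : GenPart M →ₗ[EvenField k σ] GenPart M :=
  (exists_genAct M a).choose

theorem genAct_polyIncl (a : VEnd k) (p : polyPart M) :
    genAct M a (polyIncl M p) = polyIncl M (polyRep M (hat a) p) := (exists_genAct M a).choose_spec p

theorem genAct_genMul (a : VEnd k) (x : SymRing k σ) (q : GenPart M) :
    genAct M a (genMul M x q) = genMul M (symEnd σ (hat a) x) (genAct M a q) := by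
  obtain ⟨c, p, rfl⟩ := exists_smul_polyIncl M q
  simp only [map_smul]
  congr 1
  rw [genMul_polyIncl, genAct_polyIncl, genAct_polyIncl]
  exact genVal_injective M (polyRep_smul M _ x p)

theorem genAct_genAct (a b : VEnd k) (q : GenPart M) :
    genAct M a (genAct M b q) = genAct M (hat a * b) q := by
  obtain ⟨c, p, rfl⟩ := exists_smul_polyIncl M q
  simp only [map_smul, genAct_polyIncl]
  rw [← mul_app, hat_mul_hat]

theorem isLaw_genAct (q : GenPart M) : IsLaw fun a => genAct M a q := by
  obtain ⟨c, p, rfl⟩ := exists_smul_polyIncl M q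
  simp only [map_smul, genAct_polyIncl]
  exact ((lawful_polyRep M p).comp_hat.map (polyIncl M)).map
    (LinearMap.restrictScalars k (LinearMap.lsmul (EvenField k σ) (GenPart M) c))

theorem genAct_one (q : GenPart M) : genAct M 1 q = q := by
  obtain ⟨c, p, rfl⟩ := exists_smul_polyIncl M q
  rw [map_smul, genAct_polyIncl, hat_of_mul_evenProj (one_mul _), one_app]

/-- The action of `End V` on generic elements through the odd basis vectors. -/
noncomputable def genRep : Representation k (VEnd k) (GenPart M) where
  toFun a := (genAct M (plus a)).restrictScalars k
  map_one' := LinearMap.ext fun q => by rw [plus_one]; exact genAct_one M q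
  map_mul' a b := LinearMap.ext fun q => by
    change genAct M (plus (a * b)) q = genAct M (plus a) (genAct M (plus b) q)
    rw [genAct_genAct, hat_plus, plus_mul]

theorem genRep_apply (a : VEnd k) (q : GenPart M) : genRep M a q = genAct M (plus a) q := rfl

theorem genRep_smul (a : VEnd k) (c : EvenField k σ) (q : GenPart M) :
    genRep M a (c • q) = c • genRep M a q :=
  (genAct M (plus a)).map_smul c q

theorem lawful_genRep : Lawful (genRep M) := fun q => (isLaw_genAct M q).comp_plus

theorem genRep_genMul (a : VEnd k) (x : SymRing k σ) (q : GenPart M) :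
    genRep M a (genMul M x q) = genMul M (symEnd σ (plus a) x) (genRep M a q) := by
  rw [genRep_apply, genAct_genMul, hat_plus]; rfl

theorem genRep_toOdd (a : VEnd k) (p : polyPart M) :
    genRep M a (polyIncl M (polyRep M (toOdd k) p)) =
      polyIncl M (polyRep M (toOdd k) (polyRep M a p)) := by
  rw [genRep_apply, genAct_polyIncl, hat_plus, ← mul_app, ← mul_app, plus_mul_toOdd]

end Generic

end GLRep

namespace GLRep

/-! ### Freeness of generic vectors -/

section PolyMul

variable {k : Type*} [Field k] {N N' N'' : Type*} [AddCommMonoid N] [Module k N]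
  [AddCommMonoid N'] [Module k N'] [AddCommMonoid N''] [Module k N'']

/-- Products of vector-valued polynomials. -/
theorem exists_polyEval_map₂ (B : N →ₗ[k] N' →ₗ[k] N'') (p : ℕ →₀ N) (q : ℕ →₀ N') :
    ∃ r : ℕ →₀ N'', (∀ t : k, polyEval t r = B (polyEval t p) (polyEval t q)) ∧
      ∀ n, r n = ∑ x ∈ Finset.HasAntidiagonal.antidiagonal n, B (p x.1) (q x.2) := by
  classical
  induction p using Finsupp.induction_linear with
  | zero => exact ⟨0, fun t => by simp, fun n => by simp⟩
  | add p p' hp hp' =>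
    obtain ⟨r, h1, h2⟩ := hp
    obtain ⟨r', h1', h2'⟩ := hp'
    exact ⟨r + r', fun t => by simp [h1, h1'], fun n => by
      simp [h2, h2', Finset.sum_add_distrib]⟩
  | single i v =>
    induction q using Finsupp.induction_linear with
    | zero => exact ⟨0, fun t => by simp, fun n => by simp⟩
    | add p p' hp hp' =>
      obtain ⟨r, h1, h2⟩ := hp
      obtain ⟨r', h1', h2'⟩ := hp'
      exact ⟨r + r', fun t => by simp [h1, h1'], fun n => by
        simp [h2, h2', Finset.sum_add_distrib]⟩
    | single j w =>
      refine ⟨Finsupp.single (i + j) (B v w), fun t => ?_, fun n => ?_⟩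
      · simp only [polyEval_single, map_smul, LinearMap.smul_apply, smul_smul, pow_add, mul_comm]
      · by_cases h : i + j = n
        · subst h
          rw [Finset.sum_eq_single (i, j)]
          · simp
          · rintro ⟨a, b⟩ _ hab
            by_cases ha : i = a
            · subst ha
              rw [Finsupp.single_eq_of_ne (a := j) (a' := b), map_zero]
              rintro rfl
              exact hab rfl
            · rw [Finsupp.single_eq_of_ne (a := i) (a' := a), map_zero, LinearMap.zero_apply]
              exact fun h => ha h.symm
          · simp
        · rw [Finsupp.single_eq_of_ne (fun h' => h h'.symm), Finset.sum_eq_zero]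
          rintro ⟨a, b⟩ hab
          rw [Finset.HasAntidiagonal.mem_antidiagonal] at hab
          by_cases ha : i = a
          · subst ha
            rw [Finsupp.single_eq_of_ne (a := j) (a' := b), map_zero]
            rintro rfl
            exact h hab
          · rw [Finsupp.single_eq_of_ne (a := i) (a' := a), map_zero, LinearMap.zero_apply]
            exact fun h => ha h.symm

end PolyMul

section Free

variable {k : Type u} [Field k] [CharZero k] {r : ℕ} {σ : Fin r → YoungDiagram}
  (M : GLMod k (RatField k σ))

/-- The span of the multiples of the linear forms that vanish on even vectors. -/
noncomputable def genPos : Submodule (EvenField k σ) (GenPart M) :=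
  Submodule.span _ {y | ∃ e : TupleSpace k σ, tupleEnd σ (evenProj k) e = 0 ∧
    ∃ q, y = genMul M (SymmetricAlgebra.ι k _ e) q}

/-- Multiplication by elements of the symmetric algebra as a bilinear map. -/
noncomputable def genMul₂ : SymRing k σ →ₗ[k] GenPart M →ₗ[k] GenPart M :=
  LinearMap.mk₂ k (fun x q => genMul M x q) (genMul_add M) (genMul_smul M)
    (fun x => map_add (genMul M x)) (fun c x q => map_smul ((genMul M x).restrictScalars k) c q)

theorem genMul₂_apply (x : SymRing k σ) (q : GenPart M) : genMul₂ M x q = genMul M x q := rfl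

variable {M}

theorem genMul_comm (x y : SymRing k σ) (q : GenPart M) :
    genMul M x (genMul M y q) = genMul M y (genMul M x q) := by
  rw [← genMul_mul, mul_comm, genMul_mul]

theorem genMul_genPos (x : SymRing k σ) {q : GenPart M} (hq : q ∈ genPos M) :
    genMul M x q ∈ genPos M := by
  induction hq using Submodule.span_induction with
  | mem y hy =>
    obtain ⟨e, he, q, rfl⟩ := hy
    exact Submodule.subset_span ⟨e, he, genMul M x q, genMul_comm _ _ _⟩
  | zero => rw [map_zero]; exact zero_mem _
  | add y z _ _ hy hz => rw [map_add]; exact add_mem hy hz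
  | smul c y _ hy => rw [map_smul]; exact Submodule.smul_mem _ _ hy

theorem genRep_genPos (a : VEnd k) {q : GenPart M} (hq : q ∈ genPos M) :
    genRep M a q ∈ genPos M := by
  induction hq using Submodule.span_induction with
  | mem y hy =>
    obtain ⟨e, he, q, rfl⟩ := hy
    refine Submodule.subset_span ⟨tupleEnd σ (plus a) e, ?_, genRep M a q, ?_⟩
    · rw [← mul_app, evenProj_mul_plus, he]
    · rw [genRep_genMul, symEnd_ι]
  | zero => rw [map_zero]; exact zero_mem _
  | add y z _ _ hy hz => rw [map_add]; exact add_mem hy hz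
  | smul c y _ hy => rw [genRep_smul]; exact Submodule.smul_mem _ _ hy

theorem plus_zero {k : Type*} [Field k] : plus (0 : VEnd k) = evenProj k := by
  rw [plus, mul_zero, zero_mul, zero_add]

theorem genRep_zero_of_mem {q : GenPart M} (hq : q ∈ genPos M) : genRep M 0 q = 0 := by
  induction hq using Submodule.span_induction with
  | mem y hy =>
    obtain ⟨e, he, q, rfl⟩ := hy
    rw [genRep_genMul, symEnd_ι, plus_zero, he, map_zero]
    exact LinearMap.map_zero₂ (genMul₂ M) _
  | zero => exact map_zero _
  | add y z _ _ hy hz => rw [map_add, hy, hz, add_zero]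
  | smul c y _ hy => rw [genRep_smul, hy, smul_zero]

theorem genMul_sub_mem (x : SymRing k σ) (q : GenPart M) :
    genMul M x q - genMul M (symEnd σ (evenProj k) x) q ∈ genPos M := by
  induction x using SymmetricAlgebra.induction generalizing q with
  | algebraMap c => rw [AlgHom.commutes, sub_self]; exact zero_mem _
  | ι e =>
    have : genMul M (SymmetricAlgebra.ι k _ e) q -
        genMul M (symEnd σ (evenProj k) (SymmetricAlgebra.ι k _ e)) q =
        genMul M (SymmetricAlgebra.ι k _ (e - tupleEnd σ (evenProj k) e)) q := by
      rw [symEnd_ι, map_sub]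
      simp only [← genMul₂_apply, map_sub, LinearMap.sub_apply]
    rw [this]
    refine Submodule.subset_span ⟨_, ?_, q, rfl⟩
    rw [map_sub, ← mul_app, evenProj_mul_evenProj, sub_self]
  | mul x y hx hy =>
    have h1 := genMul_genPos x (hy q)
    have h2 := hx (genMul M (symEnd σ (evenProj k) y) q)
    have := add_mem h1 h2
    rwa [map_sub, sub_add_sub_cancel, ← genMul_mul, ← genMul_mul, ← map_mul] at this
  | add x y hx hy =>
    have := add_mem (hx q) (hy q)
    rwa [sub_add_sub_comm, ← genMul_add, ← genMul_add, ← map_add] at this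

/-- The projection onto even vectors plus a shift of the odd basis vectors to even positions. -/
noncomputable def toEven (n : ℕ) : VEnd k :=
  ofVecs fun i => if i % 2 = 0 then 0 else bv k (2 * (i / 2 + n))

theorem evenProj_mul_toEven (n : ℕ) : evenProj k * toEven n = toEven n := vEnd_ext fun i => by
  simp only [Module.End.mul_apply, toEven, ofVecs_bv]
  split_ifs <;> simp

theorem toEven_mul_oddProj (n : ℕ) : toEven n * oddProj k = toEven n := vEnd_ext fun i => by
  simp only [Module.End.mul_apply, toEven, ofVecs_bv, oddProj_bv]
  split_ifs with h
  · simp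
  · rw [ofVecs_bv, if_neg h]

theorem hat_one_add (n : ℕ) (t : k) : hat ((1 : VEnd k) + t • toEven n) = 1 + t • toEven n := by
  rw [hat_line, toEven_mul_oddProj, hat_of_mul_evenProj (one_mul (evenProj k))]

theorem eq_zero_of_toEven {x : SymRing k σ} {n : ℕ} (hn : symEnd σ (proj k (Finset.range n)) x = x)
    (h : symEnd σ (evenProj k + toEven n) x = 0) : x = 0 := by
  let b : VEnd k := ofVecs fun i => if i % 2 = 0 then
    (if i / 2 < n then bv k i else bv k (2 * (i / 2 - n) + 1)) else 0
  have hb : b * (evenProj k + toEven n) * proj k (Finset.range n) = proj k (Finset.range n) :=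
    vEnd_ext fun i => by
      simp only [Module.End.mul_apply, proj_bv, Finset.mem_range]
      split_ifs with hi
      · simp only [LinearMap.add_apply, evenProj_bv, toEven, ofVecs_bv]
        split_ifs with h2
        · simp only [add_zero, b, ofVecs_bv, if_pos h2]
          rw [if_pos (by omega)]
        · simp only [zero_add, b, ofVecs_bv]
          rw [if_pos (by omega), if_neg (by omega)]
          congr 1
          omega
      · simp
  rw [← hn, ← hb, symEnd_mul_app, symEnd_mul_app, hn, h, map_zero]

/-- Generic vectors that are linearly independent modulo `genPos M` over the field `EvenField` are
linearly independent over the symmetric algebra. -/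
theorem eq_zero_of_sum_genMul {C : Submodule (EvenField k σ) (GenPart M)}
    (hC : Disjoint C (genPos M)) {ι : Type*} {c : ι → GenPart M} (hc : ∀ j, c j ∈ C)
    (hli : LinearIndependent (EvenField k σ) c) (s : Finset ι) (x : ι → SymRing k σ)
    (h : ∑ j ∈ s, genMul M (x j) (c j) = 0) : ∀ j ∈ s, x j = 0 := by
  classical
  choose m hm using fun j => (lawful_symRep σ).exists_proj (x j)
  set n := s.sup m with hn
  choose p hp using fun j => ((lawful_symRep σ) (x j)).line (evenProj k) (toEven n)
  choose q hq using fun j => (isLaw_genAct M (c j)).line 1 (toEven n)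
  have hpe : ∀ j i, p j i ∈ evenAlg k σ := fun j =>
    coeff_mem_of_polyEval_mem (k := k) (Subalgebra.toSubmodule (evenAlg k σ)) (p j) fun t _ => by
      rw [← hp]
      refine ⟨symEnd σ (1 + t • toEven n) (x j), ?_⟩
      change symEnd σ (evenProj k) (symEnd σ _ (x j)) = symEnd σ _ (x j)
      rw [← symEnd_mul_app, mul_add, mul_one, mul_smul_comm, evenProj_mul_toEven]
  have hq0 : ∀ j, q j 0 = c j := fun j => by
    rw [← polyEval_zero_eq (k := k), ← hq]
    beta_reduce
    rw [zero_smul, add_zero]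
    exact genAct_one M _
  choose v hv hvn using fun j => exists_polyEval_map₂ (genMul₂ M) (p j) (q j)
  have hvm : ∀ i, ∑ j ∈ s, v j i ∈ genPos M := by
    intro i
    have := coeff_mem_of_polyEval_mem (k := k) ((genPos M).restrictScalars k) (∑ j ∈ s, v j)
      (fun t _ => ?_) i
    · rwa [Finsupp.finsetSum_apply] at this
    · rw [map_sum]
      have h1 : ∑ j ∈ s, genMul M (symEnd σ (1 + t • toEven n) (x j))
          (genAct M (1 + t • toEven n) (c j)) = 0 := by
        have := congrArg (genAct M (1 + t • toEven n)) h
        rw [map_sum, map_zero] at this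
        simpa only [genAct_genMul, hat_one_add] using this
      have h2 : ∑ j ∈ s, polyEval t (v j) = -∑ j ∈ s,
          (genMul M (symEnd σ (1 + t • toEven n) (x j)) (genAct M (1 + t • toEven n) (c j)) -
          genMul M (symEnd σ (evenProj k) (symEnd σ (1 + t • toEven n) (x j)))
            (genAct M (1 + t • toEven n) (c j))) := by
        rw [Finset.sum_sub_distrib, h1, zero_sub, neg_neg]
        refine Finset.sum_congr rfl fun j _ => ?_
        rw [hv, ← hp, ← hq, genMul₂_apply, ← symEnd_mul_app, mul_add, mul_one, mul_smul_comm,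
          evenProj_mul_toEven]
        rfl
      rw [h2]
      exact neg_mem (sum_mem fun j _ => genMul_sub_mem _ _)
  have key : ∀ i, ∀ j ∈ s, p j i = 0 := by
    intro i
    induction i using Nat.strong_induction_on with
    | _ i ih =>
      have h1 : ∑ j ∈ s, v j i = ∑ j ∈ s, evenC (hpe j i) • c j := by
        refine Finset.sum_congr rfl fun j hj => ?_
        rw [hvn, Finset.sum_eq_single (i, 0), hq0]
        · rfl
        · rintro ⟨a, b⟩ hab hne
          rw [Finset.HasAntidiagonal.mem_antidiagonal] at hab
          have : a < i := by
            rcases Nat.eq_zero_or_pos b with rfl | hb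
            · exact absurd (by rw [← hab]; rfl) hne
            · omega
          rw [ih a this j hj, map_zero, LinearMap.zero_apply]
        · simp
      have h2 : ∑ j ∈ s, evenC (hpe j i) • c j = 0 :=
        Submodule.disjoint_def.1 hC _
          (sum_mem fun j _ => Submodule.smul_mem _ _ (hc j)) (h1 ▸ hvm i)
      have h3 := linearIndependent_iff'.1 hli s _ h2
      intro j hj
      by_contra h0
      exact evenC_ne_zero (hpe j i) h0 (h3 j hj)
  intro j hj
  refine eq_zero_of_toEven (n := n) (hm j n (Finset.le_sup (f := m) hj)) ?_
  have h1 := hp j 1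
  beta_reduce at h1
  rw [one_smul] at h1
  have h2 : p j = 0 := Finsupp.ext fun i => key i j hj
  rw [h2, map_zero] at h1
  exact h1

end Free

end GLRep

namespace GLRep

/-! ### The coaction of the symmetric algebra on generic vectors -/

section Coaction

variable {k : Type u} [Field k] [CharZero k] {r : ℕ} {σ : Fin r → YoungDiagram}
  {M : GLMod k (RatField k σ)} (C : Submodule (EvenField k σ) (GenPart M))

/-- Maps that are balanced over `evenAlg`. -/
def Balanced {X : Type*} [AddCommGroup X] [Module k X] (Φ : SymRing k σ ⊗[k] C →ₗ[k] X) : Prop :=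
  ∀ (x b : SymRing k σ) (hb : b ∈ evenAlg k σ) (c : C), Φ ((x * b) ⊗ₜ c) = Φ (x ⊗ₜ (evenC hb • c))

/-- The multiplication map. -/
noncomputable def mulMap : SymRing k σ ⊗[k] C →ₗ[k] GenPart M :=
  TensorProduct.lift ((genMul₂ M).compl₂ (C.subtype.restrictScalars k))

theorem mulMap_tmul (x : SymRing k σ) (c : C) : mulMap C (x ⊗ₜ c) = genMul M x c := rfl

theorem balanced_mulMap : Balanced C (mulMap C) := fun x b hb c => by
  rw [mulMap_tmul, mulMap_tmul, genMul_mul, genMul_even M hb]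
  rfl

variable {C}

/-- The sum of the tensors of the entries of `w` with multiples of basis vectors. -/
noncomputable def basisTensor {ι : Type*} (B : ι → C) (d : EvenField k σ) :
    (ι →₀ SymRing k σ) →ₗ[k] SymRing k σ ⊗[k] C :=
  Finsupp.lsum k fun j => (TensorProduct.mk k (SymRing k σ) C).flip (d • B j)

theorem basisTensor_single {ι : Type*} (B : ι → C) (d : EvenField k σ) (j : ι) (x : SymRing k σ) :
    basisTensor B d (Finsupp.single j x) = x ⊗ₜ (d • B j) := by
  simp [basisTensor]

theorem evenC_mul {b b' : SymRing k σ} (hb : b ∈ evenAlg k σ) (hb' : b' ∈ evenAlg k σ) :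
    evenC (mul_mem hb hb') = evenC hb * evenC hb' := Subtype.ext (map_mul _ _ _)

theorem Balanced.basisTensor_mul {X : Type*} [AddCommGroup X] [Module k X]
    {Φ : SymRing k σ ⊗[k] C →ₗ[k] X} (hΦ : Balanced C Φ) {ι : Type*} (B : ι → C)
    (d : EvenField k σ) {b : SymRing k σ} (hb : b ∈ evenAlg k σ) (w : ι →₀ SymRing k σ) :
    Φ (basisTensor B d (Finsupp.mapRange.linearMap (LinearMap.mulRight k b) w)) =
      Φ (basisTensor B (evenC hb * d) w) := by
  induction w using Finsupp.induction_linear with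
  | zero => simp
  | add w w' h h' => simp only [map_add, h, h']
  | single j x =>
    rw [Finsupp.mapRange.linearMap_apply, Finsupp.mapRange_single, basisTensor_single,
      basisTensor_single, LinearMap.mulRight_apply, hΦ x b hb, smul_smul]

/-- Every tensor is a sum of multiples of basis vectors with a common denominator. -/
theorem exists_basisTensor {ι : Type*} (B : Module.Basis ι (EvenField k σ) C)
    (z : SymRing k σ ⊗[k] C) : ∃ (b : SymRing k σ) (hb : b ∈ evenAlg k σ), b ≠ 0 ∧
      ∃ w : ι →₀ SymRing k σ, ∀ {X : Type u} [AddCommGroup X] [Module k X]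
        (Φ : SymRing k σ ⊗[k] C →ₗ[k] X), Balanced C Φ →
          Φ z = Φ (basisTensor B (evenC hb)⁻¹ w) := by
  have hadd : ∀ z z' : SymRing k σ ⊗[k] C, (∃ (b : SymRing k σ) (hb : b ∈ evenAlg k σ), b ≠ 0 ∧
      ∃ w : ι →₀ SymRing k σ, ∀ {X : Type u} [AddCommGroup X] [Module k X]
        (Φ : SymRing k σ ⊗[k] C →ₗ[k] X), Balanced C Φ →
          Φ z = Φ (basisTensor B (evenC hb)⁻¹ w)) →
      (∃ (b : SymRing k σ) (hb : b ∈ evenAlg k σ), b ≠ 0 ∧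
      ∃ w : ι →₀ SymRing k σ, ∀ {X : Type u} [AddCommGroup X] [Module k X]
        (Φ : SymRing k σ ⊗[k] C →ₗ[k] X), Balanced C Φ →
          Φ z' = Φ (basisTensor B (evenC hb)⁻¹ w)) →
      (∃ (b : SymRing k σ) (hb : b ∈ evenAlg k σ), b ≠ 0 ∧
      ∃ w : ι →₀ SymRing k σ, ∀ {X : Type u} [AddCommGroup X] [Module k X]
        (Φ : SymRing k σ ⊗[k] C →ₗ[k] X), Balanced C Φ →
          Φ (z + z') = Φ (basisTensor B (evenC hb)⁻¹ w)) := by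
    rintro z z' ⟨b, hb, h0, w, hw⟩ ⟨b', hb', h0', w', hw'⟩
    refine ⟨b * b', mul_mem hb hb', mul_ne_zero h0 h0',
      Finsupp.mapRange.linearMap (LinearMap.mulRight k b') w +
        Finsupp.mapRange.linearMap (LinearMap.mulRight k b) w', fun Φ hΦ => ?_⟩
    have h1 := evenC_ne_zero hb h0
    have h1' := evenC_ne_zero hb' h0'
    rw [map_add, hw Φ hΦ, hw' Φ hΦ, map_add, map_add, hΦ.basisTensor_mul B _ hb',
      hΦ.basisTensor_mul B _ hb, evenC_mul hb hb']
    congr 4 <;> field_simp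
  have h0 : ∃ (b : SymRing k σ) (hb : b ∈ evenAlg k σ), b ≠ 0 ∧
      ∃ w : ι →₀ SymRing k σ, ∀ {X : Type u} [AddCommGroup X] [Module k X]
        (Φ : SymRing k σ ⊗[k] C →ₗ[k] X), Balanced C Φ →
          Φ 0 = Φ (basisTensor B (evenC hb)⁻¹ w) :=
    ⟨1, one_mem _, one_ne_zero, 0, fun Φ _ => by rw [map_zero (basisTensor _ _)]⟩
  induction z using TensorProduct.induction_on with
  | zero => exact h0
  | add z z' hz hz' => exact hadd z z' hz hz'
  | tmul x c =>
    obtain ⟨g, rfl⟩ := B.repr.symm.surjective c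
    induction g using Finsupp.induction_linear with
    | zero => rw [map_zero, TensorProduct.tmul_zero]; exact h0
    | add g g' hg hg' => rw [map_add, TensorProduct.tmul_add]; exact hadd _ _ hg hg'
    | single j f =>
      obtain ⟨a, ha, b, hb, hb0, rfl⟩ := exists_evenC_div f
      refine ⟨b, hb, hb0, Finsupp.single j (x * a), fun Φ hΦ => ?_⟩
      rw [basisTensor_single, hΦ x a ha, Module.Basis.repr_symm_single, smul_smul, div_eq_mul_inv]

theorem Balanced.eq_zero (hC : Disjoint C (genPos M)) {X : Type u} [AddCommGroup X] [Module k X]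
    {Φ : SymRing k σ ⊗[k] C →ₗ[k] X} (hΦ : Balanced C Φ) {z : SymRing k σ ⊗[k] C}
    (hz : mulMap C z = 0) : Φ z = 0 := by
  let B := Module.Basis.ofVectorSpace (EvenField k σ) C
  obtain ⟨b, hb, hb0, w, hw⟩ := exists_basisTensor B z
  have h1 := hw (mulMap C) (balanced_mulMap C)
  have hd : (evenC hb)⁻¹ ≠ 0 := inv_ne_zero (evenC_ne_zero hb hb0)
  have h2 : ∑ j ∈ w.support, genMul M (w j) (((evenC hb)⁻¹ • B j : C) : GenPart M) = 0 := by
    rw [← hz, h1, basisTensor, Finsupp.lsum_apply, Finsupp.sum, map_sum]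
    rfl
  have hli : LinearIndependent (EvenField k σ)
      fun j => (((evenC hb)⁻¹ • B j : C) : GenPart M) :=
    (B.linearIndependent.units_smul fun _ => Units.mk0 _ hd).map' C.subtype C.ker_subtype
  have h3 := eq_zero_of_sum_genMul hC (fun j => ((evenC hb)⁻¹ • B j).2) hli _ _ h2
  have h4 : w = 0 := by
    ext j
    by_contra h
    exact h (h3 j (Finsupp.mem_support_iff.2 h))
  rw [hw Φ hΦ, h4, map_zero, map_zero]

theorem isPolyFun_genRep_smul (q : GenPart M) : IsPolyFun fun t : k => genRep M (t • 1) q := by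
  simpa using ((lawful_genRep M) q).line 0 1

theorem mulMap_surjective (hs : ∀ a, ∀ c ∈ C, genRep M a c ∈ C) (hC : C ⊔ genPos M = ⊤) :
    Function.Surjective (mulMap C) := by
  let S : Submodule (EvenField k σ) (GenPart M) :=
    { (LinearMap.range (mulMap C)) with
      smul_mem' := by
        rintro f _ ⟨z, rfl⟩
        induction z using TensorProduct.induction_on with
        | zero => exact ⟨0, by simp⟩
        | add z z' hz hz' =>
          obtain ⟨y, hy⟩ := hz
          obtain ⟨y', hy'⟩ := hz'
          exact ⟨y + y', by rw [map_add, map_add, smul_add, hy, hy']⟩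
        | tmul x c => exact ⟨x ⊗ₜ (f • c), map_smul (genMul M x) f (c : GenPart M)⟩ }
  have hSR : ∀ a, ∀ q ∈ S, genRep M a q ∈ S := by
    rintro a _ ⟨z, rfl⟩
    induction z using TensorProduct.induction_on with
    | zero => rw [map_zero, map_zero]; exact zero_mem _
    | add z z' hz hz' => rw [map_add, map_add]; exact add_mem hz hz'
    | tmul x c => exact ⟨symEnd σ (plus a) x ⊗ₜ ⟨_, hs a c c.2⟩, (genRep_genMul M a x c).symm⟩
  have hSM : ∀ x, ∀ q ∈ S, genMul M x q ∈ S := by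
    rintro x _ ⟨z, rfl⟩
    induction z using TensorProduct.induction_on with
    | zero => rw [map_zero, map_zero]; exact zero_mem _
    | add z z' hz hz' => rw [map_add, map_add]; exact add_mem hz hz'
    | tmul y c => exact ⟨(x * y) ⊗ₜ c, genMul_mul M x y c⟩
  let L : k → GenPart M →ₗ[k] GenPart M := fun t => genRep M (t • 1)
  have hL : ∀ q, IsPolyFun fun t => L t q := isPolyFun_genRep_smul
  have key : ∀ d q, polyCoeff L hL q d ∈ S := by
    intro d
    induction d using Nat.strong_induction_on with
    | _ d ih =>
      intro q
      have hq : q ∈ C ⊔ genPos M := by rw [hC]; trivial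
      have hsm : ∀ (f : EvenField k σ) q, polyCoeff L hL (f • q) d = f • polyCoeff L hL q d :=
        fun f q => (polyCoeff_natural L hL L hL (LinearMap.lsmul (EvenField k σ) _ f |>.restrictScalars k)
          (LinearMap.lsmul (EvenField k σ) _ f |>.restrictScalars k)
            (fun t _ => (genRep_smul M _ f q).symm) d).symm
      let U : Submodule (EvenField k σ) (GenPart M) :=
        { carrier := {q | polyCoeff L hL q d ∈ S}
          add_mem' := fun {x y} hx hy => by
            rw [Set.mem_ofPred_eq, map_add, Finsupp.add_apply]
            exact add_mem hx hy
          zero_mem' := by rw [Set.mem_ofPred_eq, map_zero]; exact zero_mem _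
          smul_mem' := fun f x hx => by
            rw [Set.mem_ofPred_eq, hsm]
            exact Submodule.smul_mem _ _ hx }
      have hCS : C ≤ S := fun c hc => ⟨1 ⊗ₜ ⟨c, hc⟩, genMul_one M c⟩
      have h1 : C ≤ U := fun c hc =>
        polyCoeff_mem L hL (S.restrictScalars k) (fun t _ => hSR _ _ (hCS hc)) d
      have h2 : genPos M ≤ U := by
        refine Submodule.span_le.2 ?_
        rintro _ ⟨e, he, q', rfl⟩
        obtain ⟨p, hp⟩ := ((lawful_tupleEnd σ) e).comp_plus.line 0 1
        obtain ⟨v, hv, hvn⟩ := exists_polyEval_map₂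
          (genMul₂ M ∘ₗ SymmetricAlgebra.ι k (TupleSpace k σ)) p (polyCoeff L hL q')
        have hp0 : p 0 = 0 := by
          rw [← polyEval_zero_eq (k := k), ← hp]
          beta_reduce
          rw [zero_smul, add_zero, plus_zero, he]
        have h3 : polyCoeff L hL (genMul M (SymmetricAlgebra.ι k _ e) q') = v :=
          polyCoeff_eq L hL fun t _ => by
            rw [hv, polyEval_polyCoeff, ← hp]
            beta_reduce
            rw [zero_add]
            exact (genRep_genMul M _ _ _).trans (by rw [symEnd_ι]; rfl)
        change polyCoeff L hL (genMul M (SymmetricAlgebra.ι k _ e) q') d ∈ S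
        rw [h3, hvn]
        refine sum_mem ?_
        rintro ⟨a, b⟩ hab
        rw [Finset.HasAntidiagonal.mem_antidiagonal] at hab
        dsimp only at hab ⊢
        rcases Nat.eq_zero_or_pos a with rfl | ha
        · rw [hp0, map_zero, LinearMap.zero_apply]
          exact zero_mem _
        · exact hSM _ _ (ih b (by omega) q')
      exact sup_le h1 h2 hq
  intro q
  have h1 : q ∈ S := by
    have h2 := polyCoeff_sum L hL q
    have h3 : L 1 q = q := by
      change genRep M ((1 : k) • 1) q = q
      rw [one_smul, one_app]
    rw [← h3, ← h2]
    exact sum_mem fun d _ => key d q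
  exact h1

variable (k σ) in
/-- The map `e ↦ s†e ⊗ 1 + 1 ⊗ (e - pe)` on the symmetric algebra, where `s†` identifies odd vectors
with all vectors and `p` projects to odd vectors. -/
noncomputable def splitHom : SymRing k σ →ₐ[k] SymRing k σ ⊗[k] SymRing k σ :=
  SymmetricAlgebra.lift
    ((TensorProduct.mk k (SymRing k σ) (SymRing k σ)).flip 1 ∘ₗ SymmetricAlgebra.ι k _ ∘ₗ
        tupleEnd σ (ofOdd k) +
      (TensorProduct.mk k (SymRing k σ) (SymRing k σ)) 1 ∘ₗ SymmetricAlgebra.ι k _ ∘ₗ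
        (LinearMap.id - tupleEnd σ (oddProj k)))

theorem splitHom_ι (e : TupleSpace k σ) : splitHom k σ (SymmetricAlgebra.ι k _ e) =
    SymmetricAlgebra.ι k _ (tupleEnd σ (ofOdd k) e) ⊗ₜ 1 +
      1 ⊗ₜ SymmetricAlgebra.ι k _ (e - tupleEnd σ (oddProj k) e) := by
  simp [splitHom]

theorem splitHom_toOdd (x : SymRing k σ) :
    splitHom k σ (symEnd σ (toOdd k) x) = x ⊗ₜ 1 := by
  have : (splitHom k σ).comp (symEnd σ (toOdd k)) = Algebra.TensorProduct.includeLeft := by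
    apply SymmetricAlgebra.algHom_ext
    refine LinearMap.ext fun e => ?_
    change splitHom k σ (symEnd σ (toOdd k) (SymmetricAlgebra.ι k _ e)) =
      SymmetricAlgebra.ι k _ e ⊗ₜ 1
    rw [symEnd_ι, splitHom_ι, ← mul_app, ← mul_app, ofOdd_mul_toOdd, one_app, oddProj_mul_toOdd,
      sub_self, map_zero, TensorProduct.tmul_zero, add_zero]
  exact DFunLike.congr_fun this x

theorem splitHom_even (h0 : ∀ e, tupleEnd (k := k) σ 0 e = 0) {b : SymRing k σ}
    (hb : b ∈ evenAlg k σ) : splitHom k σ b = 1 ⊗ₜ b := by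
  obtain ⟨c, rfl⟩ := hb
  have : (splitHom k σ).comp (symEnd σ (evenProj k)) =
      Algebra.TensorProduct.includeRight.comp (symEnd σ (evenProj k)) := by
    apply SymmetricAlgebra.algHom_ext
    refine LinearMap.ext fun e => ?_
    change splitHom k σ (symEnd σ (evenProj k) (SymmetricAlgebra.ι k _ e)) =
      1 ⊗ₜ (symEnd σ (evenProj k) (SymmetricAlgebra.ι k _ e))
    rw [symEnd_ι, splitHom_ι, ← mul_app, ← mul_app, ofOdd_mul_evenProj, h0, oddProj_mul_evenProj,
      h0, map_zero, TensorProduct.zero_tmul, zero_add, sub_zero]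
  exact DFunLike.congr_fun this c

theorem splitHom_plus (a : VEnd k) (x : SymRing k σ) : splitHom k σ (symEnd σ (plus a) x) =
    Algebra.TensorProduct.map (symEnd σ a) (symEnd σ (plus a)) (splitHom k σ x) := by
  have : (splitHom k σ).comp (symEnd σ (plus a)) =
      (Algebra.TensorProduct.map (symEnd σ a) (symEnd σ (plus a))).comp (splitHom k σ) := by
    apply SymmetricAlgebra.algHom_ext
    refine LinearMap.ext fun e => ?_
    change splitHom k σ (symEnd σ (plus a) (SymmetricAlgebra.ι k _ e)) =
      Algebra.TensorProduct.map (symEnd σ a) (symEnd σ (plus a))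
        (splitHom k σ (SymmetricAlgebra.ι k _ e))
    rw [symEnd_ι, splitHom_ι, splitHom_ι, map_add, Algebra.TensorProduct.map_tmul,
      Algebra.TensorProduct.map_tmul, map_one, map_one, symEnd_ι, symEnd_ι, map_sub (tupleEnd σ _),
      ← mul_app, ← mul_app, ← mul_app, ← mul_app, ofOdd_mul_plus, oddProj_mul_plus]
  exact DFunLike.congr_fun this x

/-- A tensor in `R ⊗ R` applied to a vector. -/
noncomputable def applyTensor : SymRing k σ ⊗[k] SymRing k σ →ₗ[k] GenPart M →ₗ[k]
    SymRing k σ ⊗[k] GenPart M :=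
  TensorProduct.lift (LinearMap.mk₂ k
    (fun x y => TensorProduct.mk k (SymRing k σ) (GenPart M) x ∘ₗ genMul₂ M y)
    (fun x x' y => by rw [map_add, LinearMap.add_comp])
    (fun c x y => by rw [map_smul, LinearMap.smul_comp])
    (fun x y y' => by rw [map_add, LinearMap.comp_add])
    (fun c x y => by rw [map_smul, LinearMap.comp_smul]))

theorem applyTensor_tmul (x y : SymRing k σ) (q : GenPart M) :
    applyTensor (x ⊗ₜ y) q = x ⊗ₜ[k] genMul M y q := rfl

/-- The coaction: an injective map `Q → R ⊗ Q` that is linear over `R` and equivariant, where `R`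
acts on `Q` through odd vectors. -/
theorem exists_coaction (h0 : ∀ e, tupleEnd (k := k) σ 0 e = 0)
    (D : Submodule (EvenField k σ) (GenPart M)) (hs : ∀ a, ∀ d ∈ D, genRep M a d ∈ D)
    (hD : Disjoint D (genPos M)) : ∃ Δ : GenPart M →ₗ[k] SymRing k σ ⊗[k] GenPart M,
      (∀ x q, Δ (genMul M (symEnd σ (toOdd k) x) q) =
        LinearMap.rTensor (GenPart M) (LinearMap.mulLeft k x) (Δ q)) ∧
      (∀ a q, Δ (genRep M a q) = TensorProduct.map (symRep σ a) (genRep M a) (Δ q)) ∧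
      (∀ d ∈ D, Δ d = 1 ⊗ₜ d) ∧ Function.Injective Δ := by
  obtain ⟨D', hs', hD'⟩ := (lawful_genRep M).exists_isCompl (genRep_smul M) (D ⊔ genPos M) (by
    intro a x hx
    obtain ⟨y, hy, z, hz, rfl⟩ := Submodule.mem_sup.1 hx
    rw [map_add]
    exact add_mem (Submodule.mem_sup_left (hs a y hy)) (Submodule.mem_sup_right (genRep_genPos a hz)))
  set C := D' ⊔ D with hCdef
  have hsC : ∀ a, ∀ c ∈ C, genRep M a c ∈ C := by
    intro a x hx
    obtain ⟨y, hy, z, hz, rfl⟩ := Submodule.mem_sup.1 hx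
    rw [map_add]
    exact add_mem (Submodule.mem_sup_left (hs' a y hy)) (Submodule.mem_sup_right (hs a z hz))
  have hdis : Disjoint C (genPos M) :=
    Disjoint.disjoint_sup_left_of_disjoint_sup_right hD hD'.symm.disjoint
  have hsup : C ⊔ genPos M = ⊤ := by
    rw [hCdef, sup_assoc]
    exact hD'.symm.sup_eq_top
  have hsurj := mulMap_surjective hsC hsup
  let Φ : SymRing k σ ⊗[k] C →ₗ[k] SymRing k σ ⊗[k] GenPart M :=
    TensorProduct.lift ((applyTensor ∘ₗ (splitHom k σ).toLinearMap).compl₂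
      (C.subtype.restrictScalars k))
  have hΦt : ∀ x c, Φ (x ⊗ₜ c) = applyTensor (splitHom k σ x) (c : GenPart M) := fun _ _ => rfl
  have hΦ : Balanced C Φ := fun x b hb c => by
    rw [hΦt, hΦt, map_mul, splitHom_even h0 hb]
    induction splitHom k σ x using TensorProduct.induction_on with
    | zero => simp
    | add z z' hz hz' => rw [add_mul, map_add, map_add, LinearMap.add_apply, LinearMap.add_apply, hz, hz']
    | tmul y y' =>
      rw [Algebra.TensorProduct.tmul_mul_tmul, applyTensor_tmul, applyTensor_tmul, mul_one,
        genMul_mul, genMul_even M hb]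
      rfl
  let Δ : GenPart M →ₗ[k] SymRing k σ ⊗[k] GenPart M :=
    (LinearMap.ker (mulMap C)).liftQ Φ (fun z hz => hΦ.eq_zero hdis hz) ∘ₗ
      ((mulMap C).quotKerEquivOfSurjective hsurj).symm.toLinearMap
  have hΔm : ∀ z, Δ (mulMap C z) = Φ z := fun z => by
    have : ((mulMap C).quotKerEquivOfSurjective hsurj).symm (mulMap C z) =
        (LinearMap.ker (mulMap C)).mkQ z := by
      rw [LinearEquiv.symm_apply_eq]; rfl
    exact congrArg ((LinearMap.ker (mulMap C)).liftQ Φ fun z hz => hΦ.eq_zero hdis hz) this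
  have hΔ : ∀ x (c : C), Δ (genMul M x c) = applyTensor (splitHom k σ x) (c : GenPart M) :=
    fun x c => hΔm (x ⊗ₜ c)
  have ind : ∀ P : GenPart M → Prop, P 0 → (∀ q q', P q → P q' → P (q + q')) →
      (∀ x (c : C), P (genMul M x c)) → ∀ q, P q := by
    intro P hP0 hPa hPm q
    obtain ⟨z, rfl⟩ := hsurj q
    induction z using TensorProduct.induction_on with
    | zero => rw [map_zero]; exact hP0
    | add z z' hz hz' => rw [map_add]; exact hPa _ _ hz hz'
    | tmul x c => exact hPm x c
  refine ⟨Δ, fun x => ?_, fun a => ?_, fun d hd => ?_, ?_⟩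
  · refine ind _ (by simp) (fun q q' h h' => by rw [map_add, map_add, map_add, map_add, h, h']) ?_
    intro y c
    rw [← genMul_mul, hΔ, hΔ, map_mul, splitHom_toOdd]
    induction splitHom k σ y using TensorProduct.induction_on with
    | zero => simp
    | add z z' hz hz' => rw [mul_add, map_add, map_add, LinearMap.add_apply, LinearMap.add_apply, hz,
        hz', map_add]
    | tmul y y' =>
      rw [Algebra.TensorProduct.tmul_mul_tmul, applyTensor_tmul, applyTensor_tmul, one_mul,
        LinearMap.rTensor_tmul, LinearMap.mulLeft_apply]
  · refine ind _ (by simp) (fun q q' h h' => by rw [map_add, map_add, map_add, map_add, h, h']) ?_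
    intro y c
    rw [genRep_genMul, hΔ y c, hΔ _ ⟨_, hsC a c c.2⟩, splitHom_plus]
    induction splitHom k σ y using TensorProduct.induction_on with
    | zero => simp
    | add z z' hz hz' => rw [map_add, map_add, map_add, LinearMap.add_apply, LinearMap.add_apply, hz,
        hz', map_add]
    | tmul y y' =>
      rw [Algebra.TensorProduct.map_tmul, applyTensor_tmul, applyTensor_tmul,
        TensorProduct.map_tmul, genRep_genMul]
      rfl
  · have h1 := hΔ 1 ⟨d, Submodule.mem_sup_right hd⟩
    rw [genMul_one, map_one, Algebra.TensorProduct.one_def, applyTensor_tmul, genMul_one] at h1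
    exact h1
  · let Λ : SymRing k σ ⊗[k] GenPart M →ₗ[k] GenPart M :=
      TensorProduct.lift (genMul₂ M ∘ₗ (symEnd σ (toOdd k)).toLinearMap)
    have hΛ : ∀ q, Λ (Δ q) = q := by
      refine ind _ (by simp) (fun q q' h h' => by rw [map_add, map_add, h, h']) ?_
      intro x c
      let μ : SymRing k σ ⊗[k] SymRing k σ →ₐ[k] SymRing k σ :=
        Algebra.TensorProduct.lift (symEnd σ (toOdd k)) (AlgHom.id k _) fun _ _ => mul_comm _ _
      have hμ : ∀ y y', μ (y ⊗ₜ y') = symEnd σ (toOdd k) y * y' := fun _ _ =>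
        Algebra.TensorProduct.lift_tmul _ _ _ _ _
      have h1 : ∀ z, Λ (applyTensor z (c : GenPart M)) = genMul M (μ z) c := by
        intro z
        induction z using TensorProduct.induction_on with
        | zero => rw [map_zero, map_zero, LinearMap.zero_apply, map_zero, ← genMul₂_apply, map_zero,
            LinearMap.zero_apply]
        | add z z' hz hz' => rw [map_add, map_add, LinearMap.add_apply, map_add, genMul_add, hz, hz']
        | tmul y y' =>
          rw [applyTensor_tmul, hμ, genMul_mul]
          rfl
      have h2 : μ.comp (splitHom k σ) = AlgHom.id k _ := by
        apply SymmetricAlgebra.algHom_ext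
        refine LinearMap.ext fun e => ?_
        change μ (splitHom k σ (SymmetricAlgebra.ι k _ e)) = SymmetricAlgebra.ι k _ e
        rw [splitHom_ι, map_add, hμ, hμ,
          symEnd_ι, ← mul_app, toOdd_mul_ofOdd, map_one, mul_one, one_mul,
          ← map_add, add_sub_cancel]
      rw [hΔ, h1]
      exact congrArg (fun z => genMul M z (c : GenPart M)) (DFunLike.congr_fun h2 x)
    exact Function.LeftInverse.injective hΛ

end Coaction

end GLRep

namespace GLRep

/-! ### Base changes of polynomial representations -/

section BaseChange

variable {k : Type u} [Field k] [CharZero k] {r : ℕ} {σ : Fin r → YoungDiagram}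

theorem tupleEnd_zero (hσ : ∀ j, σ j ≠ ⊥) (e : TupleSpace k σ) : tupleEnd σ 0 e = 0 := by
  induction e using DirectSum.induction_on with
  | zero => exact map_zero _
  | add x y hx hy => exact (map_add (tupleEnd σ 0) x y).trans ((congrArg₂ (· + ·) hx hy).trans (add_zero _))
  | of j x =>
    obtain ⟨_, z, rfl⟩ := x
    let p : TPow k (σ j).cells →ₗ[k] SchurSpace k (σ j) := (youngSymmetrizer k (σ j)).rangeRestrict
    have hp : ∀ g y, p (tensorRep k (σ j).cells g y) = schurRep k (σ j) g (p y) := fun g y =>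
      Subtype.ext (youngSymmetrizer_comm k (σ j) g y)
    let f : TPow k (σ j).cells →ₗ[k] TupleSpace k σ :=
      DirectSum.lof k (Fin r) (fun i => SchurSpace k (σ i)) j ∘ₗ p
    have hf := (lawful_tensorEnd (k := k) (σ j).cells).map_of_res (lawful_tupleEnd σ) f
      (fun g y => by
        have h1 : tupleEnd σ (stdRep k g) = tupleRep k σ g := ext_stdRep _ _ g
        rw [h1]
        refine (congrArg (DirectSum.lof k (Fin r) (fun i => SchurSpace k (σ i)) j) (hp g y)).trans ?_
        exact (DirectSum.lmap_lof (fun i => schurRep k (σ i) g) j (p y)).symm) 0 z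
    refine hf.symm.trans ?_
    have hne : Nonempty (σ j).cells := by
      by_contra h
      rw [nonempty_subtype, not_exists] at h
      exact hσ j (SetLike.ext fun c => ⟨fun hc => absurd hc (h c), fun hc => absurd hc (by simp)⟩)
    have h0 : tensorEnd k (σ j).cells 0 = 0 := by
      refine LinearMap.ext_on (span_tpr (σ j).cells) ?_
      rintro _ ⟨v, rfl⟩
      rw [tensorEnd_tprod]
      exact (tpr k (σ j).cells).map_coord_zero (Classical.arbitrary _) rfl
    rw [h0]
    exact map_zero f

variable {W W' : Type u} [AddCommGroup W] [Module k W] [AddCommGroup W'] [Module k W']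
  {τ : Representation k (VEnd k) W} {τ' : Representation k (VEnd k) W'}

variable (σ) in
/-- The base change `K ⊗ W`. -/
noncomputable def bc (h : Lawful τ) : GLMod k (RatField k σ) :=
  GLMod.baseChange (RatField k σ) (res τ) h.isPolynomial

variable (σ) in
/-- The inclusion of `R ⊗ W` in `K ⊗ W`. -/
noncomputable def polyBc (h : Lawful τ) : SymRing k σ ⊗[k] W →ₗ[k] (bc σ h).carrier :=
  LinearMap.rTensor W (IsScalarTower.toAlgHom k (SymRing k σ) (RatField k σ)).toLinearMap

variable (h : Lawful τ)

theorem polyBc_tmul (x : SymRing k σ) (w : W) : polyBc σ h (x ⊗ₜ w) =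
    algebraMap (SymRing k σ) (RatField k σ) x • polyBc σ h (1 ⊗ₜ w) := by
  change algebraMap (SymRing k σ) (RatField k σ) x ⊗ₜ[k] w =
    algebraMap (SymRing k σ) (RatField k σ) x •
      (algebraMap (SymRing k σ) (RatField k σ) 1 ⊗ₜ[k] w : RatField k σ ⊗[k] W)
  rw [TensorProduct.smul_tmul', smul_eq_mul, map_one, mul_one]

theorem polyBc_mulLeft (x : SymRing k σ) (z : SymRing k σ ⊗[k] W) :
    polyBc σ h (LinearMap.rTensor W (LinearMap.mulLeft k x) z) =
      algebraMap (SymRing k σ) (RatField k σ) x • polyBc σ h z := by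
  induction z using TensorProduct.induction_on with
  | zero => simp
  | add z z' hz hz' => simp only [map_add, smul_add, hz, hz']
  | tmul y w =>
    rw [LinearMap.rTensor_tmul, polyBc_tmul, polyBc_tmul h y, LinearMap.mulLeft_apply, map_mul,
      mul_smul]

theorem polyBc_injective : Function.Injective (polyBc σ h) :=
  Module.Flat.rTensor_preserves_injective_linearMap _
    (IsFractionRing.injective (SymRing k σ) (RatField k σ))

theorem polyBc_ρ (g : GLInf k) (z : SymRing k σ ⊗[k] W) : (bc σ h).ρ g (polyBc σ h z) =
    polyBc σ h (TensorProduct.map (symRep σ (stdRep k g)) (τ (stdRep k g)) z) := by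
  induction z using TensorProduct.induction_on with
  | zero => simp
  | add z z' hz hz' => simp only [map_add, hz, hz']
  | tmul y w =>
    rw [TensorProduct.map_tmul, symRep_apply, symEnd_stdRep]
    change (g • algebraMap (SymRing k σ) (RatField k σ) y) ⊗ₜ[k] τ (stdRep k g) w = _
    rw [smul_algebraMap_symRing]
    rfl

theorem polyBc_mem (z : SymRing k σ ⊗[k] W) : polyBc σ h z ∈ polyPart (bc σ h) := by
  refine ⟨_, ((lawful_symRep σ).tprod h z).map (polyBc σ h), fun g => ?_⟩
  rw [polyBc_ρ]
  rfl

theorem polyRep_polyBc (a : VEnd k) (z : SymRing k σ ⊗[k] W) :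
    polyRep (bc σ h) a ⟨polyBc σ h z, polyBc_mem h z⟩ =
      ⟨polyBc σ h (TensorProduct.map (symRep σ a) (τ a) z), polyBc_mem h _⟩ := by
  let f : SymRing k σ ⊗[k] W →ₗ[k] polyPart (bc σ h) :=
    (polyBc σ h).codRestrict _ (polyBc_mem h)
  refine (((lawful_symRep σ).tprod h).map_of_res (lawful_polyRep (bc σ h)) f (fun g x => ?_) a z).symm
  refine Subtype.ext ?_
  rw [polyRep_stdRep]
  exact (polyBc_ρ h g x).symm

theorem span_polyBc : Submodule.span (RatField k σ) (Set.range fun w => polyBc σ h (1 ⊗ₜ w)) = ⊤ := by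
  refine eq_top_iff.2 fun x _ => ?_
  refine TensorProduct.induction_on (motive := fun x : RatField k σ ⊗[k] W =>
    (show (bc σ h).carrier from x) ∈ Submodule.span (RatField k σ)
      (Set.range fun w => polyBc σ h (1 ⊗ₜ w))) x (zero_mem _) (fun a w => ?_)
    (fun x y hx hy => add_mem hx hy)
  have := Submodule.smul_mem _ a (Submodule.subset_span (R := RatField k σ)
    (s := Set.range fun w => polyBc σ h (1 ⊗ₜ w)) ⟨w, rfl⟩)
  convert this using 1
  change a ⊗ₜ[k] w = a • (algebraMap (SymRing k σ) (RatField k σ) 1 ⊗ₜ[k] w : RatField k σ ⊗[k] W)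
  rw [TensorProduct.smul_tmul', smul_eq_mul, map_one, mul_one]

theorem bc_hom_ext {N : GLMod k (RatField k σ)} {f f' : bc σ h ⟶ N}
    (hf : ∀ w, GLMod.Hom.lin f (polyBc σ h (1 ⊗ₜ w)) = GLMod.Hom.lin f' (polyBc σ h (1 ⊗ₜ w))) :
    f = f' := by
  refine Subtype.ext (LinearMap.ext_on (span_polyBc h) ?_)
  rintro _ ⟨w, rfl⟩
  exact hf w

variable (M : GLMod k (RatField k σ))

/-- A morphism that is injective on polynomial elements is injective. -/
theorem injective_of_polyPart {M N : GLMod k (RatField k σ)} (f : M ⟶ N)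
    (hf : ∀ p ∈ polyPart M, GLMod.Hom.lin f p = 0 → p = 0) :
    Function.Injective (GLMod.Hom.lin f) := by
  rw [← LinearMap.ker_eq_bot, LinearMap.ker_eq_bot']
  intro m hm
  obtain ⟨x, hx, hxm⟩ := exists_smul_mem_polyPart M m
  have := hf _ hxm (by rw [map_smul, hm, smul_zero])
  exact (smul_eq_zero_iff_right (algebraMap_ne_zero hx)).1 this

theorem exists_hom_bc (Ψ : polyPart M →ₗ[k] SymRing k σ ⊗[k] W)
    (hR : ∀ (x : SymRing k σ) (p : polyPart M),
      Ψ ⟨algebraMap (SymRing k σ) (RatField k σ) x • p.1, smul_mem_polyPart M x p.2⟩ =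
        LinearMap.rTensor W (LinearMap.mulLeft k x) (Ψ p))
    (hE : ∀ (a : VEnd k) p, Ψ (polyRep M a p) = TensorProduct.map (symRep σ a) (τ a) (Ψ p)) :
    ∃ f : M ⟶ bc σ h, ∀ p : polyPart M, GLMod.Hom.lin f p = polyBc σ h (Ψ p) := by
  obtain ⟨f, hf⟩ := exists_hom_extend M (bc σ h) (polyBc σ h ∘ₗ Ψ)
    (fun x p => by rw [LinearMap.comp_apply, hR, polyBc_mulLeft]; rfl)
    (fun g p => by rw [LinearMap.comp_apply, LinearMap.comp_apply, hE, polyBc_ρ])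
  exact ⟨f, hf⟩

/-- Maps to base changes obtained from a coaction and an equivariant map. -/
theorem exists_hom_of_coaction {Δ : GenPart M →ₗ[k] SymRing k σ ⊗[k] GenPart M}
    (hΔ : ∀ x q, Δ (genMul M (symEnd σ (toOdd k) x) q) =
        LinearMap.rTensor (GenPart M) (LinearMap.mulLeft k x) (Δ q))
    (hΔ' : ∀ a q, Δ (genRep M a q) = TensorProduct.map (symRep σ a) (genRep M a) (Δ q))
    (π : GenPart M →ₗ[k] W) (hπ : ∀ a q, π (genRep M a q) = τ a (π q)) :
    ∃ f : M ⟶ bc σ h, ∀ p : polyPart M, GLMod.Hom.lin f p = polyBc σ h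
      (LinearMap.lTensor (SymRing k σ) π (Δ (polyIncl M (polyRep M (toOdd k) p)))) := by
  refine exists_hom_bc h M (LinearMap.lTensor (SymRing k σ) π ∘ₗ Δ ∘ₗ polyIncl M ∘ₗ
    polyRep M (toOdd k)) (fun x p => ?_) (fun a p => ?_)
  · simp only [LinearMap.comp_apply]
    have h1 : polyIncl M (polyRep M (toOdd k)
        ⟨algebraMap (SymRing k σ) (RatField k σ) x • p.1, smul_mem_polyPart M x p.2⟩) =
        genMul M (symEnd σ (toOdd k) x) (polyIncl M (polyRep M (toOdd k) p)) :=
      genVal_injective M (polyRep_smul M (toOdd k) x p)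
    rw [h1, hΔ, ← LinearMap.comp_apply, ← LinearMap.comp_apply (LinearMap.rTensor W _),
      LinearMap.lTensor_comp_rTensor, LinearMap.rTensor_comp_lTensor]
  · simp only [LinearMap.comp_apply]
    rw [← genRep_toOdd, hΔ']
    have h2 : π ∘ₗ genRep M a = τ a ∘ₗ π := LinearMap.ext (hπ a)
    rw [LinearMap.lTensor, ← LinearMap.comp_apply, ← LinearMap.comp_apply (TensorProduct.map _ _),
      ← TensorProduct.map_comp, ← TensorProduct.map_comp, h2, LinearMap.id_comp, LinearMap.comp_id]

/-- Every semilinear representation embeds in the base change of a polynomial representation. -/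
theorem exists_embedding (hσ : ∀ j, σ j ≠ ⊥) : ∃ f : M ⟶ bc σ (lawful_genRep M),
    Function.Injective (GLMod.Hom.lin f) ∧
      ∀ p ∈ polyPart M, ∃ z, GLMod.Hom.lin f p = polyBc σ (lawful_genRep M) z := by
  obtain ⟨Δ, h1, h2, -, h4⟩ := exists_coaction (M := M) (tupleEnd_zero hσ) ⊥
    (fun a d hd => by rw [(Submodule.mem_bot _).1 hd, map_zero]; exact zero_mem _) disjoint_bot_left
  obtain ⟨f, hf⟩ := exists_hom_of_coaction (lawful_genRep M) M h1 h2 LinearMap.id fun _ _ => rfl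
  refine ⟨f, injective_of_polyPart f fun p hp h0 => ?_, fun p hp => ⟨_, hf ⟨p, hp⟩⟩⟩
  have h5 := (hf ⟨p, hp⟩).symm.trans h0
  rw [LinearMap.lTensor_id] at h5
  have h6 := polyIncl_injective M
    ((h4 ((polyBc_injective _) (h5.trans (map_zero _).symm |>.trans (congrArg _ (map_zero Δ).symm)))).trans
      (map_zero _).symm)
  have h7 := congrArg (polyRep M (ofOdd k)) h6
  rw [← mul_app, ofOdd_mul_toOdd, one_app, map_zero] at h7
  exact congrArg Subtype.val h7

end BaseChange

end GLRep

namespace GLRep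

/-! ### Base changes are injective -/

theorem eq_zero_of_sum_of_annihilators {F N : Type*} [Field F] [AddCommGroup N] [Module F N] (z : ℕ → N)
    (p : ℕ → N →ₗ[F] N) (h0 : ∀ l, z l ≠ 0) (h1 : ∀ l, p l (z l) = 0)
    (h2 : ∀ l m, l ≠ m → p m (z l) = z l) {s : Finset ℕ} {f : ℕ → F} (h : ∑ l ∈ s, f l • z l = 0) :
    ∀ m ∈ s, f m = 0 := by
  intro m hm
  have h3 := congrArg (p m) h
  rw [map_sum, map_zero, ← Finset.add_sum_erase _ _ hm, map_smul, h1, smul_zero, zero_add] at h3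
  rw [← Finset.add_sum_erase _ _ hm] at h
  have h4 : ∑ l ∈ s.erase m, p m (f l • z l) = ∑ l ∈ s.erase m, f l • z l :=
    Finset.sum_congr rfl fun l hl => by rw [map_smul, h2 l m (Finset.ne_of_mem_erase hl)]
  rw [← h4, h3, add_zero] at h
  exact (smul_eq_zero.1 h).resolve_right (h0 m)

theorem isWt_sum_smul {k F N : Type*} [Field k] [Field F] [AddCommGroup N] [Module k N]
    [Module F N] [SMulCommClass F k N] {τ : Representation k (VEnd k) N}
    (hF : ∀ a (c : F) x, τ a (c • x) = c • τ a x) {s : Finset ℕ} {f : ℕ → F} {z : ℕ → N} {i d : ℕ}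
    (h : ∀ l, IsWt τ i d (z l)) : IsWt τ i d (∑ l ∈ s, f l • z l) := fun t => by
  rw [map_sum, Finset.smul_sum]
  exact Finset.sum_congr rfl fun l _ => by rw [hF, h l t, smul_comm]

section Disjoint

variable {k : Type u} [Field k] [CharZero k] {r : ℕ} {σ : Fin r → YoungDiagram}
  {M : GLMod k (RatField k σ)}

theorem hat_shear (i l : ℕ) (t : k) : hat (shear (2 * i + 1) (2 * l) t) =
    shear (2 * i + 1) (2 * l) t := hat_of_mul_evenProj (vEnd_ext fun j => by
  simp only [Module.End.mul_apply, evenProj_bv]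
  split_ifs with h
  · rw [shear_bv, if_neg (by omega)]
  · simp)

theorem plus_scl (i : ℕ) (t : k) : plus (scl i t) = scl (2 * i + 1) t := vEnd_ext fun j => by
  simp only [plus, LinearMap.add_apply, Module.End.mul_apply, ofOdd_bv, evenProj_bv, scl_bv]
  split_ifs with h h' h'
  · omega
  · simp
  · rw [scl_bv, if_pos (by omega), map_smul, toOdd_bv, add_zero]
    congr 2
    omega
  · rw [scl_bv, if_neg (by omega), toOdd_bv, add_zero]
    congr 1
    omega

theorem isPolyFun_genAct_shear (i l : ℕ) (q : GenPart M) :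
    IsPolyFun fun t : k => genAct M (shear (2 * i + 1) (2 * l) t) q := by
  simp only [shear_line]
  exact (isLaw_genAct M q).line _ _

/-- The derivative of the action of `1 + t E_{2l,2i+1}` on generic vectors. -/
noncomputable def genPolar (i l : ℕ) : GenPart M →ₗ[k] GenPart M :=
  Finsupp.lapply 1 ∘ₗ polyCoeff (fun t : k => (genAct M (shear (2 * i + 1) (2 * l) t)).restrictScalars k)
    (isPolyFun_genAct_shear i l)

theorem genPolar_smul (i l : ℕ) (f : EvenField k σ) (q : GenPart M) :
    genPolar i l (f • q) = f • genPolar i l q :=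
  (polyCoeff_natural _ (isPolyFun_genAct_shear (M := M) i l) _ (isPolyFun_genAct_shear i l)
    ((LinearMap.lsmul (EvenField k σ) (GenPart M) f).restrictScalars k)
    ((LinearMap.lsmul (EvenField k σ) (GenPart M) f).restrictScalars k)
    (fun t _ => ((genAct M (shear (2 * i + 1) (2 * l) t)).map_smul f q).symm) 1).symm

/-- The polarizations of an element of `genPos M` lie in a finite-dimensional space modulo
`genPos M`. -/
theorem exists_finiteDimensional_genPolar (i : ℕ) {q : GenPart M} (hq : q ∈ genPos M) :
    ∃ G : Submodule (EvenField k σ) (GenPart M), FiniteDimensional (EvenField k σ) G ∧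
      ∀ l, genPolar i l q ∈ G ⊔ genPos M := by
  induction hq using Submodule.span_induction with
  | zero => exact ⟨⊥, inferInstance, fun l => by rw [map_zero]; exact zero_mem _⟩
  | add x y _ _ hx hy =>
    obtain ⟨G, hG, h⟩ := hx
    obtain ⟨G', hG', h'⟩ := hy
    refine ⟨G ⊔ G', inferInstance, fun l => ?_⟩
    rw [map_add]
    exact add_mem (SetLike.le_def.1 (sup_le_sup_right le_sup_left _) (h l))
      (SetLike.le_def.1 (sup_le_sup_right le_sup_right _) (h' l))
  | smul f x _ hx =>
    obtain ⟨G, hG, h⟩ := hx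
    exact ⟨G, hG, fun l => by rw [genPolar_smul]; exact Submodule.smul_mem _ _ (h l)⟩
  | mem y hy =>
    obtain ⟨e, he, q, rfl⟩ := hy
    refine ⟨Submodule.span _ {q}, inferInstance, fun l => ?_⟩
    obtain ⟨p, hp⟩ := (lawful_tupleEnd σ e).line 1
      (ofVecs fun j => if j = 2 * i + 1 then bv k (2 * l) else 0)
    have hp : ∀ t, tupleEnd σ (shear (2 * i + 1) (2 * l) t) e = polyEval t p := fun t => by
      rw [shear_line]; exact hp t
    set L : k → GenPart M →ₗ[k] GenPart M :=
      fun t => (genAct M (shear (2 * i + 1) (2 * l) t)).restrictScalars k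
    have hL : ∀ q, IsPolyFun fun t => L t q := isPolyFun_genAct_shear i l
    obtain ⟨v, hv, hvn⟩ := exists_polyEval_map₂
      (genMul₂ M ∘ₗ SymmetricAlgebra.ι k (TupleSpace k σ)) p (polyCoeff L hL q)
    have h3 : polyCoeff L hL (genMul M (SymmetricAlgebra.ι k _ e) q) = v :=
      polyCoeff_eq L hL fun t _ => by
        rw [hv, polyEval_polyCoeff, ← hp]
        exact (genAct_genMul M _ _ _).trans (by rw [hat_shear, symEnd_ι]; rfl)
    have h0 : ∀ e : TupleSpace k σ, tupleEnd σ (shear (2 * i + 1) (2 * l) 0) e = e := fun e => by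
      rw [shear_line, zero_smul, add_zero, one_app]
    have hp0 : p 0 = e := by rw [← polyEval_zero_eq (k := k), ← hp, h0]
    have h4 : genPolar i l (genMul M (SymmetricAlgebra.ι k _ e) q) =
        genMul M (SymmetricAlgebra.ι k _ e) (polyCoeff L hL q 1) +
        genMul M (SymmetricAlgebra.ι k _ (p 1)) (polyCoeff L hL q 0) := by
      change polyCoeff L hL (genMul M (SymmetricAlgebra.ι k _ e) q) 1 = _
      rw [h3, hvn, show Finset.HasAntidiagonal.antidiagonal 1 = {(0, 1), (1, 0)} from rfl,
        Finset.sum_pair (by decide), hp0]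
      rfl
    have hq0 : polyCoeff L hL q 0 = q := by
      rw [← polyEval_zero_eq (k := k), polyEval_polyCoeff]
      change genAct M (shear (2 * i + 1) (2 * l) 0) q = q
      rw [shear_line, zero_smul, add_zero, genAct_one]
    rw [h4, hq0]
    refine add_mem (Submodule.mem_sup_right (Submodule.subset_span ⟨e, he, _, rfl⟩)) ?_
    have h5 := genMul_sub_mem (SymmetricAlgebra.ι k _ (p 1)) q
    rw [← sub_add_cancel (genMul M (SymmetricAlgebra.ι k _ (p 1)) q)
      (genMul M (symEnd σ (evenProj k) (SymmetricAlgebra.ι k _ (p 1))) q)]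
    refine add_mem (Submodule.mem_sup_right h5) (Submodule.mem_sup_left ?_)
    have hb : symEnd σ (evenProj k) (SymmetricAlgebra.ι k _ (p 1)) ∈ evenAlg k σ := ⟨_, rfl⟩
    rw [genMul_even M hb]
    exact Submodule.smul_mem _ _ (Submodule.mem_span_singleton_self q)

variable {W : Type u} [AddCommGroup W] [Module k W] {τ : Representation k (VEnd k) W}

variable (σ) in
/-- The action of `End V` on `F ⊗ W` through the second factor. -/
noncomputable def evenRep (τ : Representation k (VEnd k) W) :
    Representation k (VEnd k) (EvenField k σ ⊗[k] W) :=
  Representation.tprod 1 τ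

theorem evenRep_tmul (a : VEnd k) (f : EvenField k σ) (w : W) :
    evenRep σ τ a (f ⊗ₜ w) = f ⊗ₜ τ a w := rfl

theorem lawful_evenRep (h : Lawful τ) : Lawful (evenRep σ τ) :=
  Lawful.tprod (fun x => IsLaw.const x) h

theorem evenRep_smul (a : VEnd k) (f : EvenField k σ) (x : EvenField k σ ⊗[k] W) :
    evenRep σ τ a (f • x) = f • evenRep σ τ a x := by
  induction x using TensorProduct.induction_on with
  | zero => simp
  | add x y hx hy => simp only [smul_add, map_add, hx, hy]
  | tmul g w => rw [TensorProduct.smul_tmul', evenRep_tmul, evenRep_tmul, TensorProduct.smul_tmul']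

/-- `τ` composed with `plus`. -/
noncomputable def plusRep {N : Type*} [AddCommGroup N] [Module k N]
    (τ : Representation k (VEnd k) N) : Representation k (VEnd k) N where
  toFun a := τ (plus a)
  map_one' := by rw [plus_one, map_one]
  map_mul' a b := by rw [plus_mul, map_mul]

theorem plusRep_apply {N : Type*} [AddCommGroup N] [Module k N]
    (τ : Representation k (VEnd k) N) (a : VEnd k) : plusRep τ a = τ (plus a) := rfl

theorem plusRep_evenRep_smul (a : VEnd k) (f : EvenField k σ) (x : EvenField k σ ⊗[k] W) :
    plusRep (evenRep σ τ) a (f • x) = f • plusRep (evenRep σ τ) a x := by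
  rw [plusRep_apply, evenRep_smul]

theorem isWt_plusRep {N : Type*} [AddCommGroup N] [Module k N]
    {τ : Representation k (VEnd k) N} {i d : ℕ} {x : N} :
    IsWt (plusRep τ) i d x ↔ IsWt τ (2 * i + 1) d x := by
  refine forall_congr' fun t => ?_
  rw [← plus_scl]; rfl


/-- Generic vectors coming from a subspace with a constant action do not meet `genPos M`. -/
theorem disjoint_genPos (h : Lawful τ) (j : EvenField k σ ⊗[k] W →ₗ[EvenField k σ] GenPart M)
    (hj : Function.Injective j) (hja : ∀ a x, j (evenRep σ τ (hat a) x) = genAct M a (j x)) :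
    Disjoint (LinearMap.range j) (genPos M) := by
  have hB := lawful_evenRep (σ := σ) h
  have hpl : ∀ a x, j (plusRep (evenRep σ τ) a x) = genRep M a (j x) := fun a x => by
    have := hja (plus a) x
    rwa [hat_plus] at this
  have key : ∀ n (α : ℕ →₀ ℕ), α.degree = n → ∀ y, (∀ i, IsWt (plusRep (evenRep σ τ)) i (α i) y) →
      j y ∈ genPos M → y = 0 := by
    intro n
    induction n with
    | zero =>
      intro α hα y hy hyG
      rw [Finsupp.degree_eq_zero_iff] at hα
      have h1 := Lawful.proj_support (fun x => (hB x).comp_plus) hy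
      rw [hα, Finsupp.support_zero] at h1
      have h2 : proj k ∅ = 0 := vEnd_ext fun i => by simp
      rw [h2] at h1
      apply hj
      rw [← h1, hpl, genRep_zero_of_mem hyG, map_zero]
    | succ n ih =>
      intro α hα y hy hyG
      obtain ⟨i, hi⟩ : ∃ i, α i ≠ 0 := by
        by_contra! hc
        have : α = 0 := Finsupp.ext hc
        rw [this, map_zero] at hα
        exact absurd hα (by omega)
      by_contra hy0
      obtain ⟨d, hd⟩ := Nat.exists_eq_succ_of_ne_zero hi
      set β := α - Finsupp.single i 1 with hβ
      have hαβ : β + Finsupp.single i 1 = α :=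
        tsub_add_cancel_of_le (Finsupp.single_le_iff.2 (Nat.one_le_iff_ne_zero.2 hi))
      have hβn : β.degree = n := by
        have := hα
        rw [← hαβ, map_add, Finsupp.degree_single] at this
        omega
      have hβi : β i = d := by rw [hβ, Finsupp.tsub_apply, hd, Finsupp.single_eq_same]; rfl
      have hβj : ∀ m, m ≠ i → β m = α m := fun m hm => by
        rw [hβ, Finsupp.tsub_apply, Finsupp.single_eq_of_ne hm, tsub_zero]
      obtain ⟨l₀, hl₀⟩ := hB.exists_proj y
      have hw0 : ∀ l, l₀ ≤ l → IsWt (evenRep σ τ) l 0 y := fun l hl t => by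
        have h1 := hl₀ l hl
        rw [← h1, ← mul_app, scl_mul_proj (by simp), pow_zero, one_smul]
      have hwi : IsWt (evenRep σ τ) (2 * i + 1) (d + 1) y := by
        have := hy i
        rwa [isWt_plusRep, hd] at this
      let z : ℕ → EvenField k σ ⊗[k] W := fun l => hB.polar (2 * i + 1) (2 * (l₀ + l)) y
      have hz0 : ∀ l, z l ≠ 0 := fun l hz => by
        have h1 := hB.fold_polar (i := 2 * i + 1) (j := 2 * (l₀ + l)) (by omega) hwi (hw0 _ (by omega))
        change evenRep σ τ _ (z l) = _ at h1
        rw [hz, map_zero] at h1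
        exact hy0 ((smul_eq_zero_iff_right (Nat.cast_ne_zero.2 (Nat.succ_ne_zero d))).1 h1.symm)
      have hz1 : ∀ l, evenRep σ τ (scl (2 * (l₀ + l)) 0) (z l) = 0 := fun l => by
        have := hB.polar_isWt_right (i := 2 * i + 1) (j := 2 * (l₀ + l)) (by omega) (hw0 _ (by omega)) 0
        rw [this, zero_add, pow_one, zero_smul]
      have hz2 : ∀ l m, l ≠ m → evenRep σ τ (scl (2 * (l₀ + m)) 0) (z l) = z l := fun l m hlm => by
        have := hB.polar_isWt_of_ne (i := 2 * i + 1) (j := 2 * (l₀ + l)) (l := 2 * (l₀ + m)) (by omega)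
          (by omega) (hw0 _ (by omega)) 0
        rw [this, pow_zero, one_smul]
      have hzw : ∀ l m, IsWt (plusRep (evenRep σ τ)) m (β m) (z l) := fun l m => by
        rw [isWt_plusRep]
        by_cases hm : m = i
        · subst hm
          rw [hβi]
          exact hB.polar_isWt_left (by omega) hwi
        · rw [hβj m hm]
          exact hB.polar_isWt_of_ne (by omega) (by omega) (isWt_plusRep.1 (hy m))
      have hjz : ∀ l, j (z l) = genPolar i (l₀ + l) (j y) := fun l =>
        polyCoeff_natural _ (hB.isPolyFun_shear (2 * i + 1) (2 * (l₀ + l))) _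
          (isPolyFun_genAct_shear i (l₀ + l)) (j.restrictScalars k) (j.restrictScalars k)
          (fun t _ => by
            have := hja (shear (2 * i + 1) (2 * (l₀ + l)) t) y
            rwa [hat_shear] at this) 1
      obtain ⟨G, hG, hGl⟩ := exists_finiteDimensional_genPolar i hyG
      have hmem : ∀ l, (genPos M).mkQ (j (z l)) ∈ G.map (genPos M).mkQ := fun l => by
        obtain ⟨g, hg, q, hq, hgq⟩ := Submodule.mem_sup.1 (hGl (l₀ + l))
        refine ⟨g, hg, ?_⟩
        rw [hjz, ← hgq, map_add, Submodule.mkQ_apply _ q, (Submodule.Quotient.mk_eq_zero _).2 hq,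
          add_zero]
      have hli : LinearIndependent (EvenField k σ)
          fun l => (⟨_, hmem l⟩ : G.map (genPos M).mkQ) := by
        rw [linearIndependent_iff']
        intro s f hf
        have h1 : j (∑ l ∈ s, f l • z l) ∈ genPos M := by
          rw [← Submodule.Quotient.mk_eq_zero, ← Submodule.mkQ_apply, map_sum, map_sum]
          simpa using congrArg Subtype.val hf
        have h2w : ∀ m, IsWt (plusRep (evenRep σ τ)) m (β m) (∑ l ∈ s, f l • z l) := fun m =>
          isWt_sum_smul plusRep_evenRep_smul fun l => hzw l m
        have h2 : ∑ l ∈ s, f l • z l = 0 := ih β hβn _ h2w h1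
        intro m hm
        exact eq_zero_of_sum_of_annihilators z (fun m =>
          { evenRep σ τ (scl (2 * (l₀ + m)) 0) with map_smul' := evenRep_smul _ })
          hz0 hz1 hz2 h2 m hm
      exact not_finite_iff_infinite.2 inferInstance hli.finite_of_isNoetherian
  rw [Submodule.disjoint_def]
  rintro _ ⟨y, rfl⟩ hyG
  let U : Submodule k (EvenField k σ ⊗[k] W) :=
    ((genPos M).restrictScalars k).comap (j.restrictScalars k)
  have hpB : Lawful (plusRep (evenRep σ τ)) := fun x => (hB x).comp_plus
  have h1 := hpB.mem_span_isWt (U := U) (fun a x hx => by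
    change j _ ∈ genPos M
    rw [hpl]
    exact genRep_genPos a hx) (x := y) hyG
  have h2 : Submodule.span k {x | x ∈ U ∧ ∃ α : ℕ →₀ ℕ, ∀ i, IsWt (plusRep (evenRep σ τ)) i (α i) x} ≤ ⊥ := by
    refine Submodule.span_le.2 ?_
    rintro x ⟨hx, α, hα⟩
    exact key _ α rfl x hα hx
  rw [(Submodule.mem_bot k).1 (h2 h1), map_zero]

end Disjoint

end GLRep

namespace GLRep

section Retraction

variable {k : Type u} [Field k] [CharZero k] {r : ℕ} {σ : Fin r → YoungDiagram}
  {M : GLMod k (RatField k σ)} {W : Type u} [AddCommGroup W] [Module k W]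
  {τ : Representation k (VEnd k) W}

theorem polyRep_lin {M N : GLMod k (RatField k σ)} (φ : M ⟶ N) (hφ : ∀ p ∈ polyPart M,
    GLMod.Hom.lin φ p ∈ polyPart N) (a : VEnd k) (p : polyPart M) :
    polyRep N a ⟨_, hφ p p.2⟩ = ⟨_, hφ _ (polyRep M a p).2⟩ := by
  let f : polyPart M →ₗ[k] polyPart N :=
    ((GLMod.Hom.lin φ).restrictScalars k).restrict hφ
  refine ((lawful_polyRep M).map_of_res (lawful_polyRep N) f (fun g x => Subtype.ext ?_) a p).symm
  rw [polyRep_stdRep]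
  refine Eq.trans ?_ (GLMod.Hom.comm φ g x)
  change GLMod.Hom.lin φ (polyRep M (stdRep k g) x) = _
  rw [polyRep_stdRep]

theorem lin_mem_polyPart {M N : GLMod k (RatField k σ)} (φ : M ⟶ N) {p : M.carrier}
    (hp : p ∈ polyPart M) : GLMod.Hom.lin φ p ∈ polyPart N :=
  PolyElt.map hp ((GLMod.Hom.lin φ).restrictScalars k) (GLMod.Hom.comm φ)

/-- The polynomial vector that is the image of `1 ⊗ w`. -/
noncomputable def bcVec (h : Lawful τ) (φ : bc σ h ⟶ M) : W →ₗ[k] polyPart M :=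
  LinearMap.codRestrict _ ((GLMod.Hom.lin φ).restrictScalars k ∘ₗ polyBc σ h ∘ₗ
    TensorProduct.mk k _ _ 1) fun w => lin_mem_polyPart φ (polyBc_mem h (1 ⊗ₜ w))

theorem bcVec_coe (h : Lawful τ) (φ : bc σ h ⟶ M) (w : W) :
    (bcVec h φ w : M.carrier) = GLMod.Hom.lin φ (polyBc σ h (1 ⊗ₜ w)) := rfl

theorem polyRep_bcVec (h : Lawful τ) (φ : bc σ h ⟶ M) (a : VEnd k) (w : W) :
    polyRep M a (bcVec h φ w) = bcVec h φ (τ a w) := by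
  have h1 := polyRep_lin φ (fun p hp => lin_mem_polyPart φ hp) a ⟨_, polyBc_mem h (1 ⊗ₜ w)⟩
  refine h1.trans (Subtype.ext ?_)
  rw [bcVec_coe, polyRep_polyBc]
  rw [TensorProduct.map_tmul, symRep_apply, map_one]

/-- The embedding of `F ⊗ W` in the space of generic vectors. -/
noncomputable def bcGen (h : Lawful τ) (φ : bc σ h ⟶ M) :
    EvenField k σ ⊗[k] W →ₗ[EvenField k σ] GenPart M :=
  TensorProduct.AlgebraTensorModule.lift
    { toFun := fun f => (LinearMap.lsmul (EvenField k σ) (GenPart M) f).restrictScalars k ∘ₗ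
        polyIncl M ∘ₗ bcVec h φ
      map_add' := fun f g => LinearMap.ext fun w => add_smul f g _
      map_smul' := fun f g => LinearMap.ext fun w => mul_smul f g _ }

theorem bcGen_tmul (h : Lawful τ) (φ : bc σ h ⟶ M) (f : EvenField k σ) (w : W) :
    bcGen h φ (f ⊗ₜ w) = f • polyIncl M (bcVec h φ w) := rfl

theorem genAct_bcGen (h : Lawful τ) (φ : bc σ h ⟶ M) (a : VEnd k) (x : EvenField k σ ⊗[k] W) :
    bcGen h φ (evenRep σ τ (hat a) x) = genAct M a (bcGen h φ x) := by
  induction x using TensorProduct.induction_on with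
  | zero => simp
  | add x y hx hy => simp only [map_add, hx, hy]
  | tmul f w =>
    rw [evenRep_tmul, bcGen_tmul, bcGen_tmul, map_smul, genAct_polyIncl, polyRep_bcVec]

theorem bcGen_injective (h : Lawful τ) (φ : bc σ h ⟶ M)
    (hφ : Function.Injective (GLMod.Hom.lin φ)) : Function.Injective (bcGen h φ) := by
  let e : EvenField k σ ⊗[k] W →ₗ[k] (bc σ h).carrier :=
    LinearMap.rTensor W (evenVal (k := k) (σ := σ)).toLinearMap
  have he : Function.Injective e := Module.Flat.rTensor_preserves_injective_linearMap _
    (evenVal (k := k) (σ := σ)).toRingHom.injective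
  have key : ∀ x, genVal M (bcGen h φ x) = GLMod.Hom.lin φ (e x) := by
    intro x
    induction x using TensorProduct.induction_on with
    | zero => simp
    | add x y hx hy => simp only [map_add, hx, hy]
    | tmul f w =>
      rw [bcGen_tmul, map_smul, genVal_polyIncl, bcVec_coe, evenVal_smul, ← map_smul]
      congr 1
      change evenVal f • (algebraMap (SymRing k σ) (RatField k σ) 1 ⊗ₜ[k] w : RatField k σ ⊗[k] W) =
        evenVal f ⊗ₜ[k] w
      rw [TensorProduct.smul_tmul', smul_eq_mul, map_one, mul_one]
  refine fun x y hxy => he (hφ ?_)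
  rw [← key, ← key, hxy]

/-- Base changes of polynomial representations are relatively injective, by retractions that
preserve integrality. -/
theorem exists_retraction (hσ : ∀ j, σ j ≠ ⊥) (h : Lawful τ) (φ : bc σ h ⟶ M)
    (hφ : Function.Injective (GLMod.Hom.lin φ)) : ∃ ψ : M ⟶ bc σ h, φ ≫ ψ = 𝟙 _ ∧
      ∀ p ∈ polyPart M, ∃ z, GLMod.Hom.lin ψ p = polyBc σ h z := by
  let j := bcGen h φ
  have hj : Function.Injective j := bcGen_injective h φ hφ
  have hja := genAct_bcGen h φ
  have hjR : ∀ a x, j (evenRep σ τ (plus a) x) = genRep M a (j x) := fun a x => by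
    have := hja (plus a) x
    rwa [hat_plus] at this
  have hst : ∀ a, ∀ d ∈ LinearMap.range j, genRep M a d ∈ LinearMap.range j := by
    rintro a _ ⟨x, rfl⟩
    exact ⟨_, hjR a x⟩
  obtain ⟨Δ, h1, h2, h3, -⟩ := exists_coaction (M := M) (tupleEnd_zero hσ) (LinearMap.range j) hst
    (disjoint_genPos h j hj hja)
  obtain ⟨p, hp, hp', hpc⟩ := (lawful_genRep M).exists_projection (genRep_smul M) _ hst
  obtain ⟨θ, hθ⟩ := LinearMap.exists_leftInverse_of_injective (Algebra.linearMap k (EvenField k σ))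
    (LinearMap.ker_eq_bot.2 (algebraMap k (EvenField k σ)).injective)
  have hθ1 : θ 1 = 1 := by simpa using LinearMap.congr_fun hθ 1
  let e := LinearEquiv.ofInjective j hj
  let π₀ : GenPart M →ₗ[EvenField k σ] EvenField k σ ⊗[k] W :=
    e.symm.toLinearMap ∘ₗ p.codRestrict _ hp
  have hπ₀ : ∀ q, j (π₀ q) = p q := fun q =>
    congrArg Subtype.val (e.apply_symm_apply (p.codRestrict _ hp q))
  let ev : EvenField k σ ⊗[k] W →ₗ[k] W := TensorProduct.lid k W ∘ₗ TensorProduct.map θ (τ (ofOdd k))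
  have hev : ∀ a x, ev (evenRep σ τ (plus a) x) = τ a (ev x) := by
    intro a x
    induction x using TensorProduct.induction_on with
    | zero => simp
    | add x y hx hy => simp only [map_add, hx, hy]
    | tmul f w =>
      change θ f • τ (ofOdd k) (τ (plus a) w) = τ a (θ f • τ (ofOdd k) w)
      rw [← mul_app, ofOdd_mul_plus, map_smul, mul_app]
  obtain ⟨ψ, hψ⟩ := exists_hom_of_coaction h M h1 h2 (ev ∘ₗ π₀.restrictScalars k) (fun a q => by
    change ev (π₀ (genRep M a q)) = τ a (ev (π₀ q))
    rw [← hev]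
    congr 1
    apply hj
    rw [hπ₀, hpc, hjR, hπ₀])
  refine ⟨ψ, bc_hom_ext h fun w => ?_, fun p hp => ⟨_, hψ ⟨p, hp⟩⟩⟩
  rw [GLMod.lin_comp, GLMod.lin_id]
  refine (hψ (bcVec h φ w)).trans ?_
  congr 1
  rw [polyRep_bcVec]
  have h4 : polyIncl M (bcVec h φ (τ (toOdd k) w)) = j (1 ⊗ₜ τ (toOdd k) w) := by
    rw [bcGen_tmul, one_smul]
  rw [h4, h3 _ ⟨_, rfl⟩, LinearMap.lTensor_tmul]
  congr 1
  change ev (π₀ (j _)) = w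
  have h5 : π₀ (j (1 ⊗ₜ τ (toOdd k) w)) = 1 ⊗ₜ τ (toOdd k) w := hj (by rw [hπ₀, hp' _ ⟨_, rfl⟩])
  rw [h5]
  change θ 1 • τ (ofOdd k) (τ (toOdd k) w) = w
  rw [hθ1, one_smul, ← mul_app, ofOdd_mul_toOdd, one_app]

/-- The polynomial elements of `K ⊗ W` are those of `R ⊗ W`. -/
theorem mem_polyPart_bc (hσ : ∀ j, σ j ≠ ⊥) (h : Lawful τ) {p : (bc σ h).carrier}
    (hp : p ∈ polyPart (bc σ h)) : ∃ z, p = polyBc σ h z := by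
  obtain ⟨ψ, h1, h2⟩ := exists_retraction hσ h (𝟙 (bc σ h)) fun _ _ h => h
  rw [Category.id_comp] at h1
  obtain ⟨z, hz⟩ := h2 p hp
  rw [h1] at hz
  exact ⟨z, hz⟩

theorem injective_bc (hσ : ∀ j, σ j ≠ ⊥) (h : Lawful τ) : Injective (bc σ h) where
  factors {X Y} g f _ := by
    obtain ⟨ψ, h1, -⟩ := exists_retraction hσ h (pushout.inr f g)
      (GLMod.injective_of_mono _)
    exact ⟨pushout.inl f g ≫ ψ, by rw [← Category.assoc, pushout.condition, Category.assoc, h1,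
      Category.comp_id]⟩

end Retraction

section HomBaseChange

variable {k : Type u} [Field k] [CharZero k] {r : ℕ} {σ : Fin r → YoungDiagram}
  {W W' : Type u} [AddCommGroup W] [Module k W] [AddCommGroup W'] [Module k W']
  {τ : Representation k (VEnd k) W} {τ' : Representation k (VEnd k) W'}

/-- An equivariant map `W → R ⊗ W'` extends to a morphism of base changes. -/
theorem exists_bc_hom (h : Lawful τ) (h' : Lawful τ') (f : W →ₗ[k] SymRing k σ ⊗[k] W')
    (hf : ∀ a w, f (τ a w) = TensorProduct.map (symRep σ a) (τ' a) (f w)) :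
    ∃ φ : bc σ h ⟶ bc σ h', ∀ w, GLMod.Hom.lin φ (polyBc σ h (1 ⊗ₜ w)) = polyBc σ h' (f w) := by
  let L : RatField k σ ⊗[k] W →ₗ[RatField k σ] (bc σ h').carrier :=
    TensorProduct.AlgebraTensorModule.lift
      { toFun := fun a => (LinearMap.lsmul (RatField k σ) (bc σ h').carrier a).restrictScalars k ∘ₗ
          polyBc σ h' ∘ₗ f
        map_add' := fun a b => LinearMap.ext fun w => add_smul a b _
        map_smul' := fun a b => LinearMap.ext fun w => mul_smul a b _ }
  have hL : ∀ a w, L (a ⊗ₜ w) = a • polyBc σ h' (f w) := fun _ _ => rfl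
  let L' : (bc σ h).carrier →ₗ[RatField k σ] (bc σ h').carrier := L
  refine ⟨GLMod.homMk L' fun g m => ?_, fun w => ?_⟩
  · refine TensorProduct.induction_on (motive := fun m : RatField k σ ⊗[k] W =>
      L' ((bc σ h).ρ g m) = (bc σ h').ρ g (L' m)) m ?_ ?_ ?_
    · exact (congrArg L' (map_zero ((bc σ h).ρ g))).trans
        ((map_zero L').trans ((map_zero ((bc σ h').ρ g)).symm.trans
          (congrArg ((bc σ h').ρ g) (map_zero L').symm)))
    · intro a w
      change L ((g • a) ⊗ₜ τ (stdRep k g) w) = (bc σ h').ρ g (L (a ⊗ₜ w))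
      rw [hL, hL, (bc σ h').ρ_smul, polyBc_ρ, hf]
    · intro x y hx hy
      exact (congrArg L' (map_add ((bc σ h).ρ g) x y)).trans ((map_add L' _ _).trans
        ((congrArg₂ (· + ·) hx hy).trans ((map_add ((bc σ h').ρ g) _ _).symm.trans
          (congrArg ((bc σ h').ρ g) (map_add L' x y).symm))))
  · change L (algebraMap (SymRing k σ) (RatField k σ) 1 ⊗ₜ w) = _
    rw [map_one, hL, one_smul]

/-- Every morphism of base changes comes from an equivariant map `W → R ⊗ W'`. -/
theorem exists_of_bc_hom (hσ : ∀ j, σ j ≠ ⊥) (h : Lawful τ) (h' : Lawful τ')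
    (φ : bc σ h ⟶ bc σ h') : ∃ f : W →ₗ[k] SymRing k σ ⊗[k] W',
      (∀ a w, f (τ a w) = TensorProduct.map (symRep σ a) (τ' a) (f w)) ∧
      ∀ w, GLMod.Hom.lin φ (polyBc σ h (1 ⊗ₜ w)) = polyBc σ h' (f w) := by
  have hm : ∀ w, (bcVec h φ w : (bc σ h').carrier) ∈ LinearMap.range (polyBc σ h') := fun w => by
    obtain ⟨z, hz⟩ := mem_polyPart_bc hσ h' (bcVec h φ w).2
    exact ⟨z, hz.symm⟩
  let e := LinearEquiv.ofInjective (polyBc σ h') (polyBc_injective h')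
  let f : W →ₗ[k] SymRing k σ ⊗[k] W' :=
    e.symm.toLinearMap ∘ₗ ((polyPart (bc σ h')).subtype ∘ₗ bcVec h φ).codRestrict _ hm
  have hf : ∀ w, polyBc σ h' (f w) = bcVec h φ w := fun w =>
    congrArg Subtype.val (e.apply_symm_apply
      (((polyPart (bc σ h')).subtype ∘ₗ bcVec h φ).codRestrict _ hm w))
  refine ⟨f, fun a w => ?_, fun w => (hf w).symm⟩
  apply polyBc_injective h'
  rw [hf, ← polyRep_bcVec]
  have : bcVec h φ w = ⟨_, polyBc_mem h' (f w)⟩ := Subtype.ext (hf w).symm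
  rw [this, polyRep_polyBc]

end HomBaseChange

end GLRep

namespace GLRep

section Koszul

variable {k : Type*} [Field k] {E N : Type*} [AddCommGroup E] [Module k E] [AddCommGroup N] [Module k N]

variable (k E) in
/-- The exterior powers. -/
def Wedge (i : ℕ) : Type _ := ⋀[k]^i E

noncomputable instance (i : ℕ) : AddCommGroup (Wedge k E i) := inferInstanceAs (AddCommGroup (⋀[k]^i E))

noncomputable instance (i : ℕ) : Module k (Wedge k E i) := inferInstanceAs (Module k (⋀[k]^i E))

variable (k) in
/-- The wedge product of `i` vectors. -/
noncomputable def wedge (i : ℕ) : E [⋀^Fin i]→ₗ[k] Wedge k E i := exteriorPower.ιMulti k i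

variable (k E) in
theorem span_wedge (i : ℕ) : Submodule.span k (Set.range (wedge k i (E := E))) = ⊤ :=
  exteriorPower.ιMulti_span k i E

/-- The linear map on an exterior power given by an alternating map. -/
noncomputable def wedgeLift (i : ℕ) : (E [⋀^Fin i]→ₗ[k] N) →ₗ[k] Wedge k E i →ₗ[k] N :=
  (exteriorPower.alternatingMapLinearEquiv (R := k) (M := E) (N := N) (n := i)).toLinearMap

theorem wedgeLift_wedge (i : ℕ) (f : E [⋀^Fin i]→ₗ[k] N) (v : Fin i → E) :
    wedgeLift i f (wedge k i v) = f v :=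
  exteriorPower.alternatingMapLinearEquiv_apply_ιMulti f v

variable (k E N) in
/-- The alternating maps `v ↦ v₁ ∧ … ∧ vᵢ ⊗ n`. -/
noncomputable def extTmul (i : ℕ) : N →ₗ[k] E [⋀^Fin i]→ₗ[k] (Wedge k E i ⊗[k] N) where
  toFun n := ((TensorProduct.mk k (Wedge k E i) N).flip n).compAlternatingMap (wedge k i)
  map_add' _ _ := AlternatingMap.ext fun _ => TensorProduct.tmul_add _ _ _
  map_smul' _ _ := AlternatingMap.ext fun _ => TensorProduct.tmul_smul _ _ _

theorem neg_one_zpow_smul (k : Type*) [Field k] {N : Type*} [AddCommGroup N] [Module k N] (j : ℕ) (x : N) :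
    (-1 : ℤ) ^ j • x = (-1 : k) ^ j • x := by
  rw [← Int.cast_smul_eq_zsmul k]
  simp

variable (k E) in
/-- The comultiplication component `⋀ⁱ⁺¹E → ⋀ⁱE ⊗ E`. -/
noncomputable def extComul (i : ℕ) : Wedge k E (i + 1) →ₗ[k] Wedge k E i ⊗[k] E :=
  wedgeLift (i + 1) (AlternatingMap.alternatizeUncurryFin (R := k) (M := E)
    (N := Wedge k E i ⊗[k] E) (extTmul k E E i))

theorem extComul_ιMulti {i : ℕ} (v : Fin (i + 1) → E) :
    extComul k E i (wedge k (i + 1) v) =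
      ∑ j : Fin (i + 1), (-1 : k) ^ (j : ℕ) • wedge k i (j.removeNth v) ⊗ₜ[k] v j := by
  rw [extComul, wedgeLift_wedge,
    AlternatingMap.alternatizeUncurryFin_apply]
  exact Finset.sum_congr rfl fun j _ => neg_one_zpow_smul k j _

/-- The Koszul differential `⋀ⁱ⁺¹E ⊗ N → ⋀ⁱE ⊗ N` attached to `E → End N`. -/
noncomputable def koszul (act : E →ₗ[k] N →ₗ[k] N) (i : ℕ) :
    Wedge k E (i + 1) ⊗[k] N →ₗ[k] Wedge k E i ⊗[k] N :=
  (TensorProduct.lift act).lTensor _ ∘ₗ (TensorProduct.assoc k _ E N).toLinearMap ∘ₗ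
    (extComul k E i).rTensor N

theorem koszul_ιMulti (act : E →ₗ[k] N →ₗ[k] N) {i : ℕ} (v : Fin (i + 1) → E) (n : N) :
    koszul act i (wedge k (i + 1) v ⊗ₜ n) =
      ∑ j : Fin (i + 1), (-1 : k) ^ (j : ℕ) • wedge k i (j.removeNth v) ⊗ₜ[k] act (v j) n := by
  rw [koszul, LinearMap.comp_apply, LinearMap.comp_apply, LinearMap.rTensor_tmul, extComul_ιMulti,
    TensorProduct.sum_tmul, map_sum, map_sum]
  refine Finset.sum_congr rfl fun j _ => ?_
  rw [← TensorProduct.smul_tmul', map_smul, map_smul]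
  rfl

theorem ext_tensor_induction {i : ℕ} {p : Wedge k E i ⊗[k] N → Prop} (z : Wedge k E i ⊗[k] N)
    (zero : p 0) (add : ∀ x y, p x → p y → p (x + y))
    (tmul : ∀ v n, p (wedge k i v ⊗ₜ n)) : p z := by
  induction z using TensorProduct.induction_on with
  | zero => exact zero
  | add x y hx hy => exact add x y hx hy
  | tmul w n =>
    have hw : w ∈ Submodule.span k (Set.range (wedge k i (E := E))) := by
      rw [span_wedge]; trivial
    induction hw using Submodule.span_induction generalizing n with
    | mem x hx => obtain ⟨v, rfl⟩ := hx; exact tmul v n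
    | zero => rwa [TensorProduct.zero_tmul]
    | add x y _ _ hx hy => rw [TensorProduct.add_tmul]; exact add _ _ (hx n) (hy n)
    | smul c x _ hx => rw [TensorProduct.smul_tmul]; exact hx _

theorem koszul_koszul {act : E →ₗ[k] N →ₗ[k] N} (hact : ∀ e e' n, act e (act e' n) = act e' (act e n))
    {i : ℕ} (z : Wedge k E (i + 1 + 1) ⊗[k] N) : koszul act i (koszul act (i + 1) z) = 0 := by
  refine ext_tensor_induction (p := fun z => koszul act i (koszul act (i + 1) z) = 0) z
    (by rw [map_zero, map_zero]) (fun x y hx hy => by rw [map_add, map_add, hx, hy, add_zero])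
    fun v n => ?_
  let f : E →ₗ[k] E →ₗ[k] E [⋀^Fin i]→ₗ[k] (Wedge k E i ⊗[k] N) := LinearMap.mk₂ k
    (fun a b => extTmul k E N i (act b (act a n)))
    (fun a a' b => by simp only [map_add, LinearMap.add_apply])
    (fun c a b => by simp only [map_smul, LinearMap.smul_apply])
    (fun a b b' => by rw [map_add, LinearMap.add_apply, map_add])
    (fun c a b => by rw [map_smul, LinearMap.smul_apply, map_smul])
  have h := AlternatingMap.alternatizeUncurryFin_alternatizeUncurryFinLM_comp_of_symmetric (R := k) (M := E)
    (N := Wedge k E i ⊗[k] N) (f := f)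
    (fun x y => by simp only [f, LinearMap.mk₂_apply, hact x y])
  have h1 := congrArg (fun F => F v) h
  rw [koszul_ιMulti, map_sum]
  simp only [map_smul, koszul_ιMulti]
  simp only [AlternatingMap.alternatizeUncurryFin_apply, LinearMap.comp_apply,
    AlternatingMap.alternatizeUncurryFinLM_apply, neg_one_zpow_smul k] at h1
  exact h1

variable (k E) in
/-- The product `E × ⋀ⁱE → ⋀ⁱ⁺¹E`. -/
noncomputable def extMul (i : ℕ) : E →ₗ[k] Wedge k E i →ₗ[k] Wedge k E (i + 1) :=
  wedgeLift i ∘ₗ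
    (wedge k (i + 1)).curryLeft

theorem extMul_ιMulti {i : ℕ} (e : E) (v : Fin i → E) :
    extMul k E i e (wedge k i v) =
      wedge k (i + 1) (Matrix.vecCons e v) := by
  rw [extMul, LinearMap.comp_apply, wedgeLift_wedge]
  rfl

/-- The map `⋀ⁱE ⊗ (E ⊗ N) → ⋀ⁱ⁺¹E ⊗ N` given by the product. -/
noncomputable def extShift (N : Type*) [AddCommGroup N] [Module k N] (i : ℕ) :
    Wedge k E i ⊗[k] (E ⊗[k] N) →ₗ[k] Wedge k E (i + 1) ⊗[k] N :=
  (TensorProduct.lift (extMul k E i).flip).rTensor N ∘ₗ (TensorProduct.assoc k _ E N).symm.toLinearMap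

theorem extShift_ιMulti {i : ℕ} (e : E) (v : Fin i → E) (n : N) :
    extShift N i (wedge k i v ⊗ₜ[k] (e ⊗ₜ[k] n)) =
      wedge k (i + 1) (Matrix.vecCons e v) ⊗ₜ n := by
  rw [← extMul_ιMulti]
  rfl

theorem pow_succ_smul_add {N : Type*} [AddCommGroup N] [Module k N] (j : ℕ) {x y : N} (h : x = y) :
    (-1 : k) ^ (j + 1) • x + (-1 : k) ^ j • y = 0 := by
  rw [h, pow_succ, mul_neg_one, neg_smul, neg_add_cancel]

theorem koszul_extShift (act : E →ₗ[k] N →ₗ[k] N) {i : ℕ} (v : Fin (i + 1) → E) (z : E ⊗[k] N) :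
    koszul act (i + 1) (extShift N (i + 1) (wedge k (i + 1) v ⊗ₜ[k] z)) =
      wedge k (i + 1) v ⊗ₜ[k] TensorProduct.lift act z -
      ∑ j : Fin (i + 1), (-1 : k) ^ (j : ℕ) • extShift N i (wedge k i (j.removeNth v) ⊗ₜ[k]
        (act (v j)).lTensor E z) := by
  induction z using TensorProduct.induction_on with
  | zero => simp
  | add x y hx hy =>
    simp only [TensorProduct.tmul_add, map_add, hx, hy, smul_add, Finset.sum_add_distrib]
    abel
  | tmul e n =>
    rw [extShift_ιMulti, koszul_ιMulti, Fin.sum_univ_succ, eq_sub_iff_add_eq, add_assoc,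
      ← Finset.sum_add_distrib, Finset.sum_eq_zero, add_zero]
    · simp [Matrix.vecCons, Fin.removeNth_zero]
    · intro j _
      rw [LinearMap.lTensor_tmul, extShift_ιMulti, Fin.val_succ]
      refine pow_succ_smul_add (N := Wedge k E (i + 1) ⊗[k] N) j ?_
      congr 2
      funext l
      refine Fin.cases ?_ (fun l => ?_) l <;>
        simp [Matrix.vecCons, Fin.removeNth_apply, Fin.succ_succAbove_succ]

theorem koszul_homotopy {act : E →ₗ[k] N →ₗ[k] N} {D : N →ₗ[k] E ⊗[k] N}
    (hD : ∀ e n, D (act e n) = (act e).lTensor E (D n) + e ⊗ₜ n) {i : ℕ}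
    (z : Wedge k E (i + 1) ⊗[k] N) :
    koszul act (i + 1) (extShift N (i + 1) (D.lTensor _ z)) +
      extShift N i (D.lTensor _ (koszul act i z)) =
    (TensorProduct.lift act ∘ₗ D).lTensor _ z + (i + 1) • z := by
  refine ext_tensor_induction (p := fun z => koszul act (i + 1) (extShift N (i + 1) (D.lTensor _ z)) +
      extShift N i (D.lTensor _ (koszul act i z)) =
    (TensorProduct.lift act ∘ₗ D).lTensor _ z + (i + 1) • z) z (by simp only [map_zero, smul_zero])
    (fun x y hx hy => ?_) fun v n => ?_
  · simp only [map_add, smul_add]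
    rw [add_add_add_comm, hx, hy, add_add_add_comm]
  simp only [LinearMap.comp_apply, LinearMap.lTensor_tmul, koszul_extShift,
    koszul_ιMulti, map_sum, map_smul, hD, TensorProduct.tmul_add, map_add, smul_add,
    Finset.sum_add_distrib, extShift_ιMulti]
  rw [← add_assoc, sub_add_cancel]
  congr 1
  have : ∀ j : Fin (i + 1), (-1 : k) ^ (j : ℕ) • wedge k (i + 1)
      (Matrix.vecCons (v j) (j.removeNth v)) ⊗ₜ[k] n = wedge k (i + 1) v ⊗ₜ[k] n := by
    intro j
    rw [← AlternatingMap.neg_one_pow_smul_map_insertNth, neg_one_zpow_smul k, ← TensorProduct.smul_tmul', smul_smul,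
      ← mul_pow, neg_one_mul, neg_neg, one_pow, one_smul, Fin.insertNth_self_removeNth]
  rw [Finset.sum_congr rfl fun j _ => this j, Finset.sum_const, Finset.card_univ, Fintype.card_fin]

theorem aeval_comm {N N' : Type*} [AddCommGroup N] [Module k N] [AddCommGroup N'] [Module k N']
    (A : N →ₗ[k] N') (T : Module.End k N) (T' : Module.End k N') (h : ∀ n, A (T n) = T' (A n))
    (q : Polynomial k) (n : N) :
    A (Polynomial.aeval T q n) = Polynomial.aeval T' q (A n) := by
  induction q using Polynomial.induction_on' generalizing n with
  | add p q hp hq => simp only [map_add, LinearMap.add_apply, hp, hq]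
  | monomial m c =>
    simp only [Polynomial.aeval_monomial, Module.End.mul_apply, Module.algebraMap_end_apply, map_smul]
    congr 1
    induction m generalizing n with
    | zero => rfl
    | succ m ih => rw [pow_succ, pow_succ, Module.End.mul_apply, Module.End.mul_apply, ih, h]

theorem aeval_mem {U : Submodule k N} {T : Module.End k N} (h : ∀ n ∈ U, T n ∈ U) (q : Polynomial k)
    {n : N} (hn : n ∈ U) : Polynomial.aeval T q n ∈ U := by
  have := aeval_comm U.subtype (T.restrict h) T (fun _ => rfl) q ⟨n, hn⟩
  change _ = Polynomial.aeval T q n at this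
  rw [← this]
  exact Subtype.property _

/-- A vector killed by a polynomial in `T` without negative integral zeros. -/
def NonnegRoots (T : Module.End k N) (n : N) : Prop :=
  ∃ q : Polynomial k, (∀ m : ℕ, q.eval (-(m + 1 : k)) ≠ 0) ∧ Polynomial.aeval T q n = 0

theorem NonnegRoots.zero (T : Module.End k N) : NonnegRoots T 0 := ⟨1, by simp, by simp⟩

theorem NonnegRoots.add {T : Module.End k N} {n n' : N} (h : NonnegRoots T n) (h' : NonnegRoots T n') :
    NonnegRoots T (n + n') := by
  obtain ⟨q, hq, h⟩ := h
  obtain ⟨q', hq', h'⟩ := h'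
  refine ⟨q * q', fun m => by rw [Polynomial.eval_mul]; exact mul_ne_zero (hq m) (hq' m), ?_⟩
  rw [map_add]
  nth_rw 1 [mul_comm]
  simp only [map_mul, Module.End.mul_apply, h, h', map_zero, add_zero]

theorem NonnegRoots.map {N' : Type*} [AddCommGroup N'] [Module k N'] {T : Module.End k N} {n : N}
    (h : NonnegRoots T n) (A : N →ₗ[k] N') (T' : Module.End k N') (hA : ∀ n, A (T n) = T' (A n)) :
    NonnegRoots T' (A n) := by
  obtain ⟨q, hq, h⟩ := h
  exact ⟨q, hq, by rw [← aeval_comm A T T' hA, h, map_zero]⟩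

theorem NonnegRoots.shift {T : Module.End k N} {n : N} (h : NonnegRoots T n) (A : N →ₗ[k] N)
    (hA : ∀ n, T (A n) = A (T n) + A n) : NonnegRoots T (A n) := by
  obtain ⟨q, hq, h⟩ := h
  refine ⟨q.comp (Polynomial.X - 1), fun m => ?_, ?_⟩
  · have := hq (m + 1)
    have e : (Polynomial.X - 1 : Polynomial k).eval (-(m + 1 : k)) = -((m + 1 : ℕ) + 1 : k) := by
      simp only [Polynomial.eval_sub, Polynomial.eval_X, Polynomial.eval_one, Nat.cast_add, Nat.cast_one]
      ring
    rwa [Polynomial.eval_comp, e]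
  · rw [Polynomial.aeval_comp, map_sub, Polynomial.aeval_X, map_one,
      ← aeval_comm A T (T - 1) (fun n => ?_), h, map_zero]
    rw [LinearMap.sub_apply, hA, Module.End.one_apply, add_sub_cancel_right]

theorem mem_of_aeval_eq_zero {S : Module.End k N} {U B : Submodule k N} (hU : ∀ n ∈ U, S n ∈ U) {c : k}
    (hB : ∀ n ∈ U, S n + c • n ∈ B) {q : Polynomial k} (hq : q.eval (-c) ≠ 0) {z : N} (hz : z ∈ U)
    (h : Polynomial.aeval S q z = 0) : z ∈ B := by
  let p := q /ₘ (Polynomial.X - Polynomial.C (-c))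
  have hp : q = Polynomial.C (q.eval (-c)) + (Polynomial.X + Polynomial.C c) * p := by
    have := Polynomial.modByMonic_add_div q (Polynomial.X - Polynomial.C (-c))
    rw [Polynomial.modByMonic_X_sub_C_eq_C_eval] at this
    refine this.symm.trans ?_
    simp only [p, Polynomial.C_neg, sub_neg_eq_add]
  have hw := hB _ (aeval_mem hU p hz)
  have h1 : q.eval (-c) • z + (S (Polynomial.aeval S p z) + c • Polynomial.aeval S p z) = 0 := by
    rw [hp] at h
    simpa [Module.algebraMap_end_apply] using h
  have h2 : q.eval (-c) • z ∈ B := by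
    rw [eq_neg_of_add_eq_zero_left h1]
    exact B.neg_mem hw
  exact (B.smul_mem_iff hq).1 h2

theorem nonnegRoots_lTensor {P : Type*} [AddCommGroup P] [Module k P] {T : Module.End k N}
    (hT : ∀ n, NonnegRoots T n) (z : P ⊗[k] N) : NonnegRoots (T.lTensor P) z := by
  induction z using TensorProduct.induction_on with
  | zero => exact NonnegRoots.zero _
  | tmul w n => exact (hT n).map (TensorProduct.mk k P N w) _ fun _ => rfl
  | add x y hx hy => exact hx.add hy

theorem koszul_extShift_of_koszul_eq_zero {act : E →ₗ[k] N →ₗ[k] N} {D : N →ₗ[k] E ⊗[k] N}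
    (hD : ∀ e n, D (act e n) = (act e).lTensor E (D n) + e ⊗ₜ n) {i : ℕ}
    {z : Wedge k E (i + 1) ⊗[k] N} (hz : koszul act i z = 0) :
    koszul act (i + 1) (extShift N (i + 1) (D.lTensor _ z)) =
      (TensorProduct.lift act ∘ₗ D).lTensor _ z + (i + 1 : k) • z := by
  have h := koszul_homotopy hD z
  rw [hz, map_zero, map_zero, add_zero] at h
  rw [h, ← Nat.cast_smul_eq_nsmul k, Nat.cast_add, Nat.cast_one]

theorem exists_of_homotopy {A B C : Type*} [AddCommGroup A] [Module k A] [AddCommGroup B] [Module k B]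
    [AddCommGroup C] [Module k C] (f : A →ₗ[k] B) (g : B →ₗ[k] C) (hfg : ∀ a, g (f a) = 0)
    (S : Module.End k B) (n : ℕ) (h : ∀ b, g b = 0 → ∃ a, f a = S b + (n + 1 : k) • b)
    (hS : ∀ b, NonnegRoots S b) {z : B} (hz : g z = 0) : ∃ y, f y = z := by
  obtain ⟨q, hq, hqz⟩ := hS z
  refine LinearMap.mem_range.1 (mem_of_aeval_eq_zero (S := S) (U := LinearMap.ker g)
    (B := LinearMap.range f) (c := (n + 1 : k)) (fun w hw => ?_) (fun w hw => h w hw) (hq n) hz hqz)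
  obtain ⟨a, ha⟩ := h w hw
  have h1 := hfg a
  rw [ha, map_add, map_smul, LinearMap.mem_ker.1 hw, smul_zero, add_zero] at h1
  exact h1

theorem koszul_exact {act : E →ₗ[k] N →ₗ[k] N} (hact : ∀ e e' n, act e (act e' n) = act e' (act e n))
    {D : N →ₗ[k] E ⊗[k] N} (hD : ∀ e n, D (act e n) = (act e).lTensor E (D n) + e ⊗ₜ n)
    (hT : ∀ n, NonnegRoots (TensorProduct.lift act ∘ₗ D) n) {i : ℕ} {z : Wedge k E (i + 1) ⊗[k] N}
    (hz : koszul act i z = 0) : ∃ y, koszul act (i + 1) y = z := by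
  have h1 := nonnegRoots_lTensor (P := Wedge k E (i + 1)) hT
  have h2 : ∀ b, koszul act i b = 0 → ∃ a, koszul act (i + 1) a =
      (TensorProduct.lift act ∘ₗ D).lTensor _ b + (i + 1 : k) • b :=
    fun b hb => Exists.intro _ (koszul_extShift_of_koszul_eq_zero hD hb)
  have h3 := exists_of_homotopy (A := Wedge k E (i + 1 + 1) ⊗[k] N) (B := Wedge k E (i + 1) ⊗[k] N)
    (C := Wedge k E i ⊗[k] N) (koszul act (i + 1)) (koszul act i) (fun z => koszul_koszul hact z)
  exact h3 _ i h2 h1 hz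

end Koszul
end GLRep

namespace GLRep

section SymKoszul

variable {k : Type*} [Field k] (E : Type*) [AddCommGroup E] [Module k E]
  (Y : Type*) [AddCommGroup Y] [Module k Y]

theorem exists_symDer : ∃ d : SymmetricAlgebra k E →ₗ[k] E ⊗[k] SymmetricAlgebra k E,
    d 1 = 0 ∧ ∀ e x, d (SymmetricAlgebra.ι k E e * x) =
      (LinearMap.mulLeft k (SymmetricAlgebra.ι k E e)).lTensor E (d x) + e ⊗ₜ x := by
  let R := SymmetricAlgebra k E
  let N := R ⊗[k] E
  let F : R →ₐ[k] TrivSqZeroExt R N := SymmetricAlgebra.lift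
    { toFun e := TrivSqZeroExt.inl (SymmetricAlgebra.ι k E e) + TrivSqZeroExt.inr (1 ⊗ₜ[k] e : N)
      map_add' a b := by
        ext <;> simp [TensorProduct.tmul_add]
      map_smul' c a := by
        ext <;> simp }
  have hF : ∀ x, (F x).fst = x := by
    intro x
    have : (TrivSqZeroExt.fstHom k R N).comp F = AlgHom.id k R := by
      apply SymmetricAlgebra.algHom_ext
      ext e
      exact congrArg TrivSqZeroExt.fst (SymmetricAlgebra.lift_ι_apply _ e) |>.trans
        ((add_zero _).trans rfl)
    exact congrArg (fun G : R →ₐ[k] R => G x) this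
  refine ⟨(TensorProduct.comm k R E).toLinearMap ∘ₗ
    ((TrivSqZeroExt.sndHom R N).restrictScalars k) ∘ₗ F.toLinearMap, by simp, fun e x => ?_⟩
  have h1 : F (SymmetricAlgebra.ι k E e) = TrivSqZeroExt.inl (SymmetricAlgebra.ι k E e) +
    TrivSqZeroExt.inr (1 ⊗ₜ[k] e : N) := SymmetricAlgebra.lift_ι_apply _ e
  have h2 : ∀ n : N, TensorProduct.comm k R E (SymmetricAlgebra.ι k E e • n) =
      (LinearMap.mulLeft k (SymmetricAlgebra.ι k E e)).lTensor E (TensorProduct.comm k R E n) := by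
    intro n
    induction n using TensorProduct.induction_on with
    | zero => simp
    | add a b ha hb => simp only [smul_add, map_add, ha, hb]
    | tmul r e' => rfl
  simp only [LinearMap.comp_apply, AlgHom.toLinearMap_apply, map_mul, h1]
  have h3 : ∀ y : TrivSqZeroExt R N, (TrivSqZeroExt.sndHom R N).restrictScalars k
      ((TrivSqZeroExt.inl (SymmetricAlgebra.ι k E e) + TrivSqZeroExt.inr (1 ⊗ₜ[k] e : N)) * y) =
      SymmetricAlgebra.ι k E e • y.snd + y.fst • (1 ⊗ₜ[k] e : N) := by
    intro y
    simp [TrivSqZeroExt.snd_mul]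
  rw [h3, map_add, hF]
  refine congrArg₂ (· + ·) (h2 _) ?_
  simp [TensorProduct.smul_tmul']

/-- The action of `E` on `Sym E ⊗ Y` by multiplication. -/
noncomputable def symAct : E →ₗ[k] SymmetricAlgebra k E ⊗[k] Y →ₗ[k] SymmetricAlgebra k E ⊗[k] Y :=
  LinearMap.rTensorHom Y ∘ₗ LinearMap.mul k (SymmetricAlgebra k E) ∘ₗ SymmetricAlgebra.ι k E

theorem symAct_tmul (e : E) (x : SymmetricAlgebra k E) (y : Y) :
    symAct E Y e (x ⊗ₜ y) = (SymmetricAlgebra.ι k E e * x) ⊗ₜ y := rfl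

theorem symAct_eq_smul (e : E) (z : SymmetricAlgebra k E ⊗[k] Y) :
    symAct E Y e z = SymmetricAlgebra.ι k E e • z := by
  induction z using TensorProduct.induction_on with
  | zero => simp
  | add a b ha hb => simp only [smul_add, map_add, ha, hb]
  | tmul r e' => rfl

theorem exists_symAct_der : ∃ D : SymmetricAlgebra k E ⊗[k] Y →ₗ[k] E ⊗[k] (SymmetricAlgebra k E ⊗[k] Y),
    (∀ y, D (1 ⊗ₜ y) = 0) ∧
    ∀ e z, D (symAct E Y e z) = (symAct E Y e).lTensor E (D z) + e ⊗ₜ z := by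
  obtain ⟨d, hd1, hd⟩ := exists_symDer (k := k) E
  refine ⟨(TensorProduct.assoc k _ _ _).toLinearMap ∘ₗ d.rTensor Y, fun y => by simp [hd1], fun e z => ?_⟩
  induction z using TensorProduct.induction_on with
  | zero => simp
  | add a b ha hb =>
    simp only [map_add, ha, hb, TensorProduct.tmul_add]
    rw [add_add_add_comm]
  | tmul x y =>
    rw [symAct_tmul, LinearMap.comp_apply, LinearMap.rTensor_tmul, hd, TensorProduct.add_tmul, map_add]
    refine congrArg₂ (· + ·) ?_ rfl
    rw [LinearMap.comp_apply, LinearMap.rTensor_tmul]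
    induction d x using TensorProduct.induction_on with
    | zero => simp
    | add a b ha hb => simp only [map_add, ha, hb, TensorProduct.add_tmul]
    | tmul e' r => rfl

variable {E Y} in
theorem symAct_induction {p : SymmetricAlgebra k E ⊗[k] Y → Prop} (z : SymmetricAlgebra k E ⊗[k] Y)
    (zero : p 0) (add : ∀ a b, p a → p b → p (a + b)) (one : ∀ y, p (1 ⊗ₜ y))
    (act : ∀ e a, p a → p (symAct E Y e a)) : p z := by
  induction z using TensorProduct.induction_on with
  | zero => exact zero
  | add a b ha hb => exact add a b ha hb
  | tmul x y =>
    suffices h : ∀ x z : SymmetricAlgebra k E, (∀ y, p (z ⊗ₜ y)) → ∀ y, p ((x * z) ⊗ₜ y) by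
      simpa using h x 1 one y
    intro x
    induction x using SymmetricAlgebra.induction with
    | algebraMap c =>
      intro z hz y
      rw [← Algebra.smul_def, TensorProduct.smul_tmul]
      exact hz _
    | ι e => exact fun z hz y => act e _ (hz y)
    | mul a b ha hb => intro z hz y; rw [mul_assoc]; exact ha _ (hb _ hz) y
    | add a b ha hb =>
      intro z hz y
      rw [add_mul, TensorProduct.add_tmul]
      exact add _ _ (ha _ hz y) (hb _ hz y)

theorem nonnegRoots_symAct [CharZero k] {D : SymmetricAlgebra k E ⊗[k] Y →ₗ[k] E ⊗[k] (SymmetricAlgebra k E ⊗[k] Y)}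
    (hD1 : ∀ y, D (1 ⊗ₜ y) = 0)
    (hD : ∀ e z, D (symAct E Y e z) = (symAct E Y e).lTensor E (D z) + e ⊗ₜ z)
    (z : SymmetricAlgebra k E ⊗[k] Y) : NonnegRoots (TensorProduct.lift (symAct E Y) ∘ₗ D) z := by
  refine symAct_induction z (NonnegRoots.zero _) (fun a b ha hb => ha.add hb) (fun y => ?_)
    fun e a ha => ha.shift (symAct E Y e) fun n => ?_
  · refine ⟨Polynomial.X, fun m => ?_, ?_⟩
    · rw [Polynomial.eval_X, neg_ne_zero]
      exact Nat.cast_add_one_ne_zero m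
    · rw [Polynomial.aeval_X, LinearMap.comp_apply, hD1, map_zero]
  · rw [LinearMap.comp_apply, LinearMap.comp_apply, hD, map_add]
    refine congrArg₂ (· + ·) ?_ rfl
    induction D n using TensorProduct.induction_on with
    | zero => simp
    | add a b ha hb => simp only [map_add, ha, hb]
    | tmul e' r =>
      simp only [LinearMap.lTensor_tmul, TensorProduct.lift.tmul]
      simp only [symAct_eq_smul]
      exact smul_comm _ _ _

theorem symKoszul_exact [CharZero k] {i : ℕ} {z : Wedge k E (i + 1) ⊗[k] (SymmetricAlgebra k E ⊗[k] Y)}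
    (hz : koszul (symAct E Y) i z = 0) : ∃ y, koszul (symAct E Y) (i + 1) y = z := by
  obtain ⟨D, hD1, hD⟩ := exists_symAct_der (k := k) E Y
  refine koszul_exact (fun e e' n => ?_) hD (nonnegRoots_symAct E Y hD1 hD) hz
  simp only [symAct_eq_smul]
  exact smul_comm _ _ _

theorem symKoszul_koszul {i : ℕ} (z : Wedge k E (i + 1 + 1) ⊗[k] (SymmetricAlgebra k E ⊗[k] Y)) :
    koszul (symAct E Y) i (koszul (symAct E Y) (i + 1) z) = 0 :=
  koszul_koszul (fun e e' n => by
    simp only [symAct_eq_smul]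
    exact smul_comm _ _ _) z

/-- The augmentation `Sym E ⊗ Y → Y`. -/
noncomputable def augment : SymmetricAlgebra k E ⊗[k] Y →ₗ[k] Y :=
  (TensorProduct.lid k Y).toLinearMap ∘ₗ (SymmetricAlgebra.algebraMapInv (R := k) (M := E)).toLinearMap.rTensor Y

theorem augment_tmul (x : SymmetricAlgebra k E) (y : Y) :
    augment E Y (x ⊗ₜ y) = SymmetricAlgebra.algebraMapInv x • y := rfl

theorem augment_symAct (e : E) (z : SymmetricAlgebra k E ⊗[k] Y) : augment E Y (symAct E Y e z) = 0 := by
  induction z using TensorProduct.induction_on with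
  | zero => simp
  | add a b ha hb => rw [map_add, map_add, ha, hb, add_zero]
  | tmul x y => rw [symAct_tmul, augment_tmul, map_mul, SymmetricAlgebra.algebraMapInv_ι, zero_mul, zero_smul]

theorem exists_koszul_zero (z : SymmetricAlgebra k E ⊗[k] Y) : ∃ w, koszul (symAct E Y) 0 w =
    wedge k 0 ![] ⊗ₜ (z - 1 ⊗ₜ augment E Y z) := by
  refine symAct_induction (p := fun z => ∃ w, koszul (symAct E Y) 0 w =
    wedge k 0 ![] ⊗ₜ (z - 1 ⊗ₜ augment E Y z)) z ⟨0, by simp⟩ ?_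
    (fun y => ⟨0, ?_⟩) fun e a _ => ?_
  · rintro a b ⟨w, hw⟩ ⟨w', hw'⟩
    refine ⟨w + w', ?_⟩
    rw [map_add, hw, hw', map_add, TensorProduct.tmul_add 1]
    refine (TensorProduct.tmul_add _ _ _).symm.trans (congrArg _ ?_)
    abel
  · rw [augment_tmul, map_one, one_smul, sub_self, TensorProduct.tmul_zero, map_zero]
  · refine ⟨wedge k 1 ![e] ⊗ₜ a, ?_⟩
    rw [koszul_ιMulti, augment_symAct, TensorProduct.tmul_zero, sub_zero]
    simp

end SymKoszul

section Equivariance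

variable {k : Type u} [Field k] [CharZero k] {r : ℕ} (σ : Fin r → YoungDiagram) {Y : Type*} [AddCommGroup Y]
  [Module k Y] (τ : Representation k (VEnd k) Y)

theorem tprod_app {A B : Type*} [AddCommGroup A] [Module k A] [AddCommGroup B] [Module k B] {G : Type*}
    [Monoid G] (α : Representation k G A) (β : Representation k G B) (g : G) (x : A) (y : B) :
    α.tprod β g (x ⊗ₜ y) = α g x ⊗ₜ β g y := rfl

/-- The action of `End V` on exterior powers. -/
noncomputable def wedgeEnd {E : Type*} [AddCommGroup E] [Module k E] (ε : Representation k (VEnd k) E) (i : ℕ) :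
    Representation k (VEnd k) (Wedge k E i) := extEnd ε i

theorem wedgeEnd_wedge {E : Type*} [AddCommGroup E] [Module k E] (ε : Representation k (VEnd k) E) (i : ℕ)
    (a : VEnd k) (v : Fin i → E) :
    wedgeEnd ε i a (wedge k i v) = wedge k i fun j => ε a (v j) := extEnd_ιMulti i a v

theorem Lawful.wedgeEnd {E : Type*} [AddCommGroup E] [Module k E] {ε : Representation k (VEnd k) E}
    (h : Lawful ε) (i : ℕ) : Lawful (wedgeEnd ε i) := h.extEnd i

theorem extComul_comm {E : Type*} [AddCommGroup E] [Module k E] (ε : Representation k (VEnd k) E) (i : ℕ)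
    (a : VEnd k) (w : Wedge k E (i + 1)) :
    extComul k E i (wedgeEnd ε (i + 1) a w) = (wedgeEnd ε i).tprod ε a (extComul k E i w) := by
  have hw : w ∈ Submodule.span k (Set.range (wedge k (i + 1) (E := E))) := by
    rw [span_wedge]; trivial
  induction hw using Submodule.span_induction with
  | mem x hx =>
    obtain ⟨v, rfl⟩ := hx
    rw [wedgeEnd_wedge, extComul_ιMulti, extComul_ιMulti, map_sum]
    refine Finset.sum_congr rfl fun j _ => ?_
    rw [map_smul, Representation.tprod_apply, TensorProduct.map_tmul, wedgeEnd_wedge]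
    rfl
  | zero => simp only [map_zero]
  | add x y _ _ hx hy => simp only [map_add, hx, hy]
  | smul c x _ hx => simp only [map_smul, hx]

theorem symAct_comm (a : VEnd k) (e : TupleSpace k σ) (z : SymRing k σ ⊗[k] Y) :
    symAct _ Y (tupleEnd σ a e) ((symRep σ).tprod τ a z) = (symRep σ).tprod τ a (symAct _ Y e z) := by
  induction z using TensorProduct.induction_on with
  | zero => simp
  | add x y hx hy => simp only [map_add, hx, hy]
  | tmul x y =>
    rw [Representation.tprod_apply, TensorProduct.map_tmul, symAct_tmul, symAct_tmul,
      TensorProduct.map_tmul, symRep_apply, symRep_apply, map_mul, symEnd_ι]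

theorem koszul_comm (i : ℕ) (a : VEnd k) (z : Wedge k (TupleSpace k σ) (i + 1) ⊗[k] (SymRing k σ ⊗[k] Y)) :
    koszul (symAct _ Y) i ((wedgeEnd (tupleEnd σ) (i + 1)).tprod ((symRep σ).tprod τ) a z) =
      (wedgeEnd (tupleEnd σ) i).tprod ((symRep σ).tprod τ) a (koszul (symAct _ Y) i z) := by
  refine ext_tensor_induction (p := fun z =>
    koszul (symAct _ Y) i ((wedgeEnd (tupleEnd σ) (i + 1)).tprod ((symRep σ).tprod τ) a z) =
      (wedgeEnd (tupleEnd σ) i).tprod ((symRep σ).tprod τ) a (koszul (symAct _ Y) i z)) z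
    (by simp only [map_zero]) (fun x y hx hy => by simp only [map_add, hx, hy]) fun v n => ?_
  rw [tprod_app, wedgeEnd_wedge, koszul_ιMulti, koszul_ιMulti,
    map_sum]
  refine Finset.sum_congr rfl fun j _ => ?_
  rw [map_smul, tprod_app, wedgeEnd_wedge, symAct_comm]
  rfl

theorem Lawful.exists_lift {A B X : Type*} [AddCommGroup A] [Module k A] [AddCommGroup B] [Module k B]
    [AddCommGroup X] [Module k X] {α : Representation k (VEnd k) A} (hα : Lawful α)
    {β : Representation k (VEnd k) B} {ξ : Representation k (VEnd k) X} {f : A →ₗ[k] B}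
    (hf : ∀ a x, f (α a x) = β a (f x)) {F : X →ₗ[k] B} (hF : ∀ a x, F (ξ a x) = β a (F x))
    (h : ∀ x, ∃ y, f y = F x) : ∃ G : X →ₗ[k] A, (∀ a x, G (ξ a x) = α a (G x)) ∧ ∀ x, f (G x) = F x := by
  obtain ⟨p, hp1, hp2, hp3⟩ := hα.exists_projection (F := k) (fun a c x => map_smul _ _ _) (LinearMap.ker f)
    (fun a x hx => by rw [LinearMap.mem_ker] at hx ⊢; rw [hf, hx, map_zero])
  have hinj : Function.Injective (f.domRestrict (LinearMap.ker p)) := by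
    rw [← LinearMap.ker_eq_bot, LinearMap.ker_eq_bot']
    rintro ⟨x, hx⟩ h0
    refine Subtype.ext ?_
    exact (hp2 x h0).symm.trans hx
  have hrange : ∀ x, F x ∈ LinearMap.range (f.domRestrict (LinearMap.ker p)) := by
    intro x
    obtain ⟨y, hy⟩ := h x
    refine ⟨⟨y - p y, ?_⟩, ?_⟩
    · rw [LinearMap.mem_ker, map_sub, hp2 _ (hp1 y), sub_self]
    · rw [LinearMap.domRestrict_apply, map_sub, LinearMap.mem_ker.1 (hp1 y), sub_zero, hy]
  let e := LinearEquiv.ofInjective _ hinj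
  have hG : ∀ x, f (e.symm (F.codRestrict _ hrange x)) = F x := fun x =>
    congrArg Subtype.val (e.apply_symm_apply (F.codRestrict _ hrange x))
  refine ⟨(LinearMap.ker p).subtype ∘ₗ e.symm.toLinearMap ∘ₗ F.codRestrict _ hrange, fun a x => ?_, hG⟩
  have h1 : ∀ y, α a (e.symm y) ∈ LinearMap.ker p := fun y => by
    rw [LinearMap.mem_ker, hp3, LinearMap.mem_ker.1 (e.symm y).2, map_zero]
  have h2 : e.symm (F.codRestrict _ hrange (ξ a x)) = ⟨_, h1 (F.codRestrict _ hrange x)⟩ := by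
    refine hinj ((hG _).trans ?_)
    rw [hF, ← hG]
    exact (hf _ _).symm
  exact congrArg Subtype.val h2

variable {σ τ}

theorem exists_koszul_lift (h : Lawful τ) {X : Type*} [AddCommGroup X] [Module k X]
    {ξ : Representation k (VEnd k) X} {i : ℕ}
    {F : X →ₗ[k] Wedge k (TupleSpace k σ) (i + 1) ⊗[k] (SymRing k σ ⊗[k] Y)}
    (hF : ∀ a x, F (ξ a x) = (wedgeEnd (tupleEnd σ) (i + 1)).tprod ((symRep σ).tprod τ) a (F x))
    (h0 : ∀ x, koszul (symAct _ Y) i (F x) = 0) :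
    ∃ G : X →ₗ[k] Wedge k (TupleSpace k σ) (i + 1 + 1) ⊗[k] (SymRing k σ ⊗[k] Y),
      (∀ a x, G (ξ a x) = (wedgeEnd (tupleEnd σ) (i + 1 + 1)).tprod ((symRep σ).tprod τ) a (G x)) ∧
      ∀ x, koszul (symAct _ Y) (i + 1) (G x) = F x :=
  (((lawful_tupleEnd σ).wedgeEnd _).tprod ((lawful_symRep σ).tprod h)).exists_lift
    (koszul_comm σ τ (i + 1)) hF fun x => symKoszul_exact _ Y (h0 x)

theorem exists_koszul_lift_zero (h : Lawful τ) {X : Type*} [AddCommGroup X] [Module k X]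
    {ξ : Representation k (VEnd k) X}
    {F : X →ₗ[k] SymRing k σ ⊗[k] Y}
    (hF : ∀ a x, F (ξ a x) = (symRep σ).tprod τ a (F x)) (h0 : ∀ x, augment _ Y (F x) = 0) :
    ∃ G : X →ₗ[k] Wedge k (TupleSpace k σ) (0 + 1) ⊗[k] (SymRing k σ ⊗[k] Y),
      (∀ a x, G (ξ a x) = (wedgeEnd (tupleEnd σ) (0 + 1)).tprod ((symRep σ).tprod τ) a (G x)) ∧
      ∀ x, koszul (symAct _ Y) 0 (G x) = wedge k 0 ![] ⊗ₜ F x := by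
  refine (((lawful_tupleEnd σ).wedgeEnd _).tprod ((lawful_symRep σ).tprod h)).exists_lift
    (F := TensorProduct.mk k _ _ (wedge k 0 ![]) ∘ₗ F)
    (koszul_comm σ τ 0) (fun a x => ?_) fun x => ?_
  · rw [LinearMap.comp_apply, LinearMap.comp_apply, hF, TensorProduct.mk_apply, TensorProduct.mk_apply,
      tprod_app, wedgeEnd_wedge]
    congr 2
    exact Subsingleton.elim _ _
  · obtain ⟨w, hw⟩ := exists_koszul_zero (k := k) _ Y (F x)
    refine ⟨w, hw.trans ?_⟩
    rw [h0, TensorProduct.tmul_zero, sub_zero]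
    rfl

end Equivariance
end GLRep

namespace GLRep

section Support

variable {k : Type*} [Field k] {P Q X Z : Type*} [AddCommGroup P] [Module k P] [AddCommGroup Q]
  [Module k Q] [AddCommGroup X] [Module k X] [AddCommGroup Z] [Module k Z]

/-- Contraction of the left factor of a tensor product with a functional. -/
noncomputable def slice (f : Module.Dual k P) : P ⊗[k] Q →ₗ[k] Q :=
  (TensorProduct.lid k Q).toLinearMap ∘ₗ f.rTensor Q

theorem slice_tmul (f : Module.Dual k P) (p : P) (q : Q) : slice f (p ⊗ₜ q) = f p • q := rfl

theorem slice_lTensor {Q' : Type*} [AddCommGroup Q'] [Module k Q'] (f : Module.Dual k P) (g : Q →ₗ[k] Q')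
    (z : P ⊗[k] Q) : slice f (g.lTensor P z) = g (slice f z) := by
  induction z using TensorProduct.induction_on with
  | zero => simp
  | add x y hx hy => simp only [map_add, hx, hy]
  | tmul p q => rw [LinearMap.lTensor_tmul, slice_tmul, slice_tmul, map_smul]

theorem eq_zero_of_slice {z : P ⊗[k] Q} (h : ∀ f : Module.Dual k P, slice f z = 0) : z = 0 := by
  classical
  let b := Module.Basis.ofVectorSpace k P
  rw [← (TensorProduct.equivFinsuppOfBasisLeft (N := Q) b).map_eq_zero_iff]
  ext i
  rw [Finsupp.zero_apply, ← h (b.coord i)]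
  clear h
  induction z using TensorProduct.induction_on with
  | zero => simp
  | add x y hx hy => rw [map_add, Finsupp.add_apply, hx, hy, map_add]
  | tmul p q =>
    rw [slice_tmul]
    simp

/-- The smallest subspace `S` of `Z` such that `u` takes values in `P ⊗ S`. -/
def supp (u : X →ₗ[k] P ⊗[k] Z) : Submodule k Z :=
  Submodule.span k {z | ∃ (f : Module.Dual k P) (x : X), slice f (u x) = z}

theorem slice_mem_supp (u : X →ₗ[k] P ⊗[k] Z) (f : Module.Dual k P) (x : X) : slice f (u x) ∈ supp u :=
  Submodule.subset_span ⟨f, x, rfl⟩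

theorem mem_range_supp (u : X →ₗ[k] P ⊗[k] Z) (x : X) :
    u x ∈ LinearMap.range ((supp u).subtype.lTensor P) := by
  have h := lTensor_exact P (LinearMap.exact_subtype_mkQ (supp u)) (Submodule.mkQ_surjective _)
  rw [← LinearMap.exact_iff.1 h, LinearMap.mem_ker]
  refine eq_zero_of_slice fun f => ?_
  rw [slice_lTensor]
  exact (Submodule.Quotient.mk_eq_zero _).2 (slice_mem_supp u f x)

theorem exists_supp_lift (u : X →ₗ[k] P ⊗[k] Z) : ∃ v : X →ₗ[k] P ⊗[k] supp u,
    (∀ x, (supp u).subtype.lTensor P (v x) = u x) ∧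
    ∀ (Q : Type*) [AddCommGroup Q] [Module k Q] (g : supp u →ₗ[k] Q),
      (∀ x, g.lTensor P (v x) = 0) → g = 0 := by
  have hinj : Function.Injective ((supp u).subtype.lTensor P) :=
    Module.Flat.lTensor_preserves_injective_linearMap _ Subtype.val_injective
  let e := LinearEquiv.ofInjective _ hinj
  let v : X →ₗ[k] P ⊗[k] supp u := e.symm.toLinearMap ∘ₗ u.codRestrict _ (mem_range_supp u)
  have hv : ∀ x, (supp u).subtype.lTensor P (v x) = u x := fun x =>
    congrArg Subtype.val (e.apply_symm_apply (u.codRestrict _ (mem_range_supp u) x))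
  refine ⟨v, hv, fun Q _ _ g hg => ?_⟩
  have key : ∀ z (hz : z ∈ supp u), g ⟨z, hz⟩ = 0 := by
    intro z hz
    have hle : supp u ≤ (LinearMap.ker g).map (supp u).subtype := by
      refine Submodule.span_le.2 ?_
      rintro _ ⟨f, x, rfl⟩
      refine ⟨slice f (v x), ?_, ?_⟩
      · rw [SetLike.mem_coe, LinearMap.mem_ker, ← slice_lTensor, hg, map_zero]
      · rw [← slice_lTensor, hv]
    obtain ⟨y, hy, hyz⟩ := hle hz
    have : y = ⟨z, hz⟩ := Subtype.ext hyz
    rw [← this]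
    exact hy
  exact LinearMap.ext fun z => key z.1 z.2

end Support

section Equivariant

variable {k : Type u} [Field k] {X B : Type*} [AddCommGroup X] [Module k X] [AddCommGroup B] [Module k B]

/-- The space of `End V`-equivariant linear maps. -/
def eqHom (ξ : Representation k (VEnd k) X) (β : Representation k (VEnd k) B) : Submodule k (X →ₗ[k] B) where
  carrier := {f | ∀ a x, f (ξ a x) = β a (f x)}
  add_mem' hf hg a x := by simp only [LinearMap.add_apply, hf a x, hg a x, map_add]
  zero_mem' a x := by simp
  smul_mem' c f hf a x := by simp only [LinearMap.smul_apply, hf a x, map_smul]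

variable [CharZero k] {ξ : Representation k (VEnd k) X} {β : Representation k (VEnd k) B}

theorem finiteDimensional_eqHom (hξ : Lawful ξ) (hβ : Lawful β) {n : ℕ}
    (hn : ∀ m ≠ n, ∀ c ∈ mlin ξ m, c = 0) [FiniteDimensional k (mlin ξ n)]
    [FiniteDimensional k (mlin β n)] : FiniteDimensional k (eqHom ξ β) := by
  let f : eqHom ξ β →ₗ[k] Representation.IntertwiningMap (res ξ) (res β) :=
    { toFun g := ⟨g.1, fun a => LinearMap.ext fun x => g.2 _ x⟩
      map_add' _ _ := rfl
      map_smul' _ _ := rfl }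
  have hf : Function.Injective f := fun g g' h => Subtype.ext
    (LinearMap.ext fun x => congrArg (fun q : Representation.IntertwiningMap (res ξ) (res β) => q x) h)
  exact Module.Finite.of_injective (mlinMap hξ hβ n ∘ₗ f)
    ((mlinMap_bijective hξ hβ fun m hm => Or.inl (hn m hm)).1.comp hf)

theorem permEnd_bv {m : ℕ} (s : Equiv.Perm (Fin m)) (i : Fin m) : permEnd k s (bv k i) = bv k (s i) := by
  rw [permEnd, firstVecs_bv, dif_pos i.2]

section Tensor

variable {ι : Type} [Fintype ι] {m : ℕ} (e : ι ≃ Fin m)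

theorem basic_mem_mlin : tpr k ι (fun i => bv k (e i)) ∈ mlin (tensorEnd k ι) m := by
  classical
  refine ⟨fun i hi t => ?_, ?_⟩
  · rw [tensorEnd_tprod]
    have : (fun j : ι => scl i t (bv k (e j))) = Function.update (fun j : ι => bv k (e j)) (e.symm ⟨i, hi⟩)
        (t • bv k i) := by
      funext j
      rw [scl_bv]
      by_cases h : (e j : ℕ) = i
      · obtain rfl : j = e.symm ⟨i, hi⟩ := (Equiv.eq_symm_apply e).2 (Fin.ext h)
        simp
      · rw [if_neg h, Function.update_of_ne]
        rintro rfl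
        exact h (by rw [e.apply_symm_apply])
    rw [this, MultilinearMap.map_update_smul]
    congr 2
    refine (congrArg (Function.update _ _) ?_).trans (Function.update_eq_self (e.symm ⟨i, hi⟩) _)
    rw [e.apply_symm_apply]
  · rw [tensorEnd_tprod]
    congr 1
    funext j
    rw [proj_bv, if_pos (Finset.mem_range.2 (e j).2)]

theorem exists_diag : ∃ f : TPow k ι →ₗ[k] k, ∀ (s : Equiv.Perm (Fin m)) (t : Equiv.Perm ι),
    f (tensorEnd k ι (permEnd k s) (tpr k ι fun i => bv k (e (t i)))) =
      if s = (e.permCongr t)⁻¹ then 1 else 0 := by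
  let f : TPow k ι →ₗ[k] k := PiTensorProduct.lift
    ((MultilinearMap.mkPiAlgebra k ι k).compLinearMap fun i => Finsupp.lapply (e i : ℕ))
  have hf : ∀ v, f (tpr k ι v) = ∏ i, v i (e i : ℕ) := fun v =>
    PiTensorProduct.lift.tprod (φ := (MultilinearMap.mkPiAlgebra k ι k).compLinearMap
      fun i => Finsupp.lapply (e i : ℕ)) v
  refine ⟨f, fun s t => ?_⟩
  rw [tensorEnd_tprod, hf]
  have h1 : ∀ i : ι, (permEnd k s (bv k (e (t i)))) (e i : ℕ) = if s (e (t i)) = e i then 1 else 0 := by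
    intro i
    rw [permEnd_bv]
    simp only [bv, Finsupp.single_apply, Fin.val_inj]
  have h2 : s = (e.permCongr t)⁻¹ ↔ ∀ i, s (e (t i)) = e i := by
    rw [eq_inv_iff_mul_eq_one, Equiv.ext_iff]
    refine ⟨fun h i => ?_, fun h x => ?_⟩
    · simpa using h (e i)
    · simpa using h (e.symm x)
  simp only [h1]
  split_ifs with h
  · exact Finset.prod_eq_one fun i _ => if_pos (h2.1 h i)
  · rw [h2, not_forall] at h
    obtain ⟨i, hi⟩ := h
    exact Finset.prod_eq_zero (Finset.mem_univ i) (if_neg hi)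

/-- The equivariant map to a tensor power given by a functional on the multilinear part. -/
theorem exists_hom_tensor_sum (hβ : Lawful β) (φ : Module.Dual k (mlin β m)) :
    ∃ f ∈ eqHom β (tensorEnd k ι), ∀ c : mlin β m, f c = ∑ s, φ (permRep β m s⁻¹ c) •
      tensorEnd k ι (permEnd k s) (tpr k ι fun i => bv k (e i)) := by
  let b : mlin (tensorEnd k ι) m := ⟨_, basic_mem_mlin e⟩
  let Φ : mlin β m →ₗ[k] mlin (tensorEnd k ι) m :=
    ∑ s, (φ ∘ₗ permRep β m s⁻¹).smulRight (permRep (tensorEnd k ι) m s b)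
  have hΦ : ∀ t c, Φ (permRep β m t c) = permRep (tensorEnd k ι) m t (Φ c) := by
    intro t c
    simp only [Φ, LinearMap.sum_apply, map_sum, LinearMap.smulRight_apply, LinearMap.comp_apply, map_smul]
    refine (Fintype.sum_equiv (Equiv.mulLeft t) _ _ fun s => ?_).symm
    have h : permRep β m t⁻¹ (permRep β m t c) = c := by
      rw [← Module.End.mul_apply, ← map_mul, inv_mul_cancel, map_one]
      rfl
    rw [Equiv.coe_mulLeft, map_mul, mul_inv_rev, map_mul, Module.End.mul_apply, Module.End.mul_apply, h]
  obtain ⟨f, hf, hfΦ⟩ := hβ.exists_extend (lawful_tensorEnd ι)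
    (fun n => if h : n = m then h ▸ Φ else 0) (fun n s c => by
      by_cases h : n = m
      · subst h
        simpa using hΦ s c
      · simp [h])
  refine ⟨f, hf, fun c => ?_⟩
  have h1 := hfΦ m c
  simp only [dite_true] at h1
  rw [h1]
  simp only [Φ, LinearMap.sum_apply, LinearMap.smulRight_apply, LinearMap.comp_apply,
    Submodule.coe_sum, Submodule.coe_smul, permRep_coe, b]

theorem exists_hom_tensor (hβ : Lawful β) {c : B} (hc : c ∈ mlin β m) (h0 : c ≠ 0) :
    ∃ f ∈ eqHom β (tensorEnd k (Fin m)), f c ≠ 0 := by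
  obtain ⟨φ, hφ⟩ : ∃ φ : Module.Dual k (mlin β m), φ ⟨c, hc⟩ ≠ 0 := by
    by_contra! h
    exact h0 (congrArg Subtype.val ((Module.forall_dual_apply_eq_zero_iff k _).1 h))
  obtain ⟨f, hf, hfφ⟩ := exists_hom_tensor_sum (Equiv.refl (Fin m)) hβ φ
  refine ⟨f, hf, fun h => hφ ?_⟩
  obtain ⟨d, hd⟩ := exists_diag (k := k) (Equiv.refl (Fin m))
  have h1 := hfφ ⟨c, hc⟩
  rw [h] at h1
  have h2 := congrArg d h1
  have hd' : ∀ s : Equiv.Perm (Fin m), d (tensorEnd k (Fin m) (permEnd k s) (tpr k (Fin m) fun i => bv k i)) =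
      if s = 1 then 1 else 0 := fun s => (hd s 1).trans (by
    have : (Equiv.refl (Fin m)).permCongr 1 = 1 := rfl
    rw [this, inv_one])
  simp only [map_sum, map_smul, map_zero, Equiv.refl_apply, hd'] at h2
  simpa using h2.symm

end Tensor

section Scalars

variable {P T : Type*} [AddCommGroup P] [Module k P] [AddCommGroup T] [Module k T]
  {π : Representation k (VEnd k) P} {θ : Representation k (VEnd k) T}

theorem isPolyFun_rTensor (hπ : Lawful π) (z : P ⊗[k] T) : IsPolyFun fun t : k => (π (t • 1)).rTensor T z := by
  induction z using TensorProduct.induction_on with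
  | zero => simpa using IsPolyFun.const (k := k) (0 : P ⊗[k] T)
  | add x y hx hy => simpa only [map_add] using hx.add hy
  | tmul p q =>
    have := ((hπ p).line 0 1).map ((TensorProduct.mk k P T).flip q)
    simp only [zero_add] at this
    exact this

theorem smul_rTensor_scalar {n m : ℕ} (hξ : IsHomog ξ n) (hθ : IsHomog θ m) {F : X →ₗ[k] P ⊗[k] T}
    (hF : F ∈ eqHom ξ (π.tprod θ)) (x : X) (t : k) : t ^ m • (π (t • 1)).rTensor T (F x) = t ^ n • F x := by
  rw [← map_smul F, ← hξ t x, hF]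
  have : ∀ z : P ⊗[k] T, t ^ m • (π (t • 1)).rTensor T z = π.tprod θ (t • 1) z := by
    intro z
    induction z using TensorProduct.induction_on with
    | zero => simp
    | add x y hx hy => simp only [map_add, smul_add, hx, hy]
    | tmul p q => rw [LinearMap.rTensor_tmul, tprod_app, hθ, TensorProduct.tmul_smul]
  exact this _

theorem eqHom_tprod_eq_zero (hπ : Lawful π) {n m : ℕ} (hξ : IsHomog ξ n) (hθ : IsHomog θ m) (hnm : n < m)
    {F : X →ₗ[k] P ⊗[k] T} (hF : F ∈ eqHom ξ (π.tprod θ)) : F = 0 := by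
  ext x
  obtain ⟨p, hp⟩ := isPolyFun_rTensor (T := T) hπ (F x)
  have h3 : p.mapDomain (· + m) = Finsupp.single n (F x) := by
    refine polyEval_injective (k := k) fun t _ => ?_
    rw [polyEval_single, ← smul_rTensor_scalar hξ hθ hF x t]
    refine Eq.trans ?_ (congrArg (t ^ m • ·) (hp t)).symm
    simp only [polyEval_apply]
    rw [Finsupp.sum_mapDomain_index (by simp) (by simp), Finsupp.smul_sum]
    refine Finsupp.sum_congr fun j _ => ?_
    rw [pow_add, mul_comm, mul_smul]
  have h4 := congrArg (fun q => q n) h3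
  simp only [Finsupp.single_eq_same] at h4
  rw [← h4]
  refine Finsupp.mapDomain_of_notMem_range _ _ ?_
  rintro ⟨j, hj⟩
  have : j + m = n := hj
  omega

end Scalars

end Equivariant

section Universal

variable {k : Type u} [Field k] [CharZero k] {X P : Type u} [AddCommGroup X] [Module k X] [AddCommGroup P]
  [Module k P] (ξ : Representation k (VEnd k) X) (π : Representation k (VEnd k) P)

/-- The equivariant map `u : X → P ⊗ J` is initial among the equivariant maps `X → P ⊗ Y`. -/
structure IsUniversal {J : Type u} [AddCommGroup J] [Module k J] (τ : Representation k (VEnd k) J)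
    (u : X →ₗ[k] P ⊗[k] J) : Prop where
  lawful : Lawful τ
  finWt : FinWt τ
  comm : ∀ a x, u (ξ a x) = π.tprod τ a (u x)
  ext : ∀ {Q : Type u} [AddCommGroup Q] [Module k Q] (g : J →ₗ[k] Q), (∀ x, g.lTensor P (u x) = 0) → g = 0
  lift : ∀ {Y : Type u} [AddCommGroup Y] [Module k Y] {θ : Representation k (VEnd k) Y}, Lawful θ →
    ∀ G : X →ₗ[k] P ⊗[k] Y, (∀ a x, G (ξ a x) = π.tprod θ a (G x)) →
      ∃ g : J →ₗ[k] Y, (∀ a x, g (τ a x) = θ a (g x)) ∧ ∀ x, g.lTensor P (u x) = G x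

variable {ξ π}

theorem lTensor_comm {Y Y' : Type u} [AddCommGroup Y] [Module k Y] [AddCommGroup Y'] [Module k Y']
    {θ : Representation k (VEnd k) Y} {θ' : Representation k (VEnd k) Y'} {g : Y →ₗ[k] Y'}
    (hg : ∀ a x, g (θ a x) = θ' a (g x)) (a : VEnd k) (z : P ⊗[k] Y) :
    g.lTensor P (π.tprod θ a z) = π.tprod θ' a (g.lTensor P z) := by
  induction z using TensorProduct.induction_on with
  | zero => simp
  | add x y hx hy => simp only [map_add, hx, hy]
  | tmul p q => rw [tprod_app, LinearMap.lTensor_tmul, LinearMap.lTensor_tmul, tprod_app, hg]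

theorem exists_pairing {Y Y' : Type u} [AddCommGroup Y] [Module k Y] [AddCommGroup Y'] [Module k Y']
    {θ : Representation k (VEnd k) Y} {θ' : Representation k (VEnd k) Y'} {u : X →ₗ[k] P ⊗[k] Y}
    {u' : X →ₗ[k] P ⊗[k] Y'} (hu : ∀ a x, u (ξ a x) = π.tprod θ a (u x))
    (hu' : ∀ a x, u' (ξ a x) = π.tprod θ' a (u' x)) : ∃ w : X →ₗ[k] P ⊗[k] (Y × Y'),
      (∀ a x, w (ξ a x) = π.tprod (θ.prod θ') a (w x)) ∧ (∀ x, (LinearMap.fst k Y Y').lTensor P (w x) = u x) ∧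
      ∀ x, (LinearMap.snd k Y Y').lTensor P (w x) = u' x := by
  refine ⟨(LinearMap.inl k Y Y').lTensor P ∘ₗ u + (LinearMap.inr k Y Y').lTensor P ∘ₗ u', fun a x => ?_,
    fun x => ?_, fun x => ?_⟩
  · simp only [LinearMap.add_apply, LinearMap.comp_apply, hu, hu', map_add]
    rw [lTensor_comm (θ' := θ.prod θ') (fun a x => by simp), lTensor_comm (θ' := θ.prod θ') (fun a x => by simp)]
  · simp only [LinearMap.add_apply, LinearMap.comp_apply, map_add]
    rw [← LinearMap.lTensor_comp_apply, ← LinearMap.lTensor_comp_apply]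
    simp
  · simp only [LinearMap.add_apply, LinearMap.comp_apply, map_add]
    rw [← LinearMap.lTensor_comp_apply, ← LinearMap.lTensor_comp_apply]
    simp

theorem supp_stable {Z : Type u} [AddCommGroup Z] [Module k Z]
    {ζ : Representation k (VEnd k) Z} (hζ : Lawful ζ) {u : X →ₗ[k] P ⊗[k] Z}
    (hu : ∀ a x, u (ξ a x) = π.tprod ζ a (u x)) (a : VEnd k) {z : Z} (hz : z ∈ supp u) : ζ a z ∈ supp u := by
  refine hζ.mem_of_res _ (fun g z hz => ?_) a hz
  have key : supp u ≤ (supp u).comap (ζ (stdRep k g)) := by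
    refine Submodule.span_le.2 ?_
    rintro _ ⟨f, x, rfl⟩
    have h : ∀ w : P ⊗[k] Z, ζ (stdRep k g) (slice f w) =
        slice (f ∘ₗ π (stdRep k g⁻¹)) (π.tprod ζ (stdRep k g) w) := by
      intro w
      induction w using TensorProduct.induction_on with
      | zero => simp
      | add x y hx hy => simp only [map_add, hx, hy]
      | tmul p q =>
        rw [tprod_app, slice_tmul, slice_tmul, map_smul, LinearMap.comp_apply, ← mul_app, ← map_mul,
          inv_mul_cancel, map_one, one_app]
    rw [SetLike.mem_coe, Submodule.mem_comap, h, ← hu]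
    exact slice_mem_supp u _ _
  exact key hz

/-- The restriction of a representation to a stable subspace. -/
def subRep {G Z : Type*} [Monoid G] [AddCommGroup Z] [Module k Z] (ζ : Representation k G Z)
    (U : Submodule k Z) (hU : ∀ a, ∀ z ∈ U, ζ a z ∈ U) : Representation k G U where
  toFun a := (ζ a).restrict (hU a)
  map_one' := LinearMap.ext fun z => Subtype.ext (by rw [LinearMap.coe_restrict_apply, map_one]; rfl)
  map_mul' a b := LinearMap.ext fun z => Subtype.ext (by rw [LinearMap.coe_restrict_apply, map_mul]; rfl)

theorem exists_supp_lift_comm {Z : Type u} [AddCommGroup Z] [Module k Z]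
    {ζ : Representation k (VEnd k) Z} (hζ : Lawful ζ) {u : X →ₗ[k] P ⊗[k] Z}
    (hu : ∀ a x, u (ξ a x) = π.tprod ζ a (u x)) : ∃ (J : Type u) (_ : AddCommGroup J) (_ : Module k J)
      (τ : Representation k (VEnd k) J) (v : X →ₗ[k] P ⊗[k] J) (j : J →ₗ[k] Z), Function.Injective j ∧
      (∀ a x, j (τ a x) = ζ a (j x)) ∧ (∀ a x, v (ξ a x) = π.tprod τ a (v x)) ∧
      (∀ x, j.lTensor P (v x) = u x) ∧ ∀ (Q : Type u) [AddCommGroup Q] [Module k Q] (g : J →ₗ[k] Q),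
      (∀ x, g.lTensor P (v x) = 0) → g = 0 := by
  obtain ⟨v, hv, hv'⟩ := exists_supp_lift u
  refine ⟨supp u, inferInstance, inferInstance, subRep ζ (supp u) fun a z hz => supp_stable hζ hu a hz,
    v, (supp u).subtype, Subtype.val_injective, fun a x => rfl, fun a x => ?_, hv, hv'⟩
  refine Module.Flat.lTensor_preserves_injective_linearMap (M := P) (supp u).subtype Subtype.val_injective ?_
  rw [hv, hu, lTensor_comm (θ' := ζ) (fun a x => rfl), hv]

theorem IsUniversal.of_cogenerated {J : Type u} [AddCommGroup J] [Module k J]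
    {τ : Representation k (VEnd k) J} {u : X →ₗ[k] P ⊗[k] J} (hτ : Lawful τ) (hτ' : FinWt τ)
    (hu : ∀ a x, u (ξ a x) = π.tprod τ a (u x))
    (hext : ∀ (Q : Type u) [AddCommGroup Q] [Module k Q] (g : J →ₗ[k] Q),
      (∀ x, g.lTensor P (u x) = 0) → g = 0)
    (hT : ∀ m, ∀ F ∈ eqHom ξ (π.tprod (tensorEnd k (Fin m))), ∃ c ∈ eqHom τ (tensorEnd k (Fin m)),
      ∀ x, c.lTensor P (u x) = F x) : IsUniversal ξ π τ u := by
  refine ⟨hτ, hτ', hu, fun g hg => hext _ g hg, fun {Y} _ _ {θ} hθ G hG => ?_⟩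
  obtain ⟨w, hw, hwu, hwG⟩ := exists_pairing hu hG
  obtain ⟨Γ, _, _, γ, v, j, hj, hjc, hvc, hv, hvext⟩ := exists_supp_lift_comm (hτ.prod hθ) hw
  have hγ : Lawful γ := (hτ.prod hθ).of_injective j hj hjc
  have hfst : ∀ x, (LinearMap.fst k J Y ∘ₗ j).lTensor P (v x) = u x := fun x => by
    rw [LinearMap.lTensor_comp, LinearMap.comp_apply, hv, hwu]
  have hsnd : ∀ x, (LinearMap.snd k J Y ∘ₗ j).lTensor P (v x) = G x := fun x => by
    rw [LinearMap.lTensor_comp, LinearMap.comp_apply, hv, hwG]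
  have hinj : Function.Injective (LinearMap.fst k J Y ∘ₗ j) := by
    rw [← LinearMap.ker_eq_bot]
    refine hγ.eq_bot_of_mlin (fun a x hx => ?_) fun m c hc hcU => ?_
    · rw [LinearMap.mem_ker, LinearMap.comp_apply] at hx ⊢
      rw [hjc]
      change τ a (j x).1 = 0
      have : (j x).1 = 0 := hx
      rw [this, map_zero]
    · by_contra h0
      have h1 : (j c).1 = 0 := hcU
      have h2 : (j c).2 ≠ 0 := fun h2 => h0 (hj (by rw [map_zero]; exact Prod.ext h1 h2))
      have h3 : (j c).2 ∈ mlin θ m := map_mem_mlin (f := LinearMap.snd k J Y ∘ₗ j) (τ' := θ)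
        (fun a x => by rw [LinearMap.comp_apply, hjc]; rfl) hc
      obtain ⟨f, hf, hfc⟩ := exists_hom_tensor hθ h3 h2
      obtain ⟨c', hc', hcu⟩ := hT m (f.lTensor P ∘ₗ G) (fun a x => by
        rw [LinearMap.comp_apply, hG, lTensor_comm hf]; rfl)
      have h4 := hvext _ (f ∘ₗ (LinearMap.snd k J Y ∘ₗ j) - c' ∘ₗ (LinearMap.fst k J Y ∘ₗ j)) (fun x => by
        rw [LinearMap.lTensor_sub, LinearMap.sub_apply, LinearMap.lTensor_comp, LinearMap.lTensor_comp _ c',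
          LinearMap.comp_apply, LinearMap.comp_apply, hsnd, hfst, hcu, LinearMap.comp_apply, sub_self])
      have h5 := congrArg (fun q => q c) h4
      simp only [LinearMap.sub_apply, LinearMap.comp_apply, LinearMap.fst_apply, LinearMap.snd_apply, h1,
        map_zero, sub_zero, LinearMap.zero_apply] at h5
      exact hfc h5
  have hsurj : Function.Surjective (LinearMap.fst k J Y ∘ₗ j) := by
    rw [← LinearMap.range_eq_top, ← Submodule.ker_mkQ (LinearMap.range (LinearMap.fst k J Y ∘ₗ j)),
      LinearMap.ker_eq_top]
    refine hext _ _ fun x => ?_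
    rw [← hfst, ← LinearMap.comp_apply, ← LinearMap.lTensor_comp, LinearMap.range_mkQ_comp,
      LinearMap.lTensor_zero, LinearMap.zero_apply]
  let e := LinearEquiv.ofBijective _ ⟨hinj, hsurj⟩
  have he : ∀ z, e.symm ((LinearMap.fst k J Y ∘ₗ j) z) = z := fun z => e.symm_apply_apply z
  refine ⟨(LinearMap.snd k J Y ∘ₗ j) ∘ₗ e.symm.toLinearMap, fun a x => ?_, fun x => ?_⟩
  · obtain ⟨z, rfl⟩ := hsurj x
    have h1 : τ a ((LinearMap.fst k J Y ∘ₗ j) z) = (LinearMap.fst k J Y ∘ₗ j) (γ a z) := by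
      rw [LinearMap.comp_apply, LinearMap.comp_apply, hjc]; rfl
    rw [h1]
    change (LinearMap.snd k J Y ∘ₗ j) (e.symm ((LinearMap.fst k J Y ∘ₗ j) (γ a z))) =
      θ a ((LinearMap.snd k J Y ∘ₗ j) (e.symm ((LinearMap.fst k J Y ∘ₗ j) z)))
    rw [he, he, LinearMap.comp_apply, hjc]
    rfl
  · rw [← hfst x, ← hsnd x, ← LinearMap.comp_apply, ← LinearMap.lTensor_comp, LinearMap.comp_assoc]
    have h1 : (LinearMap.snd k J Y ∘ₗ j) ∘ₗ e.symm.toLinearMap ∘ₗ LinearMap.fst k J Y ∘ₗ j =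
        LinearMap.snd k J Y ∘ₗ j := LinearMap.ext fun z => congrArg (LinearMap.snd k J Y ∘ₗ j) (he z)
    rw [h1]

theorem FinWt.prod {Y Y' : Type u} [AddCommGroup Y] [Module k Y] [AddCommGroup Y'] [Module k Y']
    {θ : Representation k (VEnd k) Y} {θ' : Representation k (VEnd k) Y'} (h : FinWt θ) (h' : FinWt θ') :
    FinWt (θ.prod θ') :=
  finWt_of_range_le fun n => by
    have := h n
    have := h' n
    refine ⟨_, _, _, inferInstance, (LinearMap.range (θ (proj k (Finset.range n)))).subtype.prodMap
      (LinearMap.range (θ' (proj k (Finset.range n)))).subtype, ?_⟩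
    rintro _ ⟨x, rfl⟩
    exact ⟨(⟨_, x.1, rfl⟩, ⟨_, x.2, rfl⟩), rfl⟩

theorem exists_capture (s : Finset (Σ m : ℕ, eqHom ξ (π.tprod (tensorEnd k (Fin m))))) :
    ∃ (Z : Type u) (_ : AddCommGroup Z) (_ : Module k Z) (ζ : Representation k (VEnd k) Z)
      (u : X →ₗ[k] P ⊗[k] Z), Lawful ζ ∧ FinWt ζ ∧ (∀ a x, u (ξ a x) = π.tprod ζ a (u x)) ∧
      ∀ F ∈ s, ∃ c ∈ eqHom ζ (tensorEnd k (Fin F.1)), ∀ x, c.lTensor P (u x) = F.2.1 x := by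
  classical
  induction s using Finset.induction_on with
  | empty =>
    refine ⟨PUnit, inferInstance, inferInstance, 1, 0, fun x => ?_, fun n => inferInstance,
      fun a x => by simp, fun F hF => absurd hF (Finset.notMem_empty F)⟩
    exact (lawful_tensorEnd (k := k) (Fin 0)).of_injective (τ := (1 : Representation k (VEnd k) PUnit.{u + 1})) 0
      (fun _ _ _ => rfl) (fun _ _ => by simp) x
  | insert F s hF ih =>
    obtain ⟨Z, _, _, ζ, u, h1, h2, h3, h4⟩ := ih
    obtain ⟨w, hw, hw1, hw2⟩ := exists_pairing h3 F.2.2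
    refine ⟨Z × TPow k (Fin F.1), inferInstance, inferInstance, ζ.prod (tensorEnd k (Fin F.1)), w,
      h1.prod (lawful_tensorEnd _), h2.prod (finWt_tensorEnd _), hw, fun F' hF' => ?_⟩
    rcases Finset.mem_insert.1 hF' with rfl | hF'
    · exact ⟨LinearMap.snd k _ _, fun a x => rfl, hw2⟩
    · obtain ⟨c, hc, hcu⟩ := h4 F' hF'
      refine ⟨c ∘ₗ LinearMap.fst k _ _, fun a x => hc a x.1, fun x => ?_⟩
      rw [LinearMap.lTensor_comp_apply, hw1, hcu]

theorem exists_universal (hξ : Lawful ξ) (hξ' : FinWt ξ) {n : ℕ} (hn : IsHomog ξ n) (hπ : Lawful π)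
    (hπ' : FinWt π) : ∃ (J : Type u) (_ : AddCommGroup J) (_ : Module k J)
      (τ : Representation k (VEnd k) J) (u : X →ₗ[k] P ⊗[k] J), IsUniversal ξ π τ u := by
  classical
  have hfin : ∀ m, ∃ s : Finset (eqHom ξ (π.tprod (tensorEnd k (Fin m)))),
      Submodule.span k (s : Set (eqHom ξ (π.tprod (tensorEnd k (Fin m))))) = ⊤ := by
    intro m
    have := hξ'.mlin n
    have := (hπ'.tprod (finWt_tensorEnd (k := k) (Fin m))).mlin n
    have := finiteDimensional_eqHom hξ (hπ.tprod (lawful_tensorEnd (k := k) (Fin m)))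
      (fun m hm c hc => hn.mlin_eq_zero hξ hm hc)
    exact Module.Finite.fg_top
  choose s hs using hfin
  obtain ⟨Z, _, _, ζ, u, h1, h2, h3, h4⟩ := exists_capture ((Finset.range (n + 1)).sigma s)
  obtain ⟨J, _, _, τ, v, j, hj, hjc, hvc, hv, hvext⟩ := exists_supp_lift_comm h1 h3
  refine ⟨J, _, _, τ, v, .of_cogenerated (h1.of_injective j hj hjc) (h2.of_injective j hj hjc) hvc hvext
    fun m F hF => ?_⟩
  by_cases hm : n < m
  · rw [eqHom_tprod_eq_zero hπ hn (by simpa using isHomog_tensorEnd (k := k) (Fin m)) hm hF]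
    exact ⟨0, Submodule.zero_mem _, fun x => by simp⟩
  · have hF' : (⟨F, hF⟩ : eqHom ξ (π.tprod (tensorEnd k (Fin m)))) ∈ Submodule.span k (s m : Set (eqHom ξ (π.tprod (tensorEnd k (Fin m))))) := by
      rw [hs]; trivial
    have key : ∀ F' ∈ Submodule.span k (s m : Set (eqHom ξ (π.tprod (tensorEnd k (Fin m))))),
        ∃ c ∈ eqHom τ (tensorEnd k (Fin m)), ∀ x, c.lTensor P (v x) = F'.1 x := by
      intro F' hF'
      induction hF' using Submodule.span_induction with
      | mem F' hF' =>
        obtain ⟨c, hc, hcu⟩ := h4 ⟨m, F'⟩ (Finset.mem_sigma.2 ⟨Finset.mem_range.2 (by change m < n + 1; omega), hF'⟩)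
        refine ⟨c ∘ₗ j, fun a x => ?_, fun x => ?_⟩
        · rw [LinearMap.comp_apply, hjc]
          exact hc a (j x)
        · rw [LinearMap.lTensor_comp_apply, hv, hcu]
      | zero => exact ⟨0, Submodule.zero_mem _, fun x => by simp⟩
      | add x y _ _ hx hy =>
        obtain ⟨c, hc, hcu⟩ := hx
        obtain ⟨d, hd, hdu⟩ := hy
        exact ⟨c + d, Submodule.add_mem _ hc hd, fun x => by
          rw [LinearMap.lTensor_add, LinearMap.add_apply, hcu, hdu]; rfl⟩
      | smul t x _ hx =>
        obtain ⟨c, hc, hcu⟩ := hx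
        exact ⟨t • c, Submodule.smul_mem _ _ hc, fun x => by
          rw [LinearMap.lTensor_smul, LinearMap.smul_apply, hcu]; rfl⟩
    exact key _ hF'

end Universal
end GLRep

namespace GLRep

section SchurEnd

variable {k : Type u} [Field k] [CharZero k]

variable (k) in
/-- The action of `End V` on `k^{⊕μ}`. -/
noncomputable def schurEnd (μ : YoungDiagram) : Representation k (VEnd k) (SchurSpace k μ) :=
  ext (schurRep k μ) fun x => IsPolynomialElement.polyElt
    (IsPolynomialElement.of_map (isPolynomial_schurRep k μ) LinearMap.id (fun _ _ => rfl) x)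

theorem lawful_schurEnd (μ : YoungDiagram) : Lawful (schurEnd k μ) := lawful_ext _ _

theorem res_schurEnd (μ : YoungDiagram) : res (schurEnd k μ) = schurRep k μ := res_ext _ _

/-- The inclusion of `S_μ(V)` in a tensor power. -/
noncomputable def schurIncl (μ : YoungDiagram) : SchurSpace k μ →ₗ[k] TPow k μ.cells :=
  (schurSub k μ).toSubmodule.subtype

theorem schurIncl_injective (μ : YoungDiagram) : Function.Injective (schurIncl (k := k) μ) :=
  Subtype.val_injective

theorem schurIncl_comm (μ : YoungDiagram) (a : VEnd k) (x : SchurSpace k μ) :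
    schurIncl μ (schurEnd k μ a x) = tensorEnd k μ.cells a (schurIncl μ x) :=
  (lawful_schurEnd μ).map_of_res (lawful_tensorEnd _) (schurIncl μ) (fun g x => by
    have h1 : schurEnd k μ (stdRep k g) = schurRep k μ g := ext_stdRep _ _ g
    rw [h1]
    rfl) a x

theorem finWt_schurEnd (μ : YoungDiagram) : FinWt (schurEnd k μ) :=
  (finWt_tensorEnd μ.cells).of_injective (schurIncl μ) (schurIncl_injective μ) (schurIncl_comm μ)

theorem isHomog_schurEnd (μ : YoungDiagram) : IsHomog (schurEnd k μ) μ.card := by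
  have := isHomog_tensorEnd (k := k) μ.cells
  rw [Fintype.card_coe] at this
  exact this.of_injective (schurIncl μ) (schurIncl_injective μ) (schurIncl_comm μ)

theorem Lawful.directSum {ι : Type*} [DecidableEq ι] {M : ι → Type*}
    [∀ i, AddCommGroup (M i)] [∀ i, Module k (M i)] {τ : ∀ i, Representation k (VEnd k) (M i)}
    (h : ∀ i, Lawful (τ i)) : Lawful (Representation.directSum τ) := fun x => by
  induction x using DirectSum.induction_on with
  | zero => simpa only [map_zero] using IsLaw.const _
  | add x y hx hy => simpa only [map_add] using hx.add hy
  | of i x =>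
    have := (h i x).map (DirectSum.lof k ι M i)
    convert this using 2 with a
    exact DirectSum.lmap_lof (fun i => τ i a) i x

variable {r : ℕ} (σ : Fin r → YoungDiagram)

theorem tupleEnd_eq : tupleEnd (k := k) σ = Representation.directSum fun i => schurEnd k (σ i) := by
  refine (lawful_tupleEnd σ).eq_of_res (Lawful.directSum fun i => lawful_schurEnd (σ i)) ?_
  rw [res_tupleEnd]
  refine MonoidHom.ext fun g => ?_
  have h1 : ∀ i, schurEnd k (σ i) (stdRep k g) = schurRep k (σ i) g := fun i => ext_stdRep _ _ g
  change DirectSum.lmap (fun i => schurRep k (σ i) g) = DirectSum.lmap fun i => schurEnd k (σ i) (stdRep k g)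
  simp only [h1]

theorem finWt_tupleEnd : FinWt (tupleEnd (k := k) σ) := by
  rw [tupleEnd_eq]
  exact FinWt.directSum fun i => finWt_schurEnd (σ i)

end SchurEnd

section Differential

variable {k : Type u} [Field k] [CharZero k] {r : ℕ} {σ : Fin r → YoungDiagram}

theorem FinWt.wedgeEnd {ε : Representation k (VEnd k) (TupleSpace k σ)} (h : FinWt ε) (i : ℕ) :
    FinWt (wedgeEnd ε i) := h.extEnd i

variable {J J' Y : Type u} [AddCommGroup J] [Module k J] [AddCommGroup J'] [Module k J']
  [AddCommGroup Y] [Module k Y] {τ : Representation k (VEnd k) J} {τ' : Representation k (VEnd k) J'}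
  {θ : Representation k (VEnd k) Y}

/-- The composite of `δ : J → E ⊗ J'` with `g : J' → Sym E ⊗ Y`. -/
noncomputable def symComp (δ : J →ₗ[k] TupleSpace k σ ⊗[k] J') (g : J' →ₗ[k] SymRing k σ ⊗[k] Y) :
    J →ₗ[k] SymRing k σ ⊗[k] Y :=
  TensorProduct.lift (symAct _ Y) ∘ₗ g.lTensor _ ∘ₗ δ

theorem lift_symAct_comm (a : VEnd k) (z : TupleSpace k σ ⊗[k] (SymRing k σ ⊗[k] Y)) :
    TensorProduct.lift (symAct _ Y) ((tupleEnd σ).tprod ((symRep σ).tprod θ) a z) =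
      (symRep σ).tprod θ a (TensorProduct.lift (symAct _ Y) z) := by
  induction z using TensorProduct.induction_on with
  | zero => simp
  | add x y hx hy => simp only [map_add, hx, hy]
  | tmul e z => rw [tprod_app, TensorProduct.lift.tmul, TensorProduct.lift.tmul, symAct_comm]

theorem symComp_comm {δ : J →ₗ[k] TupleSpace k σ ⊗[k] J'} {g : J' →ₗ[k] SymRing k σ ⊗[k] Y}
    (hδ : ∀ a x, δ (τ a x) = (tupleEnd σ).tprod τ' a (δ x)) (hg : ∀ a x, g (τ' a x) = (symRep σ).tprod θ a (g x))
    (a : VEnd k) (x : J) : symComp δ g (τ a x) = (symRep σ).tprod θ a (symComp δ g x) := by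
  rw [symComp, LinearMap.comp_apply, LinearMap.comp_apply, hδ, lTensor_comm hg, lift_symAct_comm]
  rfl

theorem lin_polyBc_lift (h : Lawful τ') (hY : Lawful θ) {ψ : bc σ h ⟶ bc σ hY}
    {g : J' →ₗ[k] SymRing k σ ⊗[k] Y} (hψ : ∀ w, GLMod.Hom.lin ψ (polyBc σ h (1 ⊗ₜ w)) = polyBc σ hY (g w))
    (z : TupleSpace k σ ⊗[k] J') :
    GLMod.Hom.lin ψ (polyBc σ h (TensorProduct.lift (symAct _ J') ((TensorProduct.mk k _ J' 1).lTensor _ z))) =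
      polyBc σ hY (TensorProduct.lift (symAct _ Y) (g.lTensor _ z)) := by
  induction z using TensorProduct.induction_on with
  | zero => simp only [map_zero]
  | add x y hx hy => simp only [map_add, hx, hy]
  | tmul e z =>
    rw [LinearMap.lTensor_tmul, LinearMap.lTensor_tmul, TensorProduct.lift.tmul, TensorProduct.lift.tmul,
      TensorProduct.mk_apply, symAct_tmul, mul_one, polyBc_tmul, map_smul, hψ, ← polyBc_mulLeft]
    rfl

variable {X : Type u} [AddCommGroup X] [Module k X] {ξ : Representation k (VEnd k) X}

theorem koszul_lTensor {i : ℕ} (g : J' →ₗ[k] SymRing k σ ⊗[k] Y) (z : Wedge k (TupleSpace k σ) (i + 1) ⊗[k] J') :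
    koszul (symAct _ Y) i (g.lTensor _ z) = (TensorProduct.lift (symAct _ Y) ∘ₗ g.lTensor _).lTensor _
      (TensorProduct.assoc k _ _ J' ((extComul k _ i).rTensor J' z)) := by
  induction z using TensorProduct.induction_on with
  | zero => simp only [map_zero]
  | add x y hx hy => simp only [map_add, hx, hy]
  | tmul w y =>
    rw [LinearMap.lTensor_tmul, LinearMap.rTensor_tmul, koszul, LinearMap.comp_apply, LinearMap.comp_apply,
      LinearMap.rTensor_tmul]
    induction extComul k (TupleSpace k σ) i w using TensorProduct.induction_on with
    | zero => simp only [TensorProduct.zero_tmul, map_zero]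
    | add x y hx hy => simp only [TensorProduct.add_tmul, map_add, hx, hy]
    | tmul w e => rfl

theorem symComp_lTensor {i : ℕ} {u : X →ₗ[k] Wedge k (TupleSpace k σ) i ⊗[k] J}
    {u' : X →ₗ[k] Wedge k (TupleSpace k σ) (i + 1) ⊗[k] J'} {δ : J →ₗ[k] TupleSpace k σ ⊗[k] J'}
    (hδ : ∀ x, δ.lTensor _ (u x) = TensorProduct.assoc k _ _ J' ((extComul k _ i).rTensor J' (u' x)))
    (g : J' →ₗ[k] SymRing k σ ⊗[k] Y) (x : X) :
    (symComp δ g).lTensor _ (u x) = koszul (symAct _ Y) i (g.lTensor _ (u' x)) := by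
  rw [koszul_lTensor, ← hδ, ← LinearMap.lTensor_comp_apply]
  rfl

theorem assoc_extComul_comm {i : ℕ} (a : VEnd k) (z : Wedge k (TupleSpace k σ) (i + 1) ⊗[k] J') :
    TensorProduct.assoc k _ _ J' ((extComul k _ i).rTensor J' ((wedgeEnd (tupleEnd σ) (i + 1)).tprod τ' a z)) =
      (wedgeEnd (tupleEnd σ) i).tprod ((tupleEnd σ).tprod τ') a
        (TensorProduct.assoc k _ _ J' ((extComul k _ i).rTensor J' z)) := by
  induction z using TensorProduct.induction_on with
  | zero => simp only [map_zero]
  | add x y hx hy => simp only [map_add, hx, hy]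
  | tmul w y =>
    rw [tprod_app, LinearMap.rTensor_tmul, LinearMap.rTensor_tmul, extComul_comm]
    induction extComul k (TupleSpace k σ) i w using TensorProduct.induction_on with
    | zero => simp only [TensorProduct.zero_tmul, map_zero]
    | add x y hx hy => simp only [TensorProduct.add_tmul, map_add, hx, hy]
    | tmul w e => rfl

theorem IsUniversal.exists_delta {i : ℕ} {u : X →ₗ[k] Wedge k (TupleSpace k σ) i ⊗[k] J}
    {u' : X →ₗ[k] Wedge k (TupleSpace k σ) (i + 1) ⊗[k] J'} (hu : IsUniversal ξ (wedgeEnd (tupleEnd σ) i) τ u)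
    (hu' : IsUniversal ξ (wedgeEnd (tupleEnd σ) (i + 1)) τ' u') : ∃ δ : J →ₗ[k] TupleSpace k σ ⊗[k] J',
      (∀ a x, δ (τ a x) = (tupleEnd σ).tprod τ' a (δ x)) ∧
      ∀ x, δ.lTensor _ (u x) = TensorProduct.assoc k _ _ J' ((extComul k _ i).rTensor J' (u' x)) :=
  hu.lift ((lawful_tupleEnd σ).tprod hu'.lawful)
    ((TensorProduct.assoc k _ _ J').toLinearMap ∘ₗ (extComul k _ i).rTensor J' ∘ₗ u') fun a x => by
      simp only [LinearMap.comp_apply, hu'.comm]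
      exact assoc_extComul_comm a _

/-- The morphism of base changes given by an equivariant map `J → Sym E ⊗ Y`. -/
noncomputable def bcHom (h : Lawful τ) (hY : Lawful θ) (f : J →ₗ[k] SymRing k σ ⊗[k] Y)
    (hf : ∀ a x, f (τ a x) = (symRep σ).tprod θ a (f x)) : bc σ h ⟶ bc σ hY :=
  (exists_bc_hom h hY f hf).choose

theorem bcHom_one_tmul (h : Lawful τ) (hY : Lawful θ) (f : J →ₗ[k] SymRing k σ ⊗[k] Y)
    (hf : ∀ a x, f (τ a x) = (symRep σ).tprod θ a (f x)) (w : J) :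
    GLMod.Hom.lin (bcHom h hY f hf) (polyBc σ h (1 ⊗ₜ w)) = polyBc σ hY (f w) :=
  (exists_bc_hom h hY f hf).choose_spec w

theorem mk_one_comm (a : VEnd k) (x : J) :
    TensorProduct.mk k (SymRing k σ) J 1 (τ a x) = (symRep σ).tprod τ a (TensorProduct.mk k (SymRing k σ) J 1 x) := by
  rw [TensorProduct.mk_apply, TensorProduct.mk_apply, tprod_app, symRep_apply, map_one]

/-- The morphism `K ⊗ J → K ⊗ J'` given by `J → E ⊗ J'`. -/
noncomputable def diff (h : Lawful τ) (h' : Lawful τ') (δ : J →ₗ[k] TupleSpace k σ ⊗[k] J')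
    (hδ : ∀ a x, δ (τ a x) = (tupleEnd σ).tprod τ' a (δ x)) : bc σ h ⟶ bc σ h' :=
  bcHom h h' (symComp δ (TensorProduct.mk k _ J' 1)) (symComp_comm hδ mk_one_comm)

theorem diff_comp {h : Lawful τ} {h' : Lawful τ'} {δ : J →ₗ[k] TupleSpace k σ ⊗[k] J'}
    (hδ : ∀ a x, δ (τ a x) = (tupleEnd σ).tprod τ' a (δ x)) (hY : Lawful θ) {ψ : bc σ h' ⟶ bc σ hY}
    {g : J' →ₗ[k] SymRing k σ ⊗[k] Y} (hψ : ∀ w, GLMod.Hom.lin ψ (polyBc σ h' (1 ⊗ₜ w)) = polyBc σ hY (g w))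
    (w : J) : GLMod.Hom.lin (diff h h' δ hδ ≫ ψ) (polyBc σ h (1 ⊗ₜ w)) = polyBc σ hY (symComp δ g w) := by
  rw [GLMod.lin_comp, diff, bcHom_one_tmul]
  exact lin_polyBc_lift h' hY hψ (δ w)

variable {J'' : Type u} [AddCommGroup J''] [Module k J''] {τ'' : Representation k (VEnd k) J''}

theorem IsUniversal.diff_diff {i : ℕ} {u : X →ₗ[k] Wedge k (TupleSpace k σ) i ⊗[k] J}
    {u' : X →ₗ[k] Wedge k (TupleSpace k σ) (i + 1) ⊗[k] J'}
    {u'' : X →ₗ[k] Wedge k (TupleSpace k σ) (i + 1 + 1) ⊗[k] J''}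
    (hu : IsUniversal ξ (wedgeEnd (tupleEnd σ) i) τ u)
    {h : Lawful τ} {h' : Lawful τ'} {h'' : Lawful τ''}
    {δ : J →ₗ[k] TupleSpace k σ ⊗[k] J'} (hδ : ∀ a x, δ (τ a x) = (tupleEnd σ).tprod τ' a (δ x))
    (hδu : ∀ x, δ.lTensor _ (u x) = TensorProduct.assoc k _ _ J' ((extComul k _ i).rTensor J' (u' x)))
    {δ' : J' →ₗ[k] TupleSpace k σ ⊗[k] J''} (hδ' : ∀ a x, δ' (τ' a x) = (tupleEnd σ).tprod τ'' a (δ' x))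
    (hδu' : ∀ x, δ'.lTensor _ (u' x) = TensorProduct.assoc k _ _ J'' ((extComul k _ (i + 1)).rTensor J'' (u'' x))) :
    diff h h' δ hδ ≫ diff h' h'' δ' hδ' = 0 := by
  have h1 : symComp δ (symComp δ' (TensorProduct.mk k (SymRing k σ) J'' 1)) = 0 := hu.ext _ fun x => by
    rw [symComp_lTensor hδu, symComp_lTensor hδu', symKoszul_koszul]
  refine bc_hom_ext h fun w => ?_
  refine (diff_comp hδ h'' (ψ := diff h' h'' δ' hδ') (fun w => bcHom_one_tmul _ _ _ _ w) w).trans ?_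
  rw [h1]
  exact map_zero _

theorem IsUniversal.exists_factor {i : ℕ}
    {u' : X →ₗ[k] Wedge k (TupleSpace k σ) (i + 1) ⊗[k] J'}
    {u'' : X →ₗ[k] Wedge k (TupleSpace k σ) (i + 1 + 1) ⊗[k] J''}
    (hu' : IsUniversal ξ (wedgeEnd (tupleEnd σ) (i + 1)) τ' u')
    (hu'' : IsUniversal ξ (wedgeEnd (tupleEnd σ) (i + 1 + 1)) τ'' u'')
    {h' : Lawful τ'} {h'' : Lawful τ''}
    {δ' : J' →ₗ[k] TupleSpace k σ ⊗[k] J''} (hδ' : ∀ a x, δ' (τ' a x) = (tupleEnd σ).tprod τ'' a (δ' x))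
    (hδu' : ∀ x, δ'.lTensor _ (u' x) = TensorProduct.assoc k _ _ J'' ((extComul k _ (i + 1)).rTensor J'' (u'' x)))
    (hY : Lawful θ) {φ : bc σ h' ⟶ bc σ hY} {f : J' →ₗ[k] SymRing k σ ⊗[k] Y}
    (hf : ∀ a x, f (τ' a x) = (symRep σ).tprod θ a (f x))
    (hφ : ∀ w, GLMod.Hom.lin φ (polyBc σ h' (1 ⊗ₜ w)) = polyBc σ hY (f w))
    (h0 : ∀ x, koszul (symAct _ Y) i (f.lTensor _ (u' x)) = 0) : ∃ ψ, φ = diff h' h'' δ' hδ' ≫ ψ := by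
  obtain ⟨G, hG, hGf⟩ := exists_koszul_lift (F := f.lTensor _ ∘ₗ u') (ξ := ξ) hY (fun a x => by
    rw [LinearMap.comp_apply, hu'.comm, lTensor_comm hf]; rfl) h0
  obtain ⟨g, hg, hgG⟩ := hu''.lift ((lawful_symRep σ).tprod hY) G hG
  have h1 : f - symComp δ' g = 0 := hu'.ext _ fun x => by
    rw [LinearMap.lTensor_sub, LinearMap.sub_apply, symComp_lTensor hδu', hgG, hGf]
    exact sub_self _
  have h2 : f = symComp δ' g := LinearMap.ext fun w => sub_eq_zero.1 (congrArg (fun q => q w) h1)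
  refine ⟨bcHom h'' hY g hg, bc_hom_ext h' fun w => ?_⟩
  rw [diff_comp hδ' hY (fun w => bcHom_one_tmul _ _ _ _ w), hφ, h2]

theorem exists_factor_zero {u' : X →ₗ[k] Wedge k (TupleSpace k σ) (0 + 1) ⊗[k] J'}
    (hu' : IsUniversal ξ (wedgeEnd (tupleEnd σ) (0 + 1)) τ' u') {hξ : Lawful ξ} {h' : Lawful τ'}
    {δ : X →ₗ[k] TupleSpace k σ ⊗[k] J'} (hδ : ∀ a x, δ (ξ a x) = (tupleEnd σ).tprod τ' a (δ x))
    (hδu : ∀ x, δ.lTensor _ (wedge k 0 ![] ⊗ₜ x) =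
      TensorProduct.assoc k _ _ J' ((extComul k _ 0).rTensor J' (u' x)))
    (hu : IsUniversal ξ (wedgeEnd (tupleEnd σ) 0) ξ (TensorProduct.mk k (Wedge k (TupleSpace k σ) 0) X (wedge k 0 ![])))
    (hY : Lawful θ) {φ : bc σ hξ ⟶ bc σ hY} {f : X →ₗ[k] SymRing k σ ⊗[k] Y}
    (hf : ∀ a x, f (ξ a x) = (symRep σ).tprod θ a (f x))
    (hφ : ∀ w, GLMod.Hom.lin φ (polyBc σ hξ (1 ⊗ₜ w)) = polyBc σ hY (f w))
    (h0 : ∀ x, augment _ Y (f x) = 0) : ∃ ψ, φ = diff hξ h' δ hδ ≫ ψ := by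
  obtain ⟨G, hG, hGf⟩ := exists_koszul_lift_zero hY hf h0
  obtain ⟨g, hg, hgG⟩ := hu'.lift ((lawful_symRep σ).tprod hY) G hG
  have h1 : f - symComp δ g = 0 := hu.ext _ fun x => by
    rw [LinearMap.lTensor_sub, LinearMap.sub_apply]
    refine sub_eq_zero.2 (Eq.symm ((symComp_lTensor (u := TensorProduct.mk k (Wedge k (TupleSpace k σ) 0) X
      (wedge k 0 ![])) hδu g x).trans ?_))
    rw [hgG, hGf]
    rfl
  have h2 : f = symComp δ g := LinearMap.ext fun w => sub_eq_zero.1 (congrArg (fun q => q w) h1)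
  refine ⟨bcHom h' hY g hg, bc_hom_ext hξ fun w => ?_⟩
  rw [diff_comp hδ hY (fun w => bcHom_one_tmul _ _ _ _ w), hφ, h2]

theorem isUniversal_zero (hξ : Lawful ξ) (hξ' : FinWt ξ) : IsUniversal ξ (wedgeEnd (tupleEnd σ) 0) ξ
    (TensorProduct.mk k (Wedge k (TupleSpace k σ) 0) X (wedge k 0 ![])) := by
  let e : Wedge k (TupleSpace k σ) 0 →ₗ[k] k := wedgeLift 0 (AlternatingMap.constOfIsEmpty k (TupleSpace k σ) (Fin 0) 1)
  have he : e (wedge k 0 ![]) = 1 := wedgeLift_wedge _ _ _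
  have hw : ∀ w : Wedge k (TupleSpace k σ) 0, w = e w • wedge k 0 ![] := by
    intro w
    have hw : w ∈ Submodule.span k (Set.range (wedge k 0 (E := TupleSpace k σ))) := by
      rw [span_wedge]; trivial
    induction hw using Submodule.span_induction with
    | mem x hx =>
      obtain ⟨v, rfl⟩ := hx
      rw [Subsingleton.elim v ![], he, one_smul]
    | zero => rw [map_zero, zero_smul]
    | add x y _ _ hx hy => rw [map_add, add_smul, ← hx, ← hy]
    | smul c x _ hx => rw [map_smul, smul_assoc, ← hx]
  have hz : ∀ (Y : Type u) [AddCommGroup Y] [Module k Y] (z : Wedge k (TupleSpace k σ) 0 ⊗[k] Y),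
      wedge k 0 ![] ⊗ₜ slice e z = z := by
    intro Y _ _ z
    induction z using TensorProduct.induction_on with
    | zero => simp only [map_zero, TensorProduct.tmul_zero]
    | add x y hx hy => rw [map_add, TensorProduct.tmul_add, hx, hy]
    | tmul w y => rw [slice_tmul, TensorProduct.tmul_smul, TensorProduct.smul_tmul', ← hw]
  have hcomm : ∀ {Y : Type u} [AddCommGroup Y] [Module k Y] (θ : Representation k (VEnd k) Y) (a : VEnd k) (y : Y),
      (wedgeEnd (tupleEnd σ) 0).tprod θ a (wedge k 0 ![] ⊗ₜ y) = wedge k 0 ![] ⊗ₜ θ a y := by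
    intro Y _ _ θ a y
    rw [tprod_app, wedgeEnd_wedge]
    congr 2
    exact Subsingleton.elim _ _
  refine ⟨hξ, hξ', fun a x => (hcomm ξ a x).symm, fun {Q} _ _ g hg => LinearMap.ext fun x => ?_,
    fun {Y} _ _ {θ} hθ G hG => ⟨slice e ∘ₗ G, fun a x => ?_, fun x => hz Y (G x)⟩⟩
  · have := congrArg (slice e) (hg x)
    rw [TensorProduct.mk_apply, LinearMap.lTensor_tmul, slice_tmul, he, one_smul, map_zero] at this
    exact this
  · rw [LinearMap.comp_apply, LinearMap.comp_apply, hG]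
    conv_lhs => rw [← hz Y (G x)]
    rw [hcomm, slice_tmul, he, one_smul]

end Differential

end GLRep

namespace GLRep

section Complex

variable {k : Type u} [Field k] [CharZero k] {r : ℕ} (σ : Fin r → YoungDiagram)

/-- A universal equivariant map `X → ⋀ⁱE ⊗ J`. -/
structure UniversalMap {X : Type u} [AddCommGroup X] [Module k X] (ξ : Representation k (VEnd k) X) (i : ℕ) where
  /-- the underlying space -/
  space : Type u
  [addCommGroup : AddCommGroup space]
  [module : Module k space]
  /-- the action of `End V` -/
  rep : Representation k (VEnd k) space
  /-- the map -/
  map : X →ₗ[k] Wedge k (TupleSpace k σ) i ⊗[k] space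
  isUniversal : IsUniversal ξ (wedgeEnd (tupleEnd σ) i) rep map

attribute [instance] UniversalMap.addCommGroup UniversalMap.module

variable (μ : YoungDiagram)

theorem nonempty_universalMap (i : ℕ) : Nonempty (UniversalMap σ (schurEnd k μ) i) := by
  obtain ⟨J, _, _, τ, u, hu⟩ := exists_universal (lawful_schurEnd μ) (finWt_schurEnd (k := k) μ)
    (isHomog_schurEnd μ) ((lawful_tupleEnd σ).wedgeEnd i) ((finWt_tupleEnd (k := k) σ).wedgeEnd i)
  exact ⟨⟨J, τ, u, hu⟩⟩

variable (k) in
/-- The terms of the resolution of `L_μ`, before base change. -/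
noncomputable def univ : ∀ i, UniversalMap σ (schurEnd k μ) i
  | 0 => ⟨SchurSpace k μ, schurEnd k μ, _, isUniversal_zero (lawful_schurEnd μ) (finWt_schurEnd μ)⟩
  | i + 1 => (nonempty_universalMap σ μ (i + 1)).some

theorem lawful_univ (i : ℕ) : Lawful (univ k σ μ i).rep := (univ k σ μ i).isUniversal.lawful

variable (k) in
/-- The terms of the resolution of `L_μ`. -/
noncomputable def resol (i : ℕ) : GLMod k (RatField k σ) := bc σ (lawful_univ σ μ i)

variable (k) in
/-- The maps `J_i → E ⊗ J_{i+1}` defining the differential. -/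
noncomputable def delta (i : ℕ) : (univ k σ μ i).space →ₗ[k] TupleSpace k σ ⊗[k] (univ k σ μ (i + 1)).space :=
  ((univ k σ μ i).isUniversal.exists_delta (univ k σ μ (i + 1)).isUniversal).choose

theorem delta_comm (i : ℕ) (a : VEnd k) (x : (univ k σ μ i).space) :
    delta k σ μ i ((univ k σ μ i).rep a x) = (tupleEnd σ).tprod (univ k σ μ (i + 1)).rep a (delta k σ μ i x) :=
  ((univ k σ μ i).isUniversal.exists_delta (univ k σ μ (i + 1)).isUniversal).choose_spec.1 a x

theorem delta_map (i : ℕ) (x : SchurSpace k μ) : (delta k σ μ i).lTensor _ ((univ k σ μ i).map x) =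
    TensorProduct.assoc k _ _ _ ((extComul k _ i).rTensor _ ((univ k σ μ (i + 1)).map x)) :=
  ((univ k σ μ i).isUniversal.exists_delta (univ k σ μ (i + 1)).isUniversal).choose_spec.2 x

variable (k) in
/-- The differential of the resolution of `L_μ`. -/
noncomputable def resolD (i : ℕ) : resol k σ μ i ⟶ resol k σ μ (i + 1) :=
  diff (lawful_univ σ μ i) (lawful_univ σ μ (i + 1)) (delta k σ μ i) (delta_comm σ μ i)

theorem resolD_comp (i : ℕ) : resolD k σ μ i ≫ resolD k σ μ (i + 1) = 0 :=
  (univ k σ μ i).isUniversal.diff_diff (delta_comm σ μ i) (delta_map σ μ i) (delta_comm σ μ (i + 1))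
    (delta_map σ μ (i + 1))

variable {σ} {Y : Type u} [AddCommGroup Y] [Module k Y] {θ : Representation k (VEnd k) Y}

theorem exists_resolD_factor (hσ : ∀ j, σ j ≠ ⊥) (i : ℕ) (hY : Lawful θ) (φ : resol k σ μ (i + 1) ⟶ bc σ hY)
    (h : resolD k σ μ i ≫ φ = 0) : ∃ ψ, φ = resolD k σ μ (i + 1) ≫ ψ := by
  obtain ⟨f, hf, hφ⟩ := exists_of_bc_hom hσ (lawful_univ σ μ (i + 1)) hY φ
  refine (univ k σ μ (i + 1)).isUniversal.exists_factor (univ k σ μ (i + 1 + 1)).isUniversal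
    (delta_comm σ μ (i + 1)) (delta_map σ μ (i + 1)) hY hf hφ fun x => ?_
  have h1 : symComp (delta k σ μ i) f = 0 := LinearMap.ext fun w => by
    refine polyBc_injective hY ?_
    refine (diff_comp (h := lawful_univ σ μ i) (delta_comm σ μ i) hY hφ w).symm.trans ?_
    refine (congrArg (fun q => GLMod.Hom.lin q (polyBc σ (lawful_univ σ μ i) (1 ⊗ₜ w))) h).trans ?_
    exact (map_zero _).symm
  rw [← symComp_lTensor (delta_map σ μ i), h1, LinearMap.lTensor_zero, LinearMap.zero_apply]

theorem exists_resolD_factor_zero (hY : Lawful θ) {φ : resol k σ μ 0 ⟶ bc σ hY}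
    {f : SchurSpace k μ →ₗ[k] SymRing k σ ⊗[k] Y}
    (hf : ∀ a x, f (schurEnd k μ a x) = (symRep σ).tprod θ a (f x))
    (hφ : ∀ w, GLMod.Hom.lin φ (polyBc σ (lawful_schurEnd μ) (1 ⊗ₜ w)) = polyBc σ hY (f w))
    (h0 : ∀ x, augment _ Y (f x) = 0) : ∃ ψ, φ = resolD k σ μ 0 ≫ ψ :=
  exists_factor_zero (univ k σ μ (0 + 1)).isUniversal (delta_comm σ μ 0) (delta_map σ μ 0)
    (univ k σ μ 0).isUniversal hY hf hφ h0

theorem resolD_exact (hσ : ∀ j, σ j ≠ ⊥) (i : ℕ) {x : (resol k σ μ (i + 1)).carrier}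
    (hx : GLMod.Hom.lin (resolD k σ μ (i + 1)) x = 0) : ∃ y, GLMod.Hom.lin (resolD k σ μ i) y = x := by
  obtain ⟨m, hm, -⟩ := exists_embedding (GLMod.quot _ _ (GLMod.range_stable (resolD k σ μ i))) hσ
  obtain ⟨ψ, hψ⟩ := exists_resolD_factor μ hσ i (lawful_genRep _) (GLMod.cokerπ (resolD k σ μ i) ≫ m) (by
    rw [← Category.assoc, GLMod.comp_cokerπ, zero_comp])
  have h1 := congrArg (fun q => GLMod.Hom.lin q x) hψ
  simp only [GLMod.lin_comp, hx, map_zero] at h1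
  exact (Submodule.Quotient.mk_eq_zero _).1 (hm (h1.trans (map_zero _).symm))

end Complex
end GLRep

namespace GLRep

section Diagrams

theorem card_cellsOfRowLens (w : List ℕ) : (YoungDiagram.cellsOfRowLens w).card = w.sum := by
  induction w with
  | nil => rfl
  | cons a w ih =>
    rw [YoungDiagram.cellsOfRowLens, Finset.card_union_of_disjoint, Finset.card_map, ih, Finset.card_product,
      Finset.card_singleton, one_mul, Finset.card_range, List.sum_cons]
    rw [Finset.disjoint_left]
    rintro ⟨i, j⟩ h1 h2
    rw [Finset.mem_product, Finset.mem_singleton] at h1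
    obtain ⟨⟨i', j'⟩, -, h⟩ := Finset.mem_map.1 h2
    have h3 : i' + 1 = i := congrArg Prod.fst h
    have h4 : i = 0 := h1.1
    omega

/-- The Young diagrams with `m` cells are at least as many as the conjugacy classes of `S_m`. -/
theorem exists_injective_diagram (m : ℕ) : ∃ f : ConjClasses (Equiv.Perm (Fin m)) → YoungDiagram,
    Function.Injective f ∧ ∀ C, (f C).card = m := by
  have hs : ∀ s : Multiset ℕ, (s.sort (· ≥ ·)).SortedGE := fun s =>
    List.sortedGE_iff_pairwise.2 (s.pairwise_sort (· ≥ ·))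
  let g : Equiv.Perm (Fin m) → YoungDiagram := fun p => YoungDiagram.ofRowLens _ (hs p.partition.parts)
  have hg : ∀ p q, g p = g q → IsConj p q := by
    intro p q h
    have h1 := congrArg YoungDiagram.rowLens h
    rw [YoungDiagram.rowLens_ofRowLens_eq_self, YoungDiagram.rowLens_ofRowLens_eq_self] at h1
    · refine Equiv.Perm.partition_eq_of_isConj.2 (Nat.Partition.ext ?_)
      rw [← Multiset.sort_eq p.partition.parts (· ≥ ·), h1, Multiset.sort_eq]
    · exact fun x hx => q.partition.parts_pos ((Multiset.mem_sort _).1 hx)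
    · exact fun x hx => p.partition.parts_pos ((Multiset.mem_sort _).1 hx)
  refine ⟨fun C => g (Quotient.out C), fun C D h => ?_, fun C => ?_⟩
  · have h1 := ConjClasses.mk_eq_mk_iff_isConj.2 (hg _ _ h)
    have hC : ConjClasses.mk (Quotient.out C) = C := Quotient.out_eq C
    have hD : ConjClasses.mk (Quotient.out D) = D := Quotient.out_eq D
    rwa [hC, hD] at h1
  · refine (card_cellsOfRowLens _).trans ?_
    rw [← Multiset.sum_coe, Multiset.sort_eq, Nat.Partition.parts_sum, Fintype.card_fin]

theorem sum_range_card_le (s : Finset ℕ) : ∑ i ∈ Finset.range s.card, i ≤ ∑ i ∈ s, i ∧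
    (∑ i ∈ Finset.range s.card, i = ∑ i ∈ s, i → s = Finset.range s.card) := by
  have h1 := Finset.sum_inter_add_sum_sdiff (Finset.range s.card) s fun i : ℕ => i
  have h2 := Finset.sum_inter_add_sum_sdiff s (Finset.range s.card) fun i : ℕ => i
  rw [Finset.inter_comm] at h2
  have hc : (s \ Finset.range s.card).card = (Finset.range s.card \ s).card :=
    Finset.card_sdiff_comm (Finset.card_range _).symm
  have h3 : (s \ Finset.range s.card).card * s.card ≤ ∑ i ∈ s \ Finset.range s.card, i := by
    rw [← smul_eq_mul]
    refine Finset.card_nsmul_le_sum _ _ _ fun i hi => ?_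
    rw [Finset.mem_sdiff, Finset.mem_range, not_lt] at hi
    exact hi.2
  have h4 : ∑ i ∈ Finset.range s.card \ s, (i + 1) ≤ (Finset.range s.card \ s).card * s.card := by
    rw [← smul_eq_mul]
    refine Finset.sum_le_card_nsmul _ _ _ fun i hi => ?_
    rw [Finset.mem_sdiff, Finset.mem_range] at hi
    exact hi.1
  rw [Finset.sum_add_distrib, Finset.sum_const, smul_eq_mul, mul_one, ← hc] at h4
  refine ⟨by omega, fun h => ?_⟩
  have h5 : (s \ Finset.range s.card).card = 0 := by omega
  exact Finset.eq_of_subset_of_card_le (Finset.sdiff_eq_empty_iff_subset.1 (Finset.card_eq_zero.1 h5))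
    (Finset.card_range _).le

variable {α : Type*} [Fintype α]

/-- A bijection between the cells of `ν` and `α`, given by its row and column coordinates. -/
def IsTableau (ν : YoungDiagram) (r c : α → ℕ) : Prop :=
  Function.Injective (fun x => (r x, c x)) ∧ Finset.univ.image (fun x => (r x, c x)) = ν.cells

theorem exists_isTableau {ν : YoungDiagram} (e : ν.cells ≃ α) :
    IsTableau ν (fun x => (e.symm x).1.1) (fun x => (e.symm x).1.2) := by
  refine ⟨fun x y h => e.symm.injective (Subtype.ext h), Finset.ext fun z => ?_⟩
  rw [Finset.mem_image]
  refine ⟨?_, fun hz => ⟨e ⟨z, hz⟩, Finset.mem_univ _, ?_⟩⟩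
  · rintro ⟨x, -, rfl⟩
    exact (e.symm x).2
  · change (e.symm (e ⟨z, hz⟩)).1 = z
    rw [e.symm_apply_apply]

theorem IsTableau.card_col {ν : YoungDiagram} {r c : α → ℕ} (h : IsTableau ν r c) (j : ℕ) :
    (Finset.univ.filter fun x => c x = j).card = ν.colLen j := by
  rw [YoungDiagram.colLen_eq_card, YoungDiagram.col, ← h.2, Finset.filter_image, Finset.card_image_of_injective _ h.1]

theorem IsTableau.card_row {ν : YoungDiagram} {r c : α → ℕ} (h : IsTableau ν r c) (i : ℕ) :
    (Finset.univ.filter fun x => r x = i).card = ν.rowLen i := by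
  rw [YoungDiagram.rowLen_eq_card, YoungDiagram.row, ← h.2, Finset.filter_image, Finset.card_image_of_injective _ h.1]

theorem IsTableau.sum_col {ν : YoungDiagram} {r c : α → ℕ} (h : IsTableau ν r c) (j : ℕ) :
    ∑ x with c x = j, r x = ∑ i ∈ Finset.range (ν.colLen j), i := by
  have : Finset.range (ν.colLen j) = (Finset.univ.filter fun x => c x = j).image r := by
    ext i
    rw [Finset.mem_range, ← YoungDiagram.mem_iff_lt_colLen, ← YoungDiagram.mem_cells, ← h.2, Finset.mem_image,
      Finset.mem_image]
    constructor
    · rintro ⟨x, -, hx⟩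
      exact ⟨x, by simpa using congrArg Prod.snd hx, congrArg Prod.fst hx⟩
    · rintro ⟨x, hx, rfl⟩
      exact ⟨x, Finset.mem_univ _, Prod.ext rfl (by simpa using hx)⟩
  rw [this, Finset.sum_image]
  intro x hx y hy hxy
  simp only [Finset.coe_filter, Finset.mem_univ, true_and, Set.mem_ofPred_eq] at hx hy
  exact h.1 (Prod.ext hxy (hx.trans hy.symm))

theorem sum_eq_sum_col (c r : α → ℕ) : ∑ x, r x = ∑ j ∈ Finset.univ.image c, ∑ x with c x = j, r x :=
  (Finset.sum_fiberwise_of_maps_to (fun x _ => Finset.mem_image_of_mem c (Finset.mem_univ x)) r).symm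

/-- Dominance: a tableau whose rows meet the columns of another in at most one element. -/
theorem IsTableau.le_of_injective {ν μ : YoungDiagram} {r c r' c' : α → ℕ} (h : IsTableau ν r c)
    (h' : IsTableau μ r' c') (g : Equiv.Perm α) (hi : Function.Injective fun x => (r (g x), c' x)) :
    ∑ x, r' x ≤ ∑ x, r x ∧ (∑ x, r' x = ∑ x, r x → ν = μ) := by
  have key : ∀ j, ∑ x with c' x = j, r (g x) = ∑ i ∈ (Finset.univ.filter fun x => c' x = j).image (r ∘ g), i := by
    intro j
    rw [Finset.sum_image]
    · rfl
    · intro x hx y hy hxy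
      simp only [Finset.coe_filter, Finset.mem_univ, true_and, Set.mem_ofPred_eq] at hx hy
      exact hi (Prod.ext hxy (hx.trans hy.symm))
  have hcard : ∀ j, ((Finset.univ.filter fun x => c' x = j).image (r ∘ g)).card = μ.colLen j := by
    intro j
    rw [← h'.card_col j, Finset.card_image_of_injOn]
    intro x hx y hy hxy
    simp only [Finset.coe_filter, Finset.mem_univ, true_and, Set.mem_ofPred_eq] at hx hy
    exact hi (Prod.ext hxy (hx.trans hy.symm))
  have hle : ∀ j, ∑ x with c' x = j, r' x ≤ ∑ x with c' x = j, r (g x) := by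
    intro j
    rw [key, h'.sum_col, ← hcard]
    exact (sum_range_card_le _).1
  have hsum : ∑ x, r x = ∑ x, r (g x) := (Equiv.sum_comp g r).symm
  rw [hsum, sum_eq_sum_col c' r', sum_eq_sum_col c' (fun x => r (g x))]
  refine ⟨Finset.sum_le_sum fun j _ => hle j, fun heq => ?_⟩
  have h1 := (Finset.sum_eq_sum_iff_of_le fun j _ => hle j).1 heq
  have h2 : ∀ x, r (g x) < μ.colLen (c' x) := by
    intro x
    have h3 := h1 (c' x) (Finset.mem_image_of_mem _ (Finset.mem_univ x))
    rw [key, h'.sum_col, ← hcard] at h3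
    have h4 := (sum_range_card_le _).2 h3
    rw [hcard] at h4
    rw [← Finset.mem_range, ← h4]
    exact Finset.mem_image_of_mem _ (by simp)
  have h5 : Finset.univ.image (fun x => (r (g x), c' x)) = μ.cells := by
    refine Finset.eq_of_subset_of_card_le (fun z hz => ?_) ?_
    · obtain ⟨x, -, rfl⟩ := Finset.mem_image.1 hz
      exact (YoungDiagram.mem_cells _).2 (YoungDiagram.mem_iff_lt_colLen.2 (h2 x))
    · rw [← h'.2, Finset.card_image_of_injective _ hi, Finset.card_image_of_injective _ h'.1]
  have h6 : IsTableau μ (r ∘ g) c' := ⟨hi, h5⟩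
  have h7 : ∀ i, ν.rowLen i = μ.rowLen i := by
    intro i
    rw [← h.card_row, ← h6.card_row]
    refine (Finset.card_bij (fun x _ => g x) (fun x hx => ?_) (fun x _ y _ hxy => g.injective hxy)
      fun y hy => ⟨g.symm y, ?_, g.apply_symm_apply y⟩).symm
    · simpa using hx
    · simpa using hy
  refine SetLike.ext fun ⟨i, j⟩ => ?_
  rw [YoungDiagram.mem_iff_lt_rowLen, YoungDiagram.mem_iff_lt_rowLen, h7]

end Diagrams

section Symmetrizers

variable (k : Type*) [Field k] {α : Type*} [Fintype α] [DecidableEq α]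

/-- The sum of the permutations preserving a function. -/
noncomputable def rowSum (r : α → ℕ) : MonoidAlgebra k (Equiv.Perm α) :=
  ∑ p : Equiv.Perm α with ∀ x, r (p x) = r x, MonoidAlgebra.single p 1

/-- The signed sum of the permutations preserving a function. -/
noncomputable def colSum (c : α → ℕ) : MonoidAlgebra k (Equiv.Perm α) :=
  ∑ q : Equiv.Perm α with ∀ x, c (q x) = c x, MonoidAlgebra.single q ((Equiv.Perm.sign q : ℤ) : k)

variable {k} {r c : α → ℕ}

theorem rowSum_mul_single {t : Equiv.Perm α} (ht : ∀ x, r (t x) = r x) :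
    rowSum k r * MonoidAlgebra.single t 1 = rowSum k r := by
  rw [rowSum, Finset.sum_mul]
  refine Finset.sum_equiv (Equiv.mulRight t) (fun p => ?_) fun p _ => ?_
  · simp only [Finset.mem_filter, Finset.mem_univ, true_and, Equiv.coe_mulRight, Equiv.Perm.mul_apply]
    refine ⟨fun h x => (h _).trans (ht x), fun h x => ?_⟩
    have := (h (t⁻¹ x)).trans (ht (t⁻¹ x)).symm
    rwa [Equiv.Perm.inv_def, Equiv.apply_symm_apply] at this
  · rw [MonoidAlgebra.single_mul_single, one_mul]
    rfl

theorem single_mul_colSum {t : Equiv.Perm α} (ht : ∀ x, c (t x) = c x) :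
    MonoidAlgebra.single t 1 * colSum k c = ((Equiv.Perm.sign t : ℤ) : k) • colSum k c := by
  rw [colSum, Finset.mul_sum, Finset.smul_sum]
  refine Finset.sum_equiv (Equiv.mulLeft t) (fun p => ?_) fun p _ => ?_
  · simp only [Finset.mem_filter, Finset.mem_univ, true_and, Equiv.coe_mulLeft, Equiv.Perm.mul_apply, ht]
  · rw [MonoidAlgebra.single_mul_single, one_mul, Equiv.coe_mulLeft, MonoidAlgebra.smul_single, map_mul]
    congr 1
    rcases Int.units_eq_one_or (Equiv.Perm.sign t) with h | h <;> simp [h]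

theorem rowSum_mul_colSum_eq_zero [CharZero k] (g : Equiv.Perm α)
    (h : ¬ Function.Injective fun x => (r (g x), c x)) :
    rowSum k r * MonoidAlgebra.single g 1 * colSum k c = 0 := by
  obtain ⟨x, y, hxy, hne⟩ : ∃ x y, (r (g x), c x) = (r (g y), c y) ∧ x ≠ y := by
    simpa only [Function.Injective, not_forall, exists_prop] using h
  have hr : ∀ z, r (Equiv.swap (g x) (g y) z) = r z := by
    intro z
    have h1 : r (g x) = r (g y) := congrArg Prod.fst hxy
    rcases eq_or_ne z (g x) with rfl | hx
    · rw [Equiv.swap_apply_left, h1]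
    · rcases eq_or_ne z (g y) with rfl | hy
      · rw [Equiv.swap_apply_right, h1]
      · rw [Equiv.swap_apply_of_ne_of_ne hx hy]
  have hc : ∀ z, c (Equiv.swap x y z) = c z := by
    intro z
    have h1 : c x = c y := congrArg Prod.snd hxy
    rcases eq_or_ne z x with rfl | hx
    · rw [Equiv.swap_apply_left, h1]
    · rcases eq_or_ne z y with rfl | hy
      · rw [Equiv.swap_apply_right, h1]
      · rw [Equiv.swap_apply_of_ne_of_ne hx hy]
  have h1 : MonoidAlgebra.single (Equiv.swap (g x) (g y)) (1 : k) * MonoidAlgebra.single g 1 =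
      MonoidAlgebra.single g 1 * MonoidAlgebra.single (Equiv.swap x y) 1 := by
    rw [MonoidAlgebra.single_mul_single, MonoidAlgebra.single_mul_single, Equiv.mul_swap_eq_swap_mul]
  have h2 := single_mul_colSum (k := k) hc
  rw [Equiv.Perm.sign_swap hne] at h2
  have h3 : rowSum k r * MonoidAlgebra.single g 1 * colSum k c =
      -(rowSum k r * MonoidAlgebra.single g 1 * colSum k c) := by
    conv_lhs => rw [← rowSum_mul_single hr, mul_assoc (rowSum k r), h1, ← mul_assoc, mul_assoc _ _ (colSum k c), h2]
    simp
  have h4 : (2 : k) • (rowSum k r * MonoidAlgebra.single g 1 * colSum k c) = 0 := by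
    rw [two_smul]
    exact eq_neg_iff_add_eq_zero.1 h3
  exact (smul_eq_zero.1 h4).resolve_left two_ne_zero

theorem coeff_colSum_mul_rowSum (h : Function.Injective fun x => (r x, c x)) :
    (colSum k c * rowSum k r).coeff 1 = 1 := by
  have h1 : ∀ q p : Equiv.Perm α, (∀ x, c (q x) = c x) → (∀ x, r (p x) = r x) → q * p = 1 → p = 1 := by
    intro q p hq hp hqp
    refine Equiv.ext fun x => h (Prod.ext (hp x) ?_)
    have : q = p⁻¹ := eq_inv_of_mul_eq_one_left hqp
    have h2 := hq (p x)
    rw [this, Equiv.Perm.inv_def, Equiv.symm_apply_apply] at h2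
    exact h2.symm
  rw [colSum, rowSum, Finset.sum_mul_sum, MonoidAlgebra.coeff_sum, Finset.sum_apply']
  simp only [MonoidAlgebra.coeff_sum, Finset.sum_apply', MonoidAlgebra.single_mul_single,
    MonoidAlgebra.coeff_single, Finsupp.single_apply, mul_one]
  rw [Finset.sum_eq_single 1, Finset.sum_eq_single 1]
  · simp
  · intro p hp hp1
    rw [if_neg]
    exact fun h => hp1 (by simpa using h)
  · intro h
    simp at h
  · intro q hq hq1
    refine Finset.sum_eq_zero fun p hp => if_neg fun hqp => hq1 ?_
    rw [Finset.mem_filter] at hq hp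
    have := h1 q p hq.2 hp.2 hqp
    rwa [this, mul_one] at hqp
  · intro h
    simp at h

end Symmetrizers

section Average

variable {k : Type*} [Field k] {G : Type*} [Group G] [Fintype G]

/-- The sum of the conjugates of an element of a group algebra. -/
noncomputable def conjSum (z : MonoidAlgebra k G) : MonoidAlgebra k G :=
  ∑ g : G, MonoidAlgebra.single g 1 * z * MonoidAlgebra.single g⁻¹ 1

theorem conjSum_comm (z : MonoidAlgebra k G) (h : G) :
    conjSum z * MonoidAlgebra.single h 1 = MonoidAlgebra.single h 1 * conjSum z := by
  rw [conjSum, Finset.sum_mul, Finset.mul_sum]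
  refine Finset.sum_equiv (Equiv.mulLeft h⁻¹) (fun _ => by simp) fun g _ => ?_
  rw [Equiv.coe_mulLeft, mul_assoc, MonoidAlgebra.single_mul_single, ← mul_assoc, ← mul_assoc,
    MonoidAlgebra.single_mul_single, mul_inv_cancel_left, mul_inv_rev, inv_inv, one_mul]

theorem coeff_conjSum_one (z : MonoidAlgebra k G) : (conjSum z).coeff 1 = Fintype.card G * z.coeff 1 := by
  rw [conjSum, MonoidAlgebra.coeff_sum, Finset.sum_apply']
  simp only [MonoidAlgebra.coeff_mul_single_apply, MonoidAlgebra.coeff_single_mul_apply]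
  simp

theorem coeff_conjSum_conj (z : MonoidAlgebra k G) (h g : G) :
    (conjSum z).coeff (h * g * h⁻¹) = (conjSum z).coeff g := by
  have h1 := congrArg (fun y => y.coeff (h * g)) (conjSum_comm z h)
  simpa [MonoidAlgebra.coeff_mul_single_apply, MonoidAlgebra.coeff_single_mul_apply] using h1

theorem coeff_one_eq_zero_of_mul_self [CharZero k] {z : MonoidAlgebra k G} (hz : z * z = 0) : z.coeff 1 = 0 := by
  classical
  have h1 : IsNilpotent (LinearMap.mulLeft k z) := ⟨2, LinearMap.ext fun x => by
    rw [pow_two, Module.End.mul_apply, LinearMap.mulLeft_apply, LinearMap.mulLeft_apply, ← mul_assoc, hz, zero_mul]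
    rfl⟩
  have h2 := (LinearMap.isNilpotent_trace_of_isNilpotent h1).eq_zero
  rw [LinearMap.trace_eq_matrix_trace k (MonoidAlgebra.basis G k), Matrix.trace] at h2
  have h3 : ∀ g : G, Matrix.diag (LinearMap.toMatrix (MonoidAlgebra.basis G k) (MonoidAlgebra.basis G k)
      (LinearMap.mulLeft k z)) g = z.coeff 1 := by
    intro g
    rw [Matrix.diag_apply, LinearMap.toMatrix_apply, MonoidAlgebra.basis_apply, LinearMap.mulLeft_apply]
    change (z * MonoidAlgebra.single g 1).coeff g = _
    rw [MonoidAlgebra.coeff_mul_single_apply, mul_inv_cancel, mul_one]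
  simp only [h3, Finset.sum_const, Finset.card_univ, nsmul_eq_mul] at h2
  rcases mul_eq_zero.1 h2 with h | h
  · exact absurd h (Nat.cast_ne_zero.2 Fintype.card_ne_zero)
  · exact h

end Average

end GLRep

namespace GLRep

section Completeness

variable {k : Type*} [Field k] [CharZero k] {m : ℕ}

/-- The Young symmetrizers do not all vanish on a nonzero representation of a symmetric group. -/
theorem exists_symmetrizer_ne_zero {W : Type*} [AddCommGroup W] [Module k W]
    (ρ : Representation k (Equiv.Perm (Fin m)) W) {w : W} (hw : w ≠ 0) :
    ∃ (ν : YoungDiagram) (e : ν.cells ≃ Fin m) (t : Equiv.Perm (Fin m)),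
      ρ.asAlgebraHom (colSum k (fun x => (e.symm x).1.2) * rowSum k fun x => (e.symm x).1.1) (ρ t w) ≠ 0 := by
  classical
  by_contra! h0
  obtain ⟨f, hf, hcard⟩ := exists_injective_diagram m
  have e : ∀ C, (f C).cells ≃ Fin m := fun C => Finset.equivFinOfCardEq (hcard C)
  let R : ConjClasses (Equiv.Perm (Fin m)) → Fin m → ℕ := fun C x => ((e C).symm x).1.1
  let S : ConjClasses (Equiv.Perm (Fin m)) → Fin m → ℕ := fun C x => ((e C).symm x).1.2
  have hT : ∀ C, IsTableau (f C) (R C) (S C) := fun C => exists_isTableau (e C)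
  let γ : ConjClasses (Equiv.Perm (Fin m)) → MonoidAlgebra k (Equiv.Perm (Fin m)) :=
    fun C => colSum k (S C) * rowSum k (R C)
  let F : ConjClasses (Equiv.Perm (Fin m)) → ConjClasses (Equiv.Perm (Fin m)) → k :=
    fun C D => (conjSum (γ C)).coeff (Quotient.out D)
  have hconj : ∀ C g h, IsConj g h → (conjSum (γ C)).coeff g = (conjSum (γ C)).coeff h := by
    intro C g h hgh
    obtain ⟨c, rfl⟩ := isConj_iff.1 hgh
    exact (coeff_conjSum_conj _ _ _).symm
  have hmk : ∀ g : Equiv.Perm (Fin m), IsConj (Quotient.out (ConjClasses.mk g)) g := fun g =>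
    ConjClasses.mk_eq_mk_iff_isConj.1 (Quotient.out_eq (ConjClasses.mk g))
  have hcoeff : ∀ (a : ConjClasses (Equiv.Perm (Fin m)) → k) g,
      (∑ C, a C • conjSum (γ C)).coeff g = (∑ C, a C • F C) (ConjClasses.mk g) := by
    intro a g
    rw [MonoidAlgebra.coeff_sum, Finset.sum_apply', Finset.sum_apply]
    refine Finset.sum_congr rfl fun C _ => ?_
    rw [MonoidAlgebra.coeff_smul_apply, Pi.smul_apply, hconj C _ _ (hmk g).symm]
  have hvan : ∀ C D, conjSum (γ C) * γ D ≠ 0 → ∑ x, R D x ≤ ∑ x, R C x ∧ (∑ x, R D x = ∑ x, R C x → C = D) := by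
    intro C D h
    obtain ⟨g, hg⟩ : ∃ g : Equiv.Perm (Fin m), Function.Injective fun x => (R C (g x), S D x) := by
      by_contra! hg
      refine h ?_
      rw [conjSum, Finset.sum_mul]
      refine Finset.sum_eq_zero fun g _ => ?_
      have h1 := rowSum_mul_colSum_eq_zero (k := k) g⁻¹ (hg g⁻¹)
      simp only [γ, mul_assoc] at h1 ⊢
      rw [← mul_assoc _ (colSum k (S D)), ← mul_assoc (rowSum k (R C)), h1, zero_mul, mul_zero, mul_zero]
    obtain ⟨h1, h2⟩ := (hT C).le_of_injective (hT D) g hg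
    exact ⟨h1, fun h => hf (h2 h)⟩
  have hsq : ∀ C, conjSum (γ C) * γ C ≠ 0 := by
    intro C h
    have h1 : conjSum (γ C) * conjSum (γ C) = 0 := by
      change conjSum (γ C) * ∑ g, MonoidAlgebra.single g 1 * γ C * MonoidAlgebra.single g⁻¹ 1 = 0
      rw [Finset.mul_sum]
      refine Finset.sum_eq_zero fun g _ => ?_
      rw [← mul_assoc, ← mul_assoc, conjSum_comm, mul_assoc _ (conjSum (γ C)), h, mul_zero, zero_mul]
    have h2 := coeff_one_eq_zero_of_mul_self h1
    rw [coeff_conjSum_one, coeff_colSum_mul_rowSum (hT C).1, mul_one] at h2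
    exact Nat.cast_ne_zero.2 Fintype.card_ne_zero h2
  have hli : LinearIndependent k F := by
    rw [Fintype.linearIndependent_iff]
    intro a ha
    by_contra! hne
    have h1 : ∑ C, a C • conjSum (γ C) = 0 := by
      refine MonoidAlgebra.coeff_injective (Finsupp.ext fun g => ?_)
      rw [hcoeff, ha]
      rfl
    obtain ⟨D, hD, hmax⟩ := Finset.exists_max_image (Finset.univ.filter fun C => a C ≠ 0) (fun C => ∑ x, R C x)
      (by obtain ⟨i, hi⟩ := hne; exact ⟨i, by simpa using hi⟩)
    have h2 := congrArg (· * γ D) h1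
    simp only [Finset.sum_mul, zero_mul] at h2
    rw [Finset.sum_eq_single D] at h2
    · rw [smul_mul_assoc, smul_eq_zero] at h2
      exact h2.elim (Finset.mem_filter.1 hD).2 (hsq D)
    · intro C _ hCD
      rw [smul_mul_assoc]
      by_cases hC : a C = 0
      · rw [hC, zero_smul]
      · by_cases hz : conjSum (γ C) * γ D = 0
        · rw [hz, smul_zero]
        · obtain ⟨h3, h4⟩ := hvan C D hz
          exact absurd (h4 (le_antisymm h3 (hmax C (by simpa using hC)))) hCD
    · exact fun h => absurd (Finset.mem_univ D) h
  have hspan := hli.span_eq_top_of_card_eq_finrank' (Module.finrank_fintype_fun_eq_card k).symm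
  obtain ⟨a, ha⟩ := (Submodule.mem_span_range_iff_exists_fun k).1
    (hspan ▸ Submodule.mem_top : (Pi.single (ConjClasses.mk 1) 1 : ConjClasses (Equiv.Perm (Fin m)) → k) ∈ _)
  have hone : ∑ C, a C • conjSum (γ C) = 1 := by
    refine MonoidAlgebra.coeff_injective (Finsupp.ext fun g => ?_)
    rw [hcoeff, ha, MonoidAlgebra.one_def, MonoidAlgebra.coeff_single, Finsupp.single_apply, Pi.single_apply]
    refine if_congr ?_ rfl rfl
    rw [ConjClasses.mk_eq_mk_iff_isConj, isConj_comm, isConj_one_right, eq_comm]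
  apply hw
  have h5 : ρ.asAlgebraHom (∑ C, a C • conjSum (γ C)) w = w := by rw [hone, map_one]; rfl
  rw [← h5, map_sum, LinearMap.sum_apply]
  refine Finset.sum_eq_zero fun C _ => ?_
  rw [map_smul, LinearMap.smul_apply, conjSum, map_sum, LinearMap.sum_apply, Finset.sum_eq_zero, smul_zero]
  intro g _
  rw [mul_assoc, map_mul, map_mul, Module.End.mul_apply, Module.End.mul_apply, Representation.asAlgebraHom_single_one,
    Representation.asAlgebraHom_single_one, h0, map_zero]

theorem asAlgebraHom_symmetrizer {W : Type*} [AddCommGroup W] [Module k W]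
    (ρ : Representation k (Equiv.Perm (Fin m)) W) {ν : YoungDiagram} (e : ν.cells ≃ Fin m) (w : W) :
    ρ.asAlgebraHom (colSum k (fun x => (e.symm x).1.2) * rowSum k fun x => (e.symm x).1.1) w =
      ∑ p : Equiv.Perm ν.cells with ∀ c, (p c).1.1 = c.1.1,
        ∑ q : Equiv.Perm ν.cells with ∀ c, (q c).1.2 = c.1.2,
          ((Equiv.Perm.sign q : ℤ) : k) • ρ (e.permCongr (q⁻¹ * p⁻¹)) w := by
  rw [colSum, rowSum, Finset.sum_mul_sum, map_sum, LinearMap.sum_apply]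
  simp only [map_sum, LinearMap.sum_apply, MonoidAlgebra.single_mul_single, Representation.asAlgebraHom_single,
    LinearMap.smul_apply, mul_one]
  rw [Finset.sum_comm]
  have hmem : ∀ (d : ν.cells → ℕ) (p : Equiv.Perm ν.cells), (∀ x, d (e.symm ((e.permCongr p)⁻¹ x)) = d (e.symm x)) ↔
      ∀ c, d (p c) = d c := by
    intro d p
    refine ⟨fun h c => ?_, fun h x => ?_⟩
    · have h1 := h (e (p c))
      have h2 : (e.permCongr p)⁻¹ (e (p c)) = e c := by
        rw [Equiv.Perm.inv_eq_iff_eq, Equiv.permCongr_apply, Equiv.symm_apply_apply]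
      rw [h2, Equiv.symm_apply_apply, Equiv.symm_apply_apply] at h1
      exact h1.symm
    · have h1 := h (e.symm ((e.permCongr p)⁻¹ x))
      have h2 : p (e.symm ((e.permCongr p)⁻¹ x)) = e.symm x := by
        rw [Equiv.eq_symm_apply, ← Equiv.permCongr_apply, ← Equiv.Perm.mul_apply, mul_inv_cancel]
        rfl
      rw [h2] at h1
      exact h1.symm
  refine (Finset.sum_equiv (e.permCongr.trans (Equiv.inv _)) (fun p => ?_) fun p _ =>
    Finset.sum_equiv (e.permCongr.trans (Equiv.inv _)) (fun q => ?_) fun q _ => ?_).symm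
  · simp only [Finset.mem_filter, Finset.mem_univ, true_and]
    exact (hmem (fun c => c.1.1) p).symm
  · simp only [Finset.mem_filter, Finset.mem_univ, true_and]
    exact (hmem (fun c => c.1.2) q).symm
  · have h1 : e.permCongr (q⁻¹ * p⁻¹) = (e.permCongr q)⁻¹ * (e.permCongr p)⁻¹ := by
      have hinv : ∀ p : Equiv.Perm ν.cells, (e.permCongr p)⁻¹ = e.permCongr p⁻¹ := fun p =>
        inv_eq_of_mul_eq_one_right (Equiv.ext fun x => by simp [Equiv.permCongr_apply])
      rw [hinv, hinv]
      exact Equiv.ext fun x => by simp [Equiv.permCongr_apply]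
    have h2 : Equiv.Perm.sign ((e.permCongr q)⁻¹) = Equiv.Perm.sign q := by
      rw [Equiv.Perm.sign_inv, Equiv.Perm.sign_permCongr]
    change _ = ((Equiv.Perm.sign ((e.permCongr q)⁻¹) : ℤ) : k) • ρ ((e.permCongr q)⁻¹ * (e.permCongr p)⁻¹) w
    rw [h2, h1]

end Completeness

section Detection

variable {k : Type u} [Field k] [CharZero k] {Y : Type*} [AddCommGroup Y] [Module k Y]
  {θ : Representation k (VEnd k) Y}

/-- The projection from the tensor power to `S_ν(V)`. -/
noncomputable def schurProj (ν : YoungDiagram) : TPow k ν.cells →ₗ[k] SchurSpace k ν :=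
  (youngSymmetrizer k ν).rangeRestrict

theorem schurIncl_schurProj (ν : YoungDiagram) (x : TPow k ν.cells) :
    schurIncl ν (schurProj ν x) = youngSymmetrizer k ν x := rfl

theorem schurProj_comm (ν : YoungDiagram) (a : VEnd k) (x : TPow k ν.cells) :
    schurProj ν (tensorEnd k ν.cells a x) = schurEnd k ν a (schurProj ν x) :=
  (lawful_tensorEnd ν.cells).map_of_res (lawful_schurEnd ν) (schurProj ν) (fun g x => by
    have h1 : schurEnd k ν (stdRep k g) = schurRep k ν g := ext_stdRep _ _ g
    rw [h1]
    exact Subtype.ext (youngSymmetrizer_comm k ν g x)) a x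

theorem reindex_tpr (ι : Type) (p : Equiv.Perm ι) (v : ι → StdSpace k) :
    PiTensorProduct.reindex k (fun _ => StdSpace k) p (tpr k ι v) = tpr k ι fun i => v (p.symm i) :=
  PiTensorProduct.reindex_tprod p v

theorem youngSymmetrizer_tpr (ν : YoungDiagram) (v : ν.cells → StdSpace k) :
    youngSymmetrizer k ν (tpr k ν.cells v) = ∑ p : Equiv.Perm ν.cells with ∀ c, (p c).1.1 = c.1.1,
        ∑ q : Equiv.Perm ν.cells with ∀ c, (q c).1.2 = c.1.2,
          ((Equiv.Perm.sign q : ℤ) : k) • tpr k ν.cells fun i => v ((q⁻¹ * p⁻¹) i) := by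
  have h : ∀ x : ⨂[k] _ : ν.cells, StdSpace k, youngSymmetrizer k ν x =
      ∑ p : Equiv.Perm ν.cells with ∀ c, (p c).1.1 = c.1.1, ∑ q : Equiv.Perm ν.cells with ∀ c, (q c).1.2 = c.1.2,
        ((Equiv.Perm.sign q : ℤ) : k) • PiTensorProduct.reindex k (fun _ => StdSpace k) p
          (PiTensorProduct.reindex k (fun _ => StdSpace k) q x) := by
    intro x
    rw [youngSymmetrizer, LinearMap.sum_apply]
    refine Finset.sum_congr rfl fun p _ => ?_
    rw [LinearMap.sum_apply]
    rfl
  refine (h _).trans (Finset.sum_congr rfl fun p _ => Finset.sum_congr rfl fun q _ => ?_)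
  rw [reindex_tpr, reindex_tpr]
  rfl

theorem exists_hom_schur_of_mlin (hθ : Lawful θ) {m : ℕ} {c : Y} (hc : c ∈ mlin θ m) (h0 : c ≠ 0) :
    ∃ (ν : YoungDiagram) (f : Y →ₗ[k] SchurSpace k ν), (∀ a y, f (θ a y) = schurEnd k ν a (f y)) ∧ f c ≠ 0 := by
  have h0' : (⟨c, hc⟩ : mlin θ m) ≠ 0 := fun h => h0 (congrArg Subtype.val h)
  obtain ⟨ν, e, t, ht⟩ := exists_symmetrizer_ne_zero (permRep θ m) h0'
  obtain ⟨φ, hφ⟩ : ∃ φ : Module.Dual k (mlin θ m), φ ((permRep θ m).asAlgebraHom (colSum k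
      (fun x => (e.symm x).1.2) * rowSum k fun x => (e.symm x).1.1) (permRep θ m t ⟨c, hc⟩)) ≠ 0 := by
    by_contra! h
    exact ht ((Module.forall_dual_apply_eq_zero_iff k _).1 h)
  obtain ⟨f, hf, hfφ⟩ := exists_hom_tensor_sum e hθ φ
  obtain ⟨d, hd⟩ := exists_diag (k := k) e
  refine ⟨ν, schurProj ν ∘ₗ f, fun a y => ?_, fun h => hφ ?_⟩
  · rw [LinearMap.comp_apply, hf, schurProj_comm]
    rfl
  have h1 : schurProj ν (f (permRep θ m t ⟨c, hc⟩)) = 0 := by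
    rw [permRep_coe, hf, schurProj_comm]
    change schurEnd k ν _ ((schurProj ν ∘ₗ f) c) = 0
    rw [h, map_zero]
  let D : TPow k ν.cells →ₗ[k] k := d ∘ₗ schurIncl ν ∘ₗ schurProj ν
  have h2 : D (f (permRep θ m t ⟨c, hc⟩)) = 0 := by
    change d (schurIncl ν (schurProj ν _)) = 0
    rw [h1, map_zero, map_zero]
  rw [asAlgebraHom_symmetrizer, ← h2, hfφ]
  have h3 : ∀ s : Equiv.Perm (Fin m), D (tensorEnd k ν.cells (permEnd k s)
      (tpr k ν.cells fun i => bv k (e i))) = ∑ p : Equiv.Perm ν.cells with ∀ c, (p c).1.1 = c.1.1,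
        ∑ q : Equiv.Perm ν.cells with ∀ c, (q c).1.2 = c.1.2,
          ((Equiv.Perm.sign q : ℤ) : k) * if s = (e.permCongr (q⁻¹ * p⁻¹))⁻¹ then 1 else 0 := by
    intro s
    change d (schurIncl ν (schurProj ν _)) = _
    rw [schurProj_comm, schurIncl_comm, schurIncl_schurProj, youngSymmetrizer_tpr]
    simp only [map_sum, map_smul, hd, smul_eq_mul]
  simp only [map_sum, map_smul, h3, smul_eq_mul, Finset.mul_sum]
  symm
  rw [Finset.sum_comm]
  refine Finset.sum_congr rfl fun p _ => ?_
  rw [Finset.sum_comm]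
  refine Finset.sum_congr rfl fun q _ => ?_
  rw [Finset.sum_eq_single (e.permCongr (q⁻¹ * p⁻¹))⁻¹]
  · rw [if_pos rfl, inv_inv, mul_one, mul_comm]
  · intro s _ hs
    rw [if_neg hs, mul_zero, mul_zero]
  · exact fun h => absurd (Finset.mem_univ _) h

/-- Equivariant maps to the representations `S_ν(V)` separate points. -/
theorem exists_hom_schur (hθ : Lawful θ) {y : Y} (h0 : y ≠ 0) : ∃ (ν : YoungDiagram) (f : Y →ₗ[k] SchurSpace k ν),
    (∀ a y, f (θ a y) = schurEnd k ν a (f y)) ∧ f y ≠ 0 := by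
  by_contra! h
  let U : Submodule k Y :=
    { carrier := {y | ∀ (ν : YoungDiagram) (f : Y →ₗ[k] SchurSpace k ν),
        (∀ a y, f (θ a y) = schurEnd k ν a (f y)) → f y = 0}
      add_mem' := fun hx hy ν f hf => by rw [map_add, hx ν f hf, hy ν f hf, add_zero]
      zero_mem' := fun ν f _ => map_zero f
      smul_mem' := fun c x hx ν f hf => by rw [map_smul, hx ν f hf, smul_zero] }
  have hU : U = ⊥ := hθ.eq_bot_of_mlin (fun a x hx ν f hf => by rw [hf, hx ν f hf, map_zero]) fun m c hc hcU => by
    by_contra h0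
    obtain ⟨ν, f, hf, hfc⟩ := exists_hom_schur_of_mlin hθ hc h0
    exact hfc (hcU ν f hf)
  exact h0 ((Submodule.mem_bot k).1 (hU ▸ (h : y ∈ U)))

end Detection

end GLRep

namespace GLRep

section Augmentation

variable {k : Type u} [Field k] [CharZero k] {r : ℕ} {σ : Fin r → YoungDiagram}
  {W Y : Type u} [AddCommGroup W] [Module k W] [AddCommGroup Y] [Module k Y]
  {τ : Representation k (VEnd k) W} {θ : Representation k (VEnd k) Y}

theorem augment_comm (a : VEnd k) (z : SymRing k σ ⊗[k] Y) :
    augment _ Y ((symRep σ).tprod θ a z) = θ a (augment _ Y z) := by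
  have h : ∀ x : SymRing k σ, SymmetricAlgebra.algebraMapInv (symEnd σ a x) =
      SymmetricAlgebra.algebraMapInv (R := k) x := by
    intro x
    have : (SymmetricAlgebra.algebraMapInv (R := k)).comp (symEnd σ a) =
        (SymmetricAlgebra.algebraMapInv (R := k) (M := TupleSpace k σ)) := by
      apply SymmetricAlgebra.algHom_ext
      refine LinearMap.ext fun e => ?_
      change SymmetricAlgebra.algebraMapInv (symEnd σ a (SymmetricAlgebra.ι k _ e)) =
        SymmetricAlgebra.algebraMapInv (SymmetricAlgebra.ι k _ e)
      rw [symEnd_ι, SymmetricAlgebra.algebraMapInv_ι, SymmetricAlgebra.algebraMapInv_ι]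
    exact DFunLike.congr_fun this x
  induction z using TensorProduct.induction_on with
  | zero => simp only [map_zero]
  | add x y hx hy => simp only [map_add, hx, hy]
  | tmul x y => rw [tprod_app, augment_tmul, augment_tmul, symRep_apply, h, map_smul]

theorem augment_mulLeft (x : SymRing k σ) (z : SymRing k σ ⊗[k] Y) :
    augment _ Y ((LinearMap.mulLeft k x).rTensor Y z) = SymmetricAlgebra.algebraMapInv (R := k) x • augment _ Y z := by
  induction z using TensorProduct.induction_on with
  | zero => simp only [map_zero, smul_zero]
  | add x y hx hy => simp only [map_add, hx, hy, smul_add]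
  | tmul y w => rw [LinearMap.rTensor_tmul, augment_tmul, augment_tmul, LinearMap.mulLeft_apply, map_mul, mul_smul]

theorem augment_lift_symAct (z : TupleSpace k σ ⊗[k] (SymRing k σ ⊗[k] Y)) :
    augment _ Y (TensorProduct.lift (symAct _ Y) z) = 0 := by
  induction z using TensorProduct.induction_on with
  | zero => simp only [map_zero]
  | add x y hx hy => simp only [map_add, hx, hy, add_zero]
  | tmul e z => rw [TensorProduct.lift.tmul, augment_symAct]

theorem exists_lin_polyBc (h : Lawful τ) (hY : Lawful θ) {χ : bc σ h ⟶ bc σ hY} {f : W →ₗ[k] SymRing k σ ⊗[k] Y}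
    (hχ : ∀ w, GLMod.Hom.lin χ (polyBc σ h (1 ⊗ₜ w)) = polyBc σ hY (f w)) (z : SymRing k σ ⊗[k] W) :
    ∃ z', GLMod.Hom.lin χ (polyBc σ h z) = polyBc σ hY z' ∧ augment _ Y z' = augment _ Y (f (augment _ W z)) := by
  induction z using TensorProduct.induction_on with
  | zero => exact ⟨0, by simp only [map_zero], by simp only [map_zero]⟩
  | add x y hx hy =>
    obtain ⟨x', hx, hx'⟩ := hx
    obtain ⟨y', hy, hy'⟩ := hy
    exact ⟨x' + y', by simp only [map_add, hx, hy], by simp only [map_add, hx', hy']⟩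
  | tmul x w =>
    refine ⟨(LinearMap.mulLeft k x).rTensor Y (f w), ?_, ?_⟩
    · rw [polyBc_tmul, map_smul, hχ, polyBc_mulLeft]
    · rw [augment_mulLeft, augment_tmul, map_smul, map_smul]

/-- The base change of an equivariant map. -/
noncomputable def bcMap (h : Lawful τ) (hY : Lawful θ) (g : eqHom τ θ) : bc σ h ⟶ bc σ hY :=
  bcHom h hY ((TensorProduct.mk k (SymRing k σ) Y 1) ∘ₗ g.1) fun a x => by
    rw [LinearMap.comp_apply, g.2 a x, mk_one_comm]
    rfl

theorem bcMap_polyBc (h : Lawful τ) (hY : Lawful θ) (g : eqHom τ θ) (z : SymRing k σ ⊗[k] W) :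
    GLMod.Hom.lin (bcMap (σ := σ) h hY g) (polyBc σ h z) = polyBc σ hY (g.1.lTensor _ z) := by
  induction z using TensorProduct.induction_on with
  | zero => simp only [map_zero]
  | add x y hx hy => simp only [map_add, hx, hy]
  | tmul x w =>
    rw [polyBc_tmul, map_smul, bcMap, bcHom_one_tmul, LinearMap.lTensor_tmul, polyBc_tmul hY x]
    rfl

/-- A vector of `K ⊗ W` vanishes if it does so after a nonzero multiple that lies in `R ⊗ W`. -/
theorem exists_smul_polyBc (hσ : ∀ j, σ j ≠ ⊥) (h : Lawful τ) (m : (bc σ h).carrier) :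
    ∃ x : SymRing k σ, x ≠ 0 ∧ ∃ z, algebraMap (SymRing k σ) (RatField k σ) x • m = polyBc σ h z := by
  obtain ⟨x, hx, hxm⟩ := exists_smul_mem_polyPart (bc σ h) m
  obtain ⟨z, hz⟩ := mem_polyPart_bc hσ h hxm
  exact ⟨x, hx, z, hz⟩

theorem bcMap_injective (hσ : ∀ j, σ j ≠ ⊥) (h : Lawful τ) (hY : Lawful θ) (g : eqHom τ θ)
    (hg : Function.Injective g.1) : Function.Injective (GLMod.Hom.lin (bcMap (σ := σ) h hY g)) := by
  refine injective_of_polyPart _ fun p hp h0 => ?_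
  obtain ⟨z, rfl⟩ := mem_polyPart_bc hσ h hp
  rw [bcMap_polyBc] at h0
  have h1 : g.1.lTensor (SymRing k σ) z = 0 := polyBc_injective hY (h0.trans (map_zero _).symm)
  have h2 : z = 0 := Module.Flat.lTensor_preserves_injective_linearMap (M := SymRing k σ) g.1 hg
    (h1.trans (map_zero _).symm)
  rw [h2, map_zero]

end Augmentation

section Degrees

variable {k : Type u} [Field k] [CharZero k] {r : ℕ} {σ : Fin r → YoungDiagram}

theorem eqHom_tprod_eq_zero_of_zero {X P T : Type*} [AddCommGroup X] [Module k X] [AddCommGroup P] [Module k P]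
    [AddCommGroup T] [Module k T] {ξ : Representation k (VEnd k) X}
    {π : Representation k (VEnd k) P} {θ : Representation k (VEnd k) T} (hπ : Lawful π) (h0 : ∀ p, π 0 p = 0)
    {n : ℕ} (hξ : IsHomog ξ n) (hθ : IsHomog θ n) {F : X →ₗ[k] P ⊗[k] T}
    (hF : F ∈ eqHom ξ (π.tprod θ)) : F = 0 := by
  ext x
  obtain ⟨p, hp⟩ := isPolyFun_rTensor (T := T) hπ (F x)
  have h2 := smul_rTensor_scalar hξ hθ hF x
  have h3 : p = Finsupp.single 0 (F x) := by
    refine polyEval_injective (k := k) fun t ht => ?_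
    rw [polyEval_single, pow_zero, one_smul]
    refine Eq.trans (hp t).symm ?_
    exact smul_right_injective _ (pow_ne_zero n ht) (h2 t)
  have h4 := hp 0
  rw [h3, polyEval_single, pow_zero, one_smul] at h4
  rw [LinearMap.zero_apply, ← h4]
  have h5 : π ((0 : k) • 1) = 0 := LinearMap.ext fun p => by rw [zero_smul, h0]; rfl
  change (π ((0 : k) • 1)).rTensor T (F x) = 0
  rw [h5, LinearMap.rTensor_zero]
  rfl

theorem wedgeEnd_zero (hσ : ∀ j, σ j ≠ ⊥) (i : ℕ) (w : Wedge k (TupleSpace k σ) (i + 1)) :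
    wedgeEnd (tupleEnd σ) (i + 1) 0 w = 0 := by
  have hw : w ∈ Submodule.span k (Set.range (wedge k (i + 1) (E := TupleSpace k σ))) := by
    rw [span_wedge]; trivial
  induction hw using Submodule.span_induction with
  | mem x hx =>
    obtain ⟨v, rfl⟩ := hx
    rw [wedgeEnd_wedge]
    exact AlternatingMap.map_coord_zero _ 0 (tupleEnd_zero hσ _)
  | zero => rw [map_zero]
  | add x y _ _ hx hy => rw [map_add, hx, hy, add_zero]
  | smul c x _ hx => rw [map_smul, hx, smul_zero]

/-- Nonzero maps from the first term of the resolution only lead to smaller partitions. -/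
theorem card_lt_of_univ_one (hσ : ∀ j, σ j ≠ ⊥) (μ ν : YoungDiagram)
    {h : (univ k σ μ 1).space →ₗ[k] SchurSpace k ν} (hh : h ∈ eqHom (univ k σ μ 1).rep (schurEnd k ν))
    (h0 : h ≠ 0) : ν.card < μ.card := by
  by_contra! hle
  refine h0 ((univ k σ μ 1).isUniversal.ext h fun x => ?_)
  have hF : h.lTensor _ ∘ₗ (univ k σ μ 1).map ∈ eqHom (schurEnd k μ)
      ((wedgeEnd (tupleEnd σ) 1).tprod (schurEnd k ν)) := fun a x => by
    rw [LinearMap.comp_apply, (univ k σ μ 1).isUniversal.comm, lTensor_comm hh]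
    rfl
  have hz : h.lTensor _ ∘ₗ (univ k σ μ 1).map = 0 := by
    rcases hle.lt_or_eq with hlt | heq
    · exact eqHom_tprod_eq_zero ((lawful_tupleEnd σ).wedgeEnd 1) (isHomog_schurEnd μ) (isHomog_schurEnd ν) hlt hF
    · exact eqHom_tprod_eq_zero_of_zero ((lawful_tupleEnd σ).wedgeEnd 1) (wedgeEnd_zero hσ 0)
        (isHomog_schurEnd μ) (heq ▸ isHomog_schurEnd ν) hF
  exact congrArg (fun q => q x) hz

end Degrees

section Simple

variable {k : Type u} [Field k] [CharZero k] {r : ℕ} {σ : Fin r → YoungDiagram}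

variable (σ) in
/-- The intersection of the kernels of the maps from `K ⊗ S_μ` to smaller `K ⊗ S_ν`. -/
noncomputable def lowKer (μ : YoungDiagram) : Submodule (RatField k σ) (bc σ (lawful_schurEnd (k := k) μ)).carrier :=
  ⨅ (ν : YoungDiagram) (_ : ν.card < μ.card)
    (f : bc σ (lawful_schurEnd (k := k) μ) ⟶ bc σ (lawful_schurEnd (k := k) ν)), LinearMap.ker (GLMod.Hom.lin f)

variable {W Y : Type u} [AddCommGroup W] [Module k W] [AddCommGroup Y] [Module k Y]
  {τ : Representation k (VEnd k) W} {θ : Representation k (VEnd k) Y} {μ : YoungDiagram}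

theorem eq_zero_of_resolD {x : (bc σ (lawful_schurEnd (k := k) μ)).carrier}
    (hx : GLMod.Hom.lin (resolD k σ μ 0) x = 0) (hY : Lawful θ) {φ : bc σ (lawful_schurEnd (k := k) μ) ⟶ bc σ hY}
    {f : SchurSpace k μ →ₗ[k] SymRing k σ ⊗[k] Y}
    (hf : ∀ a x, f (schurEnd k μ a x) = (symRep σ).tprod θ a (f x))
    (hφ : ∀ w, GLMod.Hom.lin φ (polyBc σ (lawful_schurEnd μ) (1 ⊗ₜ w)) = polyBc σ hY (f w))
    (h0 : ∀ x, augment _ Y (f x) = 0) : GLMod.Hom.lin φ x = 0 := by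
  obtain ⟨ψ, hψ⟩ := exists_resolD_factor_zero μ hY (φ := φ) hf hφ h0
  have h1 := congrArg (fun q : resol k σ μ 0 ⟶ bc σ hY => GLMod.Hom.lin q x) hψ
  refine h1.trans ?_
  change GLMod.Hom.lin ψ (GLMod.Hom.lin (resolD k σ μ 0) x) = 0
  rw [hx, map_zero]

theorem mem_lowKer_iff (hσ : ∀ j, σ j ≠ ⊥) {x : (bc σ (lawful_schurEnd (k := k) μ)).carrier} :
    x ∈ lowKer σ μ ↔ GLMod.Hom.lin (resolD k σ μ 0) x = 0 := by
  simp only [lowKer, Submodule.mem_iInf, LinearMap.mem_ker]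
  refine ⟨fun h => ?_, fun h ν hν φ => ?_⟩
  · by_contra hne
    obtain ⟨y, hy, z, hz⟩ := exists_smul_polyBc hσ (lawful_univ σ μ 1) (GLMod.Hom.lin (resolD k σ μ 0) x)
    have hz0 : z ≠ 0 := by
      rintro rfl
      rw [map_zero] at hz
      rcases smul_eq_zero.1 hz with h1 | h1
      · exact hy ((FaithfulSMul.algebraMap_injective (SymRing k σ) (RatField k σ)) (h1.trans (map_zero _).symm))
      · exact hne h1
    refine hz0 (eq_zero_of_slice fun φ => ?_)
    by_contra hs
    obtain ⟨ν, g, hg, hgs⟩ := exists_hom_schur (lawful_univ σ μ 1) hs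
    have hν := card_lt_of_univ_one hσ μ ν (h := g) hg (by rintro rfl; exact hgs rfl)
    have h1 : GLMod.Hom.lin (bcMap (lawful_univ σ μ 1) (lawful_schurEnd ν) ⟨g, hg⟩)
        (GLMod.Hom.lin (resolD k σ μ 0) x) = 0 :=
      h ν hν (show bc σ (lawful_schurEnd (k := k) μ) ⟶ bc σ (lawful_schurEnd (k := k) ν) from
        resolD k σ μ 0 ≫ bcMap (lawful_univ σ μ 1) (lawful_schurEnd ν) ⟨g, hg⟩)
    have h2 : GLMod.Hom.lin (bcMap (lawful_univ σ μ 1) (lawful_schurEnd ν) ⟨g, hg⟩)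
        (polyBc σ (lawful_univ σ μ 1) z) = 0 := by
      refine (congrArg _ hz).symm.trans ((map_smul (GLMod.Hom.lin _) _ _).trans ?_)
      exact (congrArg _ h1).trans (smul_zero _)
    rw [bcMap_polyBc] at h2
    have h3 : g.lTensor (SymRing k σ) z = 0 := polyBc_injective _ (h2.trans (map_zero _).symm)
    refine hgs ?_
    rw [← slice_lTensor, h3, map_zero]
  · obtain ⟨f, hf, hφ⟩ := exists_of_bc_hom hσ (lawful_schurEnd μ) (lawful_schurEnd ν) φ
    exact eq_zero_of_resolD h (lawful_schurEnd ν) hf hφ fun x =>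
      (isHomog_schurEnd μ).hom_eq_zero (isHomog_schurEnd ν) hν.ne' (augment _ _ ∘ₗ f) (fun a x => by
        rw [LinearMap.comp_apply, hf]
        exact augment_comm a (f x)) x

theorem lowKer_stable (μ : YoungDiagram) : ∀ g, ∀ m ∈ lowKer (k := k) σ μ,
    (bc σ (lawful_schurEnd (k := k) μ)).ρ g m ∈ lowKer (k := k) σ μ := by
  intro g m hm
  simp only [lowKer, Submodule.mem_iInf] at hm ⊢
  exact fun ν hν f => GLMod.ker_stable f g m (hm ν hν f)

variable (k σ) in
/-- The representation `L_μ`. -/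
noncomputable def simpleBc (μ : YoungDiagram) : GLMod k (RatField k σ) :=
  (bc σ (lawful_schurEnd (k := k) μ)).sub (lowKer σ μ) (lowKer_stable μ)

variable (k σ) in
/-- The inclusion of `L_μ` in `K ⊗ S_μ`. -/
noncomputable def simpleIncl (μ : YoungDiagram) : simpleBc k σ μ ⟶ bc σ (lawful_schurEnd (k := k) μ) :=
  GLMod.homMk (lowKer σ μ).subtype fun _ _ => rfl

instance (μ : YoungDiagram) : Mono (simpleIncl k σ μ) :=
  ⟨fun _ _ h => GLMod.hom_ext fun m => Subtype.ext (congrArg (fun q => GLMod.Hom.lin q m) h)⟩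

theorem simpleIncl_comp_eq_zero (hσ : ∀ j, σ j ≠ ⊥) (hY : Lawful θ)
    {φ : bc σ (lawful_schurEnd (k := k) μ) ⟶ bc σ hY} {f : SchurSpace k μ →ₗ[k] SymRing k σ ⊗[k] Y}
    (hf : ∀ a x, f (schurEnd k μ a x) = (symRep σ).tprod θ a (f x))
    (hφ : ∀ w, GLMod.Hom.lin φ (polyBc σ (lawful_schurEnd μ) (1 ⊗ₜ w)) = polyBc σ hY (f w))
    (h0 : ∀ x, augment _ Y (f x) = 0) : simpleIncl k σ μ ≫ φ = 0 :=
  GLMod.hom_ext fun m => eq_zero_of_resolD ((mem_lowKer_iff hσ).1 m.2) hY hf hφ h0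

theorem exists_resolD_polyBc (μ' : YoungDiagram) (i : ℕ) :
    ∃ f : (univ k σ μ' i).space →ₗ[k] SymRing k σ ⊗[k] (univ k σ μ' (i + 1)).space,
      (∀ w, GLMod.Hom.lin (resolD k σ μ' i) (polyBc σ (lawful_univ σ μ' i) (1 ⊗ₜ w)) =
        polyBc σ (lawful_univ σ μ' (i + 1)) (f w)) ∧ ∀ w, augment _ _ (f w) = 0 := by
  refine ⟨_, fun w => bcHom_one_tmul _ _ _ (symComp_comm (delta_comm σ μ' i) mk_one_comm) w, fun w => ?_⟩
  rw [symComp, LinearMap.comp_apply, augment_lift_symAct]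

theorem comp_resolD_eq_zero (hσ : ∀ j, σ j ≠ ⊥) (μ' : YoungDiagram) (i : ℕ)
    (φ : simpleBc k σ μ ⟶ resol k σ μ' i) : φ ≫ resolD k σ μ' i = 0 := by
  have : Injective (resol k σ μ' i) := injective_bc hσ (lawful_univ (k := k) σ μ' i)
  obtain ⟨Φ, hΦ⟩ := this.factors φ (simpleIncl k σ μ)
  rw [← hΦ, Category.assoc]
  obtain ⟨f, hf, hφ⟩ := exists_of_bc_hom hσ (lawful_schurEnd μ) (lawful_univ σ μ' (i + 1)) (Φ ≫ resolD k σ μ' i)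
  refine simpleIncl_comp_eq_zero hσ _ hf hφ fun x => ?_
  obtain ⟨g, -, hg⟩ := exists_of_bc_hom hσ (lawful_schurEnd μ) (lawful_univ σ μ' i) Φ
  obtain ⟨q, hq, hq0⟩ := exists_resolD_polyBc (k := k) (σ := σ) μ' i
  obtain ⟨z', hz', hz0⟩ := exists_lin_polyBc (lawful_univ σ μ' i) (lawful_univ σ μ' (i + 1)) hq (g x)
  have h1 : f x = z' := by
    refine polyBc_injective (lawful_univ σ μ' (i + 1)) ?_
    rw [← hφ, ← hz', ← hg]
    rfl
  rw [h1, hz0, hq0]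

end Simple

end GLRep

namespace GLRep

section HomSimple

variable {k : Type u} [Field k] [CharZero k] {r : ℕ} {σ : Fin r → YoungDiagram}
  {W Y Z : Type u} [AddCommGroup W] [Module k W] [AddCommGroup Y] [Module k Y] [AddCommGroup Z] [Module k Z]
  {τ : Representation k (VEnd k) W} {θ : Representation k (VEnd k) Y} {ζ : Representation k (VEnd k) Z}

theorem bcMap_one_tmul (h : Lawful τ) (hY : Lawful θ) (g : eqHom τ θ) (w : W) :
    GLMod.Hom.lin (bcMap (σ := σ) h hY g) (polyBc σ h (1 ⊗ₜ w)) = polyBc σ hY (1 ⊗ₜ g.1 w) := by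
  rw [bcMap_polyBc, LinearMap.lTensor_tmul]

theorem bcMap_comp (h : Lawful τ) (hY : Lawful θ) (hZ : Lawful ζ) (g : eqHom τ θ) (g' : eqHom θ ζ)
    (g'' : eqHom τ ζ) (hg : ∀ w, g''.1 w = g'.1 (g.1 w)) :
    bcMap (σ := σ) h hY g ≫ bcMap hY hZ g' = bcMap h hZ g'' :=
  bc_hom_ext h fun w => by
    rw [GLMod.lin_comp, bcMap_one_tmul, bcMap_one_tmul, bcMap_one_tmul, hg]

/-- An equivariant map `S_μ → Y` that induces zero on `L_μ` vanishes. -/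
theorem eq_zero_of_simpleIncl_bcMap (hσ : ∀ j, σ j ≠ ⊥) {μ : YoungDiagram} (hY : Lawful θ)
    (g : eqHom (schurEnd k μ) θ) (h : simpleIncl k σ μ ≫ bcMap (lawful_schurEnd μ) hY g = 0) : g = 0 := by
  have hker : ∀ a, ∀ x ∈ LinearMap.ker g.1, schurEnd k μ a x ∈ LinearMap.ker g.1 := fun a x hx => by
    rw [LinearMap.mem_ker, g.2 a x, LinearMap.mem_ker.1 hx, map_zero]
  obtain ⟨D, hD, hc⟩ := (lawful_schurEnd (k := k) μ).exists_isCompl (F := k) (fun a c x => map_smul _ c x) _ hker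
  have hDl : Lawful (subRep (schurEnd k μ) D hD) :=
    (lawful_schurEnd μ).of_injective D.subtype Subtype.val_injective fun _ _ => rfl
  let ι : eqHom (subRep (schurEnd k μ) D hD) (schurEnd k μ) := ⟨D.subtype, fun _ _ => rfl⟩
  let gι : eqHom (subRep (schurEnd k μ) D hD) θ := ⟨g.1 ∘ₗ D.subtype, fun a x => g.2 a x.1⟩
  have hgι : Function.Injective gι.1 := by
    rw [injective_iff_map_eq_zero]
    intro d hd
    exact Subtype.ext (Submodule.disjoint_def.1 hc.disjoint d.1 (LinearMap.mem_ker.2 hd) d.2)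
  let χ : bc σ hDl ⟶ resol k σ μ 0 := bcMap hDl (lawful_schurEnd μ) ι
  have hinj : Function.Injective (GLMod.Hom.lin (χ ≫ resolD k σ μ 0)) := by
    rw [injective_iff_map_eq_zero]
    intro y hy
    rw [GLMod.lin_comp] at hy
    have h1 := (mem_lowKer_iff hσ).2 hy
    have h2 : GLMod.Hom.lin (bcMap (lawful_schurEnd μ) hY g)
        (GLMod.Hom.lin (bcMap (σ := σ) hDl (lawful_schurEnd μ) ι) y) = 0 :=
      congrArg (fun q : simpleBc k σ μ ⟶ bc σ hY =>
        GLMod.Hom.lin q (⟨_, h1⟩ : lowKer (k := k) σ μ)) h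
    rw [← GLMod.lin_comp, bcMap_comp hDl (lawful_schurEnd μ) hY ι g gι fun _ => rfl] at h2
    exact bcMap_injective hσ hDl hY gι hgι (h2.trans (map_zero _).symm)
  obtain ⟨ψ, hψ, -⟩ := exists_retraction hσ hDl _ hinj
  obtain ⟨f, -, hf⟩ := exists_of_bc_hom hσ (lawful_univ σ μ 1) hDl ψ
  obtain ⟨q, hq, hq0⟩ := exists_resolD_polyBc (k := k) (σ := σ) μ 0
  have hD0 : ∀ d : D, d = 0 := fun d => by
    obtain ⟨z, hz, hz0⟩ := exists_lin_polyBc (lawful_univ σ μ 1) hDl hf (q d.1)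
    have h1 : GLMod.Hom.lin (χ ≫ resolD k σ μ 0) (polyBc σ hDl (1 ⊗ₜ d)) =
        polyBc σ (lawful_univ σ μ 1) (q d.1) := by
      rw [GLMod.lin_comp]
      refine (congrArg _ (bcMap_one_tmul hDl (lawful_schurEnd μ) ι d)).trans (hq d.1)
    have h2 : (1 : SymRing k σ) ⊗ₜ[k] d = z := by
      refine polyBc_injective hDl ?_
      rw [← hz]
      refine Eq.trans ?_ (congrArg (GLMod.Hom.lin ψ) h1)
      exact (congrArg (fun t => GLMod.Hom.lin t (polyBc σ hDl (1 ⊗ₜ d))) hψ).symm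
    have h3 : augment _ D ((1 : SymRing k σ) ⊗ₜ[k] d) = 0 := by
      refine (congrArg _ h2).trans (hz0.trans ?_)
      refine (congrArg (fun w => augment _ D (f w)) (hq0 d.1)).trans ?_
      change augment _ D (f 0) = 0
      rw [map_zero, map_zero]
    rwa [augment_tmul, map_one, one_smul] at h3
  refine Subtype.ext (LinearMap.ext fun x => ?_)
  have hx : x ∈ LinearMap.ker g.1 ⊔ D := by rw [hc.sup_eq_top]; trivial
  obtain ⟨y, hy, z, hz, rfl⟩ := Submodule.mem_sup.1 hx
  have hz0 : z = 0 := congrArg Subtype.val (hD0 ⟨z, hz⟩)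
  rw [hz0, add_zero, LinearMap.mem_ker.1 hy]
  rfl

theorem exists_simpleIncl_bcMap (hσ : ∀ j, σ j ≠ ⊥) {μ : YoungDiagram} (hY : Lawful θ)
    (φ : simpleBc k σ μ ⟶ bc σ hY) :
    ∃ g : eqHom (schurEnd k μ) θ, simpleIncl k σ μ ≫ bcMap (lawful_schurEnd μ) hY g = φ := by
  have := injective_bc hσ hY
  obtain ⟨Φ, hΦ⟩ := this.factors φ (simpleIncl k σ μ)
  obtain ⟨f, hf, hφ⟩ := exists_of_bc_hom hσ (lawful_schurEnd μ) hY Φ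
  let g : eqHom (schurEnd k μ) θ := ⟨augment _ Y ∘ₗ f, fun a x => by
    rw [LinearMap.comp_apply, hf]
    exact augment_comm a (f x)⟩
  refine ⟨g, (eq_of_sub_eq_zero ?_).trans hΦ⟩
  rw [← Preadditive.comp_sub]
  refine simpleIncl_comp_eq_zero hσ hY (f := TensorProduct.mk k (SymRing k σ) Y 1 ∘ₗ g.1 - f) (fun a x => ?_)
    (fun w => ?_) fun x => ?_
  · rw [LinearMap.sub_apply, LinearMap.sub_apply, map_sub, hf, LinearMap.comp_apply, g.2 a x, mk_one_comm]
    rfl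
  · rw [LinearMap.sub_apply, map_sub, ← hφ]
    exact (congrArg (· - GLMod.Hom.lin Φ (polyBc σ (lawful_schurEnd μ) (1 ⊗ₜ w)))
      (bcMap_one_tmul (lawful_schurEnd μ) hY g w).symm).symm
  · rw [LinearMap.sub_apply, map_sub, LinearMap.comp_apply, TensorProduct.mk_apply, augment_tmul, map_one, one_smul]
    exact sub_self _

/-- Morphisms from `L_μ` to `K ⊗ Y` are equivariant maps `S_μ → Y`. -/
noncomputable def homSimple (hσ : ∀ j, σ j ≠ ⊥) (μ : YoungDiagram) (hY : Lawful θ) :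
    eqHom (schurEnd k μ) θ ≃ₗ[k] (simpleBc k σ μ ⟶ bc σ hY) :=
  LinearEquiv.ofBijective
    { toFun := fun g => simpleIncl k σ μ ≫ bcMap (lawful_schurEnd μ) hY g
      map_add' := fun g g' => by
        rw [← Preadditive.comp_add]
        refine congrArg _ (bc_hom_ext _ fun w => ?_)
        rw [GLMod.lin_add, bcMap_one_tmul, bcMap_one_tmul, bcMap_one_tmul, ← map_add, ← TensorProduct.tmul_add]
        rfl
      map_smul' := fun c g => by
        rw [RingHom.id_apply, ← Linear.comp_smul]
        refine congrArg _ (bc_hom_ext _ fun w => ?_)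
        refine (bcMap_one_tmul _ hY _ w).trans (Eq.trans ?_ (congrArg (c • ·) (bcMap_one_tmul _ hY g w)).symm)
        rw [← map_smul, ← TensorProduct.tmul_smul]
        rfl }
    ⟨(injective_iff_map_eq_zero _).2 fun g hg => eq_zero_of_simpleIncl_bcMap hσ hY g hg,
      fun φ => exists_simpleIncl_bcMap hσ hY φ⟩

end HomSimple
end GLRep

namespace GLRep

section Ext

variable {C : Type*} [Category* C] [Abelian C] [HasExt C] (R : Type*) [CommRing R] [Linear R C] {X : C}

/-- Dimension shifting. -/
theorem exists_ext_succ {S : ShortComplex C} (hS : S.ShortExact) [Injective S.X₂]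
    (h : ∀ f : X ⟶ S.X₂, f ≫ S.g = 0) (n : ℕ) :
    Nonempty (Abelian.Ext X S.X₁ (n + 1) ≃ₗ[R] Abelian.Ext X S.X₃ n) := by
  let F : Abelian.Ext X S.X₃ n →ₗ[R] Abelian.Ext X S.X₁ (n + 1) :=
    { toFun := fun x => x.comp hS.extClass rfl
      map_add' := fun x y => Abelian.Ext.add_comp x y _ _
      map_smul' := fun c x => Abelian.Ext.smul_comp x _ _ c }
  refine ⟨(LinearEquiv.ofBijective F ⟨(injective_iff_map_eq_zero _).2 fun x hx => ?_, fun y => ?_⟩).symm⟩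
  · obtain ⟨y, rfl⟩ := Abelian.Ext.covariant_sequence_exact₃ X hS x rfl hx
    cases n with
    | zero =>
      obtain ⟨f, rfl⟩ := (Abelian.Ext.mk₀_bijective X S.X₂).2 y
      rw [Abelian.Ext.mk₀_comp_mk₀, h, Abelian.Ext.mk₀_zero]
    | succ n => rw [y.eq_zero_of_injective, Abelian.Ext.zero_comp]
  · exact Abelian.Ext.covariant_sequence_exact₁ X hS y (Abelian.Ext.eq_zero_of_injective _) rfl

theorem exists_ext_zero {S : ShortComplex C} (hS : S.ShortExact) (h : ∀ f : X ⟶ S.X₂, f ≫ S.g = 0) :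
    Nonempty (Abelian.Ext X S.X₁ 0 ≃ₗ[R] (X ⟶ S.X₂)) := by
  have := hS.mono_f
  let F : (X ⟶ S.X₁) →ₗ[R] (X ⟶ S.X₂) := Linear.rightComp R X S.f
  exact ⟨Abelian.Ext.linearEquiv₀.trans (LinearEquiv.ofBijective F
    ⟨fun a b hab => (cancel_mono S.f).1 hab, fun f => ⟨hS.exact.lift f (h f), hS.exact.lift_f f (h f)⟩⟩)⟩

/-- The groups `Extⁱ(X, Z₀)` for an injective resolution to which all maps from `X` have zero differential. -/
theorem exists_ext_iso {Z I : ℕ → C} (ι : ∀ j, Z j ⟶ I j) (p : ∀ j, I j ⟶ Z (j + 1)) (w : ∀ j, ι j ≫ p j = 0)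
    (hS : ∀ j, (ShortComplex.mk (ι j) (p j) (w j)).ShortExact) (hI : ∀ j, Injective (I j))
    (h : ∀ j (f : X ⟶ I j), f ≫ p j = 0) (i : ℕ) :
    ∀ j, Nonempty (Abelian.Ext X (Z j) i ≃ₗ[R] (X ⟶ I (j + i))) := by
  induction i with
  | zero => exact fun j => exists_ext_zero R (hS j) (h j)
  | succ i ih =>
    intro j
    have := hI j
    obtain ⟨e⟩ := exists_ext_succ R (hS j) (h j) i
    obtain ⟨e'⟩ := ih (j + 1)
    rw [show j + 1 + i = j + (i + 1) by omega] at e'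
    exact ⟨e.trans e'⟩

end Ext

section Cocycles

variable {k : Type u} [Field k] [CharZero k] {r : ℕ} {σ : Fin r → YoungDiagram} (μ : YoungDiagram)

variable (k σ) in
/-- The kernel of the differential. -/
noncomputable def cocyc (j : ℕ) : GLMod k (RatField k σ) :=
  (resol k σ μ j).sub _ (GLMod.ker_stable (resolD k σ μ j))

variable (k σ) in
/-- The inclusion of the kernel of the differential. -/
noncomputable def cocycIncl (j : ℕ) : cocyc k σ μ j ⟶ resol k σ μ j := GLMod.kerι (resolD k σ μ j)

variable (k σ) in
/-- The differential, as a map to the kernel of the next one. -/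
noncomputable def cocycProj (j : ℕ) : resol k σ μ j ⟶ cocyc k σ μ (j + 1) :=
  GLMod.homMk ((GLMod.Hom.lin (resolD k σ μ j)).codRestrict _ fun m =>
      congrArg (fun q : resol k σ μ j ⟶ resol k σ μ (j + 1 + 1) => GLMod.Hom.lin q m) (resolD_comp σ μ j))
    fun g m => Subtype.ext (GLMod.Hom.comm (resolD k σ μ j) g m)

theorem cocycProj_incl (j : ℕ) : cocycProj k σ μ j ≫ cocycIncl k σ μ (j + 1) = resolD k σ μ j := rfl

instance (j : ℕ) : Mono (cocycIncl k σ μ j) :=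
  ⟨fun _ _ h => GLMod.hom_ext fun m => Subtype.ext (congrArg (fun q => GLMod.Hom.lin q m) h)⟩

theorem cocycIncl_proj (j : ℕ) : cocycIncl k σ μ j ≫ cocycProj k σ μ j = 0 :=
  GLMod.hom_ext fun m => Subtype.ext m.2

theorem cocyc_shortExact (hσ : ∀ j, σ j ≠ ⊥) (j : ℕ) :
    (ShortComplex.mk (cocycIncl k σ μ j) (cocycProj k σ μ j) (cocycIncl_proj μ j)).ShortExact where
  exact := by
    refine ShortComplex.exact_of_f_is_kernel _ (KernelFork.IsLimit.ofι' _ _ fun {A} q hq => ?_)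
    have h0 : ∀ a, GLMod.Hom.lin (resolD k σ μ j) (GLMod.Hom.lin q a) = 0 := fun a =>
      congrArg Subtype.val (congrArg (fun t => GLMod.Hom.lin t a) hq)
    exact ⟨GLMod.homMk ((GLMod.Hom.lin q).codRestrict _ h0) fun g m => Subtype.ext (GLMod.Hom.comm q g m), rfl⟩
  mono_f := inferInstanceAs (Mono (cocycIncl k σ μ j))
  epi_g := by
    refine Preadditive.epi_of_cancel_zero _ fun {A} q hq => GLMod.hom_ext fun m => ?_
    obtain ⟨y, hy⟩ := resolD_exact μ hσ j m.2
    have h1 : GLMod.Hom.lin (cocycProj k σ μ j) y = m := Subtype.ext hy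
    rw [← h1]
    exact congrArg (fun t => GLMod.Hom.lin t y) hq

theorem simpleBc_eq (hσ : ∀ j, σ j ≠ ⊥) : simpleBc k σ μ = cocyc k σ μ 0 := by
  have h : lowKer (k := k) σ μ = LinearMap.ker (GLMod.Hom.lin (resolD k σ μ 0)) :=
    Submodule.ext fun x => mem_lowKer_iff hσ
  have key : ∀ (N N' : Submodule (RatField k σ) (resol k σ μ 0).carrier) (hN hN'), N = N' →
      (resol k σ μ 0).sub N hN = (resol k σ μ 0).sub N' hN' := by
    rintro N _ hN hN' rfl
    rfl
  exact key _ _ _ _ h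

theorem exists_ext_simpleBc (hσ : ∀ j, σ j ≠ ⊥) (lam : YoungDiagram) (i : ℕ) :
    Nonempty (Abelian.Ext (simpleBc k σ lam) (simpleBc k σ μ) i ≃ₗ[k] (simpleBc k σ lam ⟶ resol k σ μ i)) := by
  obtain ⟨e⟩ := exists_ext_iso k (X := simpleBc k σ lam) (cocycIncl k σ μ) (cocycProj k σ μ) (cocycIncl_proj μ)
    (cocyc_shortExact μ hσ) (fun j => injective_bc hσ (lawful_univ σ μ j)) (fun j f => by
      rw [← cancel_mono (cocycIncl k σ μ (j + 1)), Category.assoc, cocycProj_incl, zero_comp]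
      exact comp_resolD_eq_zero hσ μ j f) i 0
  rw [simpleBc_eq μ hσ]
  rw [zero_add] at e
  exact ⟨e⟩

end Cocycles

end GLRep

namespace GLRep

section Homs

variable {k : Type u} [Field k] [CharZero k] {W Y : Type u} [AddCommGroup W] [Module k W] [AddCommGroup Y]
  [Module k Y] {τ : Representation k (VEnd k) W} {θ : Representation k (VEnd k) Y}

/-- Equivariant maps between lawful representations of `End V` are the `GL`-equivariant ones. -/
noncomputable def eqHomEquiv (h : Lawful τ) (hY : Lawful θ) :
    eqHom τ θ ≃ₗ[k] Representation.IntertwiningMap (res τ) (res θ) where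
  toFun f := ⟨f.1, fun g => LinearMap.ext fun x => f.2 (stdRep k g) x⟩
  invFun f := ⟨f.toLinearMap, h.map_of_res hY f.toLinearMap fun g x => f.isIntertwining _ _ g x⟩
  map_add' _ _ := rfl
  map_smul' _ _ := rfl
  left_inv _ := rfl
  right_inv _ := rfl

theorem exists_eqHom_comm (h : Lawful τ) (hY : Lawful θ) (hf : FinWt τ) (hf' : FinWt θ) {n : ℕ}
    (hn : IsHomog τ n ∨ IsHomog θ n) : Nonempty (eqHom τ θ ≃ₗ[k] eqHom θ τ) := by
  have := hf.mlin n
  have := hf'.mlin n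
  obtain ⟨e⟩ := exists_intertwiningMap_comm h hY (n := n) fun m hm =>
    hn.imp (fun hn c hc => hn.mlin_eq_zero h hm hc) fun hn c hc => hn.mlin_eq_zero hY hm hc
  exact ⟨(eqHomEquiv h hY).trans (e.trans (eqHomEquiv hY h).symm)⟩

variable {X P : Type u} [AddCommGroup X] [Module k X] [AddCommGroup P] [Module k P]
  {ξ : Representation k (VEnd k) X} {π : Representation k (VEnd k) P} {u : X →ₗ[k] P ⊗[k] W}

/-- The universal property of a universal map. -/
noncomputable def IsUniversal.equiv (hu : IsUniversal ξ π τ u) (hY : Lawful θ) :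
    eqHom τ θ ≃ₗ[k] eqHom ξ (π.tprod θ) :=
  let F : eqHom τ θ →ₗ[k] eqHom ξ (π.tprod θ) :=
    ((LinearMap.lcomp k (P ⊗[k] Y) u ∘ₗ LinearMap.lTensorHom P) ∘ₗ (eqHom τ θ).subtype).codRestrict _
      fun g a x => by
        change g.1.lTensor P (u (ξ a x)) = _
        rw [hu.comm, lTensor_comm g.2]
        rfl
  LinearEquiv.ofBijective F ⟨(injective_iff_map_eq_zero _).2 fun g hg => Subtype.ext (hu.ext g.1 fun x =>
      congrArg (fun q => q.1 x) hg), fun G => by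
    obtain ⟨g, hg, hgG⟩ := hu.lift hY G.1 G.2
    exact ⟨⟨g, hg⟩, Subtype.ext (LinearMap.ext hgG)⟩⟩

end Homs

section Simple

variable {k : Type u} [Field k] [CharZero k] {r : ℕ} {σ : Fin r → YoungDiagram}

theorem schur_eq (μ : YoungDiagram) : GLMod.schur k (RatField k σ) μ = bc σ (lawful_schurEnd μ) := by
  have key : ∀ (ρ ρ' : Representation k (GLInf k) (SchurSpace k μ)) (h : IsPolynomial ρ) (h' : IsPolynomial ρ'),
      ρ = ρ' → GLMod.baseChange (RatField k σ) ρ h = GLMod.baseChange (RatField k σ) ρ' h' := by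
    rintro ρ _ h h' rfl
    rfl
  exact key _ _ _ _ (res_schurEnd μ).symm

theorem simple_eq (μ : YoungDiagram) : GLMod.simple k (RatField k σ) μ = simpleBc k σ μ := by
  have key : ∀ (A B : YoungDiagram → GLMod k (RatField k σ)), A = B → ∀ hA hB,
      (A μ).sub (⨅ (ν : YoungDiagram) (_ : ν.card < μ.card) (f : A μ ⟶ A ν), LinearMap.ker (GLMod.Hom.lin f)) hA =
      (B μ).sub (⨅ (ν : YoungDiagram) (_ : ν.card < μ.card) (f : B μ ⟶ B ν), LinearMap.ker (GLMod.Hom.lin f)) hB := by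
    rintro A _ rfl hA hB
    rfl
  exact key _ (fun ν => bc σ (lawful_schurEnd ν)) (funext schur_eq) _ _

theorem exists_ext_simple (hσ : ∀ j, σ j ≠ ⊥) (lam μ : YoungDiagram) (i : ℕ) :
    Nonempty (Abelian.Ext (GLMod.simple k (RatField k σ) lam) (GLMod.simple k (RatField k σ) μ) i ≃ₗ[k]
      Representation.IntertwiningMap ((exteriorRep (tupleRep k σ) i).tprod (schurRep k lam)) (schurRep k μ)) := by
  rw [simple_eq lam, simple_eq μ, ← res_schurEnd (k := k) lam, ← res_schurEnd (k := k) μ, ← res_tupleEnd (k := k)]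
  have hw := (lawful_tupleEnd (k := k) σ).wedgeEnd i
  have hf := (finWt_tupleEnd (k := k) σ).wedgeEnd i
  have hl := lawful_schurEnd (k := k) lam
  have hm := lawful_schurEnd (k := k) μ
  obtain ⟨e₁⟩ := exists_ext_simpleBc (k := k) μ hσ lam i
  obtain ⟨e₂⟩ := exists_eqHom_comm hl (lawful_univ σ μ i) (finWt_schurEnd lam)
    (univ k σ μ i).isUniversal.finWt (.inl (isHomog_schurEnd lam))
  obtain ⟨e₃⟩ := exists_eqHom_comm hm (hw.tprod hl) (finWt_schurEnd μ)
    (hf.tprod (finWt_schurEnd lam)) (.inl (isHomog_schurEnd μ))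
  exact ⟨e₁.trans ((homSimple hσ lam (lawful_univ σ μ i)).symm.trans (e₂.trans
    (((univ k σ μ i).isUniversal.equiv hl).trans (e₃.trans (eqHomEquiv (hw.tprod hl) hm)))))⟩

end Simple

end GLRep

theorem mainTheorem11 {k : Type u} [Field k] [CharZero k] {r : ℕ} (σ : Fin r → YoungDiagram)
    (hσ : ∀ j, σ j ≠ ⊥) (lam mu : YoungDiagram) (i : ℕ) :
    Nonempty (Abelian.Ext (GLRep.GLMod.simple k (GLRep.RatField k σ) lam)
        (GLRep.GLMod.simple k (GLRep.RatField k σ) mu) i ≃ₗ[k]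
      Representation.IntertwiningMap
        ((GLRep.exteriorRep (GLRep.tupleRep k σ) i).tprod (GLRep.schurRep k lam))
        (GLRep.schurRep k mu)) :=
  GLRep.exists_ext_simple hσ lam mu i
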